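/- **Conventions.** Let $M$ be a smooth manifold (Hausdorff, second countable, without boundary), $n\ge 2$, and $H\in\Omega^{n+1}(M)$ a closed form. An $L_\infty$-algebra structure on a graded vector space $\mathfrak g$ is given by its graded symmetric operations $m_k$ ($k\ge1$) of degree $1$ on the shift $\mathfrak g[1]$, which satisfy the homotopy Jacobi identities (they are the components of a square-zero coderivation of the reduced symmetric coalgebra of $\mathfrak g[1]$); $m_1$ is the differential and $m_k$ is the $k$-ary bracket. An $\infty$-morphism $\Phi:\mathfrak g\rightsquigarrow\mathfrak h$ is a family of graded symmetric maps $\Phi_k:\mathfrak g[1]^{k}\to\mathfrak h[1]$ ($k\ge 1$) of degree $0$ whose associated coalgebra map commutes with the coderivations. It is a *fibration* if its linear part $\Phi_1$ is surjective in every degree. $TM$ denotes the Lie algebra of vector fields, in degree $0$; $\Phi$ is *over* $TM$ if it commutes with given strict morphisms from $\mathfrak g$ and $\mathfrak h$ to $TM$. **The Courant $L_\infty$-algebra.** $\mathrm{Cour}_{n-1}(H)$ has the sections of $TM\oplus\Lambda^{n-1}T^*M$ in degree $0$ and $\Omega^r(M)$ in degree $r-(n-1)$ for $0\le r\le n-2$.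 Its differential is the de Rham differential $\Omega^r(M)\to\Omega^{r+1}(M)$ for $r\le n-2$, and zero in degree $0$. Let $L=\mathrm{Der}(\Omega^*(M))\ltimes\Omega^*(M)[-n]$ be the differential graded Lie algebra with an $r$-form in degree $r-n$, with bracket $[(Q_1,\alpha_1),(Q_2,\alpha_2)]=([Q_1,Q_2],\,Q_1\alpha_2-(-1)^{|Q_2||\alpha_1|}Q_2\alpha_1)$ and with differential $\delta_H(Q,\alpha)=([d,Q],\,d\alpha-(-1)^{|Q|}Q(H))$. Then $\mathrm{Cour}_{n-1}(H)[1]$ is identified with the negative degree part $L_{<0}$, where $X+\alpha$ corresponds to $(\iota_X,\alpha)$. Let $D:L_{<0}\to L_{0}$ be the component of $\delta_H$; thus $D(X)=L_X+\iota_XH$ for a vector field $X$, $D(\alpha)=d\alpha$ for an $(n-1)$-form $\alpha$, and $D(\alpha)=0$ for forms $\alpha$ of lower degree. For $k\ge 2$ the $k$-ary bracket on homogeneous elements is $$m_k(x_1,\dots,x_k)=-\frac{B_{k-1}}{(k-1)!}\sum_{\sigma\in S_k}\pm\,[\cdots[[Dx_{\sigma(1)},x_{\sigma(2)}],x_{\sigma(3)}],\dots,x_{\sigma(k)}],$$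 where $\pm$ are the Koszul signs, computed in $L_{<0}$, and $B_j$ are the Bernoulli numbers ($B_1=-\tfrac12$). **The Atiyah $L_\infty$-algebra.** $\mathrm{At}_{n-1}(H)=(TM\oplus C^\infty(M)[n-1],H)$ has the vector fields in degree $0$, the functions in degree $-(n-1)$ and zero differential. Its operations on the shift are $m_2(X,Y)=[X,Y]$, $m_2(X,f)=L_Xf=(-1)^n m_2(f,X)$, $m_2(f,g)=0$, and $$m_{n+1}(X_1,\dots,X_{n+1})=\iota_{X_1}\cdots\iota_{X_{n+1}}H=(-1)^{n(n+1)/2}H(X_1,\dots,X_{n+1})$$ on vector fields, zero if one of the arguments is a function; all other operations vanish. **Theorem 6.9.** Let $n\ge 2$. For every $M$ and $H$ as above, $\mathrm{Cour}_{n-1}(H)$ and $\mathrm{At}_{n-1}(H)$ are $L_\infty$-algebras, and their projections to vector fields are strict morphisms of $L_\infty$-algebras to $TM$. There is a natural family of fibrations of $L_\infty$-algebras over $TM$ $$\Phi^{(M,H)}:\ \mathrm{Cour}_{n-1}(H)\rightsquigarrow \mathrm{At}_{n-1}(H)$$ whose linear part is the projection of complexes that is the identity on $C^\infty(M)=\Omega^0(M)$,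 the projection $X+\alpha\mapsto X$ in degree $0$, and zero on $\Omega^r(M)$ for $1\le r\le n-2$. Here *natural* means the following. Let $f:N\to M$ be a smooth map and let $H_M$, $H_N$ be closed $(n+1)$-forms with $H_N=f^*H_M$. Call vector fields $X$ on $M$ and $Y$ on $N$ $f$-related if $Y(f^*a)=f^*(X(a))$ for all $a\in C^\infty(M)$, and call forms $\alpha$ on $M$ and $\beta$ on $N$ $f$-related if $\beta(Y_1,\dots,Y_r)=f^*(\alpha(X_1,\dots,X_r))$ whenever all $X_i$, $Y_i$ are $f$-related (for instance if $\beta=f^*\alpha$). Then for every $k\ge1$ the map $\Phi_k$ sends componentwise $f$-related arguments to componentwise $f$-related values; in particular, $\Phi$ commutes with diffeomorphisms and with restriction to open subsets. (The assumption $H_N=f^*H_M$ may be weakened to $H_M$ and $H_N$ being $f$-related.) -/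

import Mathlib

open scoped Nat

noncomputable section

namespace HigherCourant

section CartanCalculus

variable (A : Type*) [CommRing A] [Algebra ℝ A]

/-- Vector fields, as the derivations of the algebra `A` of functions. -/
abbrev VField : Type _ := Derivation ℝ A A

/-- Differential forms of degree `r`: alternating `A`-multilinear functions of `r` vector fields. -/
abbrev Form (r : ℕ) : Type _ := VField A [⋀^Fin r]→ₗ[A] A

variable {A}

lemma form_update_zero {r : ℕ} (ω : Form A (r + 1)) (v : Fin r → VField A) (c : ℝ)
    (X : VField A) : ω (Matrix.vecCons (c • X) v) = c • ω (Matrix.vecCons X v) := by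
  have h := map_smul (AlternatingMap.curryLeft ω) (algebraMap ℝ A c) X
  rw [algebraMap_smul] at h
  have := DFunLike.congr_fun h v
  simpa [Algebra.smul_def] using this

/-- The interior product `ι_X ω = ω(X, -, …, -)`. -/
def interior {r : ℕ} : VField A →ₗ[ℝ] Form A (r + 1) →ₗ[ℝ] Form A r :=
  LinearMap.mk₂ ℝ (fun X ω => AlternatingMap.curryLeft ω X)
    (fun X Y ω => map_add _ X Y)
    (fun c X ω => by ext v; exact form_update_zero ω v c X)
    (fun X ω η => rfl) (fun c X ω => rfl)

lemma lie_smul_field (X Y : VField A) (c : A) : ⁅X, c • Y⁆ = c • ⁅X, Y⁆ + X c • Y := by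
  ext a
  simp [Derivation.commutator_apply]

lemma smul_lie_field (X Y : VField A) (c : A) : ⁅c • X, Y⁆ = c • ⁅X, Y⁆ - Y c • X := by
  ext a
  simp [Derivation.commutator_apply, mul_sub, sub_sub, mul_comm]

/-- The Lie derivative
`(L_X ω)(Y₁, …, Y_r) = X (ω(Y₁, …, Y_r)) - ∑ i, ω(Y₁, …, [X, Y_i], …, Y_r)`. -/
def lieForm {r : ℕ} (X : VField A) (ω : Form A r) : Form A r where
  toFun Y := X (ω Y) - ∑ i, ω (Function.update Y i ⁅X, Y i⁆)
  map_update_add' := by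
    intro inst Y i a b
    obtain rfl : inst = instDecidableEqFin r := Subsingleton.elim _ _
    have key : ∀ j, ω (Function.update (Function.update Y i (a + b)) j
          ⁅X, Function.update Y i (a + b) j⁆) =
        ω (Function.update (Function.update Y i a) j ⁅X, Function.update Y i a j⁆) +
        ω (Function.update (Function.update Y i b) j ⁅X, Function.update Y i b j⁆) := by
      intro j
      rcases eq_or_ne j i with rfl | hj
      · simp [AlternatingMap.map_update_add]
      · simp only [Function.update_of_ne hj]
        rw [Function.update_comm hj.symm, Function.update_comm hj.symm,
          Function.update_comm hj.symm, AlternatingMap.map_update_add]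
    rw [Finset.sum_congr rfl (fun j _ => key j), Finset.sum_add_distrib,
      AlternatingMap.map_update_add, map_add]
    ring
  map_update_smul' := by
    intro inst Y i c a
    obtain rfl : inst = instDecidableEqFin r := Subsingleton.elim _ _
    have key : ∀ j, ω (Function.update (Function.update Y i (c • a)) j
          ⁅X, Function.update Y i (c • a) j⁆) =
        c * ω (Function.update (Function.update Y i a) j ⁅X, Function.update Y i a j⁆) +
        if j = i then X c * ω (Function.update Y i a) else 0 := by
      intro j
      rcases eq_or_ne j i with rfl | hj
      · simp [AlternatingMap.map_update_add, AlternatingMap.map_update_smul]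
      · simp only [Function.update_of_ne hj, if_neg hj]
        rw [Function.update_comm hj.symm, Function.update_comm hj.symm,
          AlternatingMap.map_update_smul, smul_eq_mul, add_zero]
    rw [Finset.sum_congr rfl (fun j _ => key j), Finset.sum_add_distrib, ← Finset.mul_sum,
      AlternatingMap.map_update_smul]
    simp
    ring
  map_eq_zero_of_eq' := by
    intro Y i j h hij
    have h0 : ω Y = 0 := ω.map_eq_zero_of_eq Y h hij
    have h1 : ∑ k, ω (Function.update Y k ⁅X, Y k⁆) =
        ω (Function.update Y i ⁅X, Y i⁆) + ω (Function.update Y j ⁅X, Y j⁆) := by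
      refine Fintype.sum_eq_add _ _ hij fun k ⟨hki, hkj⟩ => ?_
      refine ω.map_eq_zero_of_eq _ (i := i) (j := j) ?_ hij
      simp [Function.update_of_ne hki.symm, Function.update_of_ne hkj.symm, h]
    have h2 : Function.update Y j ⁅X, Y j⁆ = Function.update Y i ⁅X, Y i⁆ ∘ Equiv.swap i j := by
      funext k
      rcases eq_or_ne k i with rfl | hki
      · simp [hij, hij.symm, h]
      rcases eq_or_ne k j with rfl | hkj
      · simp [h]
      · simp [Equiv.swap_apply_of_ne_of_ne hki hkj, hki, hkj]
    rw [h0, h1, h2, ω.map_swap _ hij]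
    simp

lemma form_update_smul {r : ℕ} (ω : Form A r) (v : Fin r → VField A) (i : Fin r) (c : ℝ)
    (X : VField A) : ω (Function.update v i (c • X)) = c • ω (Function.update v i X) := by
  rw [← algebraMap_smul A c X, AlternatingMap.map_update_smul, algebraMap_smul]

/-- `lieForm` as a bilinear map. -/
def lieDeriv {r : ℕ} : VField A →ₗ[ℝ] Form A r →ₗ[ℝ] Form A r :=
  LinearMap.mk₂ ℝ lieForm
    (fun X Y ω => by
      ext v; simp [lieForm, AlternatingMap.map_update_add, Finset.sum_add_distrib]; ring)
    (fun c X ω => by ext v; simp [lieForm, smul_sub, Finset.smul_sum, form_update_smul])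
    (fun X ω η => by ext v; simp [lieForm, Finset.sum_add_distrib]; ring)
    (fun c X ω => by ext v; simp [lieForm, smul_sub, Finset.smul_sum])

lemma lieDeriv_apply {r : ℕ} (X : VField A) (ω : Form A r) (v : Fin r → VField A) :
    lieDeriv X ω v = X (ω v) - ∑ i, ω (Function.update v i ⁅X, v i⁆) := by
  rw [lieDeriv, LinearMap.mk₂_apply]
  rfl

lemma interior_apply {r : ℕ} (X : VField A) (ω : Form A (r + 1)) (v : Fin r → VField A) :
    interior X ω v = ω (Matrix.vecCons X v) := rfl

/-- The form `da ∧ ω`, where `a` is a function. -/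
def dWedge {r : ℕ} (a : A) (ω : Form A r) : Form A (r + 1) :=
  AlternatingMap.alternatizeUncurryFin
    { toFun := fun X => X a • ω
      map_add' := fun X Y => by ext; simp [add_mul]
      map_smul' := fun c X => by ext; simp [mul_assoc] }

lemma dWedge_apply {r : ℕ} (a : A) (ω : Form A r) (v : Fin (r + 1) → VField A) :
    dWedge a ω v = ∑ i : Fin (r + 1), (-1) ^ (i : ℕ) * (v i a * ω (i.removeNth v)) := by
  simp [dWedge, AlternatingMap.alternatizeUncurryFin_apply, Algebra.smul_def]

lemma interior_dWedge {r : ℕ} (a : A) (ω : Form A (r + 1)) (X : VField A) :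
    interior X (dWedge a ω) = X a • ω - dWedge a (interior X ω) := by
  ext v
  rw [interior_apply, dWedge_apply, Fin.sum_univ_succ, AlternatingMap.sub_apply, dWedge_apply,
    sub_eq_add_neg, ← Finset.sum_neg_distrib]
  congr 1
  · simp [Fin.removeNth_zero]
  · refine Finset.sum_congr rfl fun i _ => ?_
    rw [interior_apply]
    have : i.succ.removeNth (Matrix.vecCons X v) = Matrix.vecCons X (i.removeNth v) := by
      funext j
      refine Fin.cases ?_ (fun j => ?_) j <;> simp [Fin.removeNth]
    rw [this]
    simp [pow_succ]

lemma lieDeriv_smul_field {r : ℕ} (a : A) (X : VField A) (ω : Form A (r + 1)) :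
    lieDeriv (a • X) ω = a • lieDeriv X ω + dWedge a (interior X ω) := by
  ext v
  rw [AlternatingMap.add_apply, AlternatingMap.smul_apply, lieDeriv_apply, lieDeriv_apply,
    dWedge_apply]
  have key : ∀ i, ω (Function.update v i ⁅a • X, v i⁆) =
      a * ω (Function.update v i ⁅X, v i⁆)
        - (-1) ^ (i : ℕ) * (v i a * (interior X ω) (i.removeNth v)) := by
    intro i
    rw [smul_lie_field, AlternatingMap.map_update_sub, AlternatingMap.map_update_smul,
      AlternatingMap.map_update_smul, interior_apply, ← Fin.insertNth_removeNth i X v,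
      AlternatingMap.map_insertNth]
    simp [Algebra.smul_def]
    ring
  rw [Finset.sum_congr rfl fun i _ => key i, Finset.sum_sub_distrib, ← Finset.mul_sum]
  simp [mul_sub]
  ring

lemma lieDeriv_smul {r : ℕ} (a : A) (X : VField A) (ω : Form A r) :
    lieDeriv X (a • ω) = a • lieDeriv X ω + X a • ω := by
  ext v
  simp [lieDeriv_apply, mul_sub, ← Finset.mul_sum]
  ring

lemma interior_smul {r : ℕ} (a : A) (X : VField A) (ω : Form A (r + 1)) :
    interior X (a • ω) = a • interior X ω := rfl

lemma interior_smul_field {r : ℕ} (a : A) (X : VField A) (ω : Form A (r + 1)) :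
    interior (a • X) ω = a • interior X ω := map_smul (AlternatingMap.curryLeft ω) a X

lemma interior_self {r : ℕ} (X : VField A) (ω : Form A (r + 2)) :
    interior X (interior X ω) = 0 := AlternatingMap.curryLeft_same ω X

/-- An alternating form of degree `r + 1` from a linear family `F` of forms of degree `r` with
`ι_X (F X) = 0`. -/
def uncurryForm {r : ℕ} (F : VField A →ₗ[A] Form A r)
    (hF : ∀ X (v : Fin r → VField A), (∃ i, v i = X) → F X v = 0) : Form A (r + 1) where
  toMultilinearMap := LinearMap.uncurryLeft (AlternatingMap.toMultilinearMapLM ∘ₗ F)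
  map_eq_zero_of_eq' := by
    intro v i j h hij
    simp only [MultilinearMap.toFun_eq_coe, LinearMap.uncurryLeft_apply, LinearMap.comp_apply,
      AlternatingMap.toMultilinearMapLM_apply]
    change F (v 0) (Fin.tail v) = 0
    induction i using Fin.cases with
    | zero =>
      induction j using Fin.cases with
      | zero => exact absurd rfl hij
      | succ j => exact hF _ _ ⟨j, h.symm⟩
    | succ i =>
      induction j using Fin.cases with
      | zero => exact hF _ _ ⟨i, h⟩
      | succ j => exact (F (v 0)).map_eq_zero_of_eq _ h (fun e => hij (congrArg _ e))

lemma interior_uncurryForm {r : ℕ} (F : VField A →ₗ[A] Form A r)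
    (hF : ∀ X (v : Fin r → VField A), (∃ i, v i = X) → F X v = 0) (X : VField A) :
    interior X (uncurryForm F hF) = F X := by
  ext v; rfl

lemma form_eq_zero_of_interior {r : ℕ} (X : VField A) (ω : Form A (r + 1))
    (h : interior X ω = 0) (v : Fin (r + 1) → VField A) (hv : ∃ i, v i = X) : ω v = 0 := by
  obtain ⟨i, rfl⟩ := hv
  have h1 := AlternatingMap.map_insertNth ω i (v i) (i.removeNth v)
  rw [Fin.insertNth_self_removeNth, ← interior_apply, h] at h1
  simpa using h1

lemma interior_lieDeriv_self {r : ℕ} (X : VField A) (ω : Form A (r + 1)) :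
    interior X (lieDeriv X ω) = lieDeriv X (interior X ω) := by
  ext w
  have h0 : Function.update (Matrix.vecCons X w) 0 0 = Matrix.vecCons 0 w := by
    funext j; refine Fin.cases ?_ (fun j => ?_) j <;> simp
  have h1 : ∀ (i : Fin r) Y, Function.update (Matrix.vecCons X w) i.succ Y =
      Matrix.vecCons X (Function.update w i Y) := fun i Y => by
    simp [Matrix.vecCons, Fin.cons_update]
  have h2 : ω (Matrix.vecCons 0 w) = 0 := ω.map_coord_zero 0 rfl
  simp only [interior_apply, lieDeriv_apply, Fin.sum_univ_succ, Matrix.cons_val_zero,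
    Matrix.cons_val_succ, lie_self, h0, h1, h2, zero_add]

/-- The operators with the properties that are carried along the recursion for the de Rham
differential. -/
structure DiffAux (A : Type*) [CommRing A] [Algebra ℝ A] (r : ℕ) where
  /-- The differential on forms of degree `r`. -/
  op : Form A r →ₗ[ℝ] Form A (r + 1)
  leibniz : ∀ (a : A) (ω : Form A r), op (a • ω) = a • op ω + dWedge a ω
  cartan : ∀ (X : VField A) (ω : Form A (r + 1)),
    interior X (op (interior X ω)) = lieDeriv X (interior X ω)

lemma ext_interior {r : ℕ} {ω η : Form A (r + 1)} (h : ∀ X, interior X ω = interior X η) :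
    ω = η := by
  ext v
  have := DFunLike.congr_fun (h (v 0)) (Matrix.vecTail v)
  simp only [interior_apply] at this
  rwa [show Matrix.vecCons (v 0) (Matrix.vecTail v) = v from Matrix.cons_head_tail v] at this

lemma dWedge_zero_form (a : A) (f : Form A 0) (X : VField A) :
    interior X (dWedge a f) = X a • f := by
  ext v
  rw [interior_apply, dWedge_apply]
  simp [Fin.removeNth_zero]

/-- The differential of a function, `(df)(X) = X f`. -/
def diffZeroForm (f : Form A 0) : Form A 1 :=
  uncurryForm
    { toFun := fun X => lieDeriv X f
      map_add' := fun X Y => by simp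
      map_smul' := fun c X => by ext v; simp [lieDeriv_apply] }
    (fun _ _ ⟨i, _⟩ => i.elim0)

lemma interior_diffZeroForm (X : VField A) (f : Form A 0) :
    interior X (diffZeroForm f) = lieDeriv X f := interior_uncurryForm _ _ X

/-- `diffZeroForm`, with its properties. -/
def diffZero : DiffAux A 0 where
  op :=
    { toFun := diffZeroForm
      map_add' := fun f g => ext_interior fun X => by
        rw [map_add, interior_diffZeroForm, map_add, interior_diffZeroForm, interior_diffZeroForm]
      map_smul' := fun c f => ext_interior fun X => by
        rw [RingHom.id_apply, map_smul, interior_diffZeroForm, map_smul, interior_diffZeroForm] }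
  leibniz a f := ext_interior fun X => by
    change interior X (diffZeroForm (a • f)) = interior X (a • diffZeroForm f + dWedge a f)
    rw [map_add, dWedge_zero_form, interior_smul,
      interior_diffZeroForm, interior_diffZeroForm, lieDeriv_smul]
  cartan X ω := by
    change interior X (diffZeroForm (interior X ω)) = _
    rw [interior_diffZeroForm]

/-- The differential of a form of degree `r + 1`, from the differential in degree `r`, by
`ι_X d = L_X - d ι_X`. -/
def diffSuccForm {r : ℕ} (D : DiffAux A r) (ω : Form A (r + 1)) : Form A (r + 2) :=
  uncurryForm
    { toFun := fun X => lieDeriv X ω - D.op (interior X ω)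
      map_add' := fun X Y => by simp; abel
      map_smul' := fun c X => by
        simp only [lieDeriv_smul_field, interior_smul_field, D.leibniz, RingHom.id_apply,
          smul_sub]
        abel }
    (fun X v hv => form_eq_zero_of_interior X _ (by
        change interior X (lieDeriv X ω - D.op (interior X ω)) = 0
        rw [map_sub, D.cartan, interior_lieDeriv_self, sub_self])
        v hv)

lemma interior_diffSuccForm {r : ℕ} (D : DiffAux A r) (X : VField A) (ω : Form A (r + 1)) :
    interior X (diffSuccForm D ω) = lieDeriv X ω - D.op (interior X ω) :=
  interior_uncurryForm _ _ X

/-- `diffSuccForm`, with its properties. -/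
def diffSucc {r : ℕ} (D : DiffAux A r) : DiffAux A (r + 1) where
  op :=
    { toFun := diffSuccForm D
      map_add' := fun ω η => ext_interior fun X => by
        rw [map_add (interior X) (diffSuccForm D ω), interior_diffSuccForm, interior_diffSuccForm,
          interior_diffSuccForm, map_add, map_add, map_add]
        abel
      map_smul' := fun c ω => ext_interior fun X => by
        rw [RingHom.id_apply, map_smul, interior_diffSuccForm, interior_diffSuccForm,
          map_smul, map_smul, map_smul, smul_sub] }
  leibniz a ω := ext_interior fun X => by
    change interior X (diffSuccForm D (a • ω)) = interior X (a • diffSuccForm D ω + dWedge a ω)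
    rw [map_add, interior_dWedge, interior_smul,
      interior_diffSuccForm, interior_diffSuccForm, lieDeriv_smul, interior_smul, D.leibniz,
      smul_sub]
    abel
  cartan X ω := by
    change interior X (diffSuccForm D (interior X ω)) = _
    rw [interior_diffSuccForm, interior_self, map_zero, sub_zero]

/-- The recursion that defines the de Rham differential. -/
def diffAux : (r : ℕ) → DiffAux A r
  | 0 => diffZero
  | r + 1 => diffSucc (diffAux r)

/-- The de Rham differential. It is determined by `(df)(X) = X f` for functions and by Cartan's
formula `ι_X d + d ι_X = L_X`. -/
def extd {r : ℕ} : Form A r →ₗ[ℝ] Form A (r + 1) := (diffAux r).op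

lemma interior_extd_zero (X : VField A) (f : Form A 0) :
    interior X (extd f) = lieDeriv X f := interior_diffZeroForm X f

lemma interior_extd {r : ℕ} (X : VField A) (ω : Form A (r + 1)) :
    interior X (extd ω) = lieDeriv X ω - extd (interior X ω) :=
  interior_diffSuccForm _ X ω

end CartanCalculus

section LInfinity

/-- The operations of an `L_∞`-algebra `g`, written on the total space of its shift `V = g[1]`:
a grading of `V` (an element of degree `j` of `g` has degree `j - 1` in `V`), and for each `k ≥ 1`
a `k`-ary operation, the differential of `g` for `k = 1` and the `k`-ary bracket for `k ≥ 2`.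
Antisymmetric brackets of degree `2 - k` on `g` are the same as symmetric operations of degree `1`
on `V`. (The value at `k = 0` plays no role.) -/
structure LInftyData (V : Type*) [AddCommGroup V] [Module ℝ V] where
  /-- the homogeneous elements of `V` of a given degree -/
  gr : ℤ → Submodule ℝ V
  /-- the operations -/
  bracket : (k : ℕ) → MultilinearMap ℝ (fun _ : Fin k => V) V

/-- The Koszul sign `ε` of a permutation `σ` of homogeneous elements `x_i` of degrees `d_i`, for
which `x_0 ⊙ x_1 ⊙ ⋯ = ε • x_{σ 0} ⊙ x_{σ 1} ⊙ ⋯` in the graded symmetric algebra. -/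
def koszulSign {k : ℕ} (d : Fin k → ℤ) (σ : Equiv.Perm (Fin k)) : ℤˣ :=
  ∏ i, ∏ j, if i < j ∧ σ j < σ i then (d (σ i) * d (σ j)).negOnePow else 1

variable {V W : Type*} [AddCommGroup V] [Module ℝ V] [AddCommGroup W] [Module ℝ W]

/-- A family of multilinear maps `V^k → W` that is graded symmetric and raises degrees by `e`. -/
structure IsGradedSymmetric (gV : ℤ → Submodule ℝ V) (gW : ℤ → Submodule ℝ W) (e : ℤ)
    (f : (k : ℕ) → MultilinearMap ℝ (fun _ : Fin k => V) W) : Prop where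
  degree : ∀ k, 1 ≤ k → ∀ (d : Fin k → ℤ) (x : Fin k → V), (∀ i, x i ∈ gV (d i)) →
    f k x ∈ gW (∑ i, d i + e)
  symm : ∀ k, 1 ≤ k → ∀ (d : Fin k → ℤ) (x : Fin k → V), (∀ i, x i ∈ gV (d i)) →
    ∀ σ : Equiv.Perm (Fin k), f k x = koszulSign d σ • f k (x ∘ σ)

/-- The component `V^k → W` of the composite of `f : Sym(V) → W` with the coderivation of `Sym(V)`
that has the operations `m` of `S` as components:
`∑_{p + q = k, p ≥ 1} ∑ ± f_{q + 1} (m_p (x_{σ 1}, …, x_{σ p}), x_{σ (p + 1)}, …, x_{σ k})`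
over the `(p, q)`-shuffles `σ`. By symmetry, the sum over shuffles is the sum over all permutations
divided by `p! q!`. Below, `p` is written as `p + 1`. -/
def insertBracket (S : LInftyData V) (f : (k : ℕ) → MultilinearMap ℝ (fun _ : Fin k => V) W)
    (k : ℕ) (d : Fin k → ℤ) (x : Fin k → V) : W :=
  ∑ p : Fin k, ((((p : ℕ) + 1)! : ℝ) * ((k - 1 - p : ℕ)! : ℝ))⁻¹ •
    ∑ σ : Equiv.Perm (Fin k), koszulSign d σ •
      f (k - 1 - p + 1) (Matrix.vecCons
        (S.bracket (p + 1) fun i => x (σ (Fin.castLE (by omega) i)))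
        (fun j : Fin (k - 1 - p) => x (σ ⟨p + 1 + j, by omega⟩)))

/-- The component `V^k → W` of the composite of the operations of `T` on `W` with the coalgebra map
`Sym(V) → Sym(W)` that has the components `f_k`:
`∑_{j ≥ 1} ∑_{k_1 + ⋯ + k_j = k} 1 / (j! k_1! ⋯ k_j!) ∑_σ ± m_j (f_{k_1} (x_{σ 1}, …), …,
f_{k_j} (…, x_{σ k}))` over all permutations `σ`. -/
def bracketOfMaps (T : LInftyData W) (f : (k : ℕ) → MultilinearMap ℝ (fun _ : Fin k => V) W)
    (k : ℕ) (d : Fin k → ℤ) (x : Fin k → V) : W :=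
  ∑ c : Composition k, ((c.length ! : ℝ) * ∏ i, ((c.blocksFun i)! : ℝ))⁻¹ •
    ∑ σ : Equiv.Perm (Fin k), koszulSign d σ •
      T.bracket c.length fun i => f (c.blocksFun i) fun j => x (σ (c.embedding i j))

/-- The operations of `S` form an `L_∞`-algebra: `V` is the direct sum of its homogeneous parts,
the operations are graded symmetric of degree `1`, and they satisfy the homotopy Jacobi identities
(equivalently, they define a square-zero coderivation of the reduced symmetric coalgebra of
`V = g[1]`). -/
structure IsLInftyAlgebra (S : LInftyData V) : Prop where
  isInternal : DirectSum.IsInternal S.gr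
  isGradedSymmetric : IsGradedSymmetric S.gr S.gr 1 S.bracket
  jacobi : ∀ k, 1 ≤ k → ∀ (d : Fin k → ℤ) (x : Fin k → V), (∀ i, x i ∈ S.gr (d i)) →
    insertBracket S S.bracket k d x = 0

/-- `Φ` is an `∞`-morphism of `L_∞`-algebras: its components `Φ_k : V^k → W` are graded symmetric
of degree `0`, and the coalgebra map `Sym(V) → Sym(W)` with these components commutes with the
coderivations. -/
structure IsInftyMorphism (S : LInftyData V) (T : LInftyData W)
    (Φ : (k : ℕ) → MultilinearMap ℝ (fun _ : Fin k => V) W) : Prop where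
  isGradedSymmetric : IsGradedSymmetric S.gr T.gr 0 Φ
  map_bracket : ∀ k, 1 ≤ k → ∀ (d : Fin k → ℤ) (x : Fin k → V), (∀ i, x i ∈ S.gr (d i)) →
    insertBracket S Φ k d x = bracketOfMaps T Φ k d x

/-- `f` is a strict morphism of `L_∞`-algebras. -/
structure IsStrictMorphism (S : LInftyData V) (T : LInftyData W) (f : V →ₗ[ℝ] W) : Prop where
  degree : ∀ i, ∀ v ∈ S.gr i, f v ∈ T.gr i
  map_bracket : ∀ k, 1 ≤ k → ∀ x : Fin k → V, f (S.bracket k x) = T.bracket k fun i => f (x i)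

/-- The linear part of an `∞`-morphism. -/
def linearPart (Φ : (k : ℕ) → MultilinearMap ℝ (fun _ : Fin k => V) W) (v : V) : W :=
  Φ 1 fun _ => v

/-- A fibration: the linear part is surjective in each degree. -/
def IsFibration (S : LInftyData V) (T : LInftyData W)
    (Φ : (k : ℕ) → MultilinearMap ℝ (fun _ : Fin k => V) W) : Prop :=
  ∀ i, ∀ w ∈ T.gr i, ∃ v ∈ S.gr i, linearPart Φ v = w

/-- The `∞`-morphism `Φ` commutes with the strict morphisms `ρ_V`, `ρ_W` to a third
`L_∞`-algebra. -/
def IsOver {U : Type*} [AddCommGroup U] [Module ℝ U] (ρV : V →ₗ[ℝ] U) (ρW : W →ₗ[ℝ] U)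
    (Φ : (k : ℕ) → MultilinearMap ℝ (fun _ : Fin k => V) W) : Prop :=
  (∀ v, ρW (linearPart Φ v) = ρV v) ∧ ∀ k, 2 ≤ k → ∀ x : Fin k → V, ρW (Φ k x) = 0

end LInfinity

section TangentLie

variable (A : Type*) [CommRing A] [Algebra ℝ A]

/-- The Lie algebra of vector fields, in degree `0`, hence in degree `-1` after the shift. -/
def tangentLie : LInftyData (VField A) where
  gr i := if i = -1 then ⊤ else ⊥
  bracket
    | 2 => MultilinearMap.mk' (fun x => ⁅x 0, x 1⁆)
        (by intro x i a b; fin_cases i <;> simp)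
        (by intro x i c a; fin_cases i <;> simp)
    | _ => 0

end TangentLie

section Atiyah

variable {A : Type*} [CommRing A] [Algebra ℝ A]

/-- The total space `TM ⊕ C^∞(M)` of the Atiyah `L_∞`-algebra. -/
abbrev AtiyahSpace (A : Type*) [CommRing A] [Algebra ℝ A] : Type _ := VField A × A

/-- The `k`-ary operation `(X_1, …, X_k) ↦ ι_{X_1} ⋯ ι_{X_k} H = (-1)^{k (k - 1) / 2}
H(X_1, …, X_k)` given by a `k`-form `H`. -/
def formBracket {k : ℕ} (H : Form A k) :
    MultilinearMap ℝ (fun _ : Fin k => AtiyahSpace A) (AtiyahSpace A) :=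
  ((-1 : ℝ) ^ (k * (k - 1) / 2)) • (LinearMap.inr ℝ (VField A) A).compMultilinearMap
    ((H.toMultilinearMap.restrictScalars ℝ).compLinearMap fun _ => LinearMap.fst ℝ (VField A) A)

/-- The binary operation of `At_{n - 1}(H)`: the Lie bracket of vector fields, and
`[X, f] = X f = (-1)^n [f, X]`. -/
def atiyahBinary (n : ℕ) : MultilinearMap ℝ (fun _ : Fin 2 => AtiyahSpace A) (AtiyahSpace A) :=
  MultilinearMap.mk'
    (fun x => (⁅(x 0).1, (x 1).1⁆, (x 0).1 (x 1).2 + (-1 : ℝ) ^ n • (x 1).1 (x 0).2))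
    (by
      intro x i a b
      fin_cases i <;> ext <;> simp [add_add_add_comm])
    (by
      intro x i c a
      fin_cases i
      · exact Prod.ext (by simp) (by simp [smul_comm ((-1 : ℝ) ^ n) c])
      · exact Prod.ext (by simp) (by simp [smul_comm ((-1 : ℝ) ^ n) c]))

/-- The Atiyah `L_∞`-algebra `At_{n - 1}(H) = (TM ⊕ C^∞(M)[n - 1], H)` of an `(n + 1)`-form `H`.
It has the vector fields in degree `0` and the functions in degree `-(n - 1)` (so `-1` and `-n`
after the shift), zero differential, the binary bracket given by the Lie bracket and by
`[X, f] = X f`, the `(n + 1)`-ary bracket given by `H`, and no other brackets. -/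
def atiyah (n : ℕ) (H : Form A (n + 1)) : LInftyData (AtiyahSpace A) where
  gr i :=
    { carrier := {w | (i ≠ -1 → w.1 = 0) ∧ (i ≠ -n → w.2 = 0)}
      add_mem' := fun {v w} hv hw =>
        ⟨fun h => by simp [hv.1 h, hw.1 h], fun h => by simp [hv.2 h, hw.2 h]⟩
      zero_mem' := ⟨fun _ => rfl, fun _ => rfl⟩
      smul_mem' := fun c v hv => ⟨fun h => by simp [hv.1 h], fun h => by simp [hv.2 h]⟩ }
  bracket k :=
    (if h : k = 2 then (atiyahBinary n).domDomCongr (finCongr h.symm) else 0) +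
    (if h : k = n + 1 then (formBracket H).domDomCongr (finCongr h.symm) else 0)

end Atiyah

section Courant

variable {A : Type*} [CommRing A] [Algebra ℝ A]

/-- Inhomogeneous forms. -/
abbrev Forms (A : Type*) [CommRing A] [Algebra ℝ A] : Type _ := (r : ℕ) → Form A r

/-- The de Rham differential of inhomogeneous forms. -/
def extdAll : Forms A →ₗ[ℝ] Forms A :=
  LinearMap.pi fun r => match r with
    | 0 => 0
    | r + 1 => extd ∘ₗ LinearMap.proj r

/-- The interior product of inhomogeneous forms. -/
def interiorAll : VField A →ₗ[ℝ] Forms A →ₗ[ℝ] Forms A :=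
  LinearMap.mk₂ ℝ (fun X β r => interior X (β (r + 1)))
    (fun X Y β => by ext; simp) (fun c X β => by ext; simp)
    (fun X β γ => by ext; simp) (fun c X β => by ext; simp)

/-- The Lie derivative of inhomogeneous forms. -/
def lieDerivAll : VField A →ₗ[ℝ] Forms A →ₗ[ℝ] Forms A :=
  LinearMap.mk₂ ℝ (fun X β r => lieDeriv X (β r))
    (fun X Y β => by ext; simp) (fun c X β => by ext; simp)
    (fun X β γ => by ext; simp) (fun c X β => by ext; simp)

/-- The sign `(-1)^{|β|}` in `Ω^*(M)[-n]`, where an `r`-form has degree `r - n`. -/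
def paritySign (n : ℕ) : Forms A →ₗ[ℝ] Forms A :=
  LinearMap.pi fun r => ((-1 : ℝ) ^ (r + n)) • LinearMap.proj r

/-- The total space of the graded Lie subalgebra of `Der(Ω^*(M)) ⋉ Ω^*(M)[-n]` that consists of
the Lie derivatives `L_P` (of degree `0`), the contractions `ι_Q` (of degree `-1`) and all forms
`β` (an `r`-form has degree `r - n`). Its elements are the triples `(P, Q, β)`. It contains all
elements of negative degree of `Der(Ω^*(M)) ⋉ Ω^*(M)[-n]` and is closed under the differential. -/
abbrev CartanSpace (A : Type*) [CommRing A] [Algebra ℝ A] : Type _ :=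
  VField A × VField A × Forms A

/-- The bracket `[(Q₁, α₁), (Q₂, α₂)] = ([Q₁, Q₂], Q₁ α₂ - (-1)^{|Q₂| |α₁|} Q₂ α₁)` of
`Der(Ω^*(M)) ⋉ Ω^*(M)[-n]`, on `CartanSpace`, where `[L_P, L_P'] = L_{[P, P']}`,
`[L_P, ι_Q] = ι_{[P, Q]} = [ι_P, L_Q]` and `[ι_Q, ι_Q'] = 0`. -/
def cartanBracket (n : ℕ) : CartanSpace A →ₗ[ℝ] CartanSpace A →ₗ[ℝ] CartanSpace A :=
  LinearMap.mk₂ ℝ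
    (fun a b =>
      (⁅a.1, b.1⁆, ⁅a.1, b.2.1⁆ + ⁅a.2.1, b.1⁆,
        lieDerivAll a.1 b.2.2 + interiorAll a.2.1 b.2.2
          - lieDerivAll b.1 a.2.2 - interiorAll b.2.1 (paritySign n a.2.2)))
    (fun a a' b => by
      refine Prod.ext (by simp) (Prod.ext ?_ ?_)
      · simp; abel
      · simp; abel)
    (fun c a b => by
      refine Prod.ext (by simp) (Prod.ext ?_ ?_)
      · simp
      · simp [smul_sub])
    (fun a b b' => by
      refine Prod.ext (by simp) (Prod.ext ?_ ?_)
      · simp; abel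
      · simp; abel)
    (fun c a b => by
      refine Prod.ext (by simp) (Prod.ext ?_ ?_)
      · simp
      · simp [smul_sub])

/-- The differential `δ_H(Q, α) = ([d, Q], dα - (-1)^{|Q|} Q(H))` on `CartanSpace`, where
`[d, L_P] = 0` and `[d, ι_Q] = L_Q`. -/
def cartanDiff (n : ℕ) (H : Form A (n + 1)) : CartanSpace A →ₗ[ℝ] CartanSpace A where
  toFun a := (a.2.1, 0,
    extdAll a.2.2 - lieDerivAll a.1 (Pi.single (n + 1) H) + interiorAll a.2.1 (Pi.single (n + 1) H))
  map_add' a b := by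
    refine Prod.ext (by simp) (Prod.ext (by simp) ?_)
    simp; abel
  map_smul' c a := by
    refine Prod.ext (by simp) (Prod.ext (by simp) ?_)
    simp [smul_sub]

/-- The total space `TM ⊕ Ω^0(M) ⊕ ⋯ ⊕ Ω^{n - 1}(M)` of `Cour_{n - 1}(H)`. -/
abbrev CourantSpace (A : Type*) [CommRing A] [Algebra ℝ A] (n : ℕ) : Type _ :=
  VField A × ((r : Fin n) → Form A r)

/-- Forms of degree `< n` as inhomogeneous forms. -/
def extendForms (n : ℕ) : ((r : Fin n) → Form A r) →ₗ[ℝ] Forms A where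
  toFun α r := if h : r < n then α ⟨r, h⟩ else 0
  map_add' α β := by ext r : 1; by_cases h : r < n <;> simp [h]
  map_smul' c α := by ext r : 1; by_cases h : r < n <;> simp [h]

/-- The elements `(ι_X, α)`, which make up the part of negative degree. -/
def courantIncl (n : ℕ) : CourantSpace A n →ₗ[ℝ] CartanSpace A where
  toFun v := (0, v.1, extendForms n v.2)
  map_add' v w := by simp
  map_smul' c v := by simp

/-- The projection onto the part of negative degree, along the part of degree `≥ 0`. -/
def courantProj (n : ℕ) : CartanSpace A →ₗ[ℝ] CourantSpace A n where
  toFun a := (a.2.1, fun r => a.2.2 r)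
  map_add' _ _ := rfl
  map_smul' _ _ := rfl

/-- The projection onto the part of degree `≥ 0`, along the part of negative degree. -/
def nonnegProj (n : ℕ) : CartanSpace A →ₗ[ℝ] CartanSpace A :=
  LinearMap.id - courantIncl n ∘ₗ courantProj n

/-- The map `D` from the part of negative degree to the part of degree `≥ 0`: the component of the
differential. So `D(X) = L_X + ι_X H`, and `D(α) = dα` if `α` is an `(n - 1)`-form, while
`D(α) = 0` for forms of lower degree. -/
def connecting (n : ℕ) (H : Form A (n + 1)) : CourantSpace A n →ₗ[ℝ] CartanSpace A :=
  nonnegProj n ∘ₗ cartanDiff n H ∘ₗ courantIncl n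

/-- The iterated bracket `[⋯[[D x_0, x_1], x_2], ⋯, x_k]`. -/
def iteratedBracket (n : ℕ) (H : Form A (n + 1)) :
    (k : ℕ) → MultilinearMap ℝ (fun _ : Fin (k + 1) => CourantSpace A n) (CartanSpace A)
  | 0 => MultilinearMap.ofSubsingleton ℝ (CourantSpace A n) (CartanSpace A) (0 : Fin 1)
      (connecting n H)
  | k + 1 => MultilinearMap.uncurryRight
      (((cartanBracket n).compl₂ (courantIncl n)).compMultilinearMap (iteratedBracket n H k))

/-- The homogeneous components of an element of `CourantSpace A n`: for `r < n - 1` the `r`-form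
(of shifted degree `r - n`), and for `r = n - 1` the section of `TM ⊕ Λ^{n - 1} T^*M` (of shifted
degree `-1`). -/
def courantComponent (n : ℕ) (r : Fin n) : CourantSpace A n →ₗ[ℝ] CourantSpace A n where
  toFun v := (if (r : ℕ) + 1 = n then v.1 else 0, Pi.single r (v.2 r))
  map_add' v w := by by_cases h : (r : ℕ) + 1 = n <;> simp [h, Pi.single_add]
  map_smul' c v := by by_cases h : (r : ℕ) + 1 = n <;> simp [h, Pi.single_smul]

/-- The `L_∞`-algebra `Cour_{n - 1}(H)` of the higher Courant algebroid `TM ⊕ Λ^{n - 1} T^*M`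
twisted by the `(n + 1)`-form `H`. It has the sections `TM ⊕ Ω^{n - 1}(M)` in degree `0` and the
`r`-forms, `r ≤ n - 2`, in degree `r - (n - 1)` (these degrees drop by one in the shift). The
differential is the de Rham differential of forms of degree `≤ n - 2`. The higher brackets are
the derived brackets of the part of negative degree of `Der(Ω^*(M)) ⋉ Ω^*(M)[-n]` with the
differential `δ_H`:
`[x_1, …, x_k] = -B_{k - 1} / (k - 1)! ∑_σ ± [⋯[[D x_{σ 1}, x_{σ 2}], x_{σ 3}], …, x_{σ k}]`
for homogeneous `x_i`, with the Bernoulli numbers `B_j` (`B_1 = -1/2`) and Koszul signs `±`. -/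
def courant (n : ℕ) (H : Form A (n + 1)) : LInftyData (CourantSpace A n) where
  gr i :=
    { carrier := {v | (i ≠ -1 → v.1 = 0) ∧ ∀ r : Fin n, i ≠ (r : ℤ) - n → v.2 r = 0}
      add_mem' := fun {v w} hv hw =>
        ⟨fun h => by simp [hv.1 h, hw.1 h], fun r h => by simp [hv.2 r h, hw.2 r h]⟩
      zero_mem' := ⟨fun _ => rfl, fun _ _ => rfl⟩
      smul_mem' := fun c v hv => ⟨fun h => by simp [hv.1 h], fun r h => by simp [hv.2 r h]⟩ }
  bracket
    | 0 => 0
    | 1 => MultilinearMap.ofSubsingleton ℝ _ _ 0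
        (courantProj n ∘ₗ cartanDiff n H ∘ₗ courantIncl n)
    | k + 2 => (-(bernoulli (k + 1) : ℝ) / ((k + 1)! : ℝ)) •
        ∑ r : Fin (k + 2) → Fin n, ∑ σ : Equiv.Perm (Fin (k + 2)),
          koszulSign (fun i => (r i : ℤ) - n) σ •
            (courantProj n).compMultilinearMap
              (((iteratedBracket n H (k + 1)).compLinearMap
                fun i => courantComponent n (r (σ i))).domDomCongr σ)

/-- The natural projection of complexes from `Cour_{n - 1}(H)` to `At_{n - 1}(H)`: the identity on
functions and on vector fields, and zero on forms of positive degree. -/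
def courantToAtiyah (n : ℕ) (v : CourantSpace A n) : AtiyahSpace A :=
  (v.1, extendForms n v.2 0 ![])

end Courant

section Naturality

variable {A B : Type*} [CommRing A] [Algebra ℝ A] [CommRing B] [Algebra ℝ B]

/-- Vector fields `X` and `Y` are related along the pullback of functions `u = f^*`. -/
def FieldRelated (u : A →ₐ[ℝ] B) (X : VField A) (Y : VField B) : Prop :=
  ∀ a, Y (u a) = u (X a)

/-- Forms `α` and `β` are related along `u = f^*`: they agree on related vector fields. This holds
for `β = f^* α`, and only for it if `f` is a local diffeomorphism. -/
def FormRelated (u : A →ₐ[ℝ] B) {r : ℕ} (α : Form A r) (β : Form B r) : Prop :=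
  ∀ (X : Fin r → VField A) (Y : Fin r → VField B), (∀ i, FieldRelated u (X i) (Y i)) →
    β Y = u (α X)

/-- Componentwise related elements of Courant `L_∞`-algebras. -/
def CourantRelated (u : A →ₐ[ℝ] B) {n : ℕ} (v : CourantSpace A n) (w : CourantSpace B n) : Prop :=
  FieldRelated u v.1 w.1 ∧ ∀ r, FormRelated u (v.2 r) (w.2 r)

/-- Componentwise related elements of Atiyah `L_∞`-algebras. -/
def AtiyahRelated (u : A →ₐ[ℝ] B) (v : AtiyahSpace A) (w : AtiyahSpace B) : Prop :=
  FieldRelated u v.1 w.1 ∧ w.2 = u v.2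

end Naturality

section Manifolds

open scoped Manifold ContDiff

/-- A smooth manifold (Hausdorff, second countable, without boundary). -/
structure SmoothMfd where
  /-- the dimension -/
  dim : ℕ
  /-- the points -/
  carrier : Type*
  [top : TopologicalSpace carrier]
  [charts : ChartedSpace (EuclideanSpace ℝ (Fin dim)) carrier]
  [smooth : IsManifold (𝓡 dim) ∞ carrier]
  [t2 : T2Space carrier]
  [secondCountable : SecondCountableTopology carrier]

attribute [instance] SmoothMfd.top SmoothMfd.charts SmoothMfd.smooth SmoothMfd.t2
  SmoothMfd.secondCountable

/-- The algebra `C^∞(M)`. -/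
abbrev SmoothMfd.Fn (M : SmoothMfd) : Type _ := C^∞⟮𝓡 M.dim, M.carrier; ℝ⟯

/-- The smooth maps from `N` to `M`. -/
abbrev SmoothMfd.Map (N M : SmoothMfd) : Type _ :=
  C^∞⟮𝓡 N.dim, N.carrier; 𝓡 M.dim, M.carrier⟯

/-- The pullback of functions along a smooth map. -/
def SmoothMfd.pullback {N M : SmoothMfd} (f : N.Map M) : M.Fn →ₐ[ℝ] N.Fn where
  toFun g := g.comp f
  map_one' := rfl
  map_mul' _ _ := rfl
  map_zero' := rfl
  map_add' _ _ := rfl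
  commutes' _ := rfl

/-- The closed differential forms of degree `r` on a manifold. -/
abbrev SmoothMfd.ClosedForm (M : SmoothMfd) (r : ℕ) : Type _ := {H : Form M.Fn r // extd H = 0}

end Manifolds

end HigherCourant

end

open HigherCourant

open scoped Nat

noncomputable section

namespace HigherCourant

/-! ### Cartan calculus on inhomogeneous forms, with sign-twisted contractions -/

section CartanIdentities

variable {A : Type*} [CommRing A] [Algebra ℝ A]

/-! All operations involved, and the components of the morphism, vanish as soon as two arguments
have no vector component. By multilinearity and graded symmetry every identity therefore needs to be
checked only on vector fields, and on one form together with vector fields (`eq_zero_of_pure`).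
There the operations are operators on forms: vector fields alone give an operator applied to the
form `H`, one form `β` with vector fields gives an operator applied to `β` (`IsGivenBy`,
`IsExtension`). The Jacobi identities and the morphism equation become identities between signed
sums of composites of such operators.

These sums are handled by polarization. For vector fields `X_1, …, X_m` let `j = ∑ c(X_i) ⊗ θ_i`
with Grassmann variables `θ_i`, where `c(X)` is the contraction twisted by a sign, so that ordinary
commutators with `j` replace graded ones. The element `j` is nilpotent. Put `L = [d, j]`, a
polarized Lie derivative, and `K = [L, j]`, a polarized contraction with a bracket. Cartan's
relations become `d² = 0` and `[K, j] = 0`, and they imply `d f(j) = f(j) d + f'(j) L + 1/2 f''(j)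
K` for every power series `f` (`IsGaugePair.d_mul`). The coefficient of the product of all `θ_i`
gives back the signed sums (`topCoeff_polarize`).

Let `F = t / (e^t - 1) = 1 + t G` and `G = -1/2 - t h`, and let `p_r` be the projection to
`r`-forms. With `ν = n - 1`, the generating function of the operations of the Courant algebra on one
form is the connection `∇ = d + G(j) L + h(j) K - F(j) d p_ν`, and the brackets of vector fields are
generated by `Ψ(j) H` with `Ψ = -t (F - 1)`. The last term of `∇` is there because the differential
of an `(n - 1)`-form is not part of the complex but enters through `D`. Up to the terms in which two
vector fields are replaced by their bracket, the Jacobi identities say that `∇² = 0` on forms of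
degree at most `ν` and that `∇ Ψ(j) H = 0` if `dH = 0` (`IsGradedGaugePair.truncConn_sq`,
`IsGradedGaugePair.truncConn_mul_psi`). Both reduce to differential equations for `F`, chiefly the
Riccati equation `G' + G² + G = 2h` (`riccati`).

The morphism is generated by `p_0 E(j)` with `E = (e^t - 1) / t`: a `q`-form and `q` vector fields
are sent to the value of the form, up to sign and the factor `1 / (q + 1)`. Since `E F = 1`, it
transforms `∇` into the action of vector fields on functions by Lie derivatives
(`IsGradedGaugePair.bernE_mul_truncConn`). Since `E Ψ = e^t - 1 - t`, it transforms the brackets of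
at least two vector fields into iterated contractions of `H`; the only one of these that is a
function is the contraction with `n + 1` vector fields, which is the top bracket of the Atiyah
algebra (`IsCartanSystem.gaugeOp_courantVec`). The Jacobi identity of the Atiyah algebra involving
`H` comes from expanding `p_0 d j^(n + 2) = 0`. The constant term of `E` is `1`, which gives the
required linear part. Naturality holds because the components only evaluate forms on vector fields.
-/

lemma neg_smul_form {r : ℕ} (c : ℝ) (ω : Form A r) : -c • ω = -(c • ω) := by
  ext v
  simp

/-- Polarization of `ι_X ι_X = 0` at `X + Y`. -/
lemma interior_interior {r : ℕ} (X Y : VField A) (ω : Form A (r + 2)) :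
    interior X (interior Y ω) = -interior Y (interior X ω) := by
  have h := interior_self (X + Y) ω
  simp only [map_add, LinearMap.add_apply, interior_self, zero_add, add_zero] at h
  exact eq_neg_of_add_eq_zero_right h

/-- In the formula for `L_X ω` evaluated at `Y` and further vector fields, the summand of the first
slot is the contraction with `⁅X, Y⁆`; the other summands form `L_X (ι_Y ω)`. -/
lemma lieDeriv_interior {r : ℕ} (X Y : VField A) (ω : Form A (r + 1)) :
    lieDeriv X (interior Y ω) = interior Y (lieDeriv X ω) + interior ⁅X, Y⁆ ω := by
  ext w
  have h0 : ∀ Z, Function.update (Matrix.vecCons Y w) 0 Z = Matrix.vecCons Z w := by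
    intro Z
    funext j; refine Fin.cases ?_ (fun j => ?_) j <;> simp
  have h1 : ∀ (i : Fin r) Z, Function.update (Matrix.vecCons Y w) i.succ Z =
      Matrix.vecCons Y (Function.update w i Z) := fun i Z => by
    simp [Matrix.vecCons, Fin.cons_update]
  simp only [AlternatingMap.add_apply, interior_apply, lieDeriv_apply, Fin.sum_univ_succ,
    Matrix.cons_val_zero, Matrix.cons_val_succ, h0, h1]
  ring

/-- Forms of positive degree are determined by their contractions. Commuting `ι_Z` past both Lie
derivatives reduces the degree by one, and the contractions that arise cancel by the Jacobi identity
of vector fields. -/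
lemma lieDeriv_lieDeriv : ∀ {r : ℕ} (X Y : VField A) (ω : Form A r),
    lieDeriv X (lieDeriv Y ω) = lieDeriv Y (lieDeriv X ω) + lieDeriv ⁅X, Y⁆ ω := by
  intro r
  induction r with
  | zero =>
    intro X Y ω
    ext v
    simp [lieDeriv_apply, Derivation.commutator_apply]
  | succ r ih =>
    intro X Y ω
    refine ext_interior fun Z => ?_
    have e : ∀ (U V : VField A) (η : Form A (r + 1)), interior V (lieDeriv U η) =
        lieDeriv U (interior V η) - interior ⁅U, V⁆ η := fun U V η => by
      rw [lieDeriv_interior]; abel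
    simp only [map_add, e, map_sub, ih X Y (interior Z ω)]
    have : interior ⁅X, ⁅Y, Z⁆⁆ ω = interior ⁅⁅X, Y⁆, Z⁆ ω + interior ⁅Y, ⁅X, Z⁆⁆ ω := by
      rw [leibniz_lie X Y Z, map_add, LinearMap.add_apply]
    rw [this]
    abel

/-- Induction on the degree, as `ι_Y d` is given by Cartan's formula and `L_X` has known commutators
with `ι_Y` and `L_Y`. -/
lemma lieDeriv_extd : ∀ {r : ℕ} (X : VField A) (ω : Form A r),
    lieDeriv X (extd ω) = extd (lieDeriv X ω) := by
  intro r
  induction r with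
  | zero =>
    intro X ω
    refine ext_interior fun Y => ?_
    have := lieDeriv_interior X Y (extd ω)
    rw [interior_extd_zero, interior_extd_zero] at this
    rw [interior_extd_zero, eq_sub_of_add_eq this.symm, lieDeriv_lieDeriv]
    abel
  | succ r ih =>
    intro X ω
    refine ext_interior fun Y => ?_
    have := lieDeriv_interior X Y (extd ω)
    rw [interior_extd, interior_extd, map_sub, ih, lieDeriv_interior, map_add,
      lieDeriv_lieDeriv] at this
    rw [interior_extd, eq_sub_of_add_eq this.symm]
    abel

/-- Cartan's formula gives `ι_X d d = L_X d - d L_X + d d ι_X`, where `L_X` commutes with `d` and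
the last term vanishes by induction. -/
lemma extd_extd : ∀ {r : ℕ} (ω : Form A r), extd (extd ω) = 0 := by
  intro r
  induction r with
  | zero =>
    intro ω
    refine ext_interior fun X => ?_
    rw [interior_extd, interior_extd_zero, lieDeriv_extd, sub_self, map_zero]
  | succ r ih =>
    intro ω
    refine ext_interior fun X => ?_
    rw [interior_extd, interior_extd, lieDeriv_extd, map_sub, ih, sub_zero, sub_self, map_zero]

/-- Inhomogeneous forms, as a type with its own module structure. -/
def TotalForm (A : Type*) [CommRing A] [Algebra ℝ A] : Type _ := Forms A

instance : AddCommGroup (TotalForm A) := inferInstanceAs (AddCommGroup (Forms A))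

instance : Module ℝ (TotalForm A) := inferInstanceAs (Module ℝ (Forms A))

/-- The component of degree `r` of an inhomogeneous form. -/
def TotalForm.comp (r : ℕ) : TotalForm A →ₗ[ℝ] Form A r where
  toFun β := β r
  map_add' _ _ := rfl
  map_smul' _ _ := rfl

/-- An inhomogeneous form with given components. -/
def TotalForm.mk (β : Forms A) : TotalForm A := β

lemma TotalForm.ext {β γ : TotalForm A} (h : ∀ r, β.comp r = γ.comp r) : β = γ := funext h

/-- A homogeneous form as an inhomogeneous one. -/
def TotalForm.single (r : ℕ) : Form A r →ₗ[ℝ] TotalForm A where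
  toFun ω := TotalForm.mk (Pi.single r ω)
  map_add' ω η := Pi.single_add r ω η
  map_smul' c ω := Pi.single_smul r c ω

lemma TotalForm.comp_single_same (r : ℕ) (ω : Form A r) : (TotalForm.single r ω).comp r = ω :=
  Pi.single_eq_same r ω

lemma TotalForm.comp_single_of_ne {r s : ℕ} (h : s ≠ r) (ω : Form A r) :
    (TotalForm.single r ω).comp s = 0 := Pi.single_eq_of_ne h ω

/-- Operators on inhomogeneous forms. -/
abbrev FormOp (A : Type*) [CommRing A] [Algebra ℝ A] : Type _ := Module.End ℝ (TotalForm A)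

/-- The de Rham differential. -/
def dOp : FormOp A where
  toFun β := TotalForm.mk (extdAll β)
  map_add' β γ := map_add extdAll β γ
  map_smul' c β := map_smul extdAll c β

/-- The contraction with a vector field. -/
def iOp : VField A →ₗ[ℝ] FormOp A where
  toFun X :=
    { toFun := fun β => TotalForm.mk (interiorAll X β)
      map_add' := fun β γ => map_add (interiorAll X) β γ
      map_smul' := fun c β => map_smul (interiorAll X) c β }
  map_add' X Y := LinearMap.ext fun β => LinearMap.map_add₂ interiorAll X Y β
  map_smul' c X := LinearMap.ext fun β => LinearMap.map_smul₂ interiorAll c X β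

/-- The Lie derivative along a vector field. -/
def lOp (X : VField A) : FormOp A where
  toFun β := TotalForm.mk (lieDerivAll X β)
  map_add' β γ := map_add (lieDerivAll X) β γ
  map_smul' c β := map_smul (lieDerivAll X) c β

/-- The sign `(-1)^{r + n}` on forms of degree `r`. -/
def signOp (n : ℕ) : FormOp A where
  toFun β := TotalForm.mk (paritySign n β)
  map_add' β γ := map_add (paritySign n) β γ
  map_smul' c β := map_smul (paritySign n) c β

/-- The projection onto the forms of degree `r`. -/
def degProj (r : ℕ) : FormOp A := TotalForm.single r ∘ₗ TotalForm.comp r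

variable (X Y : VField A) (n : ℕ) (β : TotalForm A)

lemma comp_dOp_succ (r : ℕ) : (dOp β).comp (r + 1) = extd (β.comp r) := rfl

lemma comp_dOp_zero : (dOp β).comp 0 = 0 := rfl

lemma comp_iOp (r : ℕ) : (iOp X β).comp r = interior X (β.comp (r + 1)) := rfl

lemma comp_lOp (r : ℕ) : (lOp X β).comp r = lieDeriv X (β.comp r) := rfl

lemma comp_signOp (r : ℕ) : (signOp n β).comp r = (-1 : ℝ) ^ (r + n) • β.comp r := rfl

lemma degProj_apply (r : ℕ) : degProj r β = TotalForm.single r (β.comp r) := rfl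

lemma comp_degProj (r s : ℕ) : (degProj r β).comp s = if s = r then β.comp s else 0 := by
  split_ifs with h
  · subst h; rw [degProj_apply, TotalForm.comp_single_same]
  · rw [degProj_apply, TotalForm.comp_single_of_ne h]

lemma dOp_mul_dOp : (dOp : FormOp A) * dOp = 0 := by
  refine LinearMap.ext fun β => TotalForm.ext fun r => ?_
  rcases r with _ | _ | r
  · rfl
  · change extd ((dOp β).comp 0) = 0
    rw [comp_dOp_zero, map_zero]
  · exact extd_extd (β.comp r)

lemma lOp_eq : lOp X = dOp * iOp X + iOp X * dOp := by
  refine LinearMap.ext fun β => TotalForm.ext fun r => ?_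
  rcases r with _ | r
  · change lieDeriv X (β.comp 0) = 0 + interior X (extd (β.comp 0))
    rw [interior_extd_zero, zero_add]
  · change lieDeriv X (β.comp (r + 1)) =
      extd (interior X (β.comp (r + 1))) + interior X (extd (β.comp (r + 1)))
    rw [interior_extd]
    abel

lemma lOp_mul_iOp : lOp X * iOp Y = iOp Y * lOp X + iOp ⁅X, Y⁆ :=
  LinearMap.ext fun β => TotalForm.ext fun r => lieDeriv_interior X Y (β.comp (r + 1))

lemma iOp_mul_iOp : iOp X * iOp Y = -(iOp Y * iOp X) :=
  LinearMap.ext fun β => TotalForm.ext fun r => interior_interior X Y (β.comp (r + 2))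

lemma signOp_mul_self : (signOp n : FormOp A) * signOp n = 1 := by
  refine LinearMap.ext fun β => TotalForm.ext fun r => ?_
  change (-1 : ℝ) ^ (r + n) • (-1 : ℝ) ^ (r + n) • β.comp r = β.comp r
  rw [smul_smul, ← mul_pow]
  simp

lemma dOp_mul_signOp : (dOp : FormOp A) * signOp n = -(signOp n * dOp) := by
  refine LinearMap.ext fun β => TotalForm.ext fun r => ?_
  rcases r with _ | r
  · change 0 = -((-1 : ℝ) ^ (0 + n) • (0 : Form A 0))
    rw [smul_zero, neg_zero]
  · change extd ((-1 : ℝ) ^ (r + n) • β.comp r) = -((-1 : ℝ) ^ (r + 1 + n) • extd (β.comp r))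
    rw [map_smul, ← neg_smul_form, show r + 1 + n = r + n + 1 by ring, pow_succ, mul_neg_one,
      neg_neg]

lemma iOp_mul_signOp : iOp X * signOp n = -(signOp n * iOp X) := by
  refine LinearMap.ext fun β => TotalForm.ext fun r => ?_
  change interior X ((-1 : ℝ) ^ (r + 1 + n) • β.comp (r + 1)) =
    -((-1 : ℝ) ^ (r + n) • interior X (β.comp (r + 1)))
  rw [map_smul, ← neg_smul_form, show r + 1 + n = r + n + 1 by ring, pow_succ, mul_neg_one]

lemma dOp_mul_degProj (r : ℕ) : (dOp : FormOp A) * degProj r = degProj (r + 1) * dOp := by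
  refine LinearMap.ext fun β => TotalForm.ext fun s => ?_
  change (dOp (degProj r β)).comp s = (degProj (r + 1) (dOp β)).comp s
  rcases s with _ | s
  · rw [comp_degProj, comp_dOp_zero, comp_dOp_zero, ite_self]
  · rw [comp_degProj, comp_dOp_succ, comp_dOp_succ, comp_degProj]
    by_cases h : s = r <;> simp [h]

lemma degProj_mul_iOp (r : ℕ) : degProj r * iOp X = iOp X * degProj (r + 1) := by
  refine LinearMap.ext fun β => TotalForm.ext fun s => ?_
  change (degProj r (iOp X β)).comp s = (iOp X (degProj (r + 1) β)).comp s
  rw [comp_degProj, comp_iOp, comp_iOp, comp_degProj]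
  by_cases h : s = r <;> simp [h]

lemma degProj_mul_signOp (r : ℕ) : (degProj r : FormOp A) * signOp n =
    (-1 : ℝ) ^ (r + n) • degProj r := by
  refine LinearMap.ext fun β => TotalForm.ext fun s => ?_
  change (degProj r (signOp n β)).comp s = (-1 : ℝ) ^ (r + n) • (degProj r β).comp s
  rw [comp_degProj, comp_degProj, comp_signOp]
  by_cases h : s = r <;> simp [h]

lemma signOp_mul_degProj (r : ℕ) : (signOp n : FormOp A) * degProj r =
    (-1 : ℝ) ^ (r + n) • degProj r := by
  refine LinearMap.ext fun β => TotalForm.ext fun s => ?_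
  change (signOp n (degProj r β)).comp s = (-1 : ℝ) ^ (r + n) • (degProj r β).comp s
  rw [comp_signOp, comp_degProj]
  by_cases h : s = r <;> simp [h]

lemma degProj_mul_degProj (r s : ℕ) : (degProj r : FormOp A) * degProj s =
    if r = s then degProj r else 0 := by
  refine LinearMap.ext fun β => TotalForm.ext fun t => ?_
  change (degProj r (degProj s β)).comp t = _
  rw [comp_degProj, comp_degProj]
  by_cases h : r = s
  · subst h; rw [if_pos rfl, comp_degProj]; split_ifs <;> rfl
  · rw [if_neg h]
    by_cases h' : t = r
    · rw [if_pos h', if_neg (by omega)]; rfl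
    · rw [if_neg h']; rfl

/-- The contraction `β ↦ [β, ι_X] = -ι_X ((-1)^{|β|} β)`. -/
def contr (n : ℕ) : VField A →ₗ[ℝ] FormOp A :=
  -(LinearMap.mulRight ℝ (signOp n : FormOp A) ∘ₗ iOp)

variable {X Y n}

lemma contr_eq (n : ℕ) (X : VField A) : contr n X = -(iOp X * signOp n) := rfl

lemma comp_contr (n : ℕ) (X : VField A) (β : TotalForm A) (r : ℕ) :
    (contr n X β).comp r = (-1 : ℝ) ^ (r + n) • interior X (β.comp (r + 1)) := by
  rw [contr_eq, LinearMap.neg_apply, map_neg]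
  change -(interior X ((-1 : ℝ) ^ (r + 1 + n) • β.comp (r + 1))) = _
  rw [map_smul, ← neg_smul_form, show r + 1 + n = r + n + 1 by ring, pow_succ, mul_neg_one, neg_neg]

/-- The commutator of the de Rham differential and `contr n X`. -/
def contrLie (n : ℕ) (X : VField A) : FormOp A := dOp * contr n X - contr n X * dOp

/-- The contraction with a bracket of vector fields, as an odd operation. -/
def contrBracket (n : ℕ) (X Y : VField A) : FormOp A := contr n ⁅X, Y⁆ * signOp n

lemma signOp_mul_iOp (n : ℕ) (X : VField A) : signOp n * iOp X = -(iOp X * signOp n) := by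
  rw [iOp_mul_signOp, neg_neg]

lemma contrBracket_eq (n : ℕ) (X Y : VField A) : contrBracket n X Y = -iOp ⁅X, Y⁆ := by
  rw [contrBracket, contr_eq, neg_mul, mul_assoc, signOp_mul_self, mul_one]

/-- The purpose of the sign twist: the sign operator anticommutes with `d` and with `ι_X`, so the
plain commutator with the twisted contraction is the anticommutator `d ι_X + ι_X d` up to sign and
parity. -/
lemma contrLie_eq (n : ℕ) (X : VField A) : contrLie n X = -(lOp X * signOp n) := by
  rw [contrLie, contr_eq, lOp_eq, add_mul, mul_neg, neg_mul, mul_assoc (iOp X),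
    mul_assoc (iOp X), dOp_mul_signOp, mul_neg, mul_assoc]
  abel

lemma contr_mul_contr (n : ℕ) (X Y : VField A) :
    contr n X * contr n Y = -(contr n Y * contr n X) := by
  have h : ∀ X Y : VField A, contr n X * contr n Y = -(iOp X * iOp Y) := by
    intro X Y
    rw [contr_eq, contr_eq, neg_mul_neg, mul_assoc, ← mul_assoc (signOp n), signOp_mul_iOp,
      neg_mul, mul_neg, mul_assoc, signOp_mul_self, mul_one]
  rw [h, h, iOp_mul_iOp]

lemma contr_mul_signOp (n : ℕ) (X : VField A) :
    contr n X * signOp n = -(signOp n * contr n X) := by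
  rw [contr_eq, neg_mul, mul_neg, neg_neg, iOp_mul_signOp, neg_mul, mul_assoc, iOp_mul_signOp]
  simp

lemma lOp_mul_signOp (n : ℕ) (X : VField A) : lOp X * signOp n = signOp n * lOp X := by
  rw [lOp_eq, add_mul, mul_add, mul_assoc, mul_assoc, iOp_mul_signOp,
    dOp_mul_signOp, mul_neg, mul_neg, ← mul_assoc, ← mul_assoc, dOp_mul_signOp,
    iOp_mul_signOp]
  simp [mul_assoc]

/-- The relation `[L_X, ι_Y] = ι_{[X, Y]}`, with the two sign operators moved together until they
cancel. -/
lemma contrLie_mul_contr (n : ℕ) (X Y : VField A) :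
    contrLie n X * contr n Y + contr n Y * contrLie n X = contrBracket n X Y := by
  rw [contrLie_eq, contr_eq, contrBracket_eq, neg_mul_neg, neg_mul_neg, mul_assoc,
    ← mul_assoc (signOp n), signOp_mul_iOp, neg_mul,
    mul_neg, mul_assoc (iOp Y), signOp_mul_self, mul_one, mul_assoc (iOp Y), lOp_mul_signOp,
    ← mul_assoc (signOp n), signOp_mul_self, one_mul, lOp_mul_iOp]
  abel

lemma degProj_mul_contr (n : ℕ) (X : VField A) (r : ℕ) :
    degProj r * contr n X = contr n X * degProj (r + 1) := by
  rw [contr_eq, mul_neg, neg_mul, ← mul_assoc, degProj_mul_iOp, mul_assoc, mul_assoc,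
    degProj_mul_signOp, signOp_mul_degProj]

end CartanIdentities

/-! ### Koszul signs and signed sums over permutations -/

section Koszul

/-- Both sides are the product of the symmetric function `g` over unordered pairs. Pairs are split
according to whether `τ` keeps or reverses their order; the reversed ones are matched by exchanging
the two indices. -/
lemma prod_lt_comp_perm {k : ℕ} {G : Type*} [CommMonoid G] (g : Fin k → Fin k → G)
    (hg : ∀ i j, g i j = g j i) (τ : Equiv.Perm (Fin k)) :
    (∏ i, ∏ j, if i < j then g (τ i) (τ j) else 1) = ∏ i, ∏ j, if i < j then g i j else 1 := by
  have split : ∀ (p r : Fin k → Fin k → Prop) [∀ i j, Decidable (p i j)]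
      [∀ i j, Decidable (r i j)] (f : Fin k → Fin k → G), (∀ i j, p i j → (r i j ∨ r j i)) →
      (∀ i j, r i j → ¬ r j i) →
      (∏ i, ∏ j, if p i j then f i j else 1) = (∏ i, ∏ j, if p i j ∧ r i j then f i j else 1) *
        ∏ i, ∏ j, if p i j ∧ r j i then f i j else 1 := by
    intro p r _ _ f h h'
    simp only [← Finset.prod_mul_distrib]
    refine Finset.prod_congr rfl fun i _ => Finset.prod_congr rfl fun j _ => ?_
    by_cases hp : p i j
    · rcases h i j hp with hr | hr
      · simp [hp, hr, h' _ _ hr]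
      · simp [hp, hr, h' _ _ hr]
    · simp [hp]
  have e : (∏ i, ∏ j, if i < j then g i j else 1) =
      ∏ i, ∏ j, if τ i < τ j then g (τ i) (τ j) else 1 := by
    rw [← Equiv.prod_comp τ]
    exact Finset.prod_congr rfl fun i _ => (Equiv.prod_comp τ _).symm
  rw [e, split (fun i j => τ i < τ j) (fun i j => i < j) _
    (fun i j h => by
      rcases lt_trichotomy i j with h1 | h1 | h1
      · exact .inl h1
      · subst h1; exact absurd h (lt_irrefl _)
      · exact .inr h1) (fun i j h => h.not_gt),
    split (fun i j => i < j) (fun i j => τ i < τ j) _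
    (fun i j h => by
      rcases lt_trichotomy (τ i) (τ j) with h1 | h1 | h1
      · exact .inl h1
      · exact absurd (τ.injective h1) h.ne
      · exact .inr h1) (fun i j h => h.not_gt)]
  congr 1
  · simp only [and_comm]
  · rw [Finset.prod_comm]
    refine Finset.prod_congr rfl fun i _ => Finset.prod_congr rfl fun j _ => ?_
    rw [hg]
    simp only [and_comm]

/-- A pair is inverted by `σ * τ` exactly if it is inverted by `τ`, or its image is inverted by `σ`,
but not both; if both happen, the two equal signs multiply to one. -/
lemma koszulSign_mul {k : ℕ} (d : Fin k → ℤ) (σ τ : Equiv.Perm (Fin k)) :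
    koszulSign d (σ * τ) = koszulSign d σ * koszulSign (d ∘ σ) τ := by
  -- The factor of a pair is written symmetrically in `i` and `j`, so that the product over pairs
  -- can be relabelled by `τ`.
  have h1 : koszulSign d σ = ∏ i, ∏ j, if i < j then
      (if (i < j ∧ σ j < σ i) ∨ (j < i ∧ σ i < σ j) then (d (σ i) * d (σ j)).negOnePow else 1)
      else 1 := by
    refine Finset.prod_congr rfl fun i _ => Finset.prod_congr rfl fun j _ => ?_
    by_cases h : i < j
    · simp [h, h.not_gt]
    · simp [h]
  rw [h1, ← prod_lt_comp_perm _ _ τ, koszulSign, koszulSign, ← Finset.prod_mul_distrib]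
  · refine Finset.prod_congr rfl fun i _ => ?_
    rw [← Finset.prod_mul_distrib]
    refine Finset.prod_congr rfl fun j _ => ?_
    by_cases h : i < j
    · have hτ : τ i ≠ τ j := fun e => h.ne (τ.injective e)
      have hσ : σ (τ i) ≠ σ (τ j) := fun e => hτ (σ.injective e)
      simp only [h, true_and, Equiv.Perm.mul_apply, if_true, Function.comp_apply]
      rcases lt_or_gt_of_ne hτ with a | a <;> rcases lt_or_gt_of_ne hσ with b | b <;>
        simp [a, b, a.not_gt, b.not_gt]
    · simp [h]
  · intro i j
    rw [mul_comm (d (σ i))]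
    simp only [or_comm]

lemma koszulSign_one {k : ℕ} (d : Fin k → ℤ) : koszulSign d 1 = 1 := by
  refine Finset.prod_eq_one fun i _ => Finset.prod_eq_one fun j _ => if_neg ?_
  rintro ⟨h, h'⟩
  exact h.not_gt h'

/-- Every inversion contributes `-1`. Vector fields have degree `-1` in the shift, so graded
symmetric operations are alternating on them. -/
lemma koszulSign_odd {k : ℕ} {d : Fin k → ℤ} (hd : ∀ i, d i = -1) (σ : Equiv.Perm (Fin k)) :
    koszulSign d σ = Equiv.Perm.sign σ := by
  rw [Equiv.Perm.sign_eq_prod_prod_Ioi, koszulSign]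
  refine Finset.prod_congr rfl fun i _ => ?_
  rw [← Finset.prod_subset (Finset.subset_univ (Finset.Ioi i))]
  · refine Finset.prod_congr rfl fun j hj => ?_
    have hij := Finset.mem_Ioi.mp hj
    have : σ i ≠ σ j := fun e => hij.ne (σ.injective e)
    rcases lt_or_gt_of_ne this with h | h
    · simp [hij, h, h.not_gt]
    · simp [hij, h, h.not_gt, hd]
  · intro j _ hj
    exact if_neg fun h => hj (Finset.mem_Ioi.mpr h.1)

/-- The permutation that moves `0` to the position `j` and permutes the other indices by `τ`. -/
def insertPerm {m : ℕ} (j : Fin (m + 1)) (τ : Equiv.Perm (Fin m)) : Equiv.Perm (Fin (m + 1)) :=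
  Equiv.Perm.decomposeFin.symm (0, τ) * j.cycleRange

lemma insertPerm_self {m : ℕ} (j : Fin (m + 1)) (τ : Equiv.Perm (Fin m)) :
    insertPerm j τ j = 0 := by
  simp [insertPerm]

lemma insertPerm_succAbove {m : ℕ} (j : Fin (m + 1)) (τ : Equiv.Perm (Fin m)) (i : Fin m) :
    insertPerm j τ (j.succAbove i) = (τ i).succ := by
  simp [insertPerm]

/-- The position of `0` and the order of the other indices determine a permutation, and `(m + 1) *
m! = (m + 1)!`. -/
lemma insertPerm_bijective (m : ℕ) :
    Function.Bijective fun p : Fin (m + 1) × Equiv.Perm (Fin m) => insertPerm p.1 p.2 := by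
  rw [Fintype.bijective_iff_injective_and_card]
  constructor
  · rintro ⟨j, τ⟩ ⟨j', τ'⟩ h
    dsimp only at h
    have h1 : j = j' := by
      have := insertPerm_self j τ
      rw [h, ← insertPerm_self j' τ'] at this
      exact (insertPerm j' τ').injective this
    subst h1
    congr 1
    ext i : 1
    have := insertPerm_succAbove j τ i
    rw [h, insertPerm_succAbove] at this
    exact (Fin.succ_injective _ this).symm
  · simp [Fintype.card_perm, Nat.factorial_succ]

lemma comp_insertPerm {m : ℕ} {V : Type*} (x : Fin (m + 1) → V) (j : Fin (m + 1))
    (τ : Equiv.Perm (Fin m)) :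
    x ∘ insertPerm j τ = j.insertNth (α := fun _ => V) (x 0) (Fin.tail x ∘ τ) := by
  funext i
  induction i using Fin.succAboveCases j with
  | x => simp [insertPerm_self]
  | p i => simp [insertPerm_succAbove, Fin.tail]

lemma negOnePow_mul_neg_one (a : ℤ) : (a * -1).negOnePow = a.negOnePow := by
  rw [mul_neg_one, Int.negOnePow_neg]

lemma koszulSign_cycleRange {m : ℕ} {d : Fin (m + 1) → ℤ} (hd : ∀ i : Fin m, d i.succ = -1)
    (j : Fin (m + 1)) : koszulSign d j.cycleRange = (d 0).negOnePow ^ (j : ℕ) := by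
  -- The inversions of the cycle are exactly the pairs `(i, j)` with `i < j`, as only the entry that
  -- goes to `0` overtakes others.
  have key : ∀ i i' : Fin (m + 1), (if i < i' ∧ j.cycleRange i' < j.cycleRange i then
      (d (j.cycleRange i) * d (j.cycleRange i')).negOnePow else 1) =
      if i' = j then (if i < j then (d 0).negOnePow else 1) else 1 := by
    intro i i'
    by_cases h : i' = j
    · subst h
      rw [Fin.cycleRange_self, if_pos rfl]
      by_cases hi : i < i'
      · have hc : i'.cycleRange i ≠ 0 := by
          intro e
          rw [← Fin.cycleRange_self i'] at e
          exact hi.ne (i'.cycleRange.injective e)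
        obtain ⟨l, hl⟩ := Fin.exists_succ_eq.mpr hc
        rw [if_pos ⟨hi, Fin.pos_of_ne_zero hc⟩, if_pos hi, ← hl, hd, mul_comm,
          negOnePow_mul_neg_one]
      · rw [if_neg hi, if_neg (fun h => hi h.1)]
    · rw [if_neg h, if_neg]
      rintro ⟨h1, h2⟩
      rcases lt_trichotomy i j with hi | hi | hi
      · rw [Fin.cycleRange_of_lt hi] at h2
        rcases lt_or_gt_of_ne h with h' | h'
        · rw [Fin.cycleRange_of_lt h'] at h2
          have e1 := Fin.val_add_one_of_lt (hi.trans_le (Fin.le_last _))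
          have e2 := Fin.val_add_one_of_lt (h'.trans_le (Fin.le_last _))
          rw [Fin.lt_def, e1, e2] at h2
          rw [Fin.lt_def] at h1
          omega
        · rw [Fin.cycleRange_of_gt h'] at h2
          have e1 := Fin.val_add_one_of_lt (hi.trans_le (Fin.le_last _))
          rw [Fin.lt_def, e1] at h2
          rw [Fin.lt_def] at hi h'
          omega
      · subst hi
        rw [Fin.cycleRange_self] at h2
        exact absurd h2 (Fin.not_lt_zero _)
      · rw [Fin.cycleRange_of_gt hi, Fin.cycleRange_of_gt (hi.trans h1)] at h2
        exact h1.not_gt h2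
  rw [koszulSign]
  simp only [key, Finset.prod_ite_eq', Finset.mem_univ, if_true]
  rw [Finset.prod_ite, Finset.prod_const_one, mul_one, Finset.prod_const]
  congr 1
  rw [show (Finset.univ.filter fun i => i < j) = Finset.Iio j by ext; simp, Fin.card_Iio]

lemma koszulSign_insertPerm {m : ℕ} {d : Fin (m + 1) → ℤ} (hd : ∀ i : Fin m, d i.succ = -1)
    (j : Fin (m + 1)) (τ : Equiv.Perm (Fin m)) :
    koszulSign d (insertPerm j τ) = (d 0).negOnePow ^ (j : ℕ) * Equiv.Perm.sign τ := by
  -- The permutation by `τ` only exchanges arguments of the same degree `-1`, so the degrees seen by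
  -- the cycle are unchanged.
  have e : d ∘ Equiv.Perm.decomposeFin.symm (0, τ) = d := by
    funext i
    induction i using Fin.cases <;> simp [hd]
  rw [insertPerm, koszulSign_mul, e, koszulSign_cycleRange hd, mul_comm]
  congr 1
  rw [← koszulSign_odd (d := fun i : Fin m => d i.succ) hd τ, koszulSign, koszulSign,
    Fin.prod_univ_succ]
  have h0 : (∏ j : Fin (m + 1), if (0 : Fin (m + 1)) < j ∧
      Equiv.Perm.decomposeFin.symm (0, τ) j < Equiv.Perm.decomposeFin.symm (0, τ) 0 then
        (d (Equiv.Perm.decomposeFin.symm (0, τ) 0) *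
          d (Equiv.Perm.decomposeFin.symm (0, τ) j)).negOnePow else 1) = 1 :=
    Finset.prod_eq_one fun i _ => by simp
  rw [h0, one_mul]
  refine Finset.prod_congr rfl fun i _ => ?_
  rw [Fin.prod_univ_succ]
  simp

variable {V W : Type*} [AddCommGroup W]

/-- The sum of `F (x ∘ σ)` over all permutations, with Koszul signs. -/
def koszulSum {k : ℕ} (d : Fin k → ℤ) (F : (Fin k → V) → W) (x : Fin k → V) : W :=
  ∑ σ : Equiv.Perm (Fin k), koszulSign d σ • F (x ∘ σ)

/-- The sum of `F (x ∘ σ)` over all permutations, with signs. -/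
def altSum {k : ℕ} (F : (Fin k → V) → W) (x : Fin k → V) : W :=
  ∑ σ : Equiv.Perm (Fin k), Equiv.Perm.sign σ • F (x ∘ σ)

lemma koszulSum_odd {k : ℕ} {d : Fin k → ℤ} (hd : ∀ i, d i = -1) (F : (Fin k → V) → W)
    (x : Fin k → V) : koszulSum d F x = altSum F x :=
  Finset.sum_congr rfl fun σ _ => by rw [koszulSign_odd hd]

lemma koszulSum_comp {k : ℕ} (d : Fin k → ℤ) (F : (Fin k → V) → W) (x : Fin k → V)
    (ρ : Equiv.Perm (Fin k)) :
    koszulSum d F x = koszulSign d ρ • koszulSum (d ∘ ρ) F (x ∘ ρ) := by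
  rw [koszulSum, koszulSum, Finset.smul_sum, ← Equiv.sum_comp (Equiv.mulLeft ρ)]
  refine Finset.sum_congr rfl fun σ _ => ?_
  rw [Equiv.coe_mulLeft, koszulSign_mul, mul_smul]
  rfl

/-- A signed sum over permutations with one argument singled out. -/
lemma koszulSum_cons {m : ℕ} {d : Fin (m + 1) → ℤ} (hd : ∀ i : Fin m, d i.succ = -1)
    (F : (Fin (m + 1) → V) → W) (x : Fin (m + 1) → V) :
    koszulSum d F x = ∑ j : Fin (m + 1), (d 0).negOnePow ^ (j : ℕ) •
      altSum (fun y => F (j.insertNth (α := fun _ => V) (x 0) y)) (Fin.tail x) := by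
  rw [koszulSum, ← (Equiv.ofBijective _ (insertPerm_bijective m)).sum_comp, Fintype.sum_prod_type]
  refine Finset.sum_congr rfl fun j _ => ?_
  rw [altSum, Finset.smul_sum]
  refine Finset.sum_congr rfl fun τ _ => ?_
  rw [Equiv.ofBijective_apply, koszulSign_insertPerm hd, comp_insertPerm, mul_smul]

lemma altSum_cons {m : ℕ} (F : (Fin (m + 1) → V) → W) (x : Fin (m + 1) → V) :
    altSum F x = ∑ j : Fin (m + 1), (-1 : ℤˣ) ^ (j : ℕ) •
      altSum (fun y => F (j.insertNth (α := fun _ => V) (x 0) y)) (Fin.tail x) := by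
  rw [← koszulSum_odd (d := fun _ => -1) (fun _ => rfl), koszulSum_cons (fun _ => rfl)]
  simp

lemma altSum_congr {k : ℕ} {F G : (Fin k → V) → W} (h : ∀ y, F y = G y) (x : Fin k → V) :
    altSum F x = altSum G x := by
  rw [show F = G from funext h]

lemma altSum_add {k : ℕ} (F G : (Fin k → V) → W) (x : Fin k → V) :
    altSum (fun y => F y + G y) x = altSum F x + altSum G x := by
  simp [altSum, Finset.sum_add_distrib]

lemma altSum_zero {k : ℕ} (x : Fin k → V) : altSum (fun _ => (0 : W)) x = 0 := by
  simp [altSum]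

lemma map_altSum {k : ℕ} {U G : Type*} [AddCommGroup U] [FunLike G W U] [AddMonoidHomClass G W U]
    (u : G) (F : (Fin k → V) → W) (x : Fin k → V) :
    u (altSum F x) = altSum (fun y => u (F y)) x := by
  simp [altSum, Units.smul_def]

lemma map_koszulSum {k : ℕ} {U G : Type*} [AddCommGroup U] [FunLike G W U]
    [AddMonoidHomClass G W U] (u : G) (d : Fin k → ℤ) (F : (Fin k → V) → W) (x : Fin k → V) :
    u (koszulSum d F x) = koszulSum d (fun y => u (F y)) x := by
  simp [koszulSum, Units.smul_def]

lemma altSum_smul {k : ℕ} [Module ℝ W] (c : ℝ) (F : (Fin k → V) → W) (x : Fin k → V) :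
    altSum (fun y => c • F y) x = c • altSum F x := by
  rw [altSum, altSum, Finset.smul_sum]
  exact Finset.sum_congr rfl fun σ _ => smul_comm _ _ _

/-- The signed sum of a function that is already alternating. -/
lemma altSum_of_alternating {k : ℕ} [Module ℝ W] {F : (Fin k → V) → W}
    (hF : ∀ (y : Fin k → V) (σ : Equiv.Perm (Fin k)), F (y ∘ σ) = Equiv.Perm.sign σ • F y)
    (x : Fin k → V) : altSum F x = (k ! : ℝ) • F x := by
  have : ∀ σ : Equiv.Perm (Fin k), Equiv.Perm.sign σ • F (x ∘ σ) = F x := fun σ => by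
    rw [hF, smul_smul]
    simp
  rw [altSum, Finset.sum_congr rfl fun σ _ => this σ]
  simp [Fintype.card_perm, ← Nat.cast_smul_eq_nsmul ℝ]

end Koszul

/-! ### Polarization with Grassmann variables -/

section Polarization

open scoped TensorProduct

/-- The exterior algebra on `m` generators. -/
abbrev Grassmann (m : ℕ) : Type := ExteriorAlgebra ℝ (Fin m → ℝ)

/-- The product `θ_{f (q - 1)} ⋯ θ_{f 0}` of generators. -/
def grassmannMonomial {m q : ℕ} (f : Fin q → Fin m) : Grassmann m :=
  ExteriorAlgebra.ιMulti ℝ q fun i => Pi.single (f i.rev) 1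

lemma grassmannMonomial_eq_prod {m q : ℕ} (f : Fin q → Fin m) : grassmannMonomial f =
    (List.ofFn fun i => ExteriorAlgebra.ι ℝ (Pi.single (f i) (1 : ℝ) : Fin m → ℝ)).reverse.prod := by
  rw [grassmannMonomial, ExteriorAlgebra.ιMulti_apply]
  congr 1
  refine List.ext_getElem (by simp) fun i h1 h2 => ?_
  simp [Fin.rev]
  congr 2
  ext
  simp
  omega

lemma grassmannMonomial_comp_perm {m q : ℕ} (f : Fin q → Fin m) (σ : Equiv.Perm (Fin q)) :
    grassmannMonomial (f ∘ σ) = Equiv.Perm.sign σ • grassmannMonomial f := by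
  have h := AlternatingMap.map_perm (ExteriorAlgebra.ιMulti ℝ q)
    (fun i => (Pi.single (f i.rev) 1 : Fin m → ℝ)) (Fin.revPerm.permCongr σ)
  rw [Equiv.Perm.sign_permCongr] at h
  rw [grassmannMonomial, grassmannMonomial, ← h]
  congr 1
  funext i
  simp

lemma grassmannMonomial_of_not_injective {m q : ℕ} {f : Fin q → Fin m}
    (hf : ¬ Function.Injective f) : grassmannMonomial f = 0 := by
  refine AlternatingMap.map_eq_zero_of_not_injective _ _ fun h => hf fun a b hab => ?_
  have := @h a.rev b.rev (by simp [hab])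
  exact Fin.rev_injective this

/-- The generators are multiplied in reversed order so that, as in a composite of operators, later
arguments stand on the left. -/
lemma grassmannMonomial_append {m p q : ℕ} (f : Fin p → Fin m) (g : Fin q → Fin m) :
    grassmannMonomial (Fin.append f g) = grassmannMonomial g * grassmannMonomial f := by
  rw [grassmannMonomial_eq_prod, grassmannMonomial_eq_prod, grassmannMonomial_eq_prod,
    ← List.prod_append, ← List.reverse_append, ← List.ofFn_fin_append]
  congr 3
  funext i
  refine Fin.addCases (fun i => ?_) (fun i => ?_) i <;> simp

/-- A linear functional that is nonzero on the product of all generators, and vanishes on other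
monomials. -/
def grassmannTopAux (m : ℕ) : Grassmann m →ₗ[ℝ] ℝ :=
  ExteriorAlgebra.liftAlternating fun i =>
    if h : i = m then (Matrix.detRowAlternating (n := Fin m) (R := ℝ)).domDomCongr (finCongr h.symm)
    else 0

lemma grassmannTopAux_of_ne {m q : ℕ} (h : q ≠ m) (f : Fin q → Fin m) :
    grassmannTopAux m (grassmannMonomial f) = 0 := by
  rw [grassmannTopAux, grassmannMonomial, ExteriorAlgebra.liftAlternating_apply_ιMulti, dif_neg h]
  rfl

/-- The functional is a determinant in top degree; the reversed order of the generators only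
contributes the sign of the reversing permutation, which `grassmannTop` divides out. -/
lemma grassmannTopAux_id (m : ℕ) : grassmannTopAux m (grassmannMonomial id) ≠ 0 := by
  have h := AlternatingMap.map_perm (Matrix.detRowAlternating (n := Fin m) (R := ℝ))
    (fun i => (Pi.single i 1 : Fin m → ℝ)) Fin.revPerm
  have e : grassmannTopAux m (grassmannMonomial id) = Matrix.detRowAlternating
      ((fun i => (Pi.single i 1 : Fin m → ℝ)) ∘ Fin.revPerm) := by
    rw [grassmannTopAux, grassmannMonomial, ExteriorAlgebra.liftAlternating_apply_ιMulti,
      dif_pos rfl]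
    rfl
  rw [e, h]
  have : (Matrix.detRowAlternating fun i => (Pi.single i 1 : Fin m → ℝ)) = 1 := by
    change Matrix.det _ = 1
    rw [show (fun i => (Pi.single i 1 : Fin m → ℝ)) = (1 : Matrix (Fin m) (Fin m) ℝ) by
      ext i j; simp [Matrix.one_apply, Pi.single_apply, eq_comm]]
    exact Matrix.det_one
  rw [this]
  rcases Int.units_eq_one_or (Equiv.Perm.sign (Fin.revPerm (n := m))) with h | h <;> simp [h]

/-- The coefficient of the product of all generators. -/
def grassmannTop (m : ℕ) : Grassmann m →ₗ[ℝ] ℝ :=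
  (grassmannTopAux m (grassmannMonomial id))⁻¹ • grassmannTopAux m

lemma grassmannTop_of_ne {m q : ℕ} (h : q ≠ m) (f : Fin q → Fin m) :
    grassmannTop m (grassmannMonomial f) = 0 := by
  rw [grassmannTop, LinearMap.smul_apply, grassmannTopAux_of_ne h, smul_zero]

lemma grassmannTop_id (m : ℕ) : grassmannTop m (grassmannMonomial id) = 1 := by
  rw [grassmannTop, LinearMap.smul_apply, smul_eq_mul, inv_mul_cancel₀ (grassmannTopAux_id m)]

variable {E : Type*} [Ring E] [Algebra ℝ E] {L : Type*} {m : ℕ} (X : Fin m → L)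

/-- The polarization of an operation of `q` arguments at the universal odd linear combination
`∑ θ_i X_i`. -/
def polarize (q : ℕ) (T : (Fin q → L) → E) : E ⊗[ℝ] Grassmann m :=
  ∑ f : Fin q → Fin m, T (X ∘ f) ⊗ₜ grassmannMonomial f

lemma polarize_congr {q : ℕ} {S T : (Fin q → L) → E} (h : ∀ y, S y = T y) :
    polarize X q S = polarize X q T := by
  rw [show S = T from funext h]

lemma polarize_add {q : ℕ} (S T : (Fin q → L) → E) :
    polarize X q (fun y => S y + T y) = polarize X q S + polarize X q T := by
  simp [polarize, TensorProduct.add_tmul, Finset.sum_add_distrib]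

lemma polarize_neg {q : ℕ} (T : (Fin q → L) → E) :
    polarize X q (fun y => -T y) = -polarize X q T := by
  simp [polarize, TensorProduct.neg_tmul]

lemma polarize_sub {q : ℕ} (S T : (Fin q → L) → E) :
    polarize X q (fun y => S y - T y) = polarize X q S - polarize X q T := by
  simp only [sub_eq_add_neg, polarize_add, polarize_neg]

lemma polarize_smul {q : ℕ} (c : ℝ) (T : (Fin q → L) → E) :
    polarize X q (fun y => c • T y) = c • polarize X q T := by
  simp [polarize, TensorProduct.smul_tmul', Finset.smul_sum]

lemma polarize_zero_fun {q : ℕ} : polarize X q (fun _ => (0 : E)) = 0 := by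
  simp [polarize]

/-- Reindexing the sum over `f` moves the permutation to the Grassmann monomial, which is
alternating. So the polarization only depends on the antisymmetrization of `T`. -/
lemma polarize_comp_perm {q : ℕ} (T : (Fin q → L) → E) (σ : Equiv.Perm (Fin q)) :
    polarize X q (fun y => T (y ∘ σ)) = Equiv.Perm.sign σ • polarize X q T := by
  rw [polarize, polarize, Finset.smul_sum, ← (Equiv.arrowCongr σ (Equiv.refl (Fin m))).sum_comp]
  refine Finset.sum_congr rfl fun f _ => ?_
  have e : (Equiv.arrowCongr σ (Equiv.refl (Fin m))) f = f ∘ σ.symm := rfl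
  have e' : grassmannMonomial (f ∘ σ.symm) = Equiv.Perm.sign σ • grassmannMonomial f := by
    rw [grassmannMonomial_comp_perm, Equiv.Perm.sign_symm]
  have e2 : (X ∘ f ∘ σ.symm) ∘ σ = X ∘ f := by
    funext i; simp
  rw [e, e', e2, Units.smul_def, Units.smul_def, TensorProduct.tmul_smul]

lemma polarize_altSum {q : ℕ} (T : (Fin q → L) → E) :
    polarize X q (fun y => altSum T y) = (q ! : ℝ) • polarize X q T := by
  have h : polarize X q (fun y => altSum T y) =
      ∑ σ : Equiv.Perm (Fin q), Equiv.Perm.sign σ • polarize X q (fun y => T (y ∘ σ)) := by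
    simp only [polarize, altSum, TensorProduct.sum_tmul, Finset.smul_sum]
    rw [Finset.sum_comm]
    refine Finset.sum_congr rfl fun σ _ => Finset.sum_congr rfl fun f _ => ?_
    rw [Units.smul_def, Units.smul_def, TensorProduct.smul_tmul']
  rw [h]
  simp only [polarize_comp_perm, smul_smul, Int.units_mul_self, one_smul]
  simp [Fintype.card_perm, ← Nat.cast_smul_eq_nsmul ℝ]

/-- The tensor product carries no Koszul signs, so operators and monomials multiply separately.
Since later generators stand on the left, the left factor receives the last arguments. -/
lemma polarize_mul {p q : ℕ} (S : (Fin q → L) → E) (T : (Fin p → L) → E) :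
    polarize X q S * polarize X p T = polarize X (p + q)
      (fun y => S (fun i => y (Fin.natAdd p i)) * T (fun i => y (Fin.castAdd q i))) := by
  rw [polarize, polarize, polarize, Finset.sum_mul_sum, Finset.sum_comm, ← Finset.sum_product',
    Finset.univ_product_univ, ← (Fin.appendEquiv p q).sum_comp]
  refine Finset.sum_congr rfl fun f _ => ?_
  rw [Algebra.TensorProduct.tmul_mul_tmul]
  have e : Fin.appendEquiv (α := Fin m) p q f = Fin.append f.1 f.2 := rfl
  rw [e, grassmannMonomial_append]
  congr 3
  · funext i; simp
  · funext i; simp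

lemma polarize_zero (a : E) : polarize X 0 (fun _ => a) = a ⊗ₜ 1 := by
  rw [polarize, Fintype.sum_unique, grassmannMonomial_eq_prod]
  simp

/-- Among more than `m` generators one is repeated. -/
lemma polarize_of_lt {q : ℕ} (h : m < q) (T : (Fin q → L) → E) : polarize X q T = 0 := by
  refine Finset.sum_eq_zero fun f _ => ?_
  rw [grassmannMonomial_of_not_injective, TensorProduct.tmul_zero]
  intro hf
  have := Fintype.card_le_of_injective f hf
  simp at this
  omega

variable (E m) in
/-- The coefficient of the product of all generators. -/
def topCoeff : E ⊗[ℝ] Grassmann m →ₗ[ℝ] E :=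
  (TensorProduct.rid ℝ E).toLinearMap ∘ₗ LinearMap.lTensor E (grassmannTop m)

lemma topCoeff_tmul (a : E) (l : Grassmann m) :
    topCoeff E m (a ⊗ₜ l) = grassmannTop m l • a := by
  simp [topCoeff]

lemma topCoeff_mul_right (r : E ⊗[ℝ] Grassmann m) (a : E) :
    topCoeff E m (r * a ⊗ₜ 1) = topCoeff E m r * a := by
  induction r with
  | zero => simp
  | tmul x y => simp [topCoeff_tmul]
  | add x y hx hy => rw [add_mul, map_add, map_add, hx, hy, add_mul]

lemma topCoeff_mul_left (r : E ⊗[ℝ] Grassmann m) (a : E) :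
    topCoeff E m (a ⊗ₜ 1 * r) = a * topCoeff E m r := by
  induction r with
  | zero => simp
  | tmul x y => simp [topCoeff_tmul]
  | add x y hx hy => rw [mul_add, map_add, map_add, hx, hy, mul_add]

lemma topCoeff_polarize_of_ne {q : ℕ} (h : q ≠ m) (T : (Fin q → L) → E) :
    topCoeff E m (polarize X q T) = 0 := by
  rw [polarize, map_sum]
  refine Finset.sum_eq_zero fun f _ => ?_
  rw [topCoeff_tmul, grassmannTop_of_ne h, zero_smul]

/-- Only bijective index maps give a nonzero monomial, and a permutation contributes its sign. This
is how identities between polarizations return to identities between signed sums. -/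
lemma topCoeff_polarize (T : (Fin m → L) → E) :
    topCoeff E m (polarize X m T) = altSum T X := by
  rw [polarize, map_sum, altSum]
  symm
  refine Finset.sum_of_injOn (fun σ : Equiv.Perm (Fin m) => (σ : Fin m → Fin m))
    (fun σ _ τ _ h => Equiv.coe_fn_injective h) (fun _ _ => Finset.mem_univ _) ?_ ?_
  · intro f _ hf
    rw [grassmannMonomial_of_not_injective, TensorProduct.tmul_zero, map_zero]
    intro hi
    exact hf ⟨Equiv.ofBijective f (Finite.injective_iff_bijective.mp hi), by simp, rfl⟩
  · intro σ _
    rw [topCoeff_tmul]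
    have := grassmannMonomial_comp_perm (m := m) id σ
    rw [Function.id_comp] at this
    rw [this]
    rcases Int.units_eq_one_or (Equiv.Perm.sign σ) with h | h <;> simp [h, grassmannTop_id]

/-- The product `u (y (q - 1)) ⋯ u (y 0)`. -/
def revProd (u : L → E) : {q : ℕ} → (Fin q → L) → E
  | 0, _ => 1
  | _ + 1, y => revProd u (Fin.tail y) * u (y 0)

omit [Algebra ℝ E] in
lemma revProd_succ (u : L → E) {q : ℕ} (y : Fin (q + 1) → L) :
    revProd u y = revProd u (Fin.tail y) * u (y 0) := rfl

lemma polarize_cast {p q : ℕ} (h : p = q) (T : (Fin q → L) → E) :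
    polarize X p (fun y => T (y ∘ Fin.cast h.symm)) = polarize X q T := by
  subst h; rfl

lemma polarize_succ {q : ℕ} (S : (Fin q → L) → E) (T : L → E) :
    polarize X (q + 1) (fun y => S (Fin.tail y) * T (y 0)) =
      polarize X q S * polarize X 1 (fun y => T (y 0)) := by
  rw [polarize_mul, ← polarize_cast X (add_comm 1 q)]
  refine polarize_congr X fun y => ?_
  congr 2
  funext i
  simp only [Fin.tail, Function.comp_apply]
  congr 1
  ext
  simp [add_comm]

lemma polarize_succ_succ {q : ℕ} (S : (Fin q → L) → E) (T : L → L → E) :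
    polarize X (q + 2) (fun y => S (Fin.tail (Fin.tail y)) * T (y 0) (y 1)) =
      polarize X q S * polarize X 2 (fun y => T (y 0) (y 1)) := by
  rw [polarize_mul, ← polarize_cast X (add_comm 2 q)]
  refine polarize_congr X fun y => ?_
  congr 2
  funext i
  simp only [Fin.tail, Function.comp_apply]
  congr 1
  ext
  simp
  omega

lemma polarize_mul_const {q : ℕ} (S : (Fin q → L) → E) (a : E) :
    polarize X q (fun y => S y * a) = polarize X q S * a ⊗ₜ 1 := by
  rw [polarize, polarize, Finset.sum_mul]
  simp

lemma polarize_const_mul {q : ℕ} (S : (Fin q → L) → E) (a : E) :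
    polarize X q (fun y => a * S y) = a ⊗ₜ 1 * polarize X q S := by
  rw [polarize, polarize, Finset.mul_sum]
  simp

lemma polarize_revProd (u : L → E) (q : ℕ) :
    polarize X q (revProd u) = polarize X 1 (fun y => u (y 0)) ^ q := by
  induction q with
  | zero => exact polarize_zero X 1
  | succ q ih => rw [pow_succ, ← ih, ← polarize_succ]; rfl

lemma polarize_pow_eq_zero (u : L → E) :
    polarize X 1 (fun y => u (y 0)) ^ (m + 1) = 0 := by
  rw [← polarize_revProd, polarize_of_lt X (Nat.lt_succ_self m)]

end Polarization

/-! ### The generating function of the Bernoulli numbers and its differential equations -/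

section Series

open PowerSeries

/-- The generating function `t / (e^t - 1)` of the Bernoulli numbers. -/
def bernF : PowerSeries ℝ := bernoulliPowerSeries ℝ

/-- The series `(t / (e^t - 1) - 1) / t`. -/
def bernG : PowerSeries ℝ := mk fun q => (bernoulli (q + 1) : ℝ) / (q + 1)!

/-- The series `-(t / (e^t - 1) - 1 + t / 2) / t ^ 2`. -/
def bernH : PowerSeries ℝ := mk fun q => -((bernoulli (q + 2) : ℝ) / (q + 2)!)

/-- The series `-t (t / (e^t - 1) - 1)`. -/
def bernPsi : PowerSeries ℝ := -(X ^ 2 * bernG)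

/-- The series `(e^t - 1) / t`. -/
def bernE : PowerSeries ℝ := mk fun q => ((q + 1)! : ℝ)⁻¹

lemma coeff_bernF (q : ℕ) : coeff q bernF = (bernoulli q : ℝ) / q ! := by
  simp [bernF, bernoulliPowerSeries]

lemma coeff_bernG (q : ℕ) : coeff q bernG = (bernoulli (q + 1) : ℝ) / (q + 1)! := by
  simp [bernG]

lemma coeff_bernH (q : ℕ) : coeff q bernH = -((bernoulli (q + 2) : ℝ) / (q + 2)!) := by
  simp [bernH]

lemma coeff_bernE (q : ℕ) : coeff q bernE = ((q + 1)! : ℝ)⁻¹ := by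
  simp [bernE]

lemma bernF_eq : bernF = 1 + X * bernG := by
  ext q
  rcases q with _ | q
  · simp [coeff_bernF]
  · rw [coeff_bernF, map_add, coeff_succ_X_mul, coeff_bernG]
    simp [coeff_one]

lemma bernG_eq : bernG = -C (1 / 2 : ℝ) - X * bernH := by
  ext q
  rcases q with _ | q
  · simp [coeff_bernG]
    norm_num [coeff_zero_C]
  · rw [coeff_bernG, map_sub, coeff_succ_X_mul, coeff_bernH]
    simp

lemma X_mul_bernE : X * bernE = exp ℝ - 1 := by
  ext q
  rcases q with _ | q
  · simp
  · rw [coeff_succ_X_mul, coeff_bernE]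
    simp [coeff_exp, coeff_one]

lemma bernF_mul_exp : bernF * (exp ℝ - 1) = X := bernoulliPowerSeries_mul_exp_sub_one ℝ

lemma bernE_mul_bernF : bernE * bernF = 1 := by
  have h : X * (bernE * bernF) = X * 1 := by
    rw [← mul_assoc, X_mul_bernE, mul_comm, bernF_mul_exp, mul_one]
  exact mul_left_cancel₀ X_ne_zero h

/-- The derivative of a power series. -/
abbrev der (F : PowerSeries ℝ) : PowerSeries ℝ := derivative ℝ F

lemma der_mul (F G : PowerSeries ℝ) : der (F * G) = F * der G + G * der F := by
  simp [der, Derivation.leibniz]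

lemma der_X : der X = 1 := by simp [der]

lemma der_one : der 1 = 0 := by simp [der]

lemma der_add (F G : PowerSeries ℝ) : der (F + G) = der F + der G := map_add _ F G

lemma der_sub (F G : PowerSeries ℝ) : der (F - G) = der F - der G := map_sub _ F G

lemma der_neg (F : PowerSeries ℝ) : der (-F) = -der F := map_neg _ F

lemma der_exp : der (exp ℝ) = exp ℝ := derivative_exp ℝ

/-- The relation `F (e^t - 1) = t` is differentiated and the exponential is eliminated with the
relation itself. -/
lemma X_mul_der_bernF : X * der bernF = bernF - X * bernF - bernF ^ 2 := by
  have h := congrArg der bernF_mul_exp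
  rw [der_mul, der_sub, der_exp, der_one, der_X, sub_zero] at h
  have h2 := bernF_mul_exp
  linear_combination bernF * h - (der bernF + bernF) * h2

lemma der_bernF : der bernF = -(1 + bernG) * bernF := by
  have h := X_mul_der_bernF
  refine mul_left_cancel₀ (X_ne_zero (R := ℝ)) ?_
  rw [h]
  linear_combination -bernF * bernF_eq

/-- The equation `t F' = F - t F - F²`, rewritten with `F = 1 + t G` and `G = -1/2 - t h` and
divided by `t²`. It is responsible for the Jacobi identities of the Courant algebra. -/
lemma riccati : der bernG + bernG ^ 2 + bernG = 2 * bernH := by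
  have h1 := X_mul_der_bernF
  have h2 := congrArg der bernF_eq
  rw [der_add, der_mul, der_one, der_X] at h2
  have h3 := bernF_eq
  have h4 := bernG_eq
  have hc : (C (1 / 2 : ℝ) : PowerSeries ℝ) * 2 = 1 := by
    rw [← map_ofNat (C : ℝ →+* PowerSeries ℝ) 2, ← map_mul]
    norm_num
  refine mul_left_cancel₀ (pow_ne_zero 2 (X_ne_zero (R := ℝ))) ?_
  rw [h3] at h1
  rw [h3] at h2
  rw [h2] at h1
  linear_combination h1 - 2 * X * h4 + X * hc

lemma der_bernE : der bernE = (1 + bernG) * bernE := by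
  have h := congrArg der bernE_mul_bernF
  rw [der_mul, der_bernF, der_one] at h
  linear_combination bernE * h + (-der bernE + (1 + bernG) * bernE) * bernE_mul_bernF

/-- As `E F = 1` and `t E = e^t - 1`, the product of `E` with `-t (F - 1)` is `t E - t`. The absence
of Bernoulli numbers on the right is why the target of the morphism has such simple brackets. -/
lemma bernE_mul_bernPsi : bernE * bernPsi = exp ℝ - 1 - X := by
  rw [bernPsi]
  linear_combination -X * bernE * bernF_eq.symm - X * bernE_mul_bernF + X_mul_bernE

/-- Substitution of `Ψ = -t² G`; the quadratic term in `G` is removed by the Riccati equation. -/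
lemma der_bernPsi : der bernPsi + bernG * bernPsi = X * bernF := by
  have h := riccati
  have hc : (C (1 / 2 : ℝ) : PowerSeries ℝ) * 2 = 1 := by
    rw [← map_ofNat (C : ℝ →+* PowerSeries ℝ) 2, ← map_mul]
    norm_num
  rw [bernPsi, der_neg, der_mul, pow_two, der_mul, der_X, bernF_eq]
  linear_combination -X ^ 2 * h - 2 * X * bernG_eq + X * hc

lemma coeff_bernPsi_two : coeff 2 bernPsi = 1 / 2 := by
  have h : coeff 2 (X ^ 2 * bernG) = coeff 0 bernG := coeff_X_pow_mul bernG 2 0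
  rw [bernPsi, map_neg, h, coeff_bernG]
  norm_num

end Series

/-! ### Commutation of a square-zero element with functions of a nilpotent element -/

section GaugeAlgebra

open PowerSeries

variable {R : Type*} [Ring R] [Algebra ℝ R]

/-- The value of a power series at a nilpotent element. -/
def nilEval (j : R) (N : ℕ) (F : PowerSeries ℝ) : R := Polynomial.aeval j (trunc N F)

lemma nilEval_eq_sum (j : R) (N : ℕ) (F : PowerSeries ℝ) :
    nilEval j N F = ∑ a ∈ Finset.range N, coeff a F • j ^ a := by
  rw [nilEval, trunc_apply]
  simp [Polynomial.aeval_monomial, Algebra.smul_def]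

/-- The two polynomials differ by a multiple of `X ^ N`. -/
lemma aeval_eq_of_coeff {j : R} {N : ℕ} (hj : j ^ N = 0) {p q : Polynomial ℝ}
    (h : ∀ a < N, p.coeff a = q.coeff a) : Polynomial.aeval j p = Polynomial.aeval j q := by
  obtain ⟨s, hs⟩ : Polynomial.X ^ N ∣ p - q :=
    Polynomial.X_pow_dvd_iff.mpr fun a ha => by rw [Polynomial.coeff_sub, h a ha, sub_self]
  rw [← sub_eq_zero, ← map_sub, hs, map_mul, map_pow, Polynomial.aeval_X, hj, zero_mul]

lemma nilEval_of_le {j : R} {N M : ℕ} (hj : j ^ N = 0) (h : N ≤ M) (F : PowerSeries ℝ) :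
    nilEval j N F = nilEval j M F :=
  aeval_eq_of_coeff hj fun a ha => by rw [coeff_trunc, coeff_trunc, if_pos ha, if_pos (by omega)]

variable {j d : R} {N : ℕ}

lemma nilEval_mul (hj : j ^ N = 0) (F G : PowerSeries ℝ) :
    nilEval j N (F * G) = nilEval j N F * nilEval j N G := by
  rw [nilEval, nilEval, nilEval, ← map_mul]
  refine aeval_eq_of_coeff hj fun a ha => ?_
  rw [coeff_trunc, if_pos ha, coeff_mul_eq_coeff_trunc_mul_trunc F G ha, ← Polynomial.coe_mul,
    Polynomial.coeff_coe]

lemma nilEval_add (F G : PowerSeries ℝ) :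
    nilEval j N (F + G) = nilEval j N F + nilEval j N G := by
  simp [nilEval, map_add]

lemma nilEval_neg (F : PowerSeries ℝ) : nilEval j N (-F) = -nilEval j N F := by
  simp [nilEval_eq_sum]

lemma nilEval_sub (F G : PowerSeries ℝ) :
    nilEval j N (F - G) = nilEval j N F - nilEval j N G := by
  rw [sub_eq_add_neg, nilEval_add, nilEval_neg, sub_eq_add_neg]

lemma nilEval_one (hj : j ^ N = 0) : nilEval j N 1 = 1 := by
  have : Polynomial.aeval j (1 : Polynomial ℝ) = 1 := map_one _
  rw [← this]
  refine aeval_eq_of_coeff hj fun a ha => ?_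
  rw [coeff_trunc, if_pos ha, coeff_one, Polynomial.coeff_one]

lemma nilEval_X (hj : j ^ N = 0) : nilEval j N X = j := by
  conv_rhs => rw [← Polynomial.aeval_X (R := ℝ) j]
  refine aeval_eq_of_coeff hj fun a ha => ?_
  rw [coeff_trunc, if_pos ha, coeff_X, Polynomial.coeff_X]
  simp only [eq_comm]

/-- An even element `j` and an odd element `d` with `d² = 0` that satisfy
`[[[d, j], j], j] = 0`. -/
structure IsGaugePair (j d : R) (N : ℕ) : Prop where
  nilpotent : j ^ N = 0
  sq : d * d = 0
  comm : ((d * j - j * d) * j - j * (d * j - j * d)) * j =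
    j * ((d * j - j * d) * j - j * (d * j - j * d))

/-- The commutator `[d, j]`. -/
def comm₁ (j d : R) : R := d * j - j * d

/-- The commutator `[[d, j], j]`. -/
def comm₂ (j d : R) : R := comm₁ j d * j - j * comm₁ j d

variable (h : IsGaugePair j d N)

omit [Algebra ℝ R] in
variable (j d) in
lemma d_mul_j : d * j = j * d + comm₁ j d := by rw [comm₁]; abel

omit [Algebra ℝ R] in
variable (j d) in
lemma comm₁_mul_j : comm₁ j d * j = j * comm₁ j d + comm₂ j d := by rw [comm₂]; abel

include h

omit [Algebra ℝ R] in
lemma IsGaugePair.comm₂_mul_j : comm₂ j d * j = j * comm₂ j d := h.comm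

omit [Algebra ℝ R] in
-- The commutator of `d² = 0` with `j`.
lemma IsGaugePair.d_mul_comm₁ : d * comm₁ j d = -(comm₁ j d * d) := by
  rw [comm₁, mul_sub, sub_mul, ← mul_assoc, h.sq, mul_assoc j, h.sq]
  simp [mul_assoc]

omit [Algebra ℝ R] in
lemma IsGaugePair.d_mul_comm₂ : d * comm₂ j d = -(comm₂ j d * d) - 2 * (comm₁ j d * comm₁ j d) := by
  have e : comm₁ j d * (d * j) = comm₁ j d * (j * d) + comm₁ j d * comm₁ j d := by
    rw [d_mul_j j d, mul_add]
  have e1 : d * comm₁ j d * j = -(comm₁ j d * (d * j)) := by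
    rw [h.d_mul_comm₁, neg_mul, mul_assoc]
  have e2 : d * j * comm₁ j d = -(j * (comm₁ j d * d)) + comm₁ j d * comm₁ j d := by
    rw [d_mul_j j d, add_mul, mul_assoc, h.d_mul_comm₁, mul_neg]
  rw [comm₂, mul_sub, ← mul_assoc, ← mul_assoc, e1, e2, e]
  noncomm_ring

/-- With `L = [d, j]` and `K = [L, j]`: moving `d` to the right through both sides of `K j = j K`
leaves `3 (L K + K L) = 0`. -/
lemma IsGaugePair.comm₁_mul_comm₂ : comm₁ j d * comm₂ j d = -(comm₂ j d * comm₁ j d) := by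
  have e := h.comm₂_mul_j
  have e1 := h.d_mul_comm₂
  have e2 := d_mul_j j d
  have e3 := comm₁_mul_j j d
  generalize comm₁ j d = L at *
  generalize comm₂ j d = K at *
  have l1 : d * (K * j) = -(K * (j * d)) - 2 * (L * (j * L)) - (K * L) - 2 * (L * K) := by
    rw [← mul_assoc, e1, sub_mul, neg_mul, mul_assoc K, e2, mul_assoc 2, mul_assoc L, e3]
    noncomm_ring
  have l2 : d * (j * K) = -(j * (K * d)) - 2 * (j * (L * L)) + L * K := by
    rw [← mul_assoc, e2, add_mul, mul_assoc j, e1]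
    noncomm_ring
  have l3 : L * (j * L) = j * (L * L) + K * L := by
    rw [← mul_assoc, e3, add_mul, mul_assoc]
  have l4 : K * (j * d) = j * (K * d) := by rw [← mul_assoc, e, mul_assoc]
  have : (3 : ℝ) • (L * K + K * L) = 0 := by
    have l5 : d * (K * j) = d * (j * K) := by rw [e]
    rw [l1, l2, l3, l4] at l5
    have l6 := sub_eq_zero.mpr l5.symm
    rw [← l6]
    rw [show (3 : ℝ) = ((3 : ℕ) : ℝ) by norm_num, Nat.cast_smul_eq_nsmul]
    noncomm_ring
  have := (smul_eq_zero_iff_right (by norm_num : (3 : ℝ) ≠ 0)).mp this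
  exact eq_neg_of_add_eq_zero_left this

/-- Moving `L` to the right through both sides of `K j = j K`, and using that `L` and `K`
anticommute, leaves `2 K² = 0`. -/
lemma IsGaugePair.comm₂_mul_comm₂ : comm₂ j d * comm₂ j d = 0 := by
  have e := h.comm₂_mul_j
  have e1 := h.comm₁_mul_comm₂
  have e3 := comm₁_mul_j j d
  generalize comm₁ j d = L at *
  generalize comm₂ j d = K at *
  have l1 : L * (K * j) = -(K * (j * L)) - K * K := by
    rw [← mul_assoc, e1, neg_mul, mul_assoc, e3]
    noncomm_ring
  have l2 : L * (j * K) = -(j * (K * L)) + K * K := by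
    rw [← mul_assoc, e3, add_mul, mul_assoc, e1]
    noncomm_ring
  have l3 : K * (j * L) = j * (K * L) := by rw [← mul_assoc, e, mul_assoc]
  have : (2 : ℝ) • (K * K) = 0 := by
    have l5 : L * (K * j) = L * (j * K) := by rw [e]
    rw [l1, l2, l3] at l5
    have l6 := sub_eq_zero.mpr l5.symm
    rw [← l6]
    rw [show (2 : ℝ) = ((2 : ℕ) : ℝ) by norm_num, Nat.cast_smul_eq_nsmul]
    noncomm_ring
  exact (smul_eq_zero_iff_right (by norm_num : (2 : ℝ) ≠ 0)).mp this

lemma IsGaugePair.comm₂_mul_aeval (p : Polynomial ℝ) :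
    comm₂ j d * Polynomial.aeval j p = Polynomial.aeval j p * comm₂ j d := by
  induction p using Polynomial.induction_on with
  | C a => simp [Algebra.commutes]
  | add p q hp hq => rw [map_add, mul_add, add_mul, hp, hq]
  | monomial n a ih =>
    rw [pow_succ, ← mul_assoc, map_mul, Polynomial.aeval_X, ← mul_assoc, ih, mul_assoc,
      h.comm₂_mul_j, mul_assoc]

lemma IsGaugePair.comm₁_mul_aeval (p : Polynomial ℝ) :
    comm₁ j d * Polynomial.aeval j p = Polynomial.aeval j p * comm₁ j d +
      Polynomial.aeval j p.derivative * comm₂ j d := by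
  induction p using Polynomial.induction_on with
  | C a => simp [Algebra.commutes]
  | add p q hp hq => simp only [map_add, mul_add, add_mul, hp, hq]; abel
  | monomial n a ih =>
    rw [pow_succ, ← mul_assoc]
    generalize Polynomial.C a * Polynomial.X ^ n = p at *
    simp only [Polynomial.derivative_mul, Polynomial.derivative_X, mul_one,
      map_add, map_mul, Polynomial.aeval_X]
    rw [← mul_assoc, ih, add_mul, mul_assoc _ (comm₁ j d), comm₁_mul_j j d, mul_assoc _ (comm₂ j d),
      h.comm₂_mul_j]
    noncomm_ring

/-- A Taylor formula: iterated commutators of `d` with `j` are the coefficients, and the expansion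
stops at second order because `K` commutes with `j`. -/
lemma IsGaugePair.d_mul_aeval (p : Polynomial ℝ) :
    d * Polynomial.aeval j p = Polynomial.aeval j p * d +
      Polynomial.aeval j p.derivative * comm₁ j d +
      (1 / 2 : ℝ) • (Polynomial.aeval j p.derivative.derivative * comm₂ j d) := by
  induction p using Polynomial.induction_on with
  | C a => simp [Algebra.commutes]
  | add p q hp hq => simp only [map_add, mul_add, add_mul, hp, hq, smul_add]; abel
  | monomial n a ih =>
    rw [pow_succ, ← mul_assoc]
    generalize Polynomial.C a * Polynomial.X ^ n = p at *
    simp only [Polynomial.derivative_mul, Polynomial.derivative_X, mul_one,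
      map_add, map_mul, Polynomial.aeval_X]
    rw [← mul_assoc, ih, add_mul, add_mul, mul_assoc _ d, d_mul_j j d, mul_assoc _ (comm₁ j d),
      comm₁_mul_j j d, smul_mul_assoc, mul_assoc _ (comm₂ j d), h.comm₂_mul_j]
    simp only [mul_add, add_mul, smul_add, mul_assoc]
    module

lemma IsGaugePair.comm₂_mul (F : PowerSeries ℝ) :
    comm₂ j d * nilEval j N F = nilEval j N F * comm₂ j d := h.comm₂_mul_aeval _

lemma IsGaugePair.comm₁_mul (F : PowerSeries ℝ) :
    comm₁ j d * nilEval j N F = nilEval j N F * comm₁ j d + nilEval j N (der F) * comm₂ j d := by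
  -- Differentiation lowers the order of truncation by one, so the order is raised beforehand.
  rw [nilEval_of_le h.nilpotent N.le_succ, nilEval, h.comm₁_mul_aeval, ← trunc_derivative]
  rfl

lemma IsGaugePair.d_mul (F : PowerSeries ℝ) :
    d * nilEval j N F = nilEval j N F * d + nilEval j N (der F) * comm₁ j d +
      (1 / 2 : ℝ) • (nilEval j N (der (der F)) * comm₂ j d) := by
  rw [nilEval_of_le h.nilpotent (N.le_add_right 2), nilEval, h.d_mul_aeval, ← trunc_derivative,
    ← trunc_derivative, nilEval_of_le h.nilpotent N.le_succ (der F)]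
  rfl

end GaugeAlgebra

/-! ### Second-order equations for the Bernoulli series -/

section SeriesIdentities

open PowerSeries

lemma der_riccati : der (der bernG) + 2 * (bernG * der bernG) + der bernG = 2 * der bernH := by
  have h := congrArg der riccati
  rw [der_add, der_add, pow_two, der_mul, two_mul, der_add] at h
  linear_combination h

/-- The derivative of the first-order equation for `F`, with `G'` eliminated by the Riccati
equation. This and the next two equations make the coefficients of `K` agree when the connection is
moved past `F(j)`, `Ψ(j)` and `E(j)`. -/
lemma bernF_second : der (der bernF) + 2 * (bernG * der bernF) + 2 * (bernH * bernF) +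
    der bernF = 0 := by
  have h := congrArg der der_bernF
  rw [neg_mul, der_neg, der_mul, der_add, der_one] at h
  linear_combination h + (bernG) * der_bernF - bernF * riccati

lemma bernPsi_second : der (der bernPsi) + 2 * (bernG * der bernPsi) + 2 * (bernH * bernPsi) +
    der bernPsi - bernF = 0 := by
  have h := congrArg der der_bernPsi
  rw [der_add, der_mul, der_mul, der_X] at h
  linear_combination h + (1 + bernG) * der_bernPsi + X * der_bernF - bernPsi * riccati

lemma bernE_second : 2 * (bernE * bernH) - der (der bernE) + der bernE = 0 := by
  have h := congrArg der der_bernE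
  rw [der_mul, der_add, der_one] at h
  linear_combination -h - bernG * der_bernE - bernE * riccati

end SeriesIdentities

/-! ### The connection, its curvature and the gauge transformation -/

section GaugeAlgebra

open PowerSeries

variable {R : Type*} [Ring R] [Algebra ℝ R]

lemma nilEval_two {j : R} {N : ℕ} (hj : j ^ N = 0) : nilEval j N 2 = 2 := by
  rw [← one_add_one_eq_two, nilEval_add, nilEval_one hj, one_add_one_eq_two]

/-- A gauge pair with compatible projectors `p r` onto the elements of degree `r`, where `j` lowers
and `d` raises the degree by one. -/
structure IsGradedGaugePair (j d : R) (p : ℕ → R) (N : ℕ) : Prop extends IsGaugePair j d N where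
  p_mul_j : ∀ r, p r * j = j * p (r + 1)
  d_mul_p : ∀ r, d * p r = p (r + 1) * d
  p_mul_p : ∀ r s, p r * p s = if r = s then p r else 0
  j_mul_p_zero : j * p 0 = 0
  p_zero_mul_d : p 0 * d = 0

variable {j d : R} {p : ℕ → R} {N : ℕ} (h : IsGradedGaugePair j d p N)

include h

omit [Algebra ℝ R] in
lemma IsGradedGaugePair.p_mul_comm₁ (r : ℕ) : p r * comm₁ j d = comm₁ j d * p r := by
  -- In degree zero, `p_0 d = 0` and `j p_0 = 0` take the place of the commutation of `d` with the
  -- projector one degree lower.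
  rcases r with _ | r
  · rw [comm₁, mul_sub, sub_mul, ← mul_assoc, h.p_zero_mul_d, mul_assoc d, h.j_mul_p_zero,
      ← mul_assoc, h.p_mul_j, mul_assoc j, mul_assoc j, h.d_mul_p]
    simp
  · rw [comm₁, mul_sub, sub_mul, ← mul_assoc, ← h.d_mul_p, mul_assoc d, h.p_mul_j, ← mul_assoc,
      ← mul_assoc, h.p_mul_j, mul_assoc j, ← h.d_mul_p, mul_assoc j]

omit [Algebra ℝ R] in
lemma IsGradedGaugePair.p_mul_comm₂ (r : ℕ) : p r * comm₂ j d = comm₂ j d * p (r + 1) := by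
  rw [comm₂, mul_sub, sub_mul, ← mul_assoc, h.p_mul_comm₁, mul_assoc, h.p_mul_j, ← mul_assoc,
    ← mul_assoc, h.p_mul_j, mul_assoc j, h.p_mul_comm₁, mul_assoc j]

omit [Algebra ℝ R] in
lemma IsGradedGaugePair.p_mul_pow (r a : ℕ) : p r * j ^ a = j ^ a * p (r + a) := by
  induction a generalizing r with
  | zero => simp
  | succ a ih => rw [pow_succ', ← mul_assoc, h.p_mul_j, mul_assoc, ih, mul_assoc, add_right_comm]; rfl

/-- Degree count: `j` lowers the degree by one and `Z` by `c`, so between two projectors exactly one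
power of `j` survives, and the projectors pick a single coefficient of the series. -/
lemma IsGradedGaugePair.sandwich (F : PowerSeries ℝ) {Z : R} {c : ℕ}
    (hZ : ∀ t, p t * Z = Z * p (t + c)) (r s : ℕ) :
    p r * (nilEval j N F * (Z * p s)) =
      if r + c ≤ s then coeff (s - r - c) F • (j ^ (s - r - c) * (Z * p s)) else 0 := by
  have key : ∀ a, p r * (j ^ a * (Z * p s)) = if r + a + c = s then j ^ a * (Z * p s) else 0 := by
    intro a
    rw [← mul_assoc, h.p_mul_pow, mul_assoc, ← mul_assoc (p (r + a)), hZ, mul_assoc, h.p_mul_p]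
    split_ifs with e
    · rw [e]
    · simp
  -- The truncation is moved beyond `s`, so that the exponent `s - r - c` occurs in the sum.
  rw [nilEval_of_le h.nilpotent (show N ≤ N + s + 1 by omega), nilEval_eq_sum, Finset.sum_mul,
    Finset.mul_sum]
  simp only [smul_mul_assoc, mul_smul_comm, key]
  split_ifs with e
  · rw [Finset.sum_eq_single (s - r - c)]
    · rw [if_pos (by omega)]
    · intro a _ ha
      rw [if_neg (by omega), smul_zero]
    · intro ha
      exact absurd (Finset.mem_range.mpr (by omega)) ha
  · refine Finset.sum_eq_zero fun a _ => ?_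
    rw [if_neg (by omega), smul_zero]

omit h in
variable (j d N) in
/-- The connection `d + g(j) [d, j] + h(j) [[d, j], j]`. -/
def gaugeConn : R :=
  d + nilEval j N bernG * comm₁ j d + nilEval j N bernH * comm₂ j d

omit h in
variable (j d p N) in
/-- The connection `gaugeConn` with the differential in degree `ν` removed. -/
def truncConn (ν : ℕ) : R := gaugeConn j d N - nilEval j N bernF * (d * p ν)

omit h in
-- After all functions of `j` are moved to the left, only multiples of `L²` and `K L` remain. Their
-- coefficients are evaluated by the Riccati equation and its derivative.
lemma IsGaugePair.gaugeConn_sq (h : IsGaugePair j d N) :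
    gaugeConn j d N * gaugeConn j d N =
      -(nilEval j N bernG * (comm₁ j d * comm₁ j d)) -
        (1 / 2 : ℝ) • (nilEval j N (der bernG) * (comm₂ j d * comm₁ j d)) := by
  have r1 := congrArg (nilEval j N) riccati
  have r2 := congrArg (nilEval j N) der_riccati
  have gh : nilEval j N bernG * nilEval j N bernH = nilEval j N bernH * nilEval j N bernG := by
    rw [← nilEval_mul h.nilpotent, ← nilEval_mul h.nilpotent, mul_comm]
  have d1 := h.d_mul bernG
  have d2 := h.d_mul bernH
  have l1 := h.comm₁_mul bernG
  have l2 := h.comm₁_mul bernH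
  have k1 := h.comm₂_mul bernG
  have k2 := h.comm₂_mul bernH
  have dd := h.sq
  have dL := h.d_mul_comm₁
  have dK := h.d_mul_comm₂
  have LK := h.comm₁_mul_comm₂
  have KK := h.comm₂_mul_comm₂
  simp only [nilEval_add, pow_two, nilEval_mul h.nilpotent, nilEval_two h.nilpotent] at r1 r2
  rw [gaugeConn]
  generalize nilEval j N bernG = G at *
  generalize nilEval j N bernH = H at *
  generalize nilEval j N (der bernG) = G' at *
  generalize nilEval j N (der bernH) = H' at *
  generalize nilEval j N (der (der bernG)) = G'' at *
  generalize nilEval j N (der (der bernH)) = H'' at *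
  generalize comm₁ j d = L at *
  generalize comm₂ j d = K at *
  have e1 : d * (G * L) = -(G * (L * d)) + G' * (L * L) + (1 / 2 : ℝ) • (G'' * (K * L)) := by
    rw [← mul_assoc, d1, add_mul, add_mul, smul_mul_assoc, mul_assoc, mul_assoc, mul_assoc, dL,
      mul_neg]
  have e2 : d * (H * K) = -(H * (K * d)) - 2 * (H * (L * L)) - H' * (K * L) := by
    rw [← mul_assoc, d2, add_mul, add_mul, smul_mul_assoc, mul_assoc, mul_assoc, mul_assoc, dK, LK,
      KK]
    simp only [mul_zero, smul_zero]
    noncomm_ring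
  have e3 : G * L * (G * L) = G * G * (L * L) + G * G' * (K * L) := by
    rw [mul_assoc, ← mul_assoc L, l1]
    noncomm_ring
  have e4 : G * L * (H * K) = -(H * G * (K * L)) := by
    rw [mul_assoc, ← mul_assoc L, l2, add_mul, mul_assoc H', KK, mul_assoc H, LK, ← gh]
    noncomm_ring
  have e5 : H * K * (G * L) = H * G * (K * L) := by
    rw [mul_assoc, ← mul_assoc K, k1]
    noncomm_ring
  have e6 : H * K * (H * K) = 0 := by
    rw [mul_assoc, ← mul_assoc K, k2, mul_assoc, KK]
    simp
  have s1 : G' = 2 * H - G - G * G := by rw [← r1]; abel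
  have s2 : (1 / 2 : ℝ) • G'' = H' - (1 / 2 : ℝ) • G' - G * G' := by
    have : G'' = 2 * H' - G' - 2 * (G * G') := by rw [← r2]; abel
    rw [this, two_mul, two_mul]
    module
  have expand : (d + G * L + H * K) * (d + G * L + H * K) = d * d + d * (G * L) + d * (H * K) +
      G * L * d + G * L * (G * L) + G * L * (H * K) + H * K * d + H * K * (G * L) +
      H * K * (H * K) := by noncomm_ring
  rw [expand, dd, e1, e2, e3, e4, e5, e6, ← smul_mul_assoc (1 / 2 : ℝ) G'', s2]
  have s3 : G' * (L * L) = (2 * H - G - G * G) * (L * L) := by rw [s1]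
  rw [s3]
  simp only [sub_mul, smul_mul_assoc]
  noncomm_ring

/-- The square of the truncated connection, applied to elements of low degree. -/
lemma IsGradedGaugePair.truncConn_sq {ν r : ℕ} (hr : r ≤ ν) :
    (truncConn j d p N ν * truncConn j d p N ν + nilEval j N bernG * (comm₁ j d * comm₁ j d) +
      (1 / 2 : ℝ) • (nilEval j N (der bernG) * (comm₂ j d * comm₁ j d)) -
      (1 / 2 : ℝ) • (nilEval j N (der bernF) * (comm₂ j d * (d * p ν)))) * p r = 0 := by
  have sq := h.gaugeConn_sq
  -- The projector moves past `d` and leaves `d² = 0`.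
  have dpd : d * (p ν * (d * p r)) = 0 := by
    rw [← mul_assoc, h.d_mul_p, ← mul_assoc, mul_assoc (p (ν + 1)), h.sq]
    simp
  have sL := h.sandwich bernG (c := 0) h.p_mul_comm₁ ν r
  have sK := h.sandwich bernH (c := 1) h.p_mul_comm₂ ν r
  rw [if_neg (by omega)] at sK
  have pa : p ν * (gaugeConn j d N * p r) =
      p ν * (d * p r) + p ν * (nilEval j N bernG * (comm₁ j d * p r)) := by
    rw [gaugeConn, add_mul, add_mul, mul_add, mul_add, mul_assoc (nilEval j N bernH), sK, add_zero,
      mul_assoc]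
  have dpa : d * (p ν * (gaugeConn j d N * p r)) =
      d * (p ν * (nilEval j N bernG * (comm₁ j d * p r))) := by
    rw [pa, mul_add, dpd, zero_add]
  -- Below degree `ν` the removed term does not contribute: it vanishes on the argument, and after
  -- one application of the connection the only possible component of degree `ν` is exact. In degree
  -- `ν` it gives the additional term of the statement.
  rcases hr.lt_or_eq with hr | rfl
  · have hp : p ν * p r = 0 := by rw [h.p_mul_p, if_neg (by omega)]
    rw [if_neg (by omega)] at sL
    rw [sL, mul_zero] at dpa
    have e1 : truncConn j d p N ν * p r = gaugeConn j d N * p r := by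
      rw [truncConn, sub_mul, mul_assoc, mul_assoc d, hp]
      simp
    have e2 : truncConn j d p N ν * (gaugeConn j d N * p r) =
        gaugeConn j d N * gaugeConn j d N * p r := by
      rw [truncConn, sub_mul, mul_assoc _ (d * p ν), mul_assoc d, dpa, mul_zero, sub_zero,
        mul_assoc]
    rw [sub_mul, add_mul, add_mul, mul_assoc (truncConn j d p N ν), e1, e2, sq]
    simp only [sub_mul, neg_mul, smul_mul_assoc, mul_assoc, hp, mul_zero, smul_zero]
    abel
  · have hp : p r * p r = p r := by rw [h.p_mul_p, if_pos rfl]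
    -- Between two projectors to degree `ν` only the constant term of `G`, and after `d` only the
    -- linear term of `F`, can occur; both are `-1/2`.
    have g0 : coeff 0 bernG = -(1 / 2 : ℝ) := by rw [coeff_bernG]; norm_num
    have f1 : coeff 1 bernF = -(1 / 2 : ℝ) := by rw [coeff_bernF]; norm_num
    have pF : p r * (nilEval j N bernF * (d * p r)) = -(1 / 2 : ℝ) • (j * (d * p r)) := by
      have := h.sandwich bernF (Z := 1) (c := 0) (fun t => by simp) r (r + 1)
      rw [if_pos (by omega), one_mul, ← mul_assoc, show r + 1 - r - 0 = 1 by omega, f1,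
        pow_one] at this
      rw [h.d_mul_p, ← mul_assoc, ← mul_assoc, this, smul_mul_assoc, mul_assoc]
    rw [if_pos (by omega), show r - r - 0 = 0 by omega, g0, pow_zero, one_mul] at sL
    have dF := h.d_mul bernF
    have lF := h.comm₁_mul bernF
    have kF := h.comm₂_mul bernF
    have dd := h.sq
    have dL := h.d_mul_comm₁
    have dj := d_mul_j j d
    have ser1 := congrArg (nilEval j N) der_bernF
    have ser2 := congrArg (nilEval j N) bernF_second
    rw [sL] at dpa
    simp only [nilEval_add, nilEval_neg, nilEval_one h.nilpotent, nilEval_mul h.nilpotent,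
      nilEval_two h.nilpotent] at ser1 ser2
    have z : nilEval j N 0 = 0 := by simp [nilEval_eq_sum]
    rw [z] at ser2
    have e1 : truncConn j d p N r * p r =
        gaugeConn j d N * p r - nilEval j N bernF * (d * p r) := by
      rw [truncConn, sub_mul, mul_assoc, mul_assoc d, hp]
    have aF : gaugeConn j d N * (nilEval j N bernF * (d * p r)) =
        (nilEval j N (der bernF) + nilEval j N bernG * nilEval j N bernF) *
          (comm₁ j d * (d * p r)) + ((1 / 2 : ℝ) • nilEval j N (der (der bernF)) +
          nilEval j N bernG * nilEval j N (der bernF) + nilEval j N bernH * nilEval j N bernF) *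
          (comm₂ j d * (d * p r)) := by
      rw [gaugeConn, add_mul, add_mul, ← mul_assoc d, dF, mul_assoc _ (comm₁ j d),
        ← mul_assoc (comm₁ j d), lF, mul_assoc _ (comm₂ j d), ← mul_assoc (comm₂ j d), kF]
      have : nilEval j N bernF * d * (d * p r) = 0 := by
        rw [mul_assoc, ← mul_assoc d, dd]; simp
      rw [add_mul, add_mul, this, smul_mul_assoc, add_mul (nilEval j N (der bernF)),
        add_mul (_ + _), add_mul (_ • _), smul_mul_assoc]
      simp only [mul_add, add_mul, mul_assoc]
      abel
    -- The two coefficients `-1/2` each contribute half of the right-hand side.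
    have e2 : d * (p r * (truncConn j d p N r * p r)) = comm₁ j d * (d * p r) := by
      have t1 : d * (j * (d * p r)) = comm₁ j d * (d * p r) := by
        rw [← mul_assoc, dj, add_mul, mul_assoc, ← mul_assoc d, dd]; simp
      have t2 : d * (comm₁ j d * p r) = -(comm₁ j d * (d * p r)) := by
        rw [← mul_assoc, dL, neg_mul, mul_assoc]
      rw [e1, mul_sub, pF, mul_sub, dpa, mul_smul_comm, mul_smul_comm, t1, t2]
      module
    have e3 : truncConn j d p N r * (truncConn j d p N r * p r) =
        gaugeConn j d N * gaugeConn j d N * p r -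
        gaugeConn j d N * (nilEval j N bernF * (d * p r)) -
        nilEval j N bernF * (comm₁ j d * (d * p r)) := by
      conv_lhs => enter [1]; rw [truncConn]
      rw [sub_mul, mul_assoc _ (d * p r), mul_assoc d, e2, e1, mul_sub, mul_assoc]
    rw [sub_mul, add_mul, add_mul, mul_assoc (truncConn j d p N r), e3, sq, aF]
    -- By `F' = -(1 + G) F`, the terms with `L d p_ν` cancel against the one left over from `e2`.
    have s1 : nilEval j N (der bernF) + nilEval j N bernG * nilEval j N bernF =
        -nilEval j N bernF := by
      rw [ser1]; noncomm_ring
    have s2 : (1 / 2 : ℝ) • nilEval j N (der (der bernF)) +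
          nilEval j N bernG * nilEval j N (der bernF) + nilEval j N bernH * nilEval j N bernF =
        -((1 / 2 : ℝ) • nilEval j N (der bernF)) := by
      have : nilEval j N (der (der bernF)) = -(2 * (nilEval j N bernG * nilEval j N (der bernF)))
          - 2 * (nilEval j N bernH * nilEval j N bernF) - nilEval j N (der bernF) := by
        rw [← sub_eq_zero, ← ser2]; abel
      rw [this, two_mul, two_mul]
      module
    rw [s1, s2]
    simp only [sub_mul, neg_mul, smul_mul_assoc, mul_assoc, hp]
    abel

/-- The truncated connection applied to the curvature terms. -/
lemma IsGradedGaugePair.truncConn_mul_psi (ν : ℕ) :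
    (truncConn j d p N ν * nilEval j N bernPsi +
      (1 / 2 : ℝ) • (nilEval j N (der bernPsi) * comm₂ j d)) * p (ν + 2) =
    (nilEval j N bernPsi - (1 / 2 : ℝ) • (nilEval j N bernF * (j * j))) * (d * p (ν + 2)) := by
  -- Only the coefficient of `t²` in `Ψ` lowers the degree from `ν + 2` to `ν`.
  have pPsi : p ν * (nilEval j N bernPsi * p (ν + 2)) = (1 / 2 : ℝ) • (j * (j * p (ν + 2))) := by
    have := h.sandwich bernPsi (Z := 1) (c := 0) (fun t => by simp) ν (ν + 2)
    rw [if_pos (by omega), one_mul, show ν + 2 - ν - 0 = 2 by omega, coeff_bernPsi_two,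
      pow_two, mul_assoc] at this
    exact this
  have dP := h.d_mul bernPsi
  have lP := h.comm₁_mul bernPsi
  have kP := h.comm₂_mul bernPsi
  have djj : d * (j * j) = j * j * d + 2 * (j * comm₁ j d) + comm₂ j d := by
    rw [← mul_assoc, d_mul_j j d, add_mul, mul_assoc, d_mul_j j d, comm₁_mul_j j d]
    noncomm_ring
  have ser1 := congrArg (nilEval j N) der_bernPsi
  have ser2 := congrArg (nilEval j N) bernPsi_second
  have Xj := nilEval_X h.nilpotent
  have XF : nilEval j N X * nilEval j N bernF = nilEval j N bernF * nilEval j N X := by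
    rw [← nilEval_mul h.nilpotent, ← nilEval_mul h.nilpotent, mul_comm]
  simp only [nilEval_add, nilEval_sub, nilEval_mul h.nilpotent,
    nilEval_two h.nilpotent] at ser1 ser2
  have z : nilEval j N 0 = 0 := by simp [nilEval_eq_sum]
  rw [XF, Xj] at ser1
  rw [z] at ser2
  -- This collects the multiples of `K`: those from moving the connection past `Ψ(j)`, the
  -- correction by `Ψ'`, and the one from `d (j * j)`.
  have e1 : (1 / 2 : ℝ) • nilEval j N (der (der bernPsi)) +
      nilEval j N bernG * nilEval j N (der bernPsi) + nilEval j N bernH * nilEval j N bernPsi +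
      (1 / 2 : ℝ) • nilEval j N (der bernPsi) - (1 / 2 : ℝ) • nilEval j N bernF = 0 := by
    have : nilEval j N (der (der bernPsi)) =
        -(2 * (nilEval j N bernG * nilEval j N (der bernPsi)))
        - 2 * (nilEval j N bernH * nilEval j N bernPsi) - nilEval j N (der bernPsi) +
        nilEval j N bernF := by
      rw [← sub_eq_zero, ← ser2]; abel
    rw [this, two_mul, two_mul]
    module
  have expand : truncConn j d p N ν * (nilEval j N bernPsi * p (ν + 2)) =
      gaugeConn j d N * nilEval j N bernPsi * p (ν + 2) -
      (1 / 2 : ℝ) • (nilEval j N bernF * (d * (j * j)) * p (ν + 2)) := by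
    rw [truncConn, sub_mul, mul_assoc _ (d * p ν), mul_assoc d, pPsi]
    simp only [mul_smul_comm, mul_assoc]
  rw [add_mul, mul_assoc, expand, djj, gaugeConn, add_mul _ _ (nilEval j N bernPsi),
    add_mul _ _ (nilEval j N bernPsi), dP,
    mul_assoc _ (comm₁ j d), lP, mul_assoc _ (comm₂ j d), kP]
  generalize nilEval j N bernG = G at *
  generalize nilEval j N bernH = H at *
  generalize nilEval j N bernF = F at *
  generalize nilEval j N bernPsi = Y at *
  generalize nilEval j N (der bernPsi) = Y' at *
  generalize nilEval j N (der (der bernPsi)) = Y'' at *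
  have e2 : Y'' * comm₂ j d = (2 : ℝ) • (-(G * Y') - H * Y - (1 / 2 : ℝ) • Y' +
      (1 / 2 : ℝ) • F) * comm₂ j d := by
    congr 1
    have : (1 / 2 : ℝ) • Y'' = -(G * Y') - H * Y - (1 / 2 : ℝ) • Y' + (1 / 2 : ℝ) • F := by
      rw [← sub_eq_zero, ← e1]; abel
    rw [← this, smul_smul]
    norm_num
  have e3 : Y' * comm₁ j d = (F * j - G * Y) * comm₁ j d := by
    rw [← ser1]; noncomm_ring
  rw [e2, e3, two_mul]
  simp only [smul_mul_assoc, sub_mul, add_mul, neg_mul, mul_add, mul_assoc, smul_add,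
    smul_sub, smul_neg, smul_smul]
  module

/-- The intertwining relation of the gauge transformation in degree zero. -/
lemma IsGradedGaugePair.bernE_mul_truncConn (ν : ℕ) :
    p 0 * (nilEval j N bernE * truncConn j d p N ν -
      (1 / 2 : ℝ) • (nilEval j N (der bernE) * comm₂ j d) +
      comm₁ j d * nilEval j N bernE) = 0 := by
  have dE := h.d_mul bernE
  have lE := h.comm₁_mul bernE
  have EF : nilEval j N bernE * nilEval j N bernF = 1 := by
    rw [← nilEval_mul h.nilpotent, bernE_mul_bernF, nilEval_one h.nilpotent]
  have GE : nilEval j N bernG * nilEval j N bernE = nilEval j N bernE * nilEval j N bernG := by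
    rw [← nilEval_mul h.nilpotent, ← nilEval_mul h.nilpotent, mul_comm]
  have ser1 := congrArg (nilEval j N) der_bernE
  have ser2 := congrArg (nilEval j N) bernE_second
  simp only [nilEval_add, nilEval_sub, nilEval_mul h.nilpotent, nilEval_two h.nilpotent,
    nilEval_one h.nilpotent] at ser1 ser2
  have z : nilEval j N 0 = 0 := by simp [nilEval_eq_sum]
  rw [z] at ser2
  have p0 := h.p_zero_mul_d
  -- Since `E F = 1`, the removed term becomes `d p_ν`, which `p_0` annihilates.
  have e1 : nilEval j N bernE * (nilEval j N bernF * (d * p ν)) = d * p ν := by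
    rw [← mul_assoc, EF, one_mul]
  have e2 : nilEval j N bernE * d = d * nilEval j N bernE -
      nilEval j N (der bernE) * comm₁ j d -
      (1 / 2 : ℝ) • (nilEval j N (der (der bernE)) * comm₂ j d) := by
    rw [dE]; abel
  rw [truncConn, gaugeConn, mul_sub (nilEval j N bernE), e1, mul_add (nilEval j N bernE),
    mul_add (nilEval j N bernE), e2, lE]
  generalize nilEval j N bernG = G at *
  generalize nilEval j N bernH = H at *
  generalize nilEval j N bernE = E at *
  generalize nilEval j N (der bernE) = E' at *
  generalize nilEval j N (der (der bernE)) = E'' at *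
  have e3 : E' * comm₁ j d = (E + E * G) * comm₁ j d := by
    rw [ser1, ← GE]; noncomm_ring
  have e4 : E'' * comm₂ j d = (E * H + E * H + E') * comm₂ j d := by
    congr 1
    rw [← sub_eq_zero, ← neg_eq_zero, ← ser2]; noncomm_ring
  rw [e3, e4]
  -- All multiples of `L` and `K` cancel, and the rest begins with `d`.
  have : d * E - (E + E * G) * comm₁ j d - (1 / 2 : ℝ) • ((E * H + E * H + E') * comm₂ j d) +
      E * (G * comm₁ j d) + E * (H * comm₂ j d) - d * p ν - (1 / 2 : ℝ) • (E' * comm₂ j d) +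
      (E * comm₁ j d + E' * comm₂ j d) = d * (E - p ν) := by
    simp only [add_mul, mul_assoc, mul_sub]
    module
  rw [this, ← mul_assoc, p0, zero_mul]

/-- The Bianchi identity in degree zero. -/
lemma IsGradedGaugePair.neg_comm₁_mul_pow (k : ℕ) :
    p 0 * (-(comm₁ j d * ((((k + 1)! : ℕ) : ℝ)⁻¹ • j ^ (k + 1))) +
      (1 / 2 : ℝ) • (((k ! : ℕ) : ℝ)⁻¹ • (j ^ k * comm₂ j d))) =
      p 0 * ((((k + 2)! : ℕ) : ℝ)⁻¹ • (j ^ (k + 2) * d)) := by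
  -- The identity is the Taylor expansion of `p_0 d j^(k + 2) = 0`, with `L` moved to the left of
  -- the powers of `j`.
  have e1 := h.comm₁_mul_aeval (Polynomial.X ^ (k + 1))
  have e2 := h.d_mul_aeval (Polynomial.X ^ (k + 2))
  simp only [map_pow, Polynomial.aeval_X, Polynomial.derivative_X_pow, map_mul,
    Polynomial.aeval_C, Polynomial.derivative_C_mul, add_tsub_cancel_right] at e1 e2
  rw [show k + 2 - 1 = k + 1 by omega, show k + 1 - 1 = k by omega] at e2
  simp only [← Algebra.smul_def, smul_mul_assoc] at e1 e2
  have e3 : p 0 * (d * j ^ (k + 2)) = 0 := by rw [← mul_assoc, h.p_zero_mul_d, zero_mul]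
  rw [← sub_eq_zero, ← mul_sub]
  have f0 : ((k ! : ℕ) : ℝ) ≠ 0 := by positivity
  have f1 : ((((k + 1)! : ℕ)) : ℝ) = (k + 1) * (k ! : ℕ) := by
    rw [Nat.factorial_succ]; push_cast; ring
  have f2 : ((((k + 2)! : ℕ)) : ℝ) = (k + 2) * ((k + 1) * (k ! : ℕ)) := by
    rw [Nat.factorial_succ, Nat.factorial_succ]; push_cast; ring
  have : -(comm₁ j d * ((((k + 1)! : ℕ) : ℝ)⁻¹ • j ^ (k + 1))) +
      (1 / 2 : ℝ) • (((k ! : ℕ) : ℝ)⁻¹ • (j ^ k * comm₂ j d)) -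
      (((k + 2)! : ℕ) : ℝ)⁻¹ • (j ^ (k + 2) * d) =
      -((((k + 2)! : ℕ) : ℝ)⁻¹ • (d * j ^ (k + 2))) := by
    rw [mul_smul_comm, e1, e2, f1, f2]
    simp only [smul_add, smul_smul, neg_add, ← neg_smul]
    push_cast
    match_scalars <;> field_simp <;> ring
  rw [this, mul_neg, mul_smul_comm, e3, smul_zero, neg_zero]

end GaugeAlgebra

/-! ### Polarization of composites and generating functions -/

section GeneralPolarization

open scoped TensorProduct

variable {E : Type*} [Ring E] [Algebra ℝ E] {L : Type*} {m : ℕ} (X : Fin m → L)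

lemma polarize_two_swap (T : (Fin 2 → L) → E) :
    polarize X 2 (fun y => T (y ∘ Equiv.swap 0 1)) = -polarize X 2 T := by
  rw [polarize_comp_perm, Equiv.Perm.sign_swap (by decide)]
  simp

/-- Cyclic rotations of three arguments are even, so the three summands have the same polarization.
-/
lemma polarize_three_eq_zero {T : (Fin 3 → L) → E}
    (h : ∀ y, T y + T (y ∘ finRotate 3) + T (y ∘ (finRotate 3 * finRotate 3 : Equiv.Perm _)) = 0) :
    polarize X 3 T = 0 := by
  have s : Equiv.Perm.sign (finRotate 3) = 1 := by rw [sign_finRotate]; rfl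
  have e := polarize_congr X h
  rw [polarize_add, polarize_add, polarize_comp_perm, polarize_comp_perm, Equiv.Perm.sign_mul, s,
    polarize_zero_fun] at e
  have e' : (3 : ℝ) • polarize X 3 T = 0 := by
    rw [← e, one_smul, mul_one, one_smul]; module
  exact (smul_eq_zero_iff_right (by norm_num)).mp e'

/-- Antisymmetrization in all but the first two arguments. -/
lemma polarize_altSum_tail {q : ℕ} (G : L → L → (Fin q → L) → E) :
    polarize X (q + 2) (fun y => altSum (G (y 0) (y 1)) (Fin.tail (Fin.tail y))) =
      (q ! : ℝ) • polarize X (q + 2) (fun y => G (y 0) (y 1) (Fin.tail (Fin.tail y))) := by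
  have key : ∀ σ : Equiv.Perm (Fin q),
      polarize X (q + 2) (fun y => Equiv.Perm.sign σ •
        G (y 0) (y 1) (Fin.tail (Fin.tail y) ∘ σ)) =
      polarize X (q + 2) (fun y => G (y 0) (y 1) (Fin.tail (Fin.tail y))) := by
    intro σ
    -- This permutation fixes the first two arguments and acts as `σ` on the others; its sign is
    -- that of `σ` and cancels the sign in front.
    set ρ : Equiv.Perm (Fin (q + 2)) :=
      Equiv.Perm.decomposeFin.symm (0, Equiv.Perm.decomposeFin.symm (0, σ)) with hρ
    have hs : Equiv.Perm.sign ρ = Equiv.Perm.sign σ := by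
      rw [hρ, Equiv.Perm.decomposeFin.symm_sign, Equiv.Perm.decomposeFin.symm_sign]
      simp
    have h0 : ρ 0 = 0 := by simp [hρ]
    have h1 : ρ 1 = 1 := by
      rw [hρ, ← Fin.succ_zero_eq_one, Equiv.Perm.decomposeFin_symm_apply_succ]
      simp
    have h2 : ∀ i : Fin q, ρ i.succ.succ = (σ i).succ.succ := fun i => by
      rw [hρ, Equiv.Perm.decomposeFin_symm_apply_succ, Equiv.Perm.decomposeFin_symm_apply_succ]
      simp
    have := polarize_comp_perm X (fun y => G (y 0) (y 1) (Fin.tail (Fin.tail y))) ρ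
    rw [hs] at this
    rw [show polarize X (q + 2) (fun y => G (y 0) (y 1) (Fin.tail (Fin.tail y))) =
      Equiv.Perm.sign σ • Equiv.Perm.sign σ •
        polarize X (q + 2) (fun y => G (y 0) (y 1) (Fin.tail (Fin.tail y))) by
        rw [smul_smul]; simp, ← this]
    have e : ∀ y : Fin (q + 2) → L, Fin.tail (Fin.tail (y ∘ ρ)) = Fin.tail (Fin.tail y) ∘ σ :=
      fun y => funext fun i => by simp [Fin.tail, h2]
    simp only [Function.comp_apply, h0, h1, e]
    rcases Int.units_eq_one_or (Equiv.Perm.sign σ) with hσ | hσ <;> rw [hσ]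
    · simp only [one_smul]
    · simp only [Units.neg_smul, one_smul, polarize_neg]
  have hsum : ∀ s : Finset (Equiv.Perm (Fin q)),
      polarize X (q + 2) (fun y => ∑ σ ∈ s, Equiv.Perm.sign σ •
        G (y 0) (y 1) (Fin.tail (Fin.tail y) ∘ σ)) =
      (s.card : ℝ) • polarize X (q + 2) (fun y => G (y 0) (y 1) (Fin.tail (Fin.tail y))) := by
    intro s
    induction s using Finset.induction_on with
    | empty => simp [polarize_zero_fun]
    | insert a s ha ih =>
      simp only [Finset.sum_insert ha]
      rw [polarize_add, ih, key, Finset.card_insert_of_notMem ha]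
      push_cast
      module
  have := hsum Finset.univ
  rw [Finset.card_univ, Fintype.card_perm, Fintype.card_fin] at this
  exact this

/-- The composite of an operation of `p` arguments with an operation of `q` further arguments. -/
def concatMul {p q m : ℕ} (h : p + q = m) (S : (Fin q → L) → E) (T : (Fin p → L) → E)
    (y : Fin m → L) : E :=
  S (fun i => y ⟨p + i, by omega⟩) * T (fun i => y ⟨i, by omega⟩)

lemma polarize_mul_eq_concat {p q k : ℕ} (h : p + q = k) (S : (Fin q → L) → E)
    (T : (Fin p → L) → E) :
    polarize X q S * polarize X p T = polarize X k (concatMul h S T) := by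
  subst h
  rw [polarize_mul]
  rfl

/-- The generating function of a family of operations. -/
def genFun (M : ℕ) (W : (q : ℕ) → (Fin q → L) → E) : E ⊗[ℝ] Grassmann m :=
  ∑ q ∈ Finset.range M, (q ! : ℝ)⁻¹ • polarize X q (W q)

/-- By the degree in the Grassmann variables only complementary lengths `p` and `m - p` meet. The
weights `1 / (p! (m - p)!)` turn the sum over permutations into one over shuffles. -/
lemma topCoeff_genFun_mul {M : ℕ} (hM : m < M) (S T : (q : ℕ) → (Fin q → L) → E) :
    topCoeff E m (genFun X M S * genFun X M T) = ∑ p : Fin (m + 1),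
      (((p : ℕ)! : ℝ) * ((m - p : ℕ)! : ℝ))⁻¹ •
        altSum (concatMul (show (p : ℕ) + (m - p) = m by omega) (S (m - p)) (T p)) X := by
  rw [genFun, genFun, Finset.mul_sum, map_sum, ← Finset.sum_subset (Finset.range_mono hM),
    Finset.sum_range]
  · refine Finset.sum_congr rfl fun p _ => ?_
    rw [Finset.sum_mul, map_sum, Finset.sum_eq_single (m - p)]
    · rw [smul_mul_assoc, mul_smul_comm, smul_smul,
        polarize_mul_eq_concat X (show (p : ℕ) + (m - p) = m by omega), map_smul,
        topCoeff_polarize, mul_inv, mul_comm]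
    · intro q _ hq
      rw [smul_mul_assoc, mul_smul_comm, polarize_mul, map_smul, map_smul,
        topCoeff_polarize_of_ne X (by omega), smul_zero, smul_zero]
    · intro h
      exact absurd (Finset.mem_range.mpr (by omega)) h
  · intro p _ hp
    rw [Finset.mem_range, not_lt] at hp
    rw [polarize_of_lt X (show m < p by omega), smul_zero, mul_zero, map_zero]

end GeneralPolarization

/-! ### The gauge pair of a Cartan system -/

section CartanSystems

open scoped TensorProduct

variable {L E : Type*} [LieRing L] [Ring E] [Algebra ℝ E]

/-- The relations between the differential `d`, the contractions `c X`, the parity operator `s` and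
the projectors `p r` onto the elements of degree `r`. -/
structure IsCartanSystem (d : E) (c : L →+ E) (s : E) (p : ℕ → E) : Prop where
  d_mul_d : d * d = 0
  d_mul_s : d * s = -(s * d)
  c_mul_c : ∀ X Y, c X * c Y = -(c Y * c X)
  c_mul_s : ∀ X, c X * s = -(s * c X)
  cartan : ∀ X Y, (d * c X - c X * d) * c Y + c Y * (d * c X - c X * d) = c ⁅X, Y⁆ * s
  d_mul_p : ∀ r, d * p r = p (r + 1) * d
  p_mul_c : ∀ r X, p r * c X = c X * p (r + 1)
  p_mul_p : ∀ r t, p r * p t = if r = t then p r else 0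
  s_mul_p : ∀ r, s * p r = p r * s
  c_mul_p_zero : ∀ X, c X * p 0 = 0
  p_zero_mul_d : p 0 * d = 0

/-- The negative of the Lie derivative, up to parity. -/
def lieTerm (d : E) (c : L →+ E) (X : L) : E := d * c X - c X * d

/-- The contraction with a bracket. -/
def bracketTerm (c : L →+ E) (s : E) (X Y : L) : E := c ⁅X, Y⁆ * s

omit [Algebra ℝ E] in
lemma bracketTerm_swap (c : L →+ E) (s : E) (X Y : L) :
    bracketTerm c s X Y = -bracketTerm c s Y X := by
  rw [bracketTerm, bracketTerm, ← lie_skew, map_neg, neg_mul]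

omit [Algebra ℝ E] in
lemma bracketTerm_jacobi (c : L →+ E) (s : E) (X Y Z : L) :
    bracketTerm c s ⁅X, Y⁆ Z + bracketTerm c s ⁅Y, Z⁆ X + bracketTerm c s ⁅Z, X⁆ Y = 0 := by
  rw [bracketTerm, bracketTerm, bracketTerm, ← add_mul, ← add_mul, ← map_add, ← map_add]
  have e : ∀ a b c : L, ⁅⁅a, b⁆, c⁆ = -⁅c, ⁅a, b⁆⁆ := fun a b c => (lie_skew _ _).symm
  have : ⁅⁅X, Y⁆, Z⁆ + ⁅⁅Y, Z⁆, X⁆ + ⁅⁅Z, X⁆, Y⁆ = 0 := by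
    rw [e, e, e, ← neg_add, ← neg_add, neg_eq_zero, ← lie_jacobi X Y Z]
    abel
  rw [this, map_zero, zero_mul]

variable {d : E} {c : L →+ E} {s : E} {p : ℕ → E} (h : IsCartanSystem d c s p)

omit [Algebra ℝ E] in
include h in
lemma IsCartanSystem.lieTerm_mul_c (X Y : L) :
    lieTerm d c X * c Y = bracketTerm c s X Y - c Y * lieTerm d c X :=
  eq_sub_of_add_eq (h.cartan X Y)

omit [Algebra ℝ E] in
include h in
lemma IsCartanSystem.bracketTerm_mul_c (X Y Z : L) :
    bracketTerm c s X Y * c Z = c Z * bracketTerm c s X Y := by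
  have e : s * c Z = -(c Z * s) := by rw [h.c_mul_s, neg_neg]
  rw [bracketTerm, mul_assoc, e, mul_neg, ← mul_assoc, h.c_mul_c, neg_mul, neg_neg, mul_assoc]

omit [Algebra ℝ E] in
include h in
lemma IsCartanSystem.lieTerm_mul_s (X : L) :
    lieTerm d c X * s = d * (c X * s) + c X * s * d := by
  rw [lieTerm, sub_mul, mul_assoc _ d, h.d_mul_s]
  noncomm_ring

variable {m : ℕ} (X : Fin m → L)

variable (c) in
/-- The polarization of the contractions. -/
def jHat : E ⊗[ℝ] Grassmann m := polarize X 1 (fun y => c (y 0))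

variable (d m) in
/-- The differential with Grassmann coefficients. -/
def dHat : E ⊗[ℝ] Grassmann m := d ⊗ₜ 1

variable (p m) in
/-- The projection to the elements of degree `r` with Grassmann coefficients. -/
def pHat (r : ℕ) : E ⊗[ℝ] Grassmann m := p r ⊗ₜ 1

omit [LieRing L] in
lemma comm₁_hat [LieRing L] {d : E} {c : L →+ E} (X : Fin m → L) :
    comm₁ (jHat c X) (dHat d m) = polarize X 1 (fun y => lieTerm d c (y 0)) := by
  rw [comm₁, jHat, dHat, ← polarize_const_mul, ← polarize_mul_const, ← polarize_sub]
  rfl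

include h

/-- Exchanging the two arguments in one of the two products of `[L, j]` turns the commutator into
the polarization of an anticommutator, to which the Cartan relation applies. The minus sign arises
because the left factor takes the second argument. -/
lemma IsCartanSystem.polarize_bracketTerm :
    polarize X 2 (fun y => bracketTerm c s (y 0) (y 1)) = -comm₂ (jHat c X) (dHat d m) := by
  rw [eq_comm, neg_eq_iff_eq_neg, comm₂, comm₁_hat, jHat, polarize_mul, polarize_mul]
  change polarize X 2 (fun y => lieTerm d c (y 1) * c (y 0)) -
    polarize X 2 (fun y => c (y 1) * lieTerm d c (y 0)) = _
  have := polarize_two_swap X (fun y => c (y 1) * lieTerm d c (y 0))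
  rw [sub_eq_add_neg, ← this, ← polarize_add, ← polarize_neg]
  refine polarize_congr X fun y => ?_
  rw [← bracketTerm_swap, h.lieTerm_mul_c]
  simp

lemma IsCartanSystem.isGradedGaugePair :
    IsGradedGaugePair (jHat c X) (dHat d m) (pHat p m) (m + 1) where
  nilpotent := polarize_pow_eq_zero X c
  sq := by rw [dHat, Algebra.TensorProduct.tmul_mul_tmul, h.d_mul_d, TensorProduct.zero_tmul]
  comm := by
    change comm₂ (jHat c X) (dHat d m) * jHat c X = jHat c X * comm₂ (jHat c X) (dHat d m)
    rw [← neg_inj, ← neg_mul, ← mul_neg, ← h.polarize_bracketTerm, jHat, polarize_mul,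
      polarize_mul]
    -- A bracket term commutes with a contraction; the ensuing rearrangement of the arguments is a
    -- cyclic rotation of three, hence even.
    have := polarize_comp_perm X (fun y : Fin 3 → L =>
      c (y 2) * bracketTerm c s (y 0) (y 1)) (finRotate 3)
    rw [show Equiv.Perm.sign (finRotate 3) = 1 by rw [sign_finRotate]; rfl, one_smul] at this
    refine Eq.trans ?_ this
    refine polarize_congr X fun y => ?_
    exact h.bracketTerm_mul_c (y 1) (y 2) (y 0)
  p_mul_j r := by
    rw [jHat, pHat, pHat, ← polarize_const_mul, ← polarize_mul_const]
    exact polarize_congr X fun y => h.p_mul_c r (y 0)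
  d_mul_p r := by
    rw [dHat, pHat, pHat, Algebra.TensorProduct.tmul_mul_tmul, h.d_mul_p,
      Algebra.TensorProduct.tmul_mul_tmul]
  p_mul_p r t := by
    rw [pHat, pHat, Algebra.TensorProduct.tmul_mul_tmul, h.p_mul_p, one_mul]
    split_ifs
    · rfl
    · exact TensorProduct.zero_tmul _ _
  j_mul_p_zero := by
    rw [jHat, pHat, ← polarize_mul_const, ← polarize_zero_fun X (q := 1)]
    exact polarize_congr X fun y => h.c_mul_p_zero _
  p_zero_mul_d := by
    rw [pHat, dHat, Algebra.TensorProduct.tmul_mul_tmul, h.p_zero_mul_d, TensorProduct.zero_tmul]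

lemma IsCartanSystem.polarize_c_lie :
    polarize X 2 (fun y => c ⁅y 0, y 1⁆ * s) = -comm₂ (jHat c X) (dHat d m) :=
  h.polarize_bracketTerm X

/-- The polarized form of `[L_X, L_Y] = L_{[X, Y]}`: with the parity operator, the Lie derivative
along a bracket is `-(d K + K d)`, which is `2 L²`. -/
lemma IsCartanSystem.polarize_lieTerm_lie :
    polarize X 2 (fun y => lieTerm d c ⁅y 0, y 1⁆ * s) =
      2 * (comm₁ (jHat c X) (dHat d m) * comm₁ (jHat c X) (dHat d m)) := by
  rw [polarize_congr X fun y => h.lieTerm_mul_s _, polarize_add, polarize_const_mul,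
    polarize_mul_const X (fun y => c ⁅y 0, y 1⁆ * s), h.polarize_c_lie]
  change dHat d m * _ + _ * dHat d m = _
  rw [mul_neg, (h.isGradedGaugePair X).d_mul_comm₂]
  noncomm_ring

omit h in
lemma polarize_bracketTerm_lie :
    polarize X 3 (fun y => bracketTerm c s ⁅y 0, y 1⁆ (y 2)) = 0 := by
  refine polarize_three_eq_zero X fun y => ?_
  exact bracketTerm_jacobi c s (y 0) (y 1) (y 2)

end CartanSystems

/-! ### Words with one distinguished vector field -/

section InsertedVector

open scoped TensorProduct

variable {L E : Type*} [LieRing L] [Ring E] [Algebra ℝ E] (d : E) (c : L →+ E) (s : E)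

/-- The composites of contractions with one Lie derivative. -/
def lieWord : {q : ℕ} → (Fin q → L) → E
  | 0, _ => 0
  | _ + 1, Y => revProd c (Fin.tail Y) * lieTerm d c (Y 0)

/-- The composites of contractions with one contraction with a bracket. -/
def bracketWord : {q : ℕ} → (Fin q → L) → E
  | 0, _ => 0
  | 1, _ => 0
  | _ + 2, Y => revProd c (Fin.tail (Fin.tail Y)) * bracketTerm c s (Y 0) (Y 1)

/-- The composites of contractions with one contraction with a bracket with `Z`. -/
def bracketWordWith (Z : L) : {q : ℕ} → (Fin q → L) → E
  | 0, _ => 0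
  | _ + 1, Y => revProd c (Fin.tail Y) * bracketTerm c s Z (Y 0)

variable {d c s} {p : ℕ → E} (h : IsCartanSystem d c s p)

omit [LieRing L] in
lemma tail_insertNth_succ {q : ℕ} (j : Fin (q + 1)) (Z : L) (y : Fin (q + 1) → L) :
    Fin.tail (j.succ.insertNth (α := fun _ => L) Z y) =
      j.insertNth (α := fun _ => L) Z (Fin.tail y) := by
  funext i
  induction i using Fin.succAboveCases j with
  | x => simp [Fin.tail]
  | p i =>
    rw [Fin.tail, ← Fin.succ_succAbove_succ, Fin.insertNth_apply_succAbove,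
      Fin.insertNth_apply_succAbove]
    rfl

include h

omit [Algebra ℝ E] in
-- Position `0` is the rightmost factor, so the contraction with `Z` passes `j` anticommuting
-- contractions.
lemma IsCartanSystem.revProd_insertNth {q : ℕ} (j : Fin (q + 1)) (Z : L) (y : Fin q → L) :
    revProd c (j.insertNth (α := fun _ => L) Z y) =
      (-1 : ℤˣ) ^ (j : ℕ) • (revProd c y * c Z) := by
  induction q with
  | zero =>
    obtain rfl : j = 0 := Fin.fin_one_eq_zero j
    simp [revProd]
  | succ q ih =>
    induction j using Fin.cases with
    | zero => simp [revProd_succ]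
    | succ j =>
      rw [revProd_succ, tail_insertNth_succ, ih, revProd_succ]
      have : j.succ.insertNth (α := fun _ => L) Z y 0 = y 0 := by
        rw [← Fin.succ_succAbove_zero j, Fin.insertNth_apply_succAbove]
      rw [this, smul_mul_assoc, mul_assoc, h.c_mul_c, Fin.val_succ, pow_succ]
      simp [mul_assoc]

omit h [LieRing L] [Algebra ℝ E] in
lemma smul_neg_one_pow_cancel (ε : ℤˣ) (k : ℕ) (a : E) :
    (ε * (-1) ^ k) • (-1 : ℤˣ) ^ k • a = ε • a := by
  rw [smul_smul, mul_assoc, ← mul_pow]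
  simp

/-- The effect of inserting the argument `Z` in all positions. -/
lemma IsCartanSystem.altSum_revProd_cons {q : ℕ} (a : E) (Z : L) (Y : Fin q → L) :
    altSum (fun y => revProd c y * a) (Fin.cons (α := fun _ => L) Z Y) =
      altSum (fun y => ((q : ℝ) + 1) • (revProd c y * (c Z * a))) Y := by
  rw [altSum_cons, altSum_smul]
  simp only [h.revProd_insertNth, Fin.cons_zero, Fin.tail_cons]
  have : ∀ j : Fin (q + 1), (-1 : ℤˣ) ^ (j : ℕ) •
      altSum (fun y => (-1 : ℤˣ) ^ (j : ℕ) • (revProd c y * c Z) * a) Y =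
      altSum (fun y => revProd c y * (c Z * a)) Y := by
    intro j
    rw [altSum, altSum, Finset.smul_sum]
    refine Finset.sum_congr rfl fun σ _ => ?_
    rw [smul_comm, smul_mul_assoc, smul_smul, smul_neg_one_pow_cancel, mul_assoc]
  rw [Finset.sum_congr rfl fun j _ => this j]
  simp [← Nat.cast_smul_eq_nsmul ℝ]

/-- `Z` is either the vector field of the Lie derivative or one of the `q` contracted ones. In the
second case its contraction is moved to the right end, and passing the Lie derivative creates a
bracket with `Z`. -/
lemma IsCartanSystem.altSum_lieWord_cons {q : ℕ} (Z : L) (Y : Fin q → L) :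
    altSum (lieWord d c) (Fin.cons (α := fun _ => L) Z Y) =
      altSum (fun y => revProd c y * lieTerm d c Z + (q : ℝ) • (lieWord d c y * c Z) +
        (q : ℝ) • bracketWordWith c s Z y) Y := by
  rw [altSum_cons, Fin.sum_univ_succ]
  simp only [Fin.cons_zero, Fin.tail_cons]
  rw [altSum_add, altSum_add, altSum_smul, altSum_smul, add_assoc]
  congr 1
  · simp [lieWord]
  · rcases q with _ | q
    · simp
    have : ∀ j : Fin (q + 1), (-1 : ℤˣ) ^ (j.succ : ℕ) •
        altSum (fun y => lieWord d c (j.succ.insertNth (α := fun _ => L) Z y)) Y =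
        altSum (fun y => lieWord d c y * c Z) Y + altSum (bracketWordWith c s Z) Y := by
      intro j
      rw [← altSum_add, altSum, altSum, Finset.smul_sum]
      refine Finset.sum_congr rfl fun σ _ => ?_
      have : j.succ.insertNth (α := fun _ => L) Z (Y ∘ σ) 0 = (Y ∘ σ) 0 := by
        rw [← Fin.succ_succAbove_zero j, Fin.insertNth_apply_succAbove]
      rw [smul_comm, lieWord, tail_insertNth_succ, h.revProd_insertNth, this, smul_mul_assoc,
        smul_smul, Fin.val_succ, pow_succ', ← mul_assoc, mul_neg_one, smul_neg_one_pow_cancel,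
        lieWord, bracketWordWith, mul_assoc (revProd c _), mul_assoc (revProd c _),
        h.lieTerm_mul_c, bracketTerm_swap c s Z, Units.neg_smul, ← smul_neg]
      congr 1
      simp only [Fin.tail_def, Function.comp_apply]
      noncomm_ring
    rw [Finset.sum_congr rfl fun j _ => this j]
    simp [← Nat.cast_smul_eq_nsmul ℝ]

/-- The first and the second slot of the bracket give the same term by antisymmetry; the remaining
`q - 1` positions give a contraction, which commutes with the bracket term. -/
lemma IsCartanSystem.altSum_bracketWord_cons {q : ℕ} (Z : L) (Y : Fin q → L) :
    altSum (bracketWord c s) (Fin.cons (α := fun _ => L) Z Y) =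
      altSum (fun y => (2 : ℝ) • bracketWordWith c s Z y +
        ((q : ℝ) - 1) • (bracketWord c s y * c Z)) Y := by
  rw [altSum_cons]
  simp only [Fin.cons_zero, Fin.tail_cons]
  -- For `q = 0` the coefficient `q - 1` is `-1`, but all words are too short and vanish.
  rcases q with _ | q
  · simp [bracketWord, bracketWordWith, altSum]
  rw [Fin.sum_univ_succ, Fin.sum_univ_succ, altSum_add, altSum_smul, altSum_smul, two_smul]
  have e0 : ∀ y : Fin (q + 1) → L,
      bracketWord c s ((0 : Fin (q + 2)).insertNth (α := fun _ => L) Z y) =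
      bracketWordWith c s Z y := fun y => by
    rw [Fin.insertNth_zero']; rfl
  have e1 : ∀ y : Fin (q + 1) → L,
      bracketWord c s ((Fin.succ 0 : Fin (q + 2)).insertNth (α := fun _ => L) Z y) =
      -bracketWordWith c s Z y := fun y => by
    rw [bracketWord, tail_insertNth_succ, bracketWordWith, bracketTerm_swap c s Z, mul_neg,
      neg_neg]
    rfl
  simp only [e0, e1]
  have n1 : altSum (fun y => -bracketWordWith c s Z y) Y = -altSum (bracketWordWith c s Z) Y := by
    have := altSum_smul (-1) (bracketWordWith c s Z) Y
    simpa using this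
  rw [n1]
  refine Eq.trans ?_ (add_assoc _ _ _).symm
  refine congrArg₂ _ (by simp) (congrArg₂ _ (by simp) ?_)
  rcases q with _ | q
  · simp
  have : ∀ j : Fin (q + 1), (-1 : ℤˣ) ^ (j.succ.succ : ℕ) •
      altSum (fun y => bracketWord c s (j.succ.succ.insertNth (α := fun _ => L) Z y)) Y =
      altSum (fun y => bracketWord c s y * c Z) Y := by
    intro j
    rw [altSum, altSum, Finset.smul_sum]
    refine Finset.sum_congr rfl fun σ _ => ?_
    have e2 : j.succ.succ.insertNth (α := fun _ => L) Z (Y ∘ σ) 0 = (Y ∘ σ) 0 := by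
      rw [← Fin.succ_succAbove_zero j.succ, Fin.insertNth_apply_succAbove]
    have e3 : j.succ.succ.insertNth (α := fun _ => L) Z (Y ∘ σ) 1 = (Y ∘ σ) 1 := by
      have := congrFun (tail_insertNth_succ j.succ Z (Y ∘ σ)) 0
      rw [← Fin.succ_succAbove_zero j, Fin.insertNth_apply_succAbove,
        Fin.succ_succAbove_zero] at this
      exact this
    rw [smul_comm, bracketWord, tail_insertNth_succ, tail_insertNth_succ, h.revProd_insertNth,
      e2, e3, smul_mul_assoc, smul_smul, Fin.val_succ, Fin.val_succ, pow_succ, pow_succ,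
      mul_assoc ((-1) ^ _), neg_one_mul, neg_neg, mul_one, smul_neg_one_pow_cancel, bracketWord,
      mul_assoc, mul_assoc, h.bracketTerm_mul_c]
  rw [Finset.sum_congr rfl fun j _ => this j]
  simp [← Nat.cast_smul_eq_nsmul ℝ]

end InsertedVector

/-! ### Generating functions of the Courant, gauge and Atiyah operations -/

section GeneratingFunctions

open scoped TensorProduct
open PowerSeries (coeff)

variable {L E : Type*} [LieRing L] [Ring E] [Algebra ℝ E] {m : ℕ} (X : Fin m → L)

/-- The polarization of a family of operations with one argument replaced by a bracket. -/
def insertedFun (M : ℕ) (S : (q : ℕ) → (Fin q → L) → E) : E ⊗[ℝ] Grassmann m :=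
  ∑ q ∈ Finset.range M, (1 / 2 * (q ! : ℝ)⁻¹) • polarize X (q + 2) (fun y =>
    S (q + 1) (Fin.cons (α := fun _ => L) ⁅y 0, y 1⁆ (Fin.tail (Fin.tail y))))

/-- The signed sum over the ways to replace two arguments by their bracket. -/
def insertedSum (S : (q : ℕ) → (Fin q → L) → E) : {m : ℕ} → (Fin m → L) → E
  | 0, _ => 0
  | 1, _ => 0
  | m + 2, X => (1 / 2 * (m ! : ℝ)⁻¹) • altSum (fun y =>
      S (m + 1) (Fin.cons (α := fun _ => L) ⁅y 0, y 1⁆ (Fin.tail (Fin.tail y)))) X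

lemma topCoeff_insertedFun {M : ℕ} (hM : m < M) (S : (q : ℕ) → (Fin q → L) → E) :
    topCoeff E m (insertedFun X M S) = insertedSum S X := by
  rw [insertedFun, map_sum]
  have hne : ∀ q, q + 2 ≠ m → topCoeff E m ((1 / 2 * (q ! : ℝ)⁻¹) • polarize X (q + 2) (fun y =>
      S (q + 1) (Fin.cons (α := fun _ => L) ⁅y 0, y 1⁆ (Fin.tail (Fin.tail y))))) = 0 := by
    intro q hq
    rw [map_smul, topCoeff_polarize_of_ne X hq, smul_zero]
  match m, X with
  | 0, X => exact Finset.sum_eq_zero fun q _ => hne q (by omega)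
  | 1, X => exact Finset.sum_eq_zero fun q _ => hne q (by omega)
  | m + 2, X =>
    rw [Finset.sum_eq_single m]
    · rw [map_smul, topCoeff_polarize]
      rfl
    · intro q _ hq
      exact hne q (by omega)
    · intro h
      exact absurd (Finset.mem_range.mpr (by omega)) h

variable (d : E) (c : L →+ E) (s : E) (p : ℕ → E) (ν : ℕ)

/-- The sum of all ways to insert a form of degree at most `ν` into an iterated bracket. -/
def courantWord {q : ℕ} (Y : Fin q → L) : E :=
  revProd c Y * (d * p ν) - lieWord d c Y - bracketWord c s Y

/-- The action of vector fields on forms of degree at most `ν` in the Courant algebra. -/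
def courantOp (q : ℕ) (Y : Fin q → L) : E :=
  (if q = 0 then d else 0) - ((bernoulli q : ℝ) / (q ! : ℝ)) • altSum (courantWord d c s p ν) Y

/-- The bracket of vector fields in the Courant algebra, as an operator applied to the curvature. -/
def courantVec (q : ℕ) (Y : Fin q → L) : E :=
  ((q ! : ℝ) * coeff q bernPsi) • revProd c Y

/-- The gauge transformation on forms. -/
def gaugeOp (q : ℕ) (Y : Fin q → L) : E :=
  ((q ! : ℝ) * coeff q bernE) • (p 0 * revProd c Y)

/-- The action of vector fields on functions in the Atiyah algebra. -/
def atiyahOp : (q : ℕ) → (Fin q → L) → E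
  | 1, Y => -(lieTerm d c (Y 0) * p 0)
  | _, _ => 0

/-- The bracket of vector fields in the Atiyah algebra, as an operator applied to the curvature. -/
def atiyahVec (n q : ℕ) (Y : Fin q → L) : E :=
  if q = n + 1 then revProd c Y else 0

variable {d c s p} {ν} (h : IsCartanSystem d c s p)

lemma polarize_revProd_mul (q : ℕ) (a : E) :
    polarize X q (fun y => revProd c y * a) = jHat c X ^ q * a ⊗ₜ 1 := by
  rw [polarize_mul_const, polarize_revProd]
  rfl

lemma polarize_lieWord_succ (q : ℕ) :
    polarize X (q + 1) (lieWord d c) = jHat c X ^ q * comm₁ (jHat c X) (dHat d m) := by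
  rw [comm₁_hat, jHat, ← polarize_revProd, ← polarize_succ]
  rfl

lemma polarize_lieWord_zero : polarize X 0 (lieWord d c) = 0 := polarize_zero_fun X

include h

lemma IsCartanSystem.polarize_bracketWord (q : ℕ) :
    polarize X (q + 2) (bracketWord c s) =
      -(jHat c X ^ q * comm₂ (jHat c X) (dHat d m)) := by
  rw [← mul_neg, ← h.polarize_bracketTerm, jHat, ← polarize_revProd,
    ← polarize_succ_succ X (revProd c) (bracketTerm c s)]
  rfl

lemma IsCartanSystem.nilEval_jHat {M : ℕ} (hM : m < M) (F : PowerSeries ℝ) :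
    ∑ a ∈ Finset.range M, coeff a F • jHat c X ^ a = nilEval (jHat c X) (m + 1) F := by
  rw [← nilEval_eq_sum, nilEval_of_le (h.isGradedGaugePair X).nilpotent (Nat.succ_le_of_lt hM)]

/-- Words with a Lie derivative polarize to `L` after a power of `j` shorter by one, words with a
bracket to `-K` after a power shorter by two. The correspondingly shifted coefficients of `F` are
those of `G` and, up to sign, `h`. The range `m + 3` leaves room for both shifts. -/
lemma IsCartanSystem.genFun_courantOp :
    genFun X (m + 3) (courantOp d c s p ν) =
      truncConn (jHat c X) (dHat d m) (pHat p m) (m + 1) ν := by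
  have e : ∀ q, (q ! : ℝ)⁻¹ • polarize X q (courantOp d c s p ν q) =
      (if q = 0 then dHat d m else 0) -
        (coeff q bernF • jHat c X ^ q * (dHat d m * pHat p m ν) -
          coeff q bernF • polarize X q (lieWord d c) -
          coeff q bernF • polarize X q (bracketWord c s)) := by
    intro q
    have w : polarize X q (fun y => altSum (courantWord d c s p ν) y) =
        (q ! : ℝ) • (jHat c X ^ q * (dHat d m * pHat p m ν) - polarize X q (lieWord d c) -
          polarize X q (bracketWord c s)) := by
      rw [polarize_altSum]
      change (q ! : ℝ) • polarize X q (fun y => revProd c y * (d * p ν) - lieWord d c y -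
        bracketWord c s y) = _
      rw [polarize_sub, polarize_sub, polarize_revProd_mul, dHat, pHat,
        Algebra.TensorProduct.tmul_mul_tmul, one_mul]
    change (q ! : ℝ)⁻¹ • polarize X q (fun y => (if q = 0 then d else 0) -
      ((bernoulli q : ℝ) / (q ! : ℝ)) • altSum (courantWord d c s p ν) y) = _
    rw [polarize_sub, polarize_smul, w, smul_sub, smul_smul, smul_smul, coeff_bernF]
    have hf : (q ! : ℝ) ≠ 0 := by positivity
    rw [show (q ! : ℝ)⁻¹ * (bernoulli q / (q ! : ℝ)) * (q ! : ℝ) = (bernoulli q : ℝ) / (q ! : ℝ) by field_simp,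
      smul_sub, smul_sub, smul_mul_assoc]
    congr 1
    split_ifs with hq
    · subst hq
      rw [polarize_zero, dHat]
      simp
    · rw [polarize_zero_fun, smul_zero]
  rw [genFun, Finset.sum_congr rfl fun q _ => e q, Finset.sum_sub_distrib, Finset.sum_sub_distrib,
    Finset.sum_sub_distrib, ← Finset.sum_mul, h.nilEval_jHat X (by omega), truncConn, gaugeConn]
  have e1 : ∑ q ∈ Finset.range (m + 3), (if q = 0 then dHat d m else 0) = dHat d m := by
    rw [Finset.sum_ite_eq' (Finset.range (m + 3)) 0]
    simp
  have e2 : ∑ q ∈ Finset.range (m + 3), coeff q bernF • polarize X q (lieWord d c) =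
      nilEval (jHat c X) (m + 1) bernG * comm₁ (jHat c X) (dHat d m) := by
    rw [Finset.sum_range_succ', polarize_lieWord_zero, smul_zero, add_zero,
      ← h.nilEval_jHat X (show m < m + 2 by omega), Finset.sum_mul]
    refine Finset.sum_congr rfl fun q _ => ?_
    rw [polarize_lieWord_succ, coeff_bernF, coeff_bernG, smul_mul_assoc]
  have e3 : ∑ q ∈ Finset.range (m + 3), coeff q bernF • polarize X q (bracketWord c s) =
      nilEval (jHat c X) (m + 1) bernH * comm₂ (jHat c X) (dHat d m) := by
    have z0 : polarize X 0 (bracketWord c s) = 0 := polarize_zero_fun X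
    have z1 : polarize X (0 + 1) (bracketWord c s) = 0 := polarize_zero_fun X
    rw [Finset.sum_range_succ', Finset.sum_range_succ', z0, z1, smul_zero, add_zero, smul_zero,
      add_zero, ← h.nilEval_jHat X (show m < m + 1 by omega), Finset.sum_mul]
    refine Finset.sum_congr rfl fun q _ => ?_
    rw [h.polarize_bracketWord, coeff_bernF, coeff_bernH, smul_mul_assoc, smul_neg, neg_smul]
  rw [e1, e2, e3]
  abel

lemma IsCartanSystem.genFun_courantVec :
    genFun X (m + 3) (courantVec c) = nilEval (jHat c X) (m + 1) bernPsi := by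
  rw [genFun, ← h.nilEval_jHat X (show m < m + 3 by omega)]
  refine Finset.sum_congr rfl fun q _ => ?_
  have hf : (q ! : ℝ) ≠ 0 := by positivity
  change (q ! : ℝ)⁻¹ • polarize X q (fun y => ((q ! : ℝ) * coeff q bernPsi) • revProd c y) = _
  rw [polarize_smul, polarize_revProd, smul_smul, inv_mul_cancel_left₀ hf]
  rfl

lemma IsCartanSystem.genFun_gaugeOp :
    genFun X (m + 3) (gaugeOp c p) = pHat p m 0 * nilEval (jHat c X) (m + 1) bernE := by
  rw [genFun, ← h.nilEval_jHat X (show m < m + 3 by omega), Finset.mul_sum]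
  refine Finset.sum_congr rfl fun q _ => ?_
  have hf : (q ! : ℝ) ≠ 0 := by positivity
  change (q ! : ℝ)⁻¹ • polarize X q
    (fun y => ((q ! : ℝ) * coeff q bernE) • (p 0 * revProd c y)) = _
  rw [polarize_smul, polarize_const_mul, polarize_revProd, smul_smul, inv_mul_cancel_left₀ hf,
    mul_smul_comm]
  rfl

omit h in
lemma genFun_atiyahOp :
    genFun X (m + 3) (atiyahOp d c p) =
      -(comm₁ (jHat c X) (dHat d m) * pHat p m 0) := by
  rw [genFun, Finset.sum_eq_single 1]
  · have : polarize X 1 (atiyahOp d c p 1) =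
        polarize X 1 (fun y => -(lieTerm d c (y 0) * p 0)) := rfl
    rw [this, polarize_neg, polarize_mul_const X (fun y => lieTerm d c (y 0)), comm₁_hat]
    simp [pHat]
  · intro q _ hq
    have : ∀ y, atiyahOp d c p q y = (0 : E) := by
      intro y
      match q, y, hq with
      | 0, _, _ => rfl
      | _ + 2, _, _ => rfl
    rw [polarize_congr X this, polarize_zero_fun, smul_zero]
  · intro hq
    exact absurd (Finset.mem_range.mpr (by omega)) hq

omit h in
lemma genFun_atiyahVec (n : ℕ) :
    genFun X (m + 3) (atiyahVec c n) = ((n + 1)! : ℝ)⁻¹ • jHat c X ^ (n + 1) := by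
  by_cases hn : n + 1 < m + 3
  · rw [genFun, Finset.sum_eq_single (n + 1)]
    · have : atiyahVec c n (n + 1) = revProd c := funext fun y => if_pos rfl
      rw [this, polarize_revProd]
      rfl
    · intro q _ hq
      rw [polarize_congr X fun y => show atiyahVec c n q y = 0 from if_neg hq, polarize_zero_fun,
        smul_zero]
    · intro hq
      exact absurd (Finset.mem_range.mpr hn) hq
  · have hz : jHat c X ^ (n + 1) = 0 := by
      rw [jHat, ← polarize_revProd, polarize_of_lt X (by omega)]
    rw [hz, smul_zero, genFun]
    refine Finset.sum_eq_zero fun q hq => ?_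
    rw [Finset.mem_range] at hq
    rw [polarize_congr X fun y => show atiyahVec c n q y = 0 from if_neg (by omega),
      polarize_zero_fun, smul_zero]

end GeneratingFunctions

/-! ### Operations with two vector fields replaced by their bracket -/

section InsertedBrackets

open scoped TensorProduct
open PowerSeries (coeff)

variable {L E : Type*} [LieRing L] [Ring E] [Algebra ℝ E] {m : ℕ} (X : Fin m → L)
variable {d : E} {c : L →+ E} {s : E} {p : ℕ → E} {ν : ℕ} (h : IsCartanSystem d c s p)

lemma coeff_der (q : ℕ) (F : PowerSeries ℝ) : coeff q (der F) =
    ((q : ℝ) + 1) * coeff (q + 1) F := by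
  rw [der, PowerSeries.coeff_derivative, mul_comm]

/-- A contraction with a nested bracket of three vector fields has zero polarization by the Jacobi
identity. -/
lemma polarize_bracketWordWith (q : ℕ) :
    polarize X (q + 2) (fun y => bracketWordWith c s ⁅y 0, y 1⁆ (Fin.tail (Fin.tail y)) * s) =
      0 := by
  rw [polarize_mul_const X
    (fun y : Fin (q + 2) → L => bracketWordWith c s ⁅y 0, y 1⁆ (Fin.tail (Fin.tail y)))]
  rcases q with _ | q
  · have : polarize X 2 (fun y : Fin 2 → L => bracketWordWith c s ⁅y 0, y 1⁆
      (Fin.tail (Fin.tail y))) = 0 := polarize_zero_fun X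
    rw [this, zero_mul]
  · have := polarize_mul X (revProd (q := q) c)
      (fun y : Fin 3 → L => bracketTerm c s ⁅y 0, y 1⁆ (y 2))
    rw [polarize_bracketTerm_lie, mul_zero, ← polarize_cast X (show q + 3 = 3 + q by omega)] at this
    have e : polarize X (q + 3) (fun y : Fin (q + 3) → L => bracketWordWith c s ⁅y 0, y 1⁆
        (Fin.tail (Fin.tail y))) = 0 := by
      rw [this]
      refine polarize_congr X fun y => ?_
      change revProd c (Fin.tail (Fin.tail (Fin.tail y))) * bracketTerm c s ⁅y 0, y 1⁆ (y 2) = _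
      congr 2
      funext i
      change y _ = y _
      congr 1
      ext
      simp
    rw [e, zero_mul]

include h

/-- The formulas for inserting a vector field are summed over the three kinds of words. Nested
brackets vanish by the Jacobi identity, and products of two bracket terms by `K² = 0`. -/
lemma IsCartanSystem.polarize_courantWord_cons (q : ℕ) :
    polarize X (q + 2) (fun y => altSum (courantWord d c s p ν)
      (Fin.cons (α := fun _ => L) ⁅y 0, y 1⁆ (Fin.tail (Fin.tail y))) * s) =
    (q ! : ℝ) • (((q : ℝ) + 1) • (jHat c X ^ q * (comm₂ (jHat c X) (dHat d m) *
        (dHat d m * pHat p m ν))) -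
      jHat c X ^ q * (2 * (comm₁ (jHat c X) (dHat d m) * comm₁ (jHat c X) (dHat d m))) +
      (q : ℝ) • (polarize X q (lieWord d c) * comm₂ (jHat c X) (dHat d m))) := by
  have e : ∀ Z (Y : Fin q → L),
      altSum (courantWord d c s p ν) (Fin.cons (α := fun _ => L) Z Y) * s =
      altSum (fun y => ((q : ℝ) + 1) • (revProd c y * (-(c Z * s * (d * p ν)))) -
        (revProd c y * (lieTerm d c Z * s) + (q : ℝ) • (lieWord d c y * (c Z * s)) +
          (q : ℝ) • (bracketWordWith c s Z y * s)) -
        ((2 : ℝ) • (bracketWordWith c s Z y * s) +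
          ((q : ℝ) - 1) • (bracketWord c s y * (c Z * s)))) Y := by
    intro Z Y
    have e1 : altSum (courantWord d c s p ν) (Fin.cons (α := fun _ => L) Z Y) =
        altSum (fun y => revProd c y * (d * p ν)) (Fin.cons (α := fun _ => L) Z Y) +
        (-1 : ℝ) • altSum (lieWord d c) (Fin.cons (α := fun _ => L) Z Y) +
        (-1 : ℝ) • altSum (bracketWord c s) (Fin.cons (α := fun _ => L) Z Y) := by
      rw [← altSum_smul, ← altSum_smul, ← altSum_add, ← altSum_add]
      refine altSum_congr (fun y => ?_) _
      rw [courantWord]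
      module
    rw [e1, h.altSum_revProd_cons, h.altSum_lieWord_cons, h.altSum_bracketWord_cons,
      ← altSum_smul, ← altSum_smul, ← altSum_add, ← altSum_add]
    change AddMonoidHom.mulRight s _ = _
    rw [map_altSum]
    refine altSum_congr (fun y => ?_) _
    have e2 : d * p ν * s = -(s * (d * p ν)) := by
      rw [mul_assoc, ← h.s_mul_p, ← mul_assoc, h.d_mul_s, neg_mul, mul_assoc]
    rw [AddMonoidHom.mulRight_apply]
    simp only [add_mul, smul_mul_assoc, smul_add, mul_assoc, e2]
    simp only [neg_smul, one_smul, smul_smul, mul_neg, smul_neg]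
    module
  simp only [e]
  rw [polarize_altSum_tail X (q := q) (fun a b y =>
    ((q : ℝ) + 1) • (revProd c y * (-(c ⁅a, b⁆ * s * (d * p ν)))) -
      (revProd c y * (lieTerm d c ⁅a, b⁆ * s) + (q : ℝ) • (lieWord d c y * (c ⁅a, b⁆ * s)) +
        (q : ℝ) • (bracketWordWith c s ⁅a, b⁆ y * s)) -
      ((2 : ℝ) • (bracketWordWith c s ⁅a, b⁆ y * s) +
        ((q : ℝ) - 1) • (bracketWord c s y * (c ⁅a, b⁆ * s))))]
  simp only [polarize_sub, polarize_add, polarize_smul]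
  rw [polarize_bracketWordWith,
    polarize_succ_succ X (revProd c) (fun a b => -(c ⁅a, b⁆ * s * (d * p ν))),
    polarize_succ_succ X (revProd c) (fun a b => lieTerm d c ⁅a, b⁆ * s),
    polarize_succ_succ X (lieWord d c) (fun a b => c ⁅a, b⁆ * s),
    polarize_succ_succ X (bracketWord c s) (fun a b => c ⁅a, b⁆ * s),
    h.polarize_lieTerm_lie, h.polarize_c_lie, polarize_neg,
    polarize_mul_const X (fun y => c ⁅y 0, y 1⁆ * s), h.polarize_c_lie, polarize_revProd]
  have k : polarize X q (bracketWord c s) * comm₂ (jHat c X) (dHat d m) = 0 := by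
    match q with
    | 0 => rw [show polarize X 0 (bracketWord c s) = 0 from polarize_zero_fun X, zero_mul]
    | 1 => rw [show polarize X 1 (bracketWord c s) = 0 from polarize_zero_fun X, zero_mul]
    | q + 2 =>
      rw [h.polarize_bracketWord, neg_mul, mul_assoc, (h.isGradedGaugePair X).comm₂_mul_comm₂]
      simp
  have dp : (d * p ν) ⊗ₜ[ℝ] (1 : Grassmann m) = dHat d m * pHat p m ν := by
    rw [dHat, pHat, Algebra.TensorProduct.tmul_mul_tmul, one_mul]
  rw [mul_neg (polarize X q (bracketWord c s)), k, dp]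
  simp only [smul_zero, add_zero, neg_zero, sub_zero, neg_mul, neg_neg, mul_neg, smul_neg]
  congr 1
  change _ • (jHat c X ^ q * _) - (jHat c X ^ q * _ + _) = _
  abel

/-- These are the curvature terms of the truncated connection. The numbers of positions for the
inserted vector field act on the coefficients as differentiation, which produces `G'` and `F'`. -/
lemma IsCartanSystem.insertedFun_courantOp :
    insertedFun X (m + 3) (fun q y => courantOp d c s p ν q y * s) =
      nilEval (jHat c X) (m + 1) bernG * (comm₁ (jHat c X) (dHat d m) *
        comm₁ (jHat c X) (dHat d m)) +
      (1 / 2 : ℝ) • (nilEval (jHat c X) (m + 1) (der bernG) *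
        (comm₂ (jHat c X) (dHat d m) * comm₁ (jHat c X) (dHat d m))) -
      (1 / 2 : ℝ) • (nilEval (jHat c X) (m + 1) (der bernF) *
        (comm₂ (jHat c X) (dHat d m) * (dHat d m * pHat p m ν))) := by
  have LK := (h.isGradedGaugePair X).comm₁_mul_comm₂
  have t : ∀ q, (1 / 2 * (q ! : ℝ)⁻¹) • polarize X (q + 2) (fun y => courantOp d c s p ν (q + 1)
      (Fin.cons (α := fun _ => L) ⁅y 0, y 1⁆ (Fin.tail (Fin.tail y))) * s) =
      coeff q bernG • jHat c X ^ q * (comm₁ (jHat c X) (dHat d m) *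
        comm₁ (jHat c X) (dHat d m)) -
      (1 / 2 : ℝ) • (coeff q (der bernF) • jHat c X ^ q * (comm₂ (jHat c X) (dHat d m) *
        (dHat d m * pHat p m ν))) -
      (1 / 2 : ℝ) • (((q : ℝ) * coeff q bernG) • polarize X q (lieWord d c) *
        comm₂ (jHat c X) (dHat d m)) := by
    intro q
    have e : ∀ y : Fin (q + 2) → L, courantOp d c s p ν (q + 1)
        (Fin.cons (α := fun _ => L) ⁅y 0, y 1⁆ (Fin.tail (Fin.tail y))) * s =
        (-((bernoulli (q + 1) : ℝ) / ((q + 1)! : ℝ))) • (altSum (courantWord d c s p ν)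
          (Fin.cons (α := fun _ => L) ⁅y 0, y 1⁆ (Fin.tail (Fin.tail y))) * s) := by
      intro y
      rw [courantOp, if_neg (Nat.succ_ne_zero q), zero_sub, neg_mul, smul_mul_assoc, neg_smul]
    rw [polarize_congr X e, polarize_smul, h.polarize_courantWord_cons, coeff_der, coeff_bernG,
      coeff_bernF]
    have hf : (q ! : ℝ) ≠ 0 := by positivity
    rw [smul_smul, smul_smul, show 1 / 2 * (q ! : ℝ)⁻¹ *
      -((bernoulli (q + 1) : ℝ) / ((q + 1)! : ℝ)) * (q ! : ℝ) =
      -(1 / 2) * ((bernoulli (q + 1) : ℝ) / ((q + 1)! : ℝ)) by field_simp]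
    generalize (bernoulli (q + 1) : ℝ) / ((q + 1)! : ℝ) = b
    rw [two_mul, mul_add]
    simp only [smul_mul_assoc]
    module
  rw [insertedFun, Finset.sum_congr rfl fun q _ => t q, Finset.sum_sub_distrib,
    Finset.sum_sub_distrib, ← Finset.sum_mul, ← Finset.smul_sum, ← Finset.smul_sum,
    ← Finset.sum_mul, ← Finset.sum_mul, h.nilEval_jHat X (by omega), h.nilEval_jHat X (by omega),
    Finset.sum_range_succ', ← h.nilEval_jHat X (show m < m + 2 by omega) (der bernG),
    Finset.sum_mul _ _ (comm₂ _ _ * comm₁ _ _)]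
  -- The factor `q + 1` turns the coefficients of `G` into those of `G'`, and the sign comes from `L
  -- K = -K L`.
  have l : (∑ q ∈ Finset.range (m + 2), (((q + 1 : ℕ) : ℝ) * coeff (q + 1) bernG) •
      polarize X (q + 1) (lieWord d c) + (((0 : ℕ) : ℝ) * coeff 0 bernG) •
      polarize X 0 (lieWord d c)) * comm₂ (jHat c X) (dHat d m) =
      -∑ q ∈ Finset.range (m + 2), coeff q (der bernG) • jHat c X ^ q *
        (comm₂ (jHat c X) (dHat d m) * comm₁ (jHat c X) (dHat d m)) := by
    rw [polarize_lieWord_zero, smul_zero, add_zero, Finset.sum_mul, ← Finset.sum_neg_distrib]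
    refine Finset.sum_congr rfl fun q _ => ?_
    rw [polarize_lieWord_succ, smul_mul_assoc, mul_assoc, LK, coeff_der, smul_mul_assoc]
    push_cast
    simp
  rw [l, smul_neg]
  abel

/-- Inserting a bracket into a word of `q + 1` contractions leaves `j^q K`, and comparison of the
factorials gives the coefficient `q + 1` of a derivative. -/
lemma IsCartanSystem.insertedFun_courantVec :
    insertedFun X (m + 3) (fun q y => courantVec c q y * s) =
      -((1 / 2 : ℝ) • (nilEval (jHat c X) (m + 1) (der bernPsi) *
        comm₂ (jHat c X) (dHat d m))) := by
  rw [insertedFun, ← h.nilEval_jHat X (show m < m + 3 by omega), Finset.sum_mul, Finset.smul_sum,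
    ← Finset.sum_neg_distrib]
  refine Finset.sum_congr rfl fun q _ => ?_
  have e : ∀ y : Fin (q + 2) → L, courantVec c (q + 1)
      (Fin.cons (α := fun _ => L) ⁅y 0, y 1⁆ (Fin.tail (Fin.tail y))) * s =
      (((q + 1)! : ℝ) * coeff (q + 1) bernPsi) • (revProd c (Fin.tail (Fin.tail y)) *
        (c ⁅y 0, y 1⁆ * s)) := by
    intro y
    rw [courantVec, revProd_succ, smul_mul_assoc, mul_assoc]
    rfl
  rw [polarize_congr X e, polarize_smul,
    polarize_succ_succ X (revProd c) (fun a b => c ⁅a, b⁆ * s), h.polarize_c_lie,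
    polarize_revProd, coeff_der, smul_smul, mul_neg, smul_neg, smul_mul_assoc, smul_smul,
    Nat.factorial_succ]
  have hf : (q ! : ℝ) ≠ 0 := by positivity
  rw [show 1 / 2 * (q ! : ℝ)⁻¹ * ((((q + 1) * q ! : ℕ) : ℝ) * coeff (q + 1) bernPsi) =
    1 / 2 * (((q : ℝ) + 1) * coeff (q + 1) bernPsi) by push_cast; field_simp]
  rfl

lemma IsCartanSystem.insertedFun_gaugeOp :
    insertedFun X (m + 3) (fun q y => gaugeOp c p q y * s) =
      -((1 / 2 : ℝ) • (pHat p m 0 * (nilEval (jHat c X) (m + 1) (der bernE) *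
        comm₂ (jHat c X) (dHat d m)))) := by
  rw [insertedFun, ← h.nilEval_jHat X (show m < m + 3 by omega), Finset.sum_mul, Finset.mul_sum,
    Finset.smul_sum, ← Finset.sum_neg_distrib]
  refine Finset.sum_congr rfl fun q _ => ?_
  have e : ∀ y : Fin (q + 2) → L, gaugeOp c p (q + 1)
      (Fin.cons (α := fun _ => L) ⁅y 0, y 1⁆ (Fin.tail (Fin.tail y))) * s =
      (((q + 1)! : ℝ) * coeff (q + 1) bernE) • (p 0 * (revProd c (Fin.tail (Fin.tail y)) *
        (c ⁅y 0, y 1⁆ * s))) := by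
    intro y
    rw [gaugeOp, revProd_succ, smul_mul_assoc, mul_assoc, mul_assoc]
    rfl
  rw [polarize_congr X e, polarize_smul, polarize_const_mul,
    polarize_succ_succ X (revProd c) (fun a b => c ⁅a, b⁆ * s), h.polarize_c_lie,
    polarize_revProd, coeff_der, smul_smul, mul_neg, mul_neg, smul_neg, smul_mul_assoc,
    mul_smul_comm, smul_smul, Nat.factorial_succ]
  have hf : (q ! : ℝ) ≠ 0 := by positivity
  rw [show 1 / 2 * (q ! : ℝ)⁻¹ * ((((q + 1) * q ! : ℕ) : ℝ) * coeff (q + 1) bernE) =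
    1 / 2 * (((q : ℝ) + 1) * coeff (q + 1) bernE) by push_cast; field_simp]
  rfl

lemma IsCartanSystem.insertedFun_atiyahOp :
    insertedFun X (m + 3) (fun q y => atiyahOp d c p q y * s) =
      -(comm₁ (jHat c X) (dHat d m) * comm₁ (jHat c X) (dHat d m) * pHat p m 0) := by
  rw [insertedFun, Finset.sum_eq_single 0]
  · have e : ∀ y : Fin 2 → L, atiyahOp d c p 1
        (Fin.cons (α := fun _ => L) ⁅y 0, y 1⁆ (Fin.tail (Fin.tail y))) * s =
        -(lieTerm d c ⁅y 0, y 1⁆ * s * p 0) := by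
      intro y
      rw [atiyahOp, neg_mul, mul_assoc, ← h.s_mul_p, mul_assoc]
      rfl
    rw [polarize_congr X e, polarize_neg,
      polarize_mul_const X (fun y => lieTerm d c ⁅y 0, y 1⁆ * s), h.polarize_lieTerm_lie, two_mul,
      smul_neg, ← smul_mul_assoc, ← two_smul ℝ (_ * _), smul_smul]
    norm_num
    rfl
  · intro q _ hq
    obtain ⟨q, rfl⟩ := Nat.exists_eq_succ_of_ne_zero hq
    have : ∀ y : Fin (q + 1 + 2) → L, atiyahOp d c p (q + 1 + 1)
        (Fin.cons (α := fun _ => L) ⁅y 0, y 1⁆ (Fin.tail (Fin.tail y))) * s = 0 := fun y =>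
      zero_mul _
    rw [polarize_congr X this, polarize_zero_fun, smul_zero]
  · intro hq
    exact absurd (Finset.mem_range.mpr (by omega)) hq

lemma IsCartanSystem.insertedFun_atiyahVec (n : ℕ) :
    insertedFun X (m + 3) (fun q y => atiyahVec c n q y * s) =
      -((1 / 2 : ℝ) • ((n ! : ℝ)⁻¹ • (jHat c X ^ n * comm₂ (jHat c X) (dHat d m)))) := by
  have e : ∀ y : Fin (n + 2) → L, atiyahVec c n (n + 1)
      (Fin.cons (α := fun _ => L) ⁅y 0, y 1⁆ (Fin.tail (Fin.tail y))) * s =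
      revProd c (Fin.tail (Fin.tail y)) * (c ⁅y 0, y 1⁆ * s) := by
    intro y
    rw [atiyahVec, if_pos rfl, revProd_succ, mul_assoc]
    rfl
  have t : polarize X (n + 2) (fun y => atiyahVec c n (n + 1)
      (Fin.cons (α := fun _ => L) ⁅y 0, y 1⁆ (Fin.tail (Fin.tail y))) * s) =
      -(jHat c X ^ n * comm₂ (jHat c X) (dHat d m)) := by
    rw [polarize_congr X e, polarize_succ_succ X (revProd c) (fun a b => c ⁅a, b⁆ * s),
      h.polarize_c_lie, polarize_revProd, mul_neg]
    rfl
  have z : ∀ q, q ≠ n → polarize X (q + 2) (fun y => atiyahVec c n (q + 1)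
      (Fin.cons (α := fun _ => L) ⁅y 0, y 1⁆ (Fin.tail (Fin.tail y))) * s) = 0 := by
    intro q hq
    have : ∀ y : Fin (q + 2) → L, atiyahVec c n (q + 1)
        (Fin.cons (α := fun _ => L) ⁅y 0, y 1⁆ (Fin.tail (Fin.tail y))) * s = 0 := fun y => by
      rw [atiyahVec, if_neg (by omega), zero_mul]
    rw [polarize_congr X this, polarize_zero_fun]
  rw [smul_smul, ← smul_neg, ← t, insertedFun]
  by_cases hn : n < m + 3
  · rw [Finset.sum_eq_single n]
    · intro q _ hq
      rw [z q hq, smul_zero]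
    · intro hq
      exact absurd (Finset.mem_range.mpr hn) hq
  · rw [polarize_of_lt X (show m < n + 2 by omega), smul_zero]
    refine Finset.sum_eq_zero fun q hq => ?_
    rw [Finset.mem_range] at hq
    rw [z q (by omega), smul_zero]

end InsertedBrackets

/-! ### Jacobi identities and morphism equation as operator identities -/

section OperatorIdentities

open scoped TensorProduct
open PowerSeries (coeff)

variable {L E : Type*} [LieRing L] [Ring E] [Algebra ℝ E] {m : ℕ} (X : Fin m → L)
variable {d : E} {c : L →+ E} {s : E} {p : ℕ → E} {ν : ℕ} (h : IsCartanSystem d c s p)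

omit [LieRing L] in
/-- The signed sum of the composites of two families of operations. -/
def composeSum (S T : (q : ℕ) → (Fin q → L) → E) : E :=
  ∑ p : Fin (m + 1), (((p : ℕ)! : ℝ) * ((m - p : ℕ)! : ℝ))⁻¹ •
    altSum (concatMul (show (p : ℕ) + (m - p) = m by omega) (S (m - p)) (T p)) X

/-- The signed sum over the ways to act by a Lie derivative after the operations `S`. -/
def lieSum (d : E) (c : L →+ E) (S : (q : ℕ) → (Fin q → L) → E) : {m : ℕ} → (Fin m → L) → E
  | 0, _ => 0
  | m + 1, X => (m ! : ℝ)⁻¹ •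
      altSum (fun y => lieTerm d c (y (Fin.last m)) * S m (fun i => y i.castSucc)) X

lemma topCoeff_comm₁_mul {M : ℕ} (hM : m < M) (S : (q : ℕ) → (Fin q → L) → E) :
    topCoeff E m (comm₁ (jHat c X) (dHat d m) * genFun X M S) = lieSum d c S X := by
  rw [genFun, comm₁_hat, Finset.mul_sum, map_sum]
  have hne : ∀ q, q + 1 ≠ m → topCoeff E m (polarize X 1 (fun y => lieTerm d c (y 0)) *
      (q ! : ℝ)⁻¹ • polarize X q (S q)) = 0 := by
    intro q hq
    rw [mul_smul_comm, polarize_mul, map_smul, topCoeff_polarize_of_ne X hq, smul_zero]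
  match m, X with
  | 0, X => exact Finset.sum_eq_zero fun q _ => hne q (by omega)
  | m + 1, X =>
    rw [Finset.sum_eq_single m]
    · rw [mul_smul_comm, polarize_mul, map_smul, topCoeff_polarize]
      rfl
    · intro q _ hq
      exact hne q (by omega)
    · intro hq
      exact absurd (Finset.mem_range.mpr (by omega)) hq

include h

/-- The top coefficient of the curvature identity for the truncated connection: composites of two
operations come from its square, inserted brackets from the curvature terms. -/
theorem IsCartanSystem.courantOp_jacobi {r : ℕ} (hr : r ≤ ν) :
    (composeSum X (courantOp d c s p ν) (courantOp d c s p ν) +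
      insertedSum (fun q y => courantOp d c s p ν q y * s) X) * p r = 0 := by
  have e := (h.isGradedGaugePair X).truncConn_sq hr
  rw [← h.genFun_courantOp, add_assoc, add_sub_assoc, ← h.insertedFun_courantOp] at e
  have e' := congrArg (topCoeff E m) e
  rwa [pHat, topCoeff_mul_right, map_add, topCoeff_genFun_mul X (by omega),
    topCoeff_insertedFun X (by omega), map_zero] at e'

/-- All that remains begins by applying `d`, so it vanishes on closed forms of degree `ν + 2`; this
is where closedness of the twisting form enters. -/
theorem IsCartanSystem.courantVec_jacobi :
    ∃ a : E, (composeSum X (courantOp d c s p ν) (courantVec c) -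
      insertedSum (fun q y => courantVec c q y * s) X) * p (ν + 2) = a * (d * p (ν + 2)) := by
  have e := (h.isGradedGaugePair X).truncConn_mul_psi ν
  rw [← h.genFun_courantOp, ← h.genFun_courantVec, ← sub_neg_eq_add, ← h.insertedFun_courantVec]
    at e
  have e' := congrArg (topCoeff E m) e
  rw [pHat, topCoeff_mul_right, map_sub, topCoeff_genFun_mul X (by omega),
    topCoeff_insertedFun X (by omega), dHat, Algebra.TensorProduct.tmul_mul_tmul, one_mul,
    topCoeff_mul_right] at e'
  exact ⟨_, e'⟩

theorem IsCartanSystem.gaugeOp_courantOp :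
    composeSum X (gaugeOp c p) (courantOp d c s p ν) +
      insertedSum (fun q y => gaugeOp c p q y * s) X = -lieSum d c (gaugeOp c p) X := by
  have e := (h.isGradedGaugePair X).bernE_mul_truncConn ν
  rw [mul_add, mul_sub, ← mul_assoc, ← h.genFun_courantOp, ← h.genFun_gaugeOp, ← mul_assoc,
    (h.isGradedGaugePair X).p_mul_comm₁, mul_assoc, ← h.genFun_gaugeOp, mul_smul_comm,
    sub_eq_add_neg, ← h.insertedFun_gaugeOp] at e
  have e' := congrArg (topCoeff E m) e
  rw [map_add, map_add, topCoeff_genFun_mul X (by omega), topCoeff_insertedFun X (by omega),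
    topCoeff_comm₁_mul X (by omega), map_zero] at e'
  exact eq_neg_of_add_eq_zero_left e'

omit [Algebra ℝ E] in
lemma IsCartanSystem.revProd_comp_perm {q : ℕ} (y : Fin q → L) (σ : Equiv.Perm (Fin q)) :
    revProd c (y ∘ σ) = Equiv.Perm.sign σ • revProd c y := by
  induction q with
  | zero => simp [revProd, Subsingleton.elim σ 1]
  | succ q ih =>
    obtain ⟨⟨j, τ⟩, rfl⟩ := (insertPerm_bijective q).2 σ
    have hs : Equiv.Perm.sign (insertPerm j τ) = (-1) ^ (j : ℕ) * Equiv.Perm.sign τ := by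
      rw [← koszulSign_odd (d := fun _ => -1) (fun _ => rfl),
        koszulSign_insertPerm (fun _ => rfl)]
      simp
    dsimp only
    rw [comp_insertPerm, h.revProd_insertNth, ih, hs, revProd_succ, smul_mul_assoc, smul_smul]

/-- From `E Ψ = e^t - 1 - t`: the coefficient `1 / m!` cancels against the `m!` equal terms of the
signed sum, and the terms of order zero and one are absent. -/
theorem IsCartanSystem.gaugeOp_courantVec :
    composeSum X (gaugeOp c p) (courantVec c) = if 2 ≤ m then p 0 * revProd c X else 0 := by
  rw [composeSum, ← topCoeff_genFun_mul X (show m < m + 3 by omega), h.genFun_courantVec,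
    h.genFun_gaugeOp, mul_assoc, ← nilEval_mul (h.isGradedGaugePair X).nilpotent,
    bernE_mul_bernPsi, pHat, topCoeff_mul_left, ← h.nilEval_jHat X (show m < m + 1 by omega),
    map_sum]
  have hz : ∀ q, q ≠ m → topCoeff E m (jHat c X ^ q) = 0 := by
    intro q hq
    rw [jHat, ← polarize_revProd, topCoeff_polarize_of_ne X hq]
  have ht : topCoeff E m (jHat c X ^ m) = (m ! : ℝ) • revProd c X := by
    rw [jHat, ← polarize_revProd, topCoeff_polarize,
      altSum_of_alternating fun y σ => h.revProd_comp_perm y σ]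
  rw [Finset.sum_eq_single m]
  · rw [map_smul, ht, smul_smul]
    have hf : (m ! : ℝ) ≠ 0 := by positivity
    match m with
    | 0 => simp
    | 1 => simp [PowerSeries.coeff_one, PowerSeries.coeff_exp]
    | m + 2 =>
      rw [if_pos (by omega), map_sub, map_sub, PowerSeries.coeff_exp, PowerSeries.coeff_one,
        PowerSeries.coeff_X, if_neg (by omega), if_neg (by omega), sub_zero, sub_zero]
      simp [hf]
  · intro q _ hq
    rw [map_smul, hz q hq, smul_zero]
  · intro hm
    exact absurd (Finset.mem_range.mpr (by omega)) hm

/-- Both summands are `± L² p_0`; the identity says that the Lie derivative is a representation. -/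
theorem IsCartanSystem.atiyahOp_jacobi :
    composeSum X (atiyahOp d c p) (atiyahOp d c p) +
      insertedSum (fun q y => atiyahOp d c p q y * s) X = 0 := by
  have g := h.isGradedGaugePair X
  rw [composeSum, ← topCoeff_genFun_mul X (show m < m + 3 by omega),
    ← topCoeff_insertedFun X (show m < m + 3 by omega), genFun_atiyahOp, h.insertedFun_atiyahOp,
    ← map_add, neg_mul_neg, mul_assoc, ← mul_assoc (pHat p m 0), g.p_mul_comm₁, mul_assoc,
    g.p_mul_p, if_pos rfl, mul_assoc, add_neg_cancel, map_zero]

theorem IsCartanSystem.atiyahVec_jacobi (n : ℕ) :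
    ∃ a : E, (composeSum X (atiyahOp d c p) (atiyahVec c n) -
      insertedSum (fun q y => atiyahVec c n q y * s) X) * p (n + 1) = a * (d * p (n + 1)) := by
  have g := h.isGradedGaugePair X
  rw [composeSum, ← topCoeff_genFun_mul X (show m < m + 3 by omega),
    ← topCoeff_insertedFun X (show m < m + 3 by omega), genFun_atiyahOp, h.insertedFun_atiyahVec,
    genFun_atiyahVec, ← map_sub, ← topCoeff_mul_right]
  have e1 : (jHat c X ^ n * comm₂ (jHat c X) (dHat d m)) * pHat p m (n + 1) =
      pHat p m 0 * (jHat c X ^ n * comm₂ (jHat c X) (dHat d m)) := by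
    rw [mul_assoc, ← g.p_mul_comm₂, ← mul_assoc, ← mul_assoc, g.p_mul_pow, zero_add]
  have e2 := g.neg_comm₁_mul_pow n
  -- The factor that the Bianchi identity leaves in front of `d`: the polarization of `n + 2`
  -- contractions, divided by `(n + 2)!`.
  refine ⟨topCoeff E m (pHat p m 0 * (((n + 2)! : ℕ) : ℝ)⁻¹ • jHat c X ^ (n + 2)), ?_⟩
  rw [← topCoeff_mul_right]
  congr 1
  change _ * pHat p m (n + 1) = _ * ((d * p (n + 1)) ⊗ₜ[ℝ] (1 : Grassmann m))
  have dp : (d * p (n + 1)) ⊗ₜ[ℝ] (1 : Grassmann m) = dHat d m * pHat p m (n + 1) := by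
    rw [dHat, pHat, Algebra.TensorProduct.tmul_mul_tmul, one_mul]
  have pp : pHat p m (n + 1) * pHat p m (n + 1) = pHat p m (n + 1) := by
    rw [g.p_mul_p, if_pos rfl]
  have lp := g.p_mul_comm₁ 0
  rw [dp, mul_assoc (pHat p m 0), smul_mul_assoc, ← mul_assoc (_ ^ _) (dHat d m),
    ← smul_mul_assoc _ (_ * _) (pHat p m (n + 1)), ← mul_assoc (pHat p m 0), ← e2]
  generalize pHat p m 0 = P at *
  generalize pHat p m (n + 1) = Q at *
  generalize comm₁ (jHat c X) (dHat d m) = l at *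
  generalize jHat c X ^ n * comm₂ (jHat c X) (dHat d m) = k at *
  generalize jHat c X ^ (n + 1) = J at *
  have e3 : P * k * Q = k * Q := by rw [← e1, mul_assoc, pp]
  have e4 : P * (l * J) = l * P * J := by rw [← mul_assoc, lp]
  simp only [sub_neg_eq_add, add_mul, mul_add, mul_neg, neg_mul, mul_smul_comm, smul_mul_assoc,
    e3, e4, smul_neg]

end OperatorIdentities

/-! ### Tuples with an inserted entry -/

section FinTuples

lemma insertNth_of_lt {m : ℕ} {V : Type*} (j : Fin (m + 1)) (b : V) (Y : Fin m → V)
    {i : Fin (m + 1)} (h : (i : ℕ) < j) :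
    j.insertNth (α := fun _ => V) b Y i = Y ⟨i, by omega⟩ := by
  have : i = j.succAbove ⟨i, by omega⟩ := by
    rw [Fin.succAbove_of_castSucc_lt _ _ (by rwa [Fin.lt_def])]
    rfl
  conv_lhs => rw [this]
  rw [Fin.insertNth_apply_succAbove]

lemma insertNth_of_gt {m : ℕ} {V : Type*} (j : Fin (m + 1)) (b : V) (Y : Fin m → V)
    {i : Fin (m + 1)} (h : (j : ℕ) < i) :
    j.insertNth (α := fun _ => V) b Y i = Y ⟨i - 1, by omega⟩ := by
  have : i = j.succAbove ⟨i - 1, by omega⟩ := by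
    rw [Fin.succAbove_of_le_castSucc _ _ (by rw [Fin.le_def]; simp; omega)]
    ext
    simp
    omega
  conv_lhs => rw [this]
  rw [Fin.insertNth_apply_succAbove]

lemma insertNth_of_eq {m : ℕ} {V : Type*} (j : Fin (m + 1)) (b : V) (Y : Fin m → V)
    {i : Fin (m + 1)} (h : (i : ℕ) = j) :
    j.insertNth (α := fun _ => V) b Y i = b := by
  rw [Fin.ext h, Fin.insertNth_apply_same]

/-- Restriction of a tuple with an inserted element to an interval that contains the element. -/
lemma insertNth_restrict {m r a : ℕ} {V : Type*} (j : Fin (m + 1)) (b : V) (Y : Fin m → V)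
    (i : Fin (r + 1)) (hj : a + (i : ℕ) = j) (hr : a + r ≤ m) (l : Fin (r + 1)) :
    j.insertNth (α := fun _ => V) b Y ⟨a + l, by omega⟩ =
      i.insertNth (α := fun _ => V) b (fun t : Fin r => Y ⟨a + t, by omega⟩) l := by
  rcases lt_trichotomy (l : ℕ) i with h | h | h
  · rw [insertNth_of_lt _ _ _ (by simp; omega), insertNth_of_lt _ _ _ h]
  · rw [insertNth_of_eq _ _ _ (by simp; omega), insertNth_of_eq _ _ _ h]
  · rw [insertNth_of_gt _ _ _ (by simp; omega), insertNth_of_gt _ _ _ h]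
    congr 1
    ext
    simp
    omega

end FinTuples

/-! ### Insertion of a bracket as a graded symmetric multilinear map -/

section Insertion

variable {V T : Type*} [AddCommGroup V] [Module ℝ V] [AddCommGroup T] [Module ℝ T]

/-- The operation `f` with the first argument given by a bracket. -/
def insertTerm (S : LInftyData V) (f : (k : ℕ) → MultilinearMap ℝ (fun _ : Fin k => V) T)
    {p q k : ℕ} (h : p + 1 + q = k) (y : Fin k → V) : T :=
  f (q + 1) (Fin.cons (S.bracket (p + 1) fun i => y ⟨i, by omega⟩)
    (fun j : Fin q => y ⟨p + 1 + j, by omega⟩))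

lemma insertBracket_eq_sum (S : LInftyData V)
    (f : (k : ℕ) → MultilinearMap ℝ (fun _ : Fin k => V) T) (k : ℕ) (d : Fin k → ℤ)
    (x : Fin k → V) : insertBracket S f k d x =
      ∑ p : Fin k, ((((p : ℕ) + 1)! : ℝ) * ((k - 1 - p : ℕ)! : ℝ))⁻¹ •
        koszulSum d (insertTerm S f (show (p : ℕ) + 1 + (k - 1 - p) = k by omega)) x := rfl

/-- `insertTerm` as a multilinear map. -/
def insertTermMap (S : LInftyData V) (f : (k : ℕ) → MultilinearMap ℝ (fun _ : Fin k => V) T)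
    {p q k : ℕ} (h : p + 1 + q = k) : MultilinearMap ℝ (fun _ : Fin k => V) T :=
  (((f (q + 1)).curryLeft.compMultilinearMap (S.bracket (p + 1))).uncurrySum
    (N := fun _ : Fin (p + 1) ⊕ Fin q => V)).domDomCongr (finSumFinEquiv.trans (finCongr h))

/-- A Koszul sum as a multilinear map. -/
def koszulMap {k : ℕ} (d : Fin k → ℤ) (F : MultilinearMap ℝ (fun _ : Fin k => V) T) :
    MultilinearMap ℝ (fun _ : Fin k => V) T :=
  ∑ σ : Equiv.Perm (Fin k), koszulSign d σ • F.domDomCongr σ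

lemma koszulMap_apply {k : ℕ} (d : Fin k → ℤ) (F : MultilinearMap ℝ (fun _ : Fin k => V) T)
    (x : Fin k → V) : koszulMap d F x = koszulSum d F x := by
  simp [koszulMap, koszulSum]
  rfl

/-- `insertBracket` as a multilinear map. -/
def insertBracketMap (S : LInftyData V) (f : (k : ℕ) → MultilinearMap ℝ (fun _ : Fin k => V) T)
    (k : ℕ) (d : Fin k → ℤ) : MultilinearMap ℝ (fun _ : Fin k => V) T :=
  ∑ p : Fin k, ((((p : ℕ) + 1)! : ℝ) * ((k - 1 - p : ℕ)! : ℝ))⁻¹ •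
    koszulMap d (insertTermMap S f (show (p : ℕ) + 1 + (k - 1 - p) = k by omega))

lemma insertBracketMap_apply (S : LInftyData V)
    (f : (k : ℕ) → MultilinearMap ℝ (fun _ : Fin k => V) T) (k : ℕ) (d : Fin k → ℤ)
    (x : Fin k → V) : insertBracketMap S f k d x = insertBracket S f k d x := by
  simp only [insertBracketMap, sum_apply, smul_apply,
    koszulMap_apply]
  rfl

lemma insertBracketMap_comp_perm (S : LInftyData V)
    (f : (k : ℕ) → MultilinearMap ℝ (fun _ : Fin k => V) T) (k : ℕ) (d : Fin k → ℤ)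
    (x : Fin k → V) (ρ : Equiv.Perm (Fin k)) : insertBracketMap S f k d x =
      koszulSign d ρ • insertBracketMap S f k (d ∘ ρ) (x ∘ ρ) := by
  simp only [insertBracketMap, sum_apply, smul_apply,
    koszulMap_apply, Finset.smul_sum]
  refine Finset.sum_congr rfl fun p _ => ?_
  rw [koszulSum_comp d _ x ρ, smul_comm]

end Insertion

/-! ### Reduction to at most one argument that is not a vector field -/

section ExtensionGrading

variable {A : Type*} [CommRing A] [Algebra ℝ A] {M T : Type*} [AddCommGroup M] [Module ℝ M]
  [AddCommGroup T] [Module ℝ T]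

/-- A grading of the sum of the vector fields, in degree `-1`, and a space `M`, which maps to a
space with parity operator `s`. -/
structure IsExtensionGrading (gr : ℤ → Submodule ℝ (VField A × M)) (e : M →ₗ[ℝ] T)
    (s : Module.End ℝ T) : Prop where
  injective : Function.Injective e
  vec_mem : ∀ X : VField A, (X, (0 : M)) ∈ gr (-1)
  fst_mem : ∀ i, ∀ x ∈ gr i, (x.1, (0 : M)) ∈ gr i
  snd_mem : ∀ i, ∀ x ∈ gr i, ((0 : VField A), x.2) ∈ gr i
  fst_eq_zero : ∀ i, i ≠ -1 → ∀ x ∈ gr i, x.1 = 0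
  parity : ∀ i, ∀ x ∈ gr i, s (e x.2) = i.negOnePow • e x.2

variable (M) in
/-- The embedding of vector fields. -/
def vec {k : ℕ} (X : Fin k → VField A) : Fin k → VField A × M := fun i => (X i, 0)

/-- Homogeneous graded symmetric expressions that vanish if there are at least two arguments in
`M` vanish if they vanish on vector fields and on one element of `M` and vector fields. -/
lemma eq_zero_of_pure {gr : ℤ → Submodule ℝ (VField A × M)} {e : M →ₗ[ℝ] T}
    {s : Module.End ℝ T} (hgr : IsExtensionGrading gr e s) {Z : Type*} [AddCommGroup Z]
    [Module ℝ Z] {k : ℕ} (F : (Fin k → ℤ) → MultilinearMap ℝ (fun _ : Fin k => VField A × M) Z)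
    (hF : ∀ d x (ρ : Equiv.Perm (Fin k)), F d x = koszulSign d ρ • F (d ∘ ρ) (x ∘ ρ))
    (two : ∀ d x, (∀ i, x i ∈ gr (d i)) → ∀ i j, i ≠ j → (x i).1 = 0 → (x j).1 = 0 → F d x = 0)
    (hvec : ∀ d, (∀ i, d i = -1) → ∀ X, F d (vec M X) = 0)
    (hform : ∀ m (h : m + 1 = k) (i₀ : ℤ) (β : M) (X : Fin m → VField A), (0, β) ∈ gr i₀ →
      F (Fin.cons i₀ (fun _ => -1) ∘ Fin.cast h.symm)
        ((Fin.cons (0, β) (vec M X) : Fin (m + 1) → VField A × M) ∘ Fin.cast h.symm) = 0)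
    (d : Fin k → ℤ) (x : Fin k → VField A × M) (hx : ∀ i, x i ∈ gr (d i)) : F d x = 0 := by
  -- The multilinear expansion has one term for each set `t` of slots in which the vector component
  -- is kept.
  have hsplit : x = (fun i => ((x i).1, (0 : M))) + fun i => ((0 : VField A), (x i).2) := by
    funext i
    simp
  rw [hsplit, MultilinearMap.map_add_univ]
  refine Finset.sum_eq_zero fun t _ => ?_
  set y : Fin k → VField A × M := t.piecewise (fun i => ((x i).1, (0 : M)))
    (fun i => ((0 : VField A), (x i).2)) with hy
  have y1 : ∀ i ∈ t, y i = ((x i).1, (0 : M)) := fun i hi => Finset.piecewise_eq_of_mem _ _ _ hi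
  have y2 : ∀ i ∉ t, y i = ((0 : VField A), (x i).2) := fun i hi =>
    Finset.piecewise_eq_of_notMem _ _ _ hi
  have ymem : ∀ i, y i ∈ gr (d i) := fun i => by
    by_cases hi : i ∈ t
    · rw [y1 i hi]; exact hgr.fst_mem _ _ (hx i)
    · rw [y2 i hi]; exact hgr.snd_mem _ _ (hx i)
  -- A homogeneous vector field of degree other than `-1` is zero, so such terms drop out.
  by_cases hd : ∃ i ∈ t, d i ≠ -1
  · obtain ⟨i, hi, hdi⟩ := hd
    refine (F d).map_coord_zero i ?_
    rw [y1 i hi, hgr.fst_eq_zero _ hdi _ (hx i)]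
    rfl
  push Not at hd
  by_cases ht : ∃ i, i ∉ t
  · obtain ⟨i, hi⟩ := ht
    by_cases hu : ∃ j, j ∉ t ∧ i ≠ j
    · obtain ⟨j, hj, hij⟩ := hu
      exact two d y ymem i j hij (by rw [y2 i hi]) (by rw [y2 j hj])
    · push Not at hu
      have hmem : ∀ j, j ≠ i → j ∈ t := fun j hj => by
        by_contra hjt
        exact hj (hu j hjt).symm
      obtain ⟨m, rfl⟩ : ∃ m, k = m + 1 := ⟨k - 1, by have := i.isLt; omega⟩
      -- The only slot outside `t` is moved to the front, at the cost of a Koszul sign.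
      rw [hF d y i.cycleRange.symm]
      have e1 : d ∘ i.cycleRange.symm = Fin.cons (d i) (fun _ => -1) := by
        funext j
        induction j using Fin.cases with
        | zero => simp
        | succ j => simpa using hd _ (hmem _ (Fin.succAbove_ne i j))
      have e2 : y ∘ i.cycleRange.symm =
          Fin.cons (0, (x i).2) (vec M fun j => (x (i.succAbove j)).1) := by
        funext j
        induction j using Fin.cases with
        | zero => simp [y2 i hi]
        | succ j => simpa [vec] using y1 _ (hmem _ (Fin.succAbove_ne i j))
      rw [e1, e2]
      have := hform m rfl (d i) (x i).2 (fun j => (x (i.succAbove j)).1)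
        (hgr.snd_mem _ _ (hx i))
      rw [show Fin.cast (rfl : m + 1 = m + 1) = id from rfl, Function.comp_id,
        Function.comp_id] at this
      rw [this, smul_zero]
  · push Not at ht
    have e : y = vec M fun i => (x i).1 := funext fun i => y1 i (ht i)
    rw [e]
    exact hvec d (fun i => hd i (ht i)) _

end ExtensionGrading

/-! ### Extensions of the Lie algebra of vector fields described by operators -/

section Operators

variable {A : Type*} [CommRing A] [Algebra ℝ A] {M T : Type*} [AddCommGroup M] [Module ℝ M]
  [AddCommGroup T] [Module ℝ T]

/-- The graded symmetric operations `f` are given on vector fields by the operators `N`, applied to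
the element `H`, and on one element of `M` and vector fields by the operators `W`. They vanish on
more than one element of `M`. -/
structure IsGivenBy (gr : ℤ → Submodule ℝ (VField A × M)) (e : M →ₗ[ℝ] T)
    (f : (k : ℕ) → MultilinearMap ℝ (fun _ : Fin k => VField A × M) T)
    (N W : (q : ℕ) → (Fin q → VField A) → Module.End ℝ T) (H : T) : Prop where
  symm : ∀ k, 1 ≤ k → ∀ (d : Fin k → ℤ) (x : Fin k → VField A × M), (∀ i, x i ∈ gr (d i)) →
    ∀ σ : Equiv.Perm (Fin k), f k x = koszulSign d σ • f k (x ∘ σ)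
  map_vec : ∀ k, 1 ≤ k → ∀ X, f k (vec M X) = N k X H
  map_form : ∀ q i β X, (0, β) ∈ gr i → f (q + 1) (Fin.cons (0, β) (vec M X)) = W q X (e β)
  eq_zero : ∀ k x i j, i ≠ j → (x i).1 = 0 → (x j).1 = 0 → f k x = 0

/-- The operations of `S` extend the bracket of vector fields and are given by operators. -/
structure IsExtension (S : LInftyData (VField A × M)) (e : M →ₗ[ℝ] T) (s : Module.End ℝ T)
    (N W : (q : ℕ) → (Fin q → VField A) → Module.End ℝ T) (H : T) : Prop where
  grading : IsExtensionGrading S.gr e s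
  graded : IsGradedSymmetric S.gr S.gr 1 S.bracket
  fst_bracket : ∀ k, 1 ≤ k → ∀ x, (S.bracket k x).1 = (tangentLie A).bracket k fun i => (x i).1
  givenBy : IsGivenBy S.gr e
    (fun k => (e ∘ₗ LinearMap.snd ℝ (VField A) M).compMultilinearMap (S.bracket k)) N W H

lemma tangentLie_bracket_two (x : Fin 2 → VField A) : (tangentLie A).bracket 2 x = ⁅x 0, x 1⁆ :=
  rfl

lemma tangentLie_bracket_of_ne {k : ℕ} (hk : k ≠ 2) (x : Fin k → VField A) :
    (tangentLie A).bracket k x = 0 := by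
  match k, hk with
  | 0, _ => rfl
  | 1, _ => rfl
  | k + 3, _ => rfl

variable {S : LInftyData (VField A × M)} {e : M →ₗ[ℝ] T} {s : Module.End ℝ T}
  {N W : (q : ℕ) → (Fin q → VField A) → Module.End ℝ T} {H : T}
  {f : (k : ℕ) → MultilinearMap ℝ (fun _ : Fin k => VField A × M) T}
  {N' W' : (q : ℕ) → (Fin q → VField A) → Module.End ℝ T}

/-- A graded symmetric operation with the element of `M` in another position. -/
lemma IsGivenBy.map_insertNth (hgr : IsExtensionGrading S.gr e s)
    (hf : IsGivenBy S.gr e f N' W' H) {q : ℕ} (j : Fin (q + 1)) {i : ℤ} {β : M}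
    (hβ : (0, β) ∈ S.gr i) (X : Fin q → VField A) :
    f (q + 1) (j.insertNth (α := fun _ => VField A × M) (0, β) (vec M X)) =
      i.negOnePow ^ (j : ℕ) • W' q X (e β) := by
  have h := hf.symm (q + 1) (by omega) (Fin.cons i (fun _ => -1))
    (Fin.cons (0, β) (vec M X)) (fun l => by
      induction l using Fin.cases with
      | zero => simpa using hβ
      | succ l => simpa [vec] using hgr.vec_mem (X l)) (insertPerm j 1)
  rw [koszulSign_insertPerm (fun _ => rfl), comp_insertPerm, hf.map_form q i β X hβ] at h
  simp only [Fin.cons_zero, Fin.tail_cons, map_one, mul_one, Equiv.Perm.coe_one,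
    Function.comp_id] at h
  rw [h, smul_smul, ← mul_pow]
  simp

lemma map_cons_add (g : (k : ℕ) → MultilinearMap ℝ (fun _ : Fin k => VField A × M) T) (q : ℕ)
    (v : VField A × M) (y : Fin q → VField A × M) :
    g (q + 1) (Fin.cons v y) =
      g (q + 1) (Fin.cons (v.1, 0) y) + g (q + 1) (Fin.cons (0, v.2) y) := by
  rw [← MultilinearMap.cons_add]
  simp

variable (hS : IsExtension S e s N W H) (hf : IsGivenBy S.gr e f N' W' H)

include hS

lemma IsExtension.bracket_mem {k : ℕ} (hk : 1 ≤ k) (d : Fin k → ℤ) (x : Fin k → VField A × M)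
    (hx : ∀ i, x i ∈ S.gr (d i)) : ((0 : VField A), (S.bracket k x).2) ∈ S.gr (∑ i, d i + 1) :=
  hS.grading.snd_mem _ _ (hS.graded.degree k hk d x hx)

lemma IsExtension.fst_bracket_of_eq_zero {k : ℕ} (hk : 1 ≤ k) (x : Fin k → VField A × M)
    {i : Fin k} (hi : (x i).1 = 0) : (S.bracket k x).1 = 0 := by
  rw [hS.fst_bracket k hk]
  exact MultilinearMap.map_coord_zero _ i hi

include hf

/-- The form component of the inner bracket is the form argument of the outer operation. Its vector
component can be nonzero only for the binary bracket, which is the case `p = 1` since the arity is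
`p + 1`. -/
lemma IsExtension.insertTerm_vec {p q k : ℕ} (h : p + 1 + q = k) (Y : Fin k → VField A) :
    insertTerm S f h (vec M Y) = concatMul h (W' q) (N (p + 1)) Y H +
      if hp : p = 1 then N' (q + 1) (Fin.cons (α := fun _ => VField A)
        ⁅Y ⟨0, by omega⟩, Y ⟨1, by omega⟩⁆ fun i => Y ⟨2 + i, by omega⟩) H else 0 := by
  have hN := hS.givenBy.map_vec (p + 1) (by omega) fun i => Y ⟨i, by omega⟩
  have hm := hS.bracket_mem (k := p + 1) (by omega) (fun _ => -1)
    (vec M fun i => Y ⟨i, by omega⟩) (fun i => hS.grading.vec_mem _)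
  have hfst := hS.fst_bracket (p + 1) (by omega) (vec M fun i => Y ⟨i, by omega⟩)
  rw [insertTerm, map_cons_add, add_comm]
  congr 1
  · have := hf.map_form q _ _ (fun i => Y ⟨p + 1 + i, by omega⟩) hm
    refine this.trans ?_
    rw [concatMul, Module.End.mul_apply, ← hN]
    rfl
  · split_ifs with hp
    · subst hp
      have := hf.map_vec (q + 1) (by omega) (Fin.cons (α := fun _ => VField A)
        ⁅Y ⟨0, by omega⟩, Y ⟨1, by omega⟩⁆ fun i => Y ⟨2 + i, by omega⟩)
      rw [← this]
      congr 1
      funext i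
      induction i using Fin.cases with
      | zero => exact Prod.ext hfst rfl
      | succ i => rfl
    · rw [tangentLie_bracket_of_ne (by omega)] at hfst
      refine (f (q + 1)).map_coord_zero 0 ?_
      exact Prod.ext hfst rfl

/-- If the element of `M` lies in the inner bracket, the value of that bracket has no vector
component, and the two operators compose. -/
lemma IsExtension.insertTerm_form_inner {p q m : ℕ} (h : p + q = m) (h' : p + 1 + q = m + 1)
    (Y : Fin m → VField A) {i₀ : ℤ} {β : M} (hβ : (0, β) ∈ S.gr i₀) (j : Fin (m + 1))
    (hj : (j : ℕ) ≤ p) :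
    insertTerm S f h' (j.insertNth (α := fun _ => VField A × M) (0, β) (vec M Y)) =
      i₀.negOnePow ^ (j : ℕ) • concatMul h (W' q) (W p) Y (e β) := by
  have e1 : (fun i : Fin (p + 1) => j.insertNth (α := fun _ => VField A × M) (0, β) (vec M Y)
      ⟨i, by omega⟩) = (⟨j, by omega⟩ : Fin (p + 1)).insertNth (α := fun _ => VField A × M) (0, β)
        (vec M fun i : Fin p => Y ⟨i, by omega⟩) := by
    funext i
    have := insertNth_restrict (r := p) (a := 0) j ((0 : VField A), β) (vec M Y) ⟨j, by omega⟩
      (by simp) (by omega) i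
    simp only [zero_add] at this
    exact this
  have e2 : (fun i : Fin q => j.insertNth (α := fun _ => VField A × M) (0, β) (vec M Y)
      ⟨p + 1 + i, by omega⟩) = vec M fun i : Fin q => Y ⟨p + i, by omega⟩ := by
    funext i
    rw [insertNth_of_gt _ _ _ (by simp; omega)]
    change (Y _, _) = (Y _, _)
    congr 3
    simp
  have hm := hS.bracket_mem (k := p + 1) (by omega)
    (fun i => if (i : ℕ) = j then i₀ else -1)
    ((⟨j, by omega⟩ : Fin (p + 1)).insertNth (α := fun _ => VField A × M) (0, β)
        (vec M fun i : Fin p => Y ⟨i, by omega⟩)) (fun l => by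
      split_ifs with hl
      · rw [insertNth_of_eq _ _ _ hl]; exact hβ
      · rcases Nat.lt_or_gt_of_ne hl with hl | hl
        · rw [insertNth_of_lt _ _ _ hl]; exact hS.grading.vec_mem _
        · rw [insertNth_of_gt _ _ _ hl]; exact hS.grading.vec_mem _)
  have hW := hS.givenBy.map_insertNth hS.grading (⟨j, by omega⟩ : Fin (p + 1)) hβ
    (fun i : Fin p => Y ⟨i, by omega⟩)
  have hfst := hS.fst_bracket_of_eq_zero (k := p + 1) (by omega)
    ((⟨j, by omega⟩ : Fin (p + 1)).insertNth (α := fun _ => VField A × M) (0, β)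
        (vec M fun i : Fin p => Y ⟨i, by omega⟩)) (i := ⟨j, by omega⟩) (by simp)
  rw [insertTerm, e1, e2, map_cons_add]
  rw [(f (q + 1)).map_coord_zero 0 (Prod.ext hfst rfl), zero_add, hf.map_form q _ _ _ hm,
    concatMul, Module.End.mul_apply]
  change W' q _ ((e ∘ₗ LinearMap.snd ℝ (VField A) M).compMultilinearMap (S.bracket (p + 1)) _) = _
  rw [hW]
  simp only [Units.smul_def, map_zsmul]

/-- The inner bracket consists of vector fields and, not being binary, has no vector component, so
the outer operation has two arguments in `M`. -/
lemma IsExtension.insertTerm_form_outer {p q m : ℕ} (h' : p + 1 + q = m + 1) (hp : p ≠ 1)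
    (Y : Fin m → VField A) (β : M) (j : Fin (m + 1)) (hj : p < (j : ℕ)) :
    insertTerm S f h' (j.insertNth (α := fun _ => VField A × M) (0, β) (vec M Y)) = 0 := by
  have hfst := hS.fst_bracket (p + 1) (by omega)
    (fun i => j.insertNth (α := fun _ => VField A × M) (0, β) (vec M Y) ⟨i, by omega⟩)
  rw [tangentLie_bracket_of_ne (by omega)] at hfst
  refine hf.eq_zero (q + 1) _ 0 (Fin.succ ⟨j - (p + 1), by omega⟩) (Fin.succ_ne_zero _).symm hfst ?_
  rw [Fin.cons_succ, insertNth_of_eq _ _ _ (by simp; omega)]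

/-- Only the vector component of the binary bracket survives. Two arguments before the element of
`M` are replaced by one, which shifts its position to `j - 1`. -/
lemma IsExtension.insertTerm_form_outer_two {q : ℕ} (h' : 1 + 1 + (q + 1) = q + 2 + 1)
    (Y : Fin (q + 2) → VField A) {i₀ : ℤ} {β : M} (hβ : (0, β) ∈ S.gr i₀) (j : Fin (q + 3))
    (hj : 1 < (j : ℕ)) :
    insertTerm S f h' (j.insertNth (α := fun _ => VField A × M) (0, β) (vec M Y)) =
      i₀.negOnePow ^ ((j : ℕ) - 1) • W' (q + 1) (Fin.cons (α := fun _ => VField A)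
        ⁅Y 0, Y 1⁆ (Fin.tail (Fin.tail Y))) (e β) := by
  have h0 : j.insertNth (α := fun _ => VField A × M) (0, β) (vec M Y) ⟨0, by omega⟩ = (Y 0, 0) :=
    insertNth_of_lt _ _ _ (by change 0 < (j : ℕ); omega)
  have h1 : j.insertNth (α := fun _ => VField A × M) (0, β) (vec M Y) ⟨1, by omega⟩ = (Y 1, 0) :=
    insertNth_of_lt _ _ _ hj
  have hfst : (S.bracket 2 fun i => j.insertNth (α := fun _ => VField A × M) (0, β) (vec M Y)
      ⟨i, by omega⟩).1 = ⁅Y 0, Y 1⁆ := by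
    rw [hS.fst_bracket 2 (by omega), tangentLie_bracket_two]
    exact congrArg₂ (fun a b : VField A × M => ⁅a.1, b.1⁆) h0 h1
  have hz : (Fin.cons (α := fun _ => VField A × M) (0, (S.bracket 2 fun i : Fin 2 =>
      j.insertNth (α := fun _ => VField A × M) (0, β) (vec M Y) ⟨i, by omega⟩).2)
      fun i : Fin (q + 1) => j.insertNth (α := fun _ => VField A × M) (0, β) (vec M Y)
        ⟨1 + 1 + i, by omega⟩) (Fin.succ ⟨j - 2, by omega⟩) = (0, β) := by
    rw [Fin.cons_succ, insertNth_of_eq _ _ _ (by simp; omega)]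
  rw [insertTerm, map_cons_add, hf.eq_zero (q + 1 + 1) _ 0 (Fin.succ ⟨j - 2, by omega⟩)
    (Fin.succ_ne_zero _).symm rfl (congrArg Prod.fst hz), add_zero]
  have e1 : (Fin.cons (α := fun _ => VField A × M) ((S.bracket 2 fun i : Fin 2 =>
      j.insertNth (α := fun _ => VField A × M) (0, β) (vec M Y) ⟨i, by omega⟩).1, (0 : M))
      fun i : Fin (q + 1) => j.insertNth (α := fun _ => VField A × M) (0, β) (vec M Y)
        ⟨1 + 1 + i, by omega⟩) = (⟨j - 1, by omega⟩ : Fin (q + 2)).insertNth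
        (α := fun _ => VField A × M) (0, β) (vec M (Fin.cons (α := fun _ => VField A)
        ⁅Y 0, Y 1⁆ (Fin.tail (Fin.tail Y)))) := by
    funext l
    induction l using Fin.cases with
    | zero =>
      rw [insertNth_of_lt _ _ _ (by simp; omega), Fin.cons_zero, hfst]
      rfl
    | succ l =>
      rw [Fin.cons_succ]
      rcases lt_trichotomy ((l : ℕ) + 2) j with hl | hl | hl
      · rw [insertNth_of_lt _ _ _ (by simp; omega), insertNth_of_lt _ _ _ (by simp; omega)]
        simp only [vec]
        have : (⟨(l.succ : ℕ), by have := j.isLt; simp; omega⟩ : Fin (q + 1)) =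
          Fin.succ ⟨l, by have := j.isLt; omega⟩ := rfl
        rw [this, Fin.cons_succ]
        change (Y _, _) = (Y _, _)
        congr 3
        simp
        omega
      · rw [insertNth_of_eq _ _ _ (by simp; omega), insertNth_of_eq _ _ _ (by simp; omega)]
      · rw [insertNth_of_gt _ _ _ (by simp; omega), insertNth_of_gt _ _ _ (by simp; omega)]
        simp only [vec]
        have : (⟨(l.succ : ℕ) - 1, by have := l.isLt; simp; omega⟩ : Fin (q + 1)) =
          Fin.succ ⟨l - 1, by have := l.isLt; omega⟩ := by ext; simp; omega
        rw [this, Fin.cons_succ]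
        change (Y _, _) = (Y _, _)
        congr 3
        simp
        omega
  have := hf.map_insertNth hS.grading (⟨j - 1, by omega⟩ : Fin (q + 2)) hβ
    (Fin.cons (α := fun _ => VField A) ⁅Y 0, Y 1⁆ (Fin.tail (Fin.tail Y)))
  rw [← this, ← e1]

end Operators

/-! ### Evaluation of the homotopy Jacobi expressions -/

section Evaluation

variable {A : Type*} [CommRing A] [Algebra ℝ A] {M T : Type*} [AddCommGroup M] [Module ℝ M]
  [AddCommGroup T] [Module ℝ T]
variable {S : LInftyData (VField A × M)} {e : M →ₗ[ℝ] T} {s : Module.End ℝ T}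
  {N W : (q : ℕ) → (Fin q → VField A) → Module.End ℝ T} {H : T}
  {f : (k : ℕ) → MultilinearMap ℝ (fun _ : Fin k => VField A × M) T}
  {N' W' : (q : ℕ) → (Fin q → VField A) → Module.End ℝ T}
variable (hS : IsExtension S e s N W H) (hf : IsGivenBy S.gr e f N' W' H)

lemma altSum_apply {L : Type*} {k : ℕ} (F : (Fin k → L) → Module.End ℝ T) (X : Fin k → L) (t : T) :
    altSum F X t = altSum (fun y => F y t) X := by
  simp [altSum, LinearMap.sum_apply, Units.smul_def]

omit [Module ℝ T] in
lemma sum_ite_le {m : ℕ} (p : Fin (m + 1)) (a b : T) :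
    ∑ j : Fin (m + 1), (if j ≤ p then a else b) =
      ((p : ℕ) + 1) • a + (m - p : ℕ) • b := by
  have h1 : Finset.univ.filter (fun j : Fin (m + 1) => j ≤ p) = Finset.Iic p := by ext; simp
  have h2 : Finset.univ.filter (fun j : Fin (m + 1) => ¬ j ≤ p) = Finset.Ioi p := by ext; simp
  rw [Finset.sum_ite, h1, h2, Finset.sum_const, Finset.sum_const, Fin.card_Iic, Fin.card_Ioi]
  simp

include hS hf

theorem IsExtension.insertBracket_vec (hN : ∀ y, N 0 y = 0) (hH : s H = -H) {k : ℕ} (hk : 1 ≤ k)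
    (d : Fin k → ℤ) (hd : ∀ i, d i = -1) (X : Fin k → VField A) :
    insertBracket S f k d (vec M X) =
      (composeSum X W' N - insertedSum (fun q y => N' q y * s) X) H := by
  obtain ⟨m, rfl⟩ : ∃ m, k = m + 1 := ⟨k - 1, by omega⟩
  rw [insertBracket_eq_sum]
  have e0 : ∀ p : Fin (m + 1), koszulSum d
      (insertTerm S f (show (p : ℕ) + 1 + (m + 1 - 1 - p) = m + 1 by omega)) (vec M X) =
      altSum (concatMul (show (p : ℕ) + 1 + (m + 1 - (p + 1)) = m + 1 by omega)
        (W' (m + 1 - (p + 1))) (N (p + 1))) X H +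
      altSum (fun Y : Fin (m + 1) → VField A => if hp : (p : ℕ) = 1 then
        N' (m + 1 - 1 - p + 1) (Fin.cons (α := fun _ => VField A)
        ⁅Y ⟨0, by omega⟩, Y ⟨1, by omega⟩⁆ fun i => Y ⟨2 + i, by omega⟩) H else 0) X := by
    intro p
    rw [koszulSum_odd hd, altSum_apply, ← altSum_add]
    change altSum (fun Y => insertTerm S f _ (vec M Y)) X = _
    refine altSum_congr (fun Y => ?_) X
    rw [hS.insertTerm_vec hf]
    congr 1
    have : ∀ q q' (hq : q = q') (h : (p : ℕ) + 1 + q = m + 1) (h' : (p : ℕ) + 1 + q' = m + 1),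
        concatMul h (W' q) (N (p + 1)) Y H = concatMul h' (W' q') (N (p + 1)) Y H := by
      rintro q _ rfl h h'
      rfl
    exact this _ _ (by omega) _ _
  rw [Finset.sum_congr rfl fun p _ => congrArg _ (e0 p)]
  simp only [smul_add, Finset.sum_add_distrib]
  rw [LinearMap.sub_apply, sub_eq_add_neg]
  congr 1
  · rw [composeSum, Fin.sum_univ_succ (n := m + 1), LinearMap.add_apply]
    -- `composeSum` includes an operation without arguments as the inner one, which has no
    -- counterpart among the brackets and is zero by `hN`.
    have z : ∀ (a : ℕ) (_ : a = 0) (h : a + (m + 1 - a) = m + 1),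
        altSum (concatMul h (W' (m + 1 - a)) (N a)) X = 0 := by
      rintro _ rfl h
      rw [← altSum_zero X]
      refine altSum_congr (fun y => ?_) X
      rw [concatMul, hN, mul_zero]
    rw [z ((0 : Fin (m + 1 + 1)) : ℕ) rfl, smul_zero, LinearMap.zero_apply, zero_add,
      LinearMap.sum_apply]
    refine Finset.sum_congr rfl fun p _ => ?_
    rw [LinearMap.smul_apply]
    congr 4
    simp
  · rcases m with _ | m
    · rw [Fin.sum_univ_one]
      simp [altSum, insertedSum]
    · rw [Finset.sum_eq_single (1 : Fin (m + 2))]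
      · simp only [Fin.val_one]
        rw [insertedSum, LinearMap.smul_apply, altSum_apply, ← smul_neg]
        -- Since `s H = -H`, the parity operator in `insertedSum` accounts for the minus sign in the
        -- statement.
        have e1 : ∀ Y : Fin (m + 2) → VField A, (N' (m + 1) (Fin.cons (α := fun _ => VField A)
            ⁅Y 0, Y 1⁆ (Fin.tail (Fin.tail Y))) * s) H =
            (-1 : ℝ) • N' (m + 1) (Fin.cons (α := fun _ => VField A)
            ⁅Y 0, Y 1⁆ (Fin.tail (Fin.tail Y))) H := by
          intro Y
          rw [Module.End.mul_apply, hH, map_neg, neg_one_smul]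
        rw [altSum_congr e1, altSum_smul, neg_one_smul, neg_neg]
        congr 1
        · simp [Nat.factorial, mul_comm]
        · refine altSum_congr (fun Y => ?_) X
          have : ∀ q (hq : q = m), N' (q + 1) (Fin.cons (α := fun _ => VField A)
              ⁅Y ⟨0, by omega⟩, Y ⟨1, by omega⟩⁆ fun i : Fin q => Y ⟨2 + i, by omega⟩) H =
              N' (m + 1) (Fin.cons (α := fun _ => VField A)
              ⁅Y 0, Y 1⁆ (Fin.tail (Fin.tail Y))) H := by
            rintro q rfl
            congr 2
            funext i
            induction i using Fin.cases with
            | zero => rfl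
            | succ i =>
              change Y _ = Y _
              congr 1
              ext
              simp
              omega
          exact this _ (by omega)
      · intro p _ hp
        have : (p : ℕ) ≠ 1 := fun h => hp (Fin.ext h)
        simp only [dif_neg this]
        rw [altSum_zero, smul_zero]
      · simp

/-- The sum over permutations is sorted by the position of `β`. The `p + 1` positions in the inner
bracket contribute equally and change `(p + 1)!` to `p!`, the weight of `composeSum`. Positions
outside contribute only for a binary inner bracket and give `insertedSum`. -/
theorem IsExtension.insertBracket_form {m : ℕ} (X : Fin m → VField A) {i₀ : ℤ} {β : M}
    (hβ : (0, β) ∈ S.gr i₀) :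
    insertBracket S f (m + 1) (Fin.cons i₀ fun _ => -1) (Fin.cons (0, β) (vec M X)) =
      (composeSum X W' W + insertedSum (fun q y => W' q y * s) X) (e β) := by
  set ε := i₀.negOnePow with hε
  have εε : ∀ a : ℕ, ε ^ a * ε ^ a = 1 := fun a => by rw [← mul_pow]; simp
  rw [insertBracket_eq_sum]
  have e0 : ∀ p : Fin (m + 1), koszulSum (Fin.cons i₀ fun _ => -1)
      (insertTerm S f (show (p : ℕ) + 1 + (m + 1 - 1 - p) = m + 1 by omega))
      (Fin.cons (0, β) (vec M X)) =
      ((p : ℕ) + 1) • altSum (concatMul (show (p : ℕ) + (m - p) = m by omega)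
        (W' (m - p)) (W p)) X (e β) + ∑ j : Fin (m + 1), if j ≤ p then 0 else
        ε ^ (j : ℕ) • altSum (fun Y => insertTerm S f
          (show (p : ℕ) + 1 + (m + 1 - 1 - p) = m + 1 by omega)
          (j.insertNth (α := fun _ => VField A × M) (0, β) (vec M Y))) X := by
    intro p
    have := sum_ite_le p (altSum (concatMul (show (p : ℕ) + (m - p) = m by omega)
        (W' (m - p)) (W p)) X (e β)) 0
    rw [smul_zero, add_zero] at this
    rw [← this, ← Finset.sum_add_distrib, koszulSum_cons (fun _ => rfl)]
    refine Finset.sum_congr rfl fun j _ => ?_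
    simp only [Fin.cons_zero, Fin.tail_cons]
    change ε ^ (j : ℕ) • altSum (fun Y => insertTerm S f _
      (j.insertNth (α := fun _ => VField A × M) (0, β) (vec M Y))) X = _
    split_ifs with hj
    · rw [add_zero, altSum_apply, altSum, altSum, Finset.smul_sum]
      refine Finset.sum_congr rfl fun σ _ => ?_
      rw [hS.insertTerm_form_inner hf (show (p : ℕ) + (m - p) = m by omega) _ _ hβ j hj,
        smul_comm, smul_smul (ε ^ _), ← hε, εε, one_smul]
    · rw [zero_add]
  rw [Finset.sum_congr rfl fun p _ => congrArg _ (e0 p)]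
  simp only [smul_add, Finset.sum_add_distrib]
  rw [LinearMap.add_apply]
  congr 1
  · rw [composeSum, LinearMap.sum_apply]
    refine Finset.sum_congr rfl fun p _ => ?_
    rw [LinearMap.smul_apply, ← Nat.cast_smul_eq_nsmul ℝ, smul_smul]
    congr 1
    have h1 : ((p : ℕ)! : ℝ) ≠ 0 := by positivity
    have h2 : ((m - p : ℕ)! : ℝ) ≠ 0 := by positivity
    have h3 : ((p : ℕ) : ℝ) + 1 ≠ 0 := by positivity
    rw [Nat.factorial_succ, show m + 1 - 1 - (p : ℕ) = m - p by omega]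
    push_cast
    field_simp
  · have hz : ∀ p : Fin (m + 1), (p : ℕ) ≠ 1 → (∑ j : Fin (m + 1), if j ≤ p then (0 : T) else
        ε ^ (j : ℕ) • altSum (fun Y => insertTerm S f
          (show (p : ℕ) + 1 + (m + 1 - 1 - p) = m + 1 by omega)
          (j.insertNth (α := fun _ => VField A × M) (0, β) (vec M Y))) X) = 0 := by
      intro p hp
      refine Finset.sum_eq_zero fun j _ => ?_
      split_ifs with hj
      · rfl
      · rw [altSum_congr (fun Y => hS.insertTerm_form_outer hf _ hp Y β j (by
          rw [not_le] at hj; exact hj)), altSum_zero, smul_zero]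
    rcases m with _ | _ | m
    · refine Finset.sum_eq_zero fun p _ => ?_
      rw [hz p (by omega), smul_zero]
    · refine Finset.sum_eq_zero fun p _ => ?_
      by_cases hp : (p : ℕ) = 1
      · rw [Finset.sum_eq_zero, smul_zero]
        intro j _
        rw [if_pos (by rw [Fin.le_def]; omega)]
      · rw [hz p hp, smul_zero]
    · rw [Finset.sum_eq_single (1 : Fin (m + 3))]
      · have t : ∀ j : Fin (m + 3), (if j ≤ 1 then (0 : T) else
            ε ^ (j : ℕ) • altSum (fun Y => insertTerm S f
            (show ((1 : Fin (m + 3)) : ℕ) + 1 + (m + 2 + 1 - 1 - (1 : Fin (m + 3))) = m + 2 + 1 by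
              simp; omega)
            (j.insertNth (α := fun _ => VField A × M) (0, β) (vec M Y))) X) =
            if j ≤ 1 then (0 : T) else altSum (fun Y => (W' (m + 1) (Fin.cons
              (α := fun _ => VField A) ⁅Y 0, Y 1⁆ (Fin.tail (Fin.tail Y))) * s) (e β)) X := by
          intro j
          split_ifs with hj
          · rfl
          · rw [altSum, altSum, Finset.smul_sum]
            refine Finset.sum_congr rfl fun σ _ => ?_
            have hj' : 1 < (j : ℕ) := by rw [not_le, Fin.lt_def] at hj; simpa using hj
            have := hS.insertTerm_form_outer_two hf (by omega) (X ∘ σ) hβ j hj'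
            rw [smul_comm]
            congr 1
            refine (congrArg (ε ^ (j : ℕ) • ·) this).trans ?_
            -- The signs `ε ^ j` and `ε ^ (j - 1)` leave one factor `ε`, which is the action of the
            -- parity operator on `e β`.
            obtain ⟨a, ha⟩ : ∃ a, (j : ℕ) = a + 1 := ⟨j - 1, by omega⟩
            rw [ha, Nat.add_sub_cancel, smul_smul, ← hε, pow_succ', mul_assoc, εε, mul_one,
              Module.End.mul_apply, hS.grading.parity i₀ _ hβ]
            simp only [Units.smul_def, map_zsmul]
            rfl
        -- There are `m + 1` outer positions, and `(m + 1) / (2! (m + 1)!) = 1 / (2 m!)`.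
        rw [Finset.sum_congr rfl fun j _ => t j, sum_ite_le, smul_zero, zero_add, insertedSum,
          LinearMap.smul_apply, altSum_apply, ← Nat.cast_smul_eq_nsmul ℝ, smul_smul]
        congr 1
        simp only [Fin.val_one]
        rw [show m + 2 + 1 - 1 - 1 = m + 1 by omega, show m + 2 - 1 = m + 1 by omega,
          Nat.factorial_succ m]
        have h1 : (m ! : ℝ) ≠ 0 := by positivity
        have h2 : (m : ℝ) + 1 ≠ 0 := by positivity
        push_cast
        norm_num
        field_simp
      · intro p _ hp
        rw [hz p (fun h => hp (Fin.ext h)), smul_zero]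
      · simp

/-- Two elements of `M` in the inner bracket, or two outside it, make the respective operation
vanish. If they are separated, the inner bracket has no vector component, and the outer operation
again has two arguments in `M`. -/
lemma IsExtension.insertBracket_eq_zero {k : ℕ} (d : Fin k → ℤ) (x : Fin k → VField A × M)
    {i j : Fin k} (hij : i ≠ j) (hi : (x i).1 = 0) (hj : (x j).1 = 0) :
    insertBracket S f k d x = 0 := by
  rw [insertBracket_eq_sum]
  refine Finset.sum_eq_zero fun p _ => ?_
  rw [koszulSum, Finset.sum_eq_zero, smul_zero]
  intro σ _
  have key : ∀ (q : ℕ) (h : (p : ℕ) + 1 + q = k) (y : Fin k → VField A × M) (a b : Fin k), a < b →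
      (y a).1 = 0 → (y b).1 = 0 → insertTerm S f h y = 0 := by
    intro q h y a b hab ha hb
    by_cases ha' : (a : ℕ) < p + 1
    · have hfst := hS.fst_bracket_of_eq_zero (k := p + 1) (by omega) (fun i => y ⟨i, by omega⟩)
        (i := ⟨a, ha'⟩) ha
      by_cases hb' : (b : ℕ) < p + 1
      · refine (f (q + 1)).map_coord_zero 0 (Prod.ext hfst ?_)
        refine hS.grading.injective ?_
        rw [Prod.snd_zero, map_zero]
        exact hS.givenBy.eq_zero (p + 1) (fun i => y ⟨i, by omega⟩) ⟨a, ha'⟩ ⟨b, hb'⟩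
          (fun hh => hab.ne (Fin.ext (Fin.mk.inj_iff.mp hh))) ha hb
      · refine hf.eq_zero (q + 1) _ 0 (Fin.succ ⟨b - (p + 1), by omega⟩)
          (Fin.succ_ne_zero _).symm hfst ?_
        rw [Fin.cons_succ]
        convert hb
        simp
        omega
    · refine hf.eq_zero (q + 1) _ (Fin.succ ⟨a - (p + 1), by omega⟩)
          (Fin.succ ⟨b - (p + 1), by omega⟩) (fun hh => ?_) ?_ ?_
      · have := congrArg Fin.val hh
        simp at this
        omega
      · rw [Fin.cons_succ]
        convert ha
        simp
        omega
      · rw [Fin.cons_succ]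
        convert hb
        simp
        omega
  have hne : σ.symm i ≠ σ.symm j := fun hh => hij (σ.symm.injective hh)
  rcases lt_or_gt_of_ne hne with hlt | hlt
  · rw [key _ _ (x ∘ σ) _ _ hlt (by simpa using hi) (by simpa using hj), smul_zero]
  · rw [key _ _ (x ∘ σ) _ _ hlt (by simpa using hj) (by simpa using hi), smul_zero]

end Evaluation

/-! ### Direct sum decompositions from projections -/

section Internal

lemma isInternal_of_projections {V : Type*} [AddCommGroup V] [Module ℝ V]
    (gr : ℤ → Submodule ℝ V) (π : ℤ → V →+ V) (hmem : ∀ i x, π i x ∈ gr i)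
    (hself : ∀ i, ∀ x ∈ gr i, π i x = x) (hne : ∀ i j, i ≠ j → ∀ x ∈ gr i, π j x = 0)
    (t : Finset ℤ) (ht : ∀ x, ∑ i ∈ t, π i x = x) : DirectSum.IsInternal gr := by
  constructor
  · rw [injective_iff_map_eq_zero]
    intro f hf
    have key : ∀ i, ∀ g : DirectSum ℤ (fun i => gr i),
        π i (DirectSum.coeAddMonoidHom gr g) = g i := by
      intro i g
      induction g using DirectSum.induction_on with
      | zero => simp
      | of j x =>
        rw [DirectSum.coeAddMonoidHom_of]
        by_cases h : j = i
        · subst h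
          rw [hself j _ x.2, DirectSum.of_eq_same]
        · rw [hne j i h _ x.2, DirectSum.of_eq_of_ne _ _ _ (Ne.symm h)]
          rfl
      | add g g' h h' => rw [map_add, map_add, h, h']; rfl
    refine DFinsupp.ext fun i => Subtype.ext ?_
    rw [← key, hf, map_zero]
    rfl
  · intro x
    refine ⟨∑ i ∈ t, DirectSum.of (fun i => gr i) i ⟨π i x, hmem i x⟩, ?_⟩
    rw [map_sum]
    simp only [DirectSum.coeAddMonoidHom_of]
    exact ht x

end Internal

/-! ### The Lie algebra of vector fields as an L-infinity algebra -/

section TangentJacobi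

variable {A : Type*} [CommRing A] [Algebra ℝ A]

lemma altSum_comp_right {V W : Type*} [AddCommGroup W] {k : ℕ} (F : (Fin k → V) → W)
    (ρ : Equiv.Perm (Fin k)) (x : Fin k → V) :
    altSum (fun y => F (y ∘ ρ)) x = Equiv.Perm.sign ρ • altSum F x := by
  rw [altSum, altSum, Finset.smul_sum, ← Equiv.sum_comp (Equiv.mulRight ρ)
    (fun σ => Equiv.Perm.sign ρ • Equiv.Perm.sign σ • F (x ∘ σ))]
  refine Finset.sum_congr rfl fun σ _ => ?_
  rw [Equiv.coe_mulRight, Equiv.Perm.sign_mul, smul_smul, mul_comm (Equiv.Perm.sign σ),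
    ← mul_assoc]
  simp
  rfl

lemma altSum_jacobi (x : Fin 3 → VField A) :
    altSum (fun y : Fin 3 → VField A => ⁅⁅y 0, y 1⁆, y 2⁆) x = 0 := by
  have s : Equiv.Perm.sign (finRotate 3) = 1 := by rw [sign_finRotate]; rfl
  set F : (Fin 3 → VField A) → VField A := fun y => ⁅⁅y 0, y 1⁆, y 2⁆ with hF
  have h : ∀ y, F y + F (y ∘ finRotate 3) +
      F (y ∘ (finRotate 3 * finRotate 3 : Equiv.Perm _)) = 0 := by
    intro y
    have e : ∀ a b c : VField A, ⁅⁅a, b⁆, c⁆ = -⁅c, ⁅a, b⁆⁆ := fun a b c => (lie_skew _ _).symm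
    change ⁅⁅y 0, y 1⁆, y 2⁆ + ⁅⁅y 1, y 2⁆, y 0⁆ + ⁅⁅y 2, y 0⁆, y 1⁆ = 0
    rw [e, e, e, ← neg_add, ← neg_add, neg_eq_zero, ← lie_jacobi (y 0) (y 1) (y 2)]
    abel
  have h' := altSum_congr h x
  rw [altSum_add, altSum_add, altSum_comp_right, altSum_comp_right, altSum_zero,
    Equiv.Perm.sign_mul, s] at h'
  have : (3 : ℝ) • altSum F x = 0 := by
    rw [← h', mul_one, one_smul]
    module
  exact (smul_eq_zero_iff_right (by norm_num)).mp this

lemma tangentLie_mem {i : ℤ} {X : VField A} (hX : X ∈ (tangentLie A).gr i) (hi : i ≠ -1) :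
    X = 0 := by
  simpa [tangentLie, hi] using hX

lemma isLInftyAlgebra_tangentLie : IsLInftyAlgebra (tangentLie A) where
  isInternal := by
    refine isInternal_of_projections _ (fun i => if i = -1 then AddMonoidHom.id _ else 0)
      ?_ ?_ ?_ {-1} ?_
    · intro i x
      by_cases h : i = -1 <;> simp [tangentLie, h]
    · intro i x hx
      by_cases h : i = -1
      · simp [h]
      · rw [tangentLie_mem hx h, map_zero]
    · intro i j hij x hx
      by_cases h : j = -1
      · rw [tangentLie_mem hx (fun h' => hij (h'.trans h.symm)), map_zero]
      · simp [h]
    · intro x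
      simp
  isGradedSymmetric :=
    { degree := by
        intro k _ d x hx
        by_cases hk : k = 2
        · subst hk
          by_cases hd : ∃ i, d i ≠ -1
          · obtain ⟨i, hi⟩ := hd
            rw [MultilinearMap.map_coord_zero _ i (tangentLie_mem (hx i) hi)]
            exact Submodule.zero_mem _
          · push Not at hd
            simp [hd, tangentLie]
        · rw [tangentLie_bracket_of_ne hk]
          exact Submodule.zero_mem _
      symm := by
        intro k _ d x hx σ
        by_cases hk : k = 2
        · subst hk
          by_cases hd : ∃ i, d i ≠ -1
          · obtain ⟨i, hi⟩ := hd
            have h0 := tangentLie_mem (hx i) hi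
            rw [MultilinearMap.map_coord_zero _ i h0,
              MultilinearMap.map_coord_zero _ (σ.symm i) (by simpa using h0), smul_zero]
          · push Not at hd
            rw [koszulSign_odd hd, tangentLie_bracket_two, tangentLie_bracket_two]
            have : ∀ σ : Equiv.Perm (Fin 2), σ = 1 ∨ σ = Equiv.swap 0 1 := by decide
            rcases this σ with rfl | rfl
            · simp
            · rw [Equiv.Perm.sign_swap (by decide)]
              simp
        · rw [tangentLie_bracket_of_ne hk, tangentLie_bracket_of_ne hk, smul_zero] }
  jacobi := by
    intro k _ d x hx
    by_cases hd : ∃ i, d i ≠ -1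
    · obtain ⟨i, hi⟩ := hd
      rw [← insertBracketMap_apply]
      exact MultilinearMap.map_coord_zero _ i (tangentLie_mem (hx i) hi)
    push Not at hd
    rw [insertBracket_eq_sum]
    refine Finset.sum_eq_zero fun p _ => ?_
    rw [koszulSum_odd hd]
    have key : ∀ q (h : (p : ℕ) + 1 + q = k),
        altSum (insertTerm (tangentLie A) (tangentLie A).bracket h) x = 0 := by
      intro q h
      -- Both brackets must be binary, so only `p = q = 1` is left, which is the usual Jacobi
      -- identity.
      by_cases hp : (p : ℕ) = 1
      · by_cases hq : q = 1
        · subst hq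
          generalize (p : ℕ) = p' at hp h
          subst hp
          subst h
          exact altSum_jacobi x
        · rw [← altSum_zero x]
          refine altSum_congr (fun y => ?_) x
          rw [insertTerm, tangentLie_bracket_of_ne (by omega)]
      · rw [← altSum_zero x]
        refine altSum_congr (fun y => ?_) x
        rw [insertTerm, tangentLie_bracket_of_ne (k := p + 1) (by omega)]
        exact MultilinearMap.map_coord_zero _ 0 rfl
    rw [key, smul_zero]

end TangentJacobi

/-! ### Jacobi identities of extensions -/

section ExtensionJacobi

variable {A : Type*} [CommRing A] [Algebra ℝ A] {M T : Type*} [AddCommGroup M] [Module ℝ M]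
  [AddCommGroup T] [Module ℝ T]
variable {S : LInftyData (VField A × M)} {e : M →ₗ[ℝ] T} {s : Module.End ℝ T}
  {N W : (q : ℕ) → (Fin q → VField A) → Module.End ℝ T} {H : T}

lemma map_insertBracket {V Z Z' : Type*} [AddCommGroup V] [Module ℝ V] [AddCommGroup Z]
    [Module ℝ Z] [AddCommGroup Z'] [Module ℝ Z'] (S : LInftyData V)
    (f : (k : ℕ) → MultilinearMap ℝ (fun _ : Fin k => V) Z) (u : Z →ₗ[ℝ] Z') (k : ℕ)
    (d : Fin k → ℤ) (x : Fin k → V) :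
    u (insertBracket S f k d x) = insertBracket S (fun k => u.compMultilinearMap (f k)) k d x := by
  simp only [insertBracket_eq_sum, map_sum, map_smul, map_koszulSum]
  rfl

variable {f : (k : ℕ) → MultilinearMap ℝ (fun _ : Fin k => VField A × M) T}
  {N' W' : (q : ℕ) → (Fin q → VField A) → Module.End ℝ T}
variable (hS : IsExtension S e s N W H)

include hS

lemma IsExtension.insertBracket_form_cast (hf : IsGivenBy S.gr e f N' W' H) {m k : ℕ}
    (h : m + 1 = k) (X : Fin m → VField A) {i₀ : ℤ} {β : M} (hβ : (0, β) ∈ S.gr i₀) :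
    insertBracket S f k (Fin.cons i₀ (fun _ => -1) ∘ Fin.cast h.symm)
      ((Fin.cons (0, β) (vec M X) : Fin (m + 1) → VField A × M) ∘ Fin.cast h.symm) =
      (composeSum X W' W + insertedSum (fun q y => W' q y * s) X) (e β) := by
  subst h
  exact hS.insertBracket_form hf X hβ

lemma IsExtension.fst_mem_tangentLie {i : ℤ} {x : VField A × M} (hx : x ∈ S.gr i) :
    x.1 ∈ (tangentLie A).gr i := by
  by_cases h : i = -1
  · simp [tangentLie, h]
  · rw [hS.grading.fst_eq_zero i h x hx]
    exact Submodule.zero_mem _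

theorem IsExtension.isStrictMorphism_fst :
    IsStrictMorphism S (tangentLie A) (LinearMap.fst ℝ (VField A) M) where
  degree _ _ hv := hS.fst_mem_tangentLie hv
  map_bracket k hk x := hS.fst_bracket k hk x

/-- The vector component is the Jacobi identity of vector fields. The component in `M` needs to be
known only on vector fields and on one element of `M`, where it is given by the two operator
identities. -/
theorem IsExtension.jacobi (hN : ∀ y, N 0 y = 0) (hH : s H = -H)
    (hvec : ∀ m (X : Fin m → VField A),
      (composeSum X W N - insertedSum (fun q y => N q y * s) X) H = 0)
    (hform : ∀ m (X : Fin m → VField A) i β, (0, β) ∈ S.gr i →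
      (composeSum X W W + insertedSum (fun q y => W q y * s) X) (e β) = 0)
    {k : ℕ} (hk : 1 ≤ k) (d : Fin k → ℤ) (x : Fin k → VField A × M) (hx : ∀ i, x i ∈ S.gr (d i)) :
    insertBracket S S.bracket k d x = 0 := by
  refine Prod.ext ?_ (hS.grading.injective ?_)
  · have h1 := map_insertBracket S S.bracket (LinearMap.fst ℝ (VField A) M) k d x
    have h2 := isLInftyAlgebra_tangentLie.jacobi k hk d (fun i => (x i).1)
      (fun i => hS.fst_mem_tangentLie (hx i))
    refine h1.trans (Eq.trans ?_ h2)
    rw [insertBracket_eq_sum, insertBracket_eq_sum]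
    refine Finset.sum_congr rfl fun p _ => ?_
    congr 1
    refine Finset.sum_congr rfl fun σ _ => ?_
    congr 1
    refine (hS.fst_bracket _ (by omega) _).trans ?_
    rw [insertTerm]
    congr 1
    funext i
    induction i using Fin.cases with
    | zero => exact hS.fst_bracket _ (by omega) _
    | succ i => rfl
  · have h1 := map_insertBracket S S.bracket (e ∘ₗ LinearMap.snd ℝ (VField A) M) k d x
    refine Eq.trans h1 (Eq.trans ?_ (map_zero e).symm)
    rw [← insertBracketMap_apply]
    refine eq_zero_of_pure hS.grading (fun d => insertBracketMap S _ k d) ?_ ?_ ?_ ?_ d x hx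
    · intro d x ρ
      exact insertBracketMap_comp_perm _ _ _ _ _ _
    · intro d x _ i j hij hi hj
      rw [insertBracketMap_apply]
      exact hS.insertBracket_eq_zero hS.givenBy d x hij hi hj
    · intro d hd X
      rw [insertBracketMap_apply, hS.insertBracket_vec hS.givenBy hN hH hk d hd, hvec]
    · intro m h i₀ β X hβ
      rw [insertBracketMap_apply, hS.insertBracket_form_cast hS.givenBy h X hβ, hform m X i₀ β hβ]

end ExtensionJacobi

/-! ### Recursion for words at the last argument -/

section WordRecursion

variable {L E : Type*} [LieRing L] [Ring E] [Algebra ℝ E]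

omit [LieRing L] [Algebra ℝ E] in
-- Iterated brackets grow by a last argument acting on the left, whereas words are defined by
-- splitting off the first arguments on the right; this and the next two lemmas mediate.
lemma revProd_castSucc (u : L → E) {q : ℕ} (y : Fin (q + 1) → L) :
    revProd u y = u (y (Fin.last q)) * revProd u (fun i : Fin q => y i.castSucc) := by
  induction q with
  | zero => simp [revProd]
  | succ q ih =>
    rw [revProd_succ, ih, revProd_succ, mul_assoc]
    rfl

omit [Algebra ℝ E] in
lemma lieWord_castSucc (d : E) (c : L →+ E) {q : ℕ} (y : Fin (q + 2) → L) :
    lieWord d c y =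
        c (y (Fin.last (q + 1))) * lieWord d c (fun i : Fin (q + 1) => y i.castSucc) := by
  rw [lieWord, revProd_castSucc, lieWord, mul_assoc]
  rfl

omit [Algebra ℝ E] in
lemma bracketWord_castSucc (c : L →+ E) (s : E) {q : ℕ} (y : Fin (q + 3) → L) :
    bracketWord c s y =
      c (y (Fin.last (q + 2))) * bracketWord c s (fun i : Fin (q + 2) => y i.castSucc) := by
  rw [bracketWord, revProd_castSucc, bracketWord, mul_assoc]
  rfl

end WordRecursion

variable {A : Type*} [CommRing A] [Algebra ℝ A]

lemma isCartanSystem_contr (n : ℕ) :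
    IsCartanSystem (dOp : FormOp A) (contr n : VField A →ₗ[ℝ] FormOp A).toAddMonoidHom
      (signOp n) degProj where
  d_mul_d := dOp_mul_dOp
  d_mul_s := dOp_mul_signOp n
  c_mul_c := contr_mul_contr n
  c_mul_s := contr_mul_signOp n
  cartan := contrLie_mul_contr n
  d_mul_p := dOp_mul_degProj
  p_mul_c r X := degProj_mul_contr n X r
  p_mul_p := degProj_mul_degProj
  s_mul_p r := by rw [signOp_mul_degProj, degProj_mul_signOp]
  c_mul_p_zero X := by
    refine LinearMap.ext fun β => TotalForm.ext fun r => ?_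
    change (contr n X (degProj 0 β)).comp r = _
    rw [comp_contr, comp_degProj, if_neg (Nat.succ_ne_zero r), map_zero,
      smul_zero, LinearMap.zero_apply, map_zero]
  p_zero_mul_d := by
    refine LinearMap.ext fun β => TotalForm.ext fun r => ?_
    rw [Module.End.mul_apply, comp_degProj, LinearMap.zero_apply, map_zero]
    split_ifs with h
    · subst h; rfl
    · rfl

/-! ### Iterated brackets in the semidirect product -/

section CartanSpaces

/-- The inclusion of the forms of degree `< n` in all forms. -/
def belowIncl (n : ℕ) : ((r : Fin n) → Form A r) →ₗ[ℝ] TotalForm A where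
  toFun α := TotalForm.mk (extendForms n α)
  map_add' α β := map_add (extendForms n) α β
  map_smul' c α := map_smul (extendForms n) c α

lemma comp_belowIncl_of_lt {n r : ℕ} (h : r < n) (α : (r : Fin n) → Form A r) :
    (belowIncl n α).comp r = α ⟨r, h⟩ := dif_pos h

lemma comp_belowIncl_of_le {n r : ℕ} (h : n ≤ r) (α : (r : Fin n) → Form A r) :
    (belowIncl n α).comp r = 0 := dif_neg (not_lt.mpr h)

lemma belowIncl_injective (n : ℕ) : Function.Injective (belowIncl (A := A) n) := by
  intro α β h
  funext r
  exact (comp_belowIncl_of_lt r.isLt α).symm.trans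
    ((congrArg _ h).trans (comp_belowIncl_of_lt r.isLt β))

/-- The form part of an element of `CartanSpace A`. -/
def formPart : CartanSpace A →ₗ[ℝ] TotalForm A where
  toFun a := TotalForm.mk a.2.2
  map_add' _ _ := rfl
  map_smul' _ _ := rfl

/-- Forms without components of degree `≥ n`. -/
def TotalForm.IsBelow (n : ℕ) (β : TotalForm A) : Prop := ∀ r, n ≤ r → β.comp r = 0

lemma belowIncl_courantProj {n : ℕ} {a : CartanSpace A} (h : (formPart a).IsBelow n) :
    belowIncl n (courantProj n a).2 = formPart a := by
  refine TotalForm.ext fun r => ?_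
  rcases lt_or_ge r n with hr | hr
  · rw [comp_belowIncl_of_lt hr]
    rfl
  · rw [comp_belowIncl_of_le hr, h r hr]

lemma formPart_cartanBracket (n : ℕ) (a b : CartanSpace A) :
    formPart (cartanBracket n a b) = lOp a.1 (formPart b) + iOp a.2.1 (formPart b) -
      lOp b.1 (formPart a) + contr n b.2.1 (formPart a) := by
  rw [contr_eq, LinearMap.neg_apply, ← sub_eq_add_neg]
  rfl

lemma fst_cartanBracket (n : ℕ) (a b : CartanSpace A) : (cartanBracket n a b).1 = ⁅a.1, b.1⁆ := rfl

lemma snd_fst_cartanBracket (n : ℕ) (a b : CartanSpace A) :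
    (cartanBracket n a b).2.1 = ⁅a.1, b.2.1⁆ + ⁅a.2.1, b.1⁆ := rfl

lemma formPart_courantIncl (n : ℕ) (v : CourantSpace A n) :
    formPart (courantIncl n v) = belowIncl n v.2 := rfl

lemma formPart_connecting (n : ℕ) (H : Form A (n + 1)) (v : CourantSpace A n) (r : ℕ) :
    (formPart (connecting n H v)).comp r = if r < n then 0 else
      (dOp (belowIncl n v.2) + iOp v.1 (TotalForm.single (n + 1) H)).comp r := by
  have e : formPart (connecting n H v) = formPart (cartanDiff n H (courantIncl n v)) -
    belowIncl n (courantProj n (cartanDiff n H (courantIncl n v))).2 := rfl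
  have e2 : formPart (cartanDiff n H (courantIncl n v)) =
      dOp (belowIncl n v.2) - lOp 0 (TotalForm.single (n + 1) H) +
        iOp v.1 (TotalForm.single (n + 1) H) := rfl
  have e3 : lOp (0 : VField A) (TotalForm.single (n + 1) H) = 0 :=
    congrArg (fun u => u (Pi.single (n + 1) H : Forms A)) (map_zero lieDerivAll)
  split_ifs with h
  · rw [e, map_sub, comp_belowIncl_of_lt h]
    exact sub_self _
  · rw [e, map_sub, comp_belowIncl_of_le (not_lt.mp h), sub_zero, e2, e3, sub_zero]

lemma fst_connecting (n : ℕ) (H : Form A (n + 1)) (v : CourantSpace A n) :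
    (connecting n H v).1 = v.1 := sub_zero _

lemma snd_fst_connecting (n : ℕ) (H : Form A (n + 1)) (v : CourantSpace A n) :
    (connecting n H v).2.1 = 0 := sub_zero _

variable {n : ℕ} (H : Form A (n + 1))

lemma iteratedBracket_zero (y : Fin 1 → CourantSpace A n) :
    iteratedBracket n H 0 y = connecting n H (y 0) := rfl

lemma iteratedBracket_succ (k : ℕ) (y : Fin (k + 2) → CourantSpace A n) :
    iteratedBracket n H (k + 1) y = cartanBracket n
      (iteratedBracket n H k fun i => y i.castSucc) (courantIncl n (y (Fin.last (k + 1)))) := rfl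

lemma fst_iteratedBracket_succ (k : ℕ) (y : Fin (k + 2) → CourantSpace A n) :
    (iteratedBracket n H (k + 1) y).1 = 0 := by
  rw [iteratedBracket_succ, fst_cartanBracket]
  exact lie_zero _

lemma snd_fst_iteratedBracket_one (y : Fin 2 → CourantSpace A n) :
    (iteratedBracket n H 1 y).2.1 = ⁅(y 0).1, (y 1).1⁆ := by
  rw [iteratedBracket_succ, snd_fst_cartanBracket, iteratedBracket_zero, fst_connecting]
  exact (congrArg _ (lie_zero _)).trans (add_zero _)

/-- The operator part of `D X` is a Lie derivative, that of `[D X, Y]` the contraction with `⁅X,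
Y⁆`; contractions commute with each other, so afterwards only forms remain. -/
lemma snd_fst_iteratedBracket_add_two (k : ℕ) (y : Fin (k + 3) → CourantSpace A n) :
    (iteratedBracket n H (k + 2) y).2.1 = 0 := by
  rw [iteratedBracket_succ, snd_fst_cartanBracket, fst_iteratedBracket_succ, zero_lie, zero_add]
  exact lie_zero _

lemma formPart_iteratedBracket_succ (k : ℕ) (y : Fin (k + 2) → CourantSpace A n) :
    formPart (iteratedBracket n H (k + 1) y) =
      lOp (iteratedBracket n H k fun i => y i.castSucc).1 (belowIncl n (y (Fin.last (k + 1))).2) +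
      iOp (iteratedBracket n H k fun i => y i.castSucc).2.1
        (belowIncl n (y (Fin.last (k + 1))).2) +
      contr n (y (Fin.last (k + 1))).1
        (formPart (iteratedBracket n H k fun i => y i.castSucc)) := by
  rw [iteratedBracket_succ, formPart_cartanBracket, formPart_courantIncl]
  congr 1
  exact (congrArg _ (congrArg (fun u : Forms A →ₗ[ℝ] Forms A => u _)
    (map_zero lieDerivAll))).trans (sub_zero _)

lemma lOp_zero_apply (β : TotalForm A) : lOp (0 : VField A) β = 0 :=
  congrArg (fun u : Forms A →ₗ[ℝ] Forms A => u β) (map_zero lieDerivAll)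

lemma iOp_zero_apply (β : TotalForm A) : iOp (0 : VField A) β = 0 := by
  rw [map_zero, LinearMap.zero_apply]

lemma iteratedBracket_of_fst_eq_zero (k : ℕ) (y : Fin (k + 1) → CourantSpace A n)
    (i : Fin (k + 1)) (hi : (y i).1 = 0) :
    (iteratedBracket n H k y).1 = 0 ∧ (iteratedBracket n H k y).2.1 = 0 := by
  match k with
  | 0 =>
    rw [iteratedBracket_zero, fst_connecting, snd_fst_connecting, ← hi, Fin.fin_one_eq_zero i]
    exact ⟨rfl, rfl⟩
  | 1 =>
    rw [snd_fst_iteratedBracket_one]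
    refine ⟨fst_iteratedBracket_succ H 0 y, ?_⟩
    have : ∀ i : Fin 2, i = 0 ∨ i = 1 := by decide
    rcases this i with rfl | rfl <;> rw [hi] <;> simp
  | k + 2 => exact ⟨fst_iteratedBracket_succ H _ y, snd_fst_iteratedBracket_add_two H _ y⟩

/-- Once a form has entered, the iterated bracket is a form, and forms commute with each other. -/
lemma iteratedBracket_eq_zero (k : ℕ) (y : Fin (k + 1) → CourantSpace A n)
    (i j : Fin (k + 1)) (hij : i < j) (hi : (y i).1 = 0) (hj : (y j).1 = 0) :
    iteratedBracket n H k y = 0 := by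
  induction k with
  | zero => exact absurd hij (by omega)
  | succ k ih =>
    induction j using Fin.lastCases with
    | last =>
      obtain ⟨i, rfl⟩ : ∃ i' : Fin (k + 1), i = i'.castSucc :=
        ⟨i.castLT hij, rfl⟩
      obtain ⟨h1, h2⟩ := iteratedBracket_of_fst_eq_zero H k (fun i => y i.castSucc) i hi
      have h3 := formPart_iteratedBracket_succ H k y
      rw [h1, h2, hj, lOp_zero_apply, iOp_zero_apply, map_zero, LinearMap.zero_apply, add_zero,
        add_zero] at h3
      have h4 := iteratedBracket_of_fst_eq_zero H (k + 1) y _ hj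
      exact Prod.ext h4.1 (Prod.ext h4.2 h3)
    | cast j =>
      obtain ⟨i, rfl⟩ : ∃ i' : Fin (k + 1), i = i'.castSucc :=
        ⟨i.castLT (by have := j.isLt; rw [Fin.lt_def] at hij; simp at hij; omega), rfl⟩
      rw [iteratedBracket_succ, ih (fun i => y i.castSucc) i j (by simpa using hij) hi hj,
        map_zero, LinearMap.zero_apply]

lemma TotalForm.IsBelow.add {β γ : TotalForm A} (hβ : β.IsBelow n) (hγ : γ.IsBelow n) :
    (β + γ).IsBelow n := fun r hr => by rw [map_add, hβ r hr, hγ r hr, add_zero]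

lemma isBelow_contr {β : TotalForm A} (hβ : β.IsBelow (n + 1)) (N : ℕ) (X : VField A) :
    (contr N X β).IsBelow n := fun r hr => by
  rw [comp_contr, hβ (r + 1) (by omega), map_zero, smul_zero]

lemma isBelow_iOp {β : TotalForm A} (hβ : β.IsBelow n) (X : VField A) :
    (iOp X β).IsBelow n := fun r hr => by rw [comp_iOp, hβ (r + 1) (by omega), map_zero]

lemma isBelow_lOp {β : TotalForm A} (hβ : β.IsBelow n) (X : VField A) :
    (lOp X β).IsBelow n := fun r hr => by rw [comp_lOp, hβ r (by omega), map_zero]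

lemma isBelow_belowIncl (α : (r : Fin n) → Form A r) : (belowIncl n α).IsBelow n :=
  fun _ hr => comp_belowIncl_of_le hr α

lemma isBelow_iteratedBracket (k : ℕ) (y : Fin (k + 1) → CourantSpace A n) :
    (formPart (iteratedBracket n H k y)).IsBelow (n + 1) := by
  induction k with
  | zero =>
    intro r hr
    rw [iteratedBracket_zero, formPart_connecting, if_neg (by omega)]
    obtain ⟨r, rfl⟩ : ∃ r', r = r' + 1 := ⟨r - 1, by omega⟩
    rw [map_add, comp_dOp_succ, comp_iOp, comp_belowIncl_of_le (by omega),
      TotalForm.comp_single_of_ne (by omega), map_zero, map_zero, add_zero]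
  | succ k ih =>
    rw [formPart_iteratedBracket_succ]
    have hb := isBelow_belowIncl (y (Fin.last (k + 1))).2
    have := ((isBelow_lOp hb (iteratedBracket n H k fun i => y i.castSucc).1).add
      (isBelow_iOp hb (iteratedBracket n H k fun i => y i.castSucc).2.1)).add
        (isBelow_contr (ih fun i => y i.castSucc) n (y (Fin.last (k + 1))).1)
    exact fun r hr => this r (by omega)

/-- `D x` may contain an `n`-form, but one further bracket lowers the degree below `n`. Hence
projecting the iterated brackets to the Courant algebra loses no form component. -/
lemma isBelow_iteratedBracket_succ (k : ℕ) (y : Fin (k + 2) → CourantSpace A n) :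
    (formPart (iteratedBracket n H (k + 1) y)).IsBelow n := by
  rw [formPart_iteratedBracket_succ]
  have hb := isBelow_belowIncl (y (Fin.last (k + 1))).2
  exact ((isBelow_lOp hb _).add (isBelow_iOp hb _)).add
    (isBelow_contr (isBelow_iteratedBracket H k _) n _)

/-- The iterated brackets of vector fields. -/
lemma formPart_iteratedBracket_vec (k : ℕ) (X : Fin (k + 1) → VField A) :
    formPart (iteratedBracket n H k (vec _ X)) =
      revProd (contr n) X (TotalForm.single (n + 1) H) := by
  induction k with
  | zero =>
    refine TotalForm.ext fun r => ?_
    have e : revProd (contr n) X = contr n (X 0) := by simp [revProd]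
    rw [iteratedBracket_zero, formPart_connecting, e, comp_contr]
    -- Only the component `ι_X H` of degree `n` is nonzero, and there the twist of the contraction
    -- is `(-1)^(2n) = 1`.
    by_cases h : r = n
    · subst h
      rw [if_neg (lt_irrefl _), TotalForm.comp_single_same]
      have : (dOp (belowIncl r (vec ((r' : Fin r) → Form A r') X 0).2)).comp r = 0 := by
        change (dOp (belowIncl r 0)).comp r = 0
        rw [map_zero, map_zero, map_zero]
      rw [map_add, this, zero_add, comp_iOp, TotalForm.comp_single_same, Even.neg_one_pow ⟨r, rfl⟩,
        one_smul]
      rfl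
    · rw [TotalForm.comp_single_of_ne (by omega), map_zero, smul_zero]
      split_ifs with hr
      · rfl
      · have : (dOp (belowIncl n (vec ((r' : Fin n) → Form A r') X 0).2)).comp r = 0 := by
          change (dOp (belowIncl n 0)).comp r = 0
          rw [map_zero, map_zero, map_zero]
        rw [map_add, this, zero_add, comp_iOp, TotalForm.comp_single_of_ne (by omega), map_zero]
  | succ k ih =>
    have h0 : belowIncl n (vec ((r : Fin n) → Form A r) X (Fin.last (k + 1))).2 = 0 :=
      map_zero (belowIncl n)
    rw [formPart_iteratedBracket_succ, h0, map_zero, map_zero, zero_add, zero_add,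
      revProd_castSucc, Module.End.mul_apply, ← ih]
    rfl

end CartanSpaces

/-! ### Homogeneous components, degrees and vector parts of the Courant brackets -/

section CourantComponents

variable {A : Type*} [CommRing A] [Algebra ℝ A] {n : ℕ} (H : Form A (n + 1))

lemma courantComponent_mem (r : Fin n) (v : CourantSpace A n) :
    courantComponent n r v ∈ (courant n H).gr ((r : ℤ) - n) := by
  refine ⟨fun h => if_neg (by omega), fun r' h => ?_⟩
  exact Pi.single_eq_of_ne (fun e => h (by rw [e])) _

lemma courantComponent_of_mem {i : ℤ} {v : CourantSpace A n} (hv : v ∈ (courant n H).gr i)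
    (r : Fin n) : courantComponent n r v = if i = (r : ℤ) - n then v else 0 := by
  split_ifs with h
  · refine Prod.ext ?_ (funext fun r' => ?_)
    · change (if (r : ℕ) + 1 = n then v.1 else 0) = v.1
      split_ifs with h'
      · rfl
      · exact (hv.1 (by omega)).symm
    · by_cases h' : r' = r
      · subst h'
        exact Pi.single_eq_same _ _
      · exact (Pi.single_eq_of_ne h' _).trans (hv.2 r' fun e => h' (by ext; omega)).symm
  · refine Prod.ext ?_ ?_
    · change (if (r : ℕ) + 1 = n then v.1 else 0) = 0
      split_ifs with h'
      · exact hv.1 (by omega)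
      · rfl
    · exact (congrArg (Pi.single (M := fun r : Fin n => Form A r) r) (hv.2 r h)).trans
        (Pi.single_zero r)

lemma fst_courantComponent_of_eq_zero {v : CourantSpace A n} (hv : v.1 = 0) (r : Fin n) :
    (courantComponent n r v).1 = 0 := by
  change (if (r : ℕ) + 1 = n then v.1 else 0) = 0
  rw [hv, ite_self]

lemma sum_courantComponent (hn : 1 ≤ n) (v : CourantSpace A n) :
    ∑ r, courantComponent n r v = v := by
  refine Prod.ext ?_ ?_
  · rw [Prod.fst_sum, Finset.sum_eq_single (⟨n - 1, by omega⟩ : Fin n)]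
    · exact if_pos (by simp; omega)
    · intro r _ hr
      exact if_neg fun h => hr (Fin.ext (by simp; omega))
    · simp
  · rw [Prod.snd_sum]
    exact Finset.univ_sum_single v.2

lemma eq_zero_of_mem_courant_gr (hn : 1 ≤ n) {i : ℤ} {v : CourantSpace A n}
    (hv : v ∈ (courant n H).gr i) (hi : ∀ r : Fin n, i ≠ (r : ℤ) - n) : v = 0 := by
  rw [← sum_courantComponent hn v]
  exact Finset.sum_eq_zero fun r _ => by rw [courantComponent_of_mem H hv, if_neg (hi r)]

lemma map_eq_sum_courantComponent (hn : 1 ≤ n) {Z : Type*} [AddCommGroup Z] [Module ℝ Z] {k : ℕ}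
    (F : MultilinearMap ℝ (fun _ : Fin k => CourantSpace A n) Z) (x : Fin k → CourantSpace A n) :
    F x = ∑ r : Fin k → Fin n, F fun i => courantComponent n (r i) (x i) := by
  have h := F.map_sum fun i (r : Fin n) => courantComponent n r (x i)
  simp only [sum_courantComponent hn] at h
  exact h

/-- The iterated bracket as an operation of the Courant algebra. -/
def derivedBracket (k : ℕ) : MultilinearMap ℝ (fun _ : Fin (k + 1) => CourantSpace A n)
    (CourantSpace A n) := (courantProj n).compMultilinearMap (iteratedBracket n H k)

lemma courant_bracket_one (x : Fin 1 → CourantSpace A n) : (courant n H).bracket 1 x =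
    courantProj n (cartanDiff n H (courantIncl n (x 0))) := rfl

lemma courant_bracket_add_two (k : ℕ) (x : Fin (k + 2) → CourantSpace A n) :
    (courant n H).bracket (k + 2) x = (-(bernoulli (k + 1) : ℝ) / ((k + 1)! : ℝ)) •
      ∑ r : Fin (k + 2) → Fin n, koszulSum (fun i => (r i : ℤ) - n) (derivedBracket H (k + 1))
        (fun i => courantComponent n (r i) (x i)) := by
  change ((-(bernoulli (k + 1) : ℝ) / ((k + 1)! : ℝ)) •
        ∑ r : Fin (k + 2) → Fin n, ∑ σ : Equiv.Perm (Fin (k + 2)),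
          koszulSign (fun i => (r i : ℤ) - n) σ •
            (courantProj n).compMultilinearMap
              (((iteratedBracket n H (k + 1)).compLinearMap
                fun i => courantComponent n (r (σ i))).domDomCongr σ)) x = _
  simp only [smul_apply, sum_apply]
  rfl

lemma koszulSum_map_coord_zero {V W : Type*} [AddCommGroup V] [Module ℝ V] [AddCommGroup W]
    [Module ℝ W] {k : ℕ} (d : Fin k → ℤ) (F : MultilinearMap ℝ (fun _ : Fin k => V) W)
    {x : Fin k → V} (i : Fin k) (hi : x i = 0) : koszulSum d F x = 0 := by
  rw [← koszulMap_apply]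
  exact MultilinearMap.map_coord_zero _ i hi

/-- The brackets are defined by a sum over all tuples of homogeneous components. For homogeneous
arguments at most one tuple contributes, and its Koszul signs are those of the actual degrees. -/
lemma courant_bracket_of_mem (hn : 1 ≤ n) {k : ℕ} {d : Fin (k + 2) → ℤ}
    {x : Fin (k + 2) → CourantSpace A n} (hx : ∀ i, x i ∈ (courant n H).gr (d i)) :
    (courant n H).bracket (k + 2) x = (-(bernoulli (k + 1) : ℝ) / ((k + 1)! : ℝ)) •
      koszulSum d (derivedBracket H (k + 1)) x := by
  rw [courant_bracket_add_two]
  congr 1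
  by_cases h : ∀ i, ∃ r : Fin n, d i = (r : ℤ) - n
  · choose r hr using h
    rw [Finset.sum_eq_single r]
    · have e1 : (fun i => (r i : ℤ) - n) = d := funext fun i => (hr i).symm
      have e2 : (fun i => courantComponent n (r i) (x i)) = x := funext fun i => by
        rw [courantComponent_of_mem H (hx i), if_pos (hr i)]
      rw [e1, e2]
    · intro r' _ hr'
      obtain ⟨i, hi⟩ := Function.ne_iff.mp hr'
      refine koszulSum_map_coord_zero _ _ i ?_
      rw [courantComponent_of_mem H (hx i), if_neg]
      intro e
      refine hi (Fin.ext ?_)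
      have := hr i
      omega
    · simp
  -- An argument whose degree does not occur in the Courant algebra is zero, so both sides vanish.
  · push Not at h
    obtain ⟨i, hi⟩ := h
    have h0 := eq_zero_of_mem_courant_gr H hn (hx i) hi
    rw [koszulSum_map_coord_zero _ _ i h0]
    refine Finset.sum_eq_zero fun r _ => koszulSum_map_coord_zero _ _ i ?_
    rw [h0, map_zero]

lemma isExtensionGrading_courant :
    IsExtensionGrading (courant n H).gr (belowIncl n) (signOp n) where
  injective := belowIncl_injective n
  vec_mem X := ⟨fun h => absurd rfl h, fun _ _ => rfl⟩
  fst_mem i x hx := ⟨hx.1, fun _ _ => rfl⟩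
  snd_mem i x hx := ⟨fun _ => rfl, hx.2⟩
  fst_eq_zero i hi x hx := hx.1 hi
  parity i x hx := by
    refine TotalForm.ext fun r => ?_
    rw [comp_signOp, Units.smul_def, map_zsmul]
    rcases lt_or_ge r n with hr | hr
    · rw [comp_belowIncl_of_lt hr]
      by_cases h : i = (r : ℤ) - n
      · rw [h, Int.negOnePow_sub, ← Int.negOnePow_add]
        have : ((r : ℤ) + n) = ((r + n : ℕ) : ℤ) := by push_cast; rfl
        rw [this, Int.negOnePow_def, zpow_natCast, ← Int.cast_smul_eq_zsmul ℝ]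
        simp
      · rw [hx.2 ⟨r, hr⟩ h, smul_zero, smul_zero]
    · rw [comp_belowIncl_of_le hr, smul_zero, smul_zero]

/-- Homogeneous elements of `CartanSpace A`. -/
structure IsCartanHomogeneous (n : ℕ) (i : ℤ) (a : CartanSpace A) : Prop where
  fst : i ≠ 0 → a.1 = 0
  snd_fst : i ≠ -1 → a.2.1 = 0
  form : ∀ r : ℕ, i ≠ (r : ℤ) - n → (formPart a).comp r = 0

lemma comp_belowIncl_of_mem {i : ℤ} {v : CourantSpace A n} (hv : v ∈ (courant n H).gr i) {r : ℕ}
    (hr : i ≠ (r : ℤ) - n) : (belowIncl n v.2).comp r = 0 := by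
  rcases lt_or_ge r n with h | h
  · rw [comp_belowIncl_of_lt h, hv.2 ⟨r, h⟩ hr]
  · exact comp_belowIncl_of_le h _

lemma comp_dOp_belowIncl_of_mem {i : ℤ} {v : CourantSpace A n} (hv : v ∈ (courant n H).gr i)
    {r : ℕ} (hr : i + 1 ≠ (r : ℤ) - n) : (dOp (belowIncl n v.2)).comp r = 0 := by
  match r with
  | 0 => rfl
  | r + 1 =>
    rw [comp_dOp_succ, comp_belowIncl_of_mem H hv (fun e => hr (by push_cast; omega)), map_zero]

lemma IsCartanHomogeneous.courantProj_mem {i : ℤ} {a : CartanSpace A}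
    (ha : IsCartanHomogeneous n i a) : courantProj n a ∈ (courant n H).gr i :=
  ⟨ha.snd_fst, fun r hr => ha.form r hr⟩

lemma isCartanHomogeneous_connecting {i : ℤ} {v : CourantSpace A n}
    (hv : v ∈ (courant n H).gr i) : IsCartanHomogeneous n (i + 1) (connecting n H v) where
  fst h := by rw [fst_connecting, hv.1 (by omega)]
  snd_fst _ := snd_fst_connecting n H v
  form r hr := by
    rw [formPart_connecting]
    split_ifs with h
    · rfl
    · rw [map_add, comp_iOp]
      rw [comp_dOp_belowIncl_of_mem H hv hr, zero_add]
      by_cases hrn : r = n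
      · rw [hv.1 (by subst hrn; omega), map_zero, LinearMap.zero_apply]
      · rw [TotalForm.comp_single_of_ne (by omega), map_zero]

lemma IsCartanHomogeneous.cartanBracket {i j : ℤ} {a : CartanSpace A}
    (ha : IsCartanHomogeneous n i a) {v : CourantSpace A n} (hv : v ∈ (courant n H).gr j) :
    IsCartanHomogeneous n (i + j) (cartanBracket n a (courantIncl n v)) where
  fst _ := lie_zero _
  snd_fst h := by
    rw [snd_fst_cartanBracket]
    change ⁅a.1, v.1⁆ + ⁅a.2.1, 0⁆ = 0
    rw [lie_zero, add_zero]
    by_cases hi : i = 0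
    · rw [hv.1 (by omega), lie_zero]
    · rw [ha.fst hi, zero_lie]
  form r hr := by
    have e : (courantIncl n v).1 = 0 := rfl
    rw [formPart_cartanBracket, formPart_courantIncl, e, lOp_zero_apply, sub_zero, map_add,
      map_add, comp_lOp, comp_iOp, comp_contr]
    have h1 : lieDeriv a.1 ((belowIncl n v.2).comp r) = 0 := by
      by_cases hi : i = 0
      · rw [comp_belowIncl_of_mem H hv (by omega), map_zero]
      · rw [ha.fst hi, map_zero, LinearMap.zero_apply]
    have h2 : interior a.2.1 ((belowIncl n v.2).comp (r + 1)) = 0 := by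
      by_cases hi : i = -1
      · rw [comp_belowIncl_of_mem H hv (by push_cast; omega), map_zero]
      · rw [ha.snd_fst hi, map_zero, LinearMap.zero_apply]
    have h3 : interior (courantIncl n v).2.1 ((formPart a).comp (r + 1)) = 0 := by
      by_cases hj : j = -1
      · rw [ha.form (r + 1) (by push_cast; omega), map_zero]
      · rw [show (courantIncl n v).2.1 = 0 from hv.1 hj, map_zero, LinearMap.zero_apply]
    rw [h1, h2, h3, smul_zero, add_zero, add_zero]

lemma isCartanHomogeneous_iteratedBracket (k : ℕ) {d : Fin (k + 1) → ℤ}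
    {y : Fin (k + 1) → CourantSpace A n} (hy : ∀ i, y i ∈ (courant n H).gr (d i)) :
    IsCartanHomogeneous n (∑ i, d i + 1) (iteratedBracket n H k y) := by
  induction k with
  | zero =>
    rw [iteratedBracket_zero, Fin.sum_univ_one]
    exact isCartanHomogeneous_connecting H (hy 0)
  | succ k ih =>
    rw [iteratedBracket_succ, Fin.sum_univ_castSucc, add_right_comm]
    exact (ih fun i => hy i.castSucc).cartanBracket H (hy (Fin.last (k + 1)))

lemma isGradedSymmetric_courant (hn : 1 ≤ n) :
    IsGradedSymmetric (courant n H).gr (courant n H).gr 1 (courant n H).bracket where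
  degree k hk d x hx := by
    match k, hk with
    | 1, _ =>
      rw [courant_bracket_one, Fin.sum_univ_one]
      refine ⟨fun _ => rfl, fun r hr => ?_⟩
      have e : (courantProj n (cartanDiff n H (courantIncl n (x 0)))).2 r =
          (dOp (belowIncl n (x 0).2) - lOp 0 (TotalForm.single (n + 1) H) +
            iOp (x 0).1 (TotalForm.single (n + 1) H)).comp r := rfl
      rw [e, lOp_zero_apply, sub_zero, map_add, comp_iOp, TotalForm.comp_single_of_ne (by omega),
        map_zero, add_zero]
      exact comp_dOp_belowIncl_of_mem H (hx 0) hr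
    | k + 2, _ =>
      rw [courant_bracket_of_mem H hn hx]
      refine Submodule.smul_mem _ _ (Submodule.sum_mem _ fun σ _ => ?_)
      rw [Units.smul_def]
      refine Submodule.smul_of_tower_mem _ _ ?_
      have := isCartanHomogeneous_iteratedBracket H (k + 1) (fun i => hx (σ i))
      rw [Equiv.sum_comp σ d] at this
      exact this.courantProj_mem H
  symm k hk d x hx σ := by
    match k, hk with
    | 1, _ => rw [Subsingleton.elim σ 1, koszulSign_one, one_smul]; rfl
    | k + 2, _ =>
      rw [courant_bracket_of_mem H hn hx, courant_bracket_of_mem H hn (x := x ∘ σ) (d := d ∘ σ)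
        (fun i => hx (σ i)), koszulSum_comp d _ x σ, smul_comm]

lemma fst_courant_bracket (hn : 1 ≤ n) (k : ℕ) (hk : 1 ≤ k) (x : Fin k → CourantSpace A n) :
    ((courant n H).bracket k x).1 = (tangentLie A).bracket k fun i => (x i).1 := by
  match k, hk with
  | 1, _ => rfl
  | 2, _ =>
    have hom : ∀ (d : Fin 2 → ℤ) (x : Fin 2 → CourantSpace A n),
        (∀ i, x i ∈ (courant n H).gr (d i)) →
        ((courant n H).bracket 2 x).1 = ⁅(x 0).1, (x 1).1⁆ := by
      intro d x hx
      rw [courant_bracket_of_mem H hn hx]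
      have e : ∀ y, (derivedBracket H 1 y).1 = ⁅(y 0).1, (y 1).1⁆ :=
        snd_fst_iteratedBracket_one H
      have e2 : (koszulSum d (derivedBracket H 1) x).1 =
          koszulSum d (fun y : Fin 2 → CourantSpace A n => ⁅(y 0).1, (y 1).1⁆) x := by
        have := map_koszulSum (LinearMap.fst ℝ (VField A) ((r : Fin n) → Form A r)) d
          (derivedBracket H 1) x
        refine this.trans ?_
        simp only [koszulSum]
        exact Finset.sum_congr rfl fun σ _ => congrArg _ (e _)
      rw [Prod.smul_fst, e2]
      have alt : ∀ (y : Fin 2 → CourantSpace A n) (σ : Equiv.Perm (Fin 2)),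
          ⁅((y ∘ σ) 0).1, ((y ∘ σ) 1).1⁆ = Equiv.Perm.sign σ • ⁅(y 0).1, (y 1).1⁆ := by
        intro y σ
        have : ∀ σ : Equiv.Perm (Fin 2), σ = 1 ∨ σ = Equiv.swap 0 1 := by decide
        rcases this σ with rfl | rfl
        · simp
        · rw [Equiv.Perm.sign_swap (by decide)]
          simp
      by_cases hd : ∀ i, d i = -1
      -- Both permutations contribute the same, and `-B_1 * 2 = 1`.
      · rw [koszulSum_odd hd, altSum_of_alternating alt, smul_smul]
        simp [bernoulli_one]
      · push Not at hd
        obtain ⟨i, hi⟩ := hd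
        have h0 := (hx i).1 hi
        have z : ∀ y : Fin 2 → CourantSpace A n, (∃ j, (y j).1 = 0) →
            ⁅(y 0).1, (y 1).1⁆ = 0 := by
          rintro y ⟨j, hj⟩
          have : ∀ i : Fin 2, i = 0 ∨ i = 1 := by decide
          rcases this j with rfl | rfl <;> rw [hj] <;> simp
        rw [z x ⟨i, h0⟩, koszulSum, Finset.sum_eq_zero, smul_zero]
        intro σ _
        rw [z (x ∘ σ) ⟨σ.symm i, by simpa using h0⟩, smul_zero]
    have h1 := map_eq_sum_courantComponent hn
      ((LinearMap.fst ℝ (VField A) ((r : Fin n) → Form A r)).compMultilinearMap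
        ((courant n H).bracket 2)) x
    have h2 := map_eq_sum_courantComponent hn
      (((tangentLie A).bracket 2).compLinearMap fun _ =>
        LinearMap.fst ℝ (VField A) ((r : Fin n) → Form A r)) x
    refine h1.trans (Eq.trans ?_ h2.symm)
    refine Finset.sum_congr rfl fun r _ => ?_
    exact hom (fun i => (r i : ℤ) - n) _ fun i => courantComponent_mem H (r i) (x i)
  | k + 3, _ =>
    rw [courant_bracket_add_two, tangentLie_bracket_of_ne (by omega), Prod.smul_fst, Prod.fst_sum,
      Finset.sum_eq_zero, smul_zero]
    intro r _
    have := map_koszulSum (LinearMap.fst ℝ (VField A) ((r : Fin n) → Form A r))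
      (fun i => (r i : ℤ) - n) (derivedBracket H (k + 2))
      (fun i => courantComponent n (r i) (x i))
    refine this.trans (Finset.sum_eq_zero fun σ _ => ?_)
    have h0 : ∀ y, (derivedBracket H (k + 2) y).1 = 0 := snd_fst_iteratedBracket_add_two H k
    exact (congrArg _ (h0 _)).trans (smul_zero _)

lemma courant_bracket_eq_zero (k : ℕ) (x : Fin k → CourantSpace A n) (i j : Fin k)
    (hij : i ≠ j) (hi : (x i).1 = 0) (hj : (x j).1 = 0) : (courant n H).bracket k x = 0 := by
  match k, i, j with
  | 0, i, _ => exact i.elim0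
  | 1, i, j => exact absurd (Subsingleton.elim (α := Fin 1) i j) hij
  | k + 2, i, j =>
    rw [courant_bracket_add_two, Finset.sum_eq_zero, smul_zero]
    intro r _
    refine Finset.sum_eq_zero fun σ _ => ?_
    have key : ∀ (y : Fin (k + 2) → CourantSpace A n) (a b), a < b → (y a).1 = 0 → (y b).1 = 0 →
        derivedBracket H (k + 1) y = 0 := by
      intro y a b hab ha hb
      change courantProj n (iteratedBracket n H (k + 1) y) = 0
      rw [iteratedBracket_eq_zero H (k + 1) y a b hab ha hb, map_zero]
    have hi' := fst_courantComponent_of_eq_zero hi (r i)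
    have hj' := fst_courantComponent_of_eq_zero hj (r j)
    have hne : σ.symm i ≠ σ.symm j := fun hh => hij (σ.symm.injective hh)
    rcases lt_or_gt_of_ne hne with hlt | hlt
    · rw [key _ _ _ hlt (by simpa using hi') (by simpa using hj'), smul_zero]
    · rw [key _ _ _ hlt (by simpa using hj') (by simpa using hi'), smul_zero]

end CourantComponents

/-! ### The Courant algebra as an extension given by operators; its Jacobi identities -/

section CourantEvaluation

open PowerSeries (coeff)

variable {A : Type*} [CommRing A] [Algebra ℝ A]

lemma coeff_bernPsi_add_two (k : ℕ) :
    coeff (k + 2) bernPsi = -((bernoulli (k + 1) : ℝ) / ((k + 1)! : ℝ)) := by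
  rw [bernPsi, map_neg, PowerSeries.coeff_X_pow_mul, coeff_bernG]

lemma coeff_bernPsi_of_lt {k : ℕ} (hk : k < 2) : coeff k bernPsi = 0 := by
  rw [bernPsi, map_neg, PowerSeries.coeff_X_pow_mul', if_neg (by omega), neg_zero]

lemma belowIncl_derivedBracket {n : ℕ} (H : Form A (n + 1)) (k : ℕ)
    (y : Fin (k + 2) → CourantSpace A n) : belowIncl n (derivedBracket H (k + 1) y).2 =
      formPart (iteratedBracket n H (k + 1) y) :=
  belowIncl_courantProj (isBelow_iteratedBracket_succ H k y)

/-- The embedding of the forms in the Courant algebra, as a linear map on the whole space. -/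
def courantForm (n : ℕ) : CourantSpace A n →ₗ[ℝ] TotalForm A :=
  belowIncl n ∘ₗ LinearMap.snd ℝ (VField A) _

/-- The differential of the complex is the de Rham differential, except that it vanishes on the top
forms of degree `ν = n - 1`. -/
lemma courantForm_bracket_one {ν : ℕ} (H : Form A (ν + 1 + 1))
    (x : Fin 1 → CourantSpace A (ν + 1)) : courantForm (ν + 1) ((courant (ν + 1) H).bracket 1 x) =
      (dOp - dOp * degProj ν : FormOp A) (courantForm (ν + 1) (x 0)) := by
  refine TotalForm.ext fun r => ?_
  rw [LinearMap.sub_apply, dOp_mul_degProj, map_sub, Module.End.mul_apply, comp_degProj]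
  rcases lt_or_ge r (ν + 1) with hr | hr
  · have e : (courantForm (ν + 1) ((courant (ν + 1) H).bracket 1 x)).comp r =
        (dOp (courantForm (ν + 1) (x 0)) - lOp 0 (TotalForm.single (ν + 1 + 1) H) +
            iOp (x 0).1 (TotalForm.single (ν + 1 + 1) H)).comp r :=
      comp_belowIncl_of_lt hr _
    rw [e, lOp_zero_apply, sub_zero, map_add, comp_iOp, TotalForm.comp_single_of_ne (by omega),
      map_zero, add_zero, if_neg (by omega), sub_zero]
  · refine (comp_belowIncl_of_le hr _).trans ?_
    split_ifs with h
    · rw [sub_self]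
    · obtain ⟨r, rfl⟩ : ∃ r', r = r' + 1 := ⟨r - 1, by omega⟩
      rw [comp_dOp_succ, show (courantForm (ν + 1) (x 0)).comp r = 0 from
        comp_belowIncl_of_le (by omega) _, map_zero, sub_zero]

lemma map_koszulSum_units {V W U : Type*} [AddCommGroup W] [Module ℝ W] [AddCommGroup U]
    [Module ℝ U] {k : ℕ} (g : W →ₗ[ℝ] U) (d : Fin k → ℤ) (F : (Fin k → V) → W) (G : (Fin k → V) → U)
    (h : ∀ y, g (F y) = G y) (x : Fin k → V) : g (koszulSum d F x) = koszulSum d G x := by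
  rw [map_koszulSum]
  exact Finset.sum_congr rfl fun σ _ => congrArg _ (h _)

lemma courantForm_bracket_add_two {n : ℕ} (hn : 1 ≤ n) (H : Form A (n + 1)) {k : ℕ}
    {d : Fin (k + 2) → ℤ} {x : Fin (k + 2) → CourantSpace A n}
    (hx : ∀ i, x i ∈ (courant n H).gr (d i)) :
    courantForm n ((courant n H).bracket (k + 2) x) =
      (-((bernoulli (k + 1) : ℝ) / ((k + 1)! : ℝ))) •
        koszulSum d (fun y => formPart (iteratedBracket n H (k + 1) y)) x := by
  rw [courant_bracket_of_mem H hn hx, map_smul, neg_div]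
  congr 1
  exact map_koszulSum_units (courantForm n) d (derivedBracket H (k + 1)) _
    (belowIncl_derivedBracket H k) x

/-- The contractions, as an additive map. -/
abbrev contrHom (n : ℕ) : VField A →+ FormOp A := (contr n : VField A →ₗ[ℝ] FormOp A).toAddMonoidHom

lemma courantForm_bracket_vec {n : ℕ} (hn : 1 ≤ n) (H : Form A (n + 1)) {k : ℕ} (hk : 1 ≤ k)
    (X : Fin k → VField A) : courantForm n ((courant n H).bracket k (vec _ X)) =
      courantVec (contrHom n) k X (TotalForm.single (n + 1) H) := by
  match k, hk with
  | 1, _ =>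
    rw [courantVec, coeff_bernPsi_of_lt (by omega), mul_zero, zero_smul, LinearMap.zero_apply]
    obtain ⟨ν, rfl⟩ : ∃ ν, n = ν + 1 := ⟨n - 1, by omega⟩
    rw [courantForm_bracket_one]
    have e : courantForm (ν + 1) (vec ((r : Fin (ν + 1)) → Form A r) X 0) = 0 :=
      map_zero (belowIncl (ν + 1))
    rw [e, map_zero]
  | k + 2, _ =>
    rw [courantForm_bracket_add_two hn H (d := fun _ => -1)
      (x := vec _ X) (fun i => (isExtensionGrading_courant H).vec_mem _), koszulSum_odd (fun _ => rfl)]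
    have e : altSum (fun y => formPart (iteratedBracket n H (k + 1) y))
        (vec ((r : Fin n) → Form A r) X) = altSum (fun Y : Fin (k + 2) → VField A =>
          revProd (contrHom n) Y (TotalForm.single (n + 1) H)) X := by
      change altSum (fun Y : Fin (k + 2) → VField A =>
        formPart (iteratedBracket n H (k + 1) (vec _ Y))) X = _
      exact altSum_congr (fun Y => formPart_iteratedBracket_vec H (k + 1) Y) X
    rw [e, ← altSum_apply, altSum_of_alternating
      fun y σ => (isCartanSystem_contr n).revProd_comp_perm y σ, courantVec, coeff_bernPsi_add_two,
      LinearMap.smul_apply, LinearMap.smul_apply, smul_smul, mul_comm]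

/-- The summands are distinguished by the position at which `β` enters. At the start it contributes
its differential in degree `ν`, followed by contractions; after one vector field a Lie derivative
acts on it, after two a contraction with a bracket, and after more nothing. These are the three
kinds of words in `courantWord`. -/
lemma sum_formPart_iteratedBracket {ν : ℕ} (H : Form A (ν + 1 + 1)) {i : ℤ}
    {β : (r : Fin (ν + 1)) → Form A r} (hβ : (0, β) ∈ (courant (ν + 1) H).gr i) {q : ℕ}
    (Y : Fin q → VField A) :
    ∑ j : Fin (q + 1), i.negOnePow ^ (j : ℕ) • formPart (iteratedBracket (ν + 1) H q
      (j.insertNth (α := fun _ => CourantSpace A (ν + 1)) (0, β) (vec _ Y))) =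
      courantWord dOp (contrHom (ν + 1)) (signOp (ν + 1)) degProj ν Y (belowIncl (ν + 1) β) := by
  have hpar := (isExtensionGrading_courant H).parity i _ hβ
  induction q with
  | zero =>
    have e : courantWord dOp (contrHom (ν + 1)) (signOp (ν + 1)) degProj ν Y =
        (dOp * degProj ν : FormOp A) := by
      simp [courantWord, revProd, lieWord, bracketWord]
    rw [e, Fin.sum_univ_one]
    simp only [Fin.val_zero, pow_zero, one_smul]
    refine TotalForm.ext fun r => ?_
    rw [iteratedBracket_zero, formPart_connecting, dOp_mul_degProj, Module.End.mul_apply,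
      comp_degProj, Fin.insertNth_apply_same, iOp_zero_apply, add_zero]
    by_cases h : r = ν + 1
    · rw [if_neg (by omega), if_pos h]
    · rw [if_neg h]
      split_ifs with h'
      · rfl
      · obtain ⟨r, rfl⟩ : ∃ r', r = r' + 1 := ⟨r - 1, by omega⟩
        rw [comp_dOp_succ, comp_belowIncl_of_le (by omega), map_zero]
  | succ q ih =>
    have e1 : ∀ j : Fin (q + 1), formPart (iteratedBracket (ν + 1) H (q + 1)
        (j.castSucc.insertNth (α := fun _ => CourantSpace A (ν + 1)) (0, β) (vec _ Y))) =
        contr (ν + 1) (Y (Fin.last q)) (formPart (iteratedBracket (ν + 1) H q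
        (j.insertNth (α := fun _ => CourantSpace A (ν + 1)) (0, β)
          (vec _ fun i : Fin q => Y i.castSucc)))) := by
      intro j
      have r1 : (fun l : Fin (q + 1) => j.castSucc.insertNth
          (α := fun _ => CourantSpace A (ν + 1)) (0, β) (vec _ Y) l.castSucc) =
          j.insertNth (α := fun _ => CourantSpace A (ν + 1)) (0, β)
            (vec _ fun i : Fin q => Y i.castSucc) := by
        funext l
        have := insertNth_restrict (r := q) (a := 0) j.castSucc
          ((0, β) : CourantSpace A (ν + 1)) (vec _ Y) j (by simp) (by omega) l
        simp only [zero_add] at this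
        exact this
      have r2 : j.castSucc.insertNth (α := fun _ => CourantSpace A (ν + 1)) (0, β) (vec _ Y)
          (Fin.last (q + 1)) = (Y (Fin.last q), 0) := by
        rw [insertNth_of_gt _ _ _ (by simp; omega)]
        rfl
      obtain ⟨h1, h2⟩ := iteratedBracket_of_fst_eq_zero H q (j.insertNth
        (α := fun _ => CourantSpace A (ν + 1)) (0, β) (vec _ fun i : Fin q => Y i.castSucc)) j
        (by rw [Fin.insertNth_apply_same])
      rw [formPart_iteratedBracket_succ, r1, r2, h1, h2, lOp_zero_apply, iOp_zero_apply, zero_add,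
        zero_add]
    have e2 : formPart (iteratedBracket (ν + 1) H (q + 1)
        ((Fin.last (q + 1)).insertNth (α := fun _ => CourantSpace A (ν + 1)) (0, β) (vec _ Y))) =
        lOp (iteratedBracket (ν + 1) H q (vec _ Y)).1 (belowIncl (ν + 1) β) +
        iOp (iteratedBracket (ν + 1) H q (vec _ Y)).2.1 (belowIncl (ν + 1) β) := by
      have r1 : (fun l : Fin (q + 1) => (Fin.last (q + 1)).insertNth
          (α := fun _ => CourantSpace A (ν + 1)) (0, β) (vec _ Y) l.castSucc) = vec _ Y := by
        funext l
        rw [insertNth_of_lt _ _ _ (by simp; omega)]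
        rfl
      rw [formPart_iteratedBracket_succ, r1, Fin.insertNth_apply_same, map_zero,
        LinearMap.zero_apply, add_zero]
    rw [Fin.sum_univ_castSucc]
    simp only [e1, e2, Fin.val_castSucc, Fin.val_last]
    have e3 : ∑ j : Fin (q + 1), i.negOnePow ^ (j : ℕ) • contr (ν + 1) (Y (Fin.last q))
        (formPart (iteratedBracket (ν + 1) H q
        (j.insertNth (α := fun _ => CourantSpace A (ν + 1)) (0, β)
          (vec _ fun i : Fin q => Y i.castSucc)))) = contr (ν + 1) (Y (Fin.last q))
        (courantWord dOp (contrHom (ν + 1)) (signOp (ν + 1)) degProj ν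
          (fun i : Fin q => Y i.castSucc) (belowIncl (ν + 1) β)) := by
      rw [← ih, map_sum]
      refine Finset.sum_congr rfl fun j _ => ?_
      rw [Units.smul_def, Units.smul_def, map_zsmul]
    rw [e3]
    match q, Y with
    -- Here `β` can enter directly after `D Y_0`. The sign of its position is absorbed by the parity
    -- operator in `contrLie`.
    | 0, Y =>
      have w : courantWord dOp (contrHom (ν + 1)) (signOp (ν + 1)) degProj ν Y =
          contr (ν + 1) (Y 0) * (dOp * degProj ν) - contrLie (ν + 1) (Y 0) := by
        simp [courantWord, revProd, lieWord, bracketWord]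
        rfl
      have w' : courantWord dOp (contrHom (ν + 1)) (signOp (ν + 1)) degProj ν
          (fun i : Fin 0 => Y i.castSucc) = (dOp * degProj ν : FormOp A) := by
        simp [courantWord, revProd, lieWord, bracketWord]
      have z : iOp (iteratedBracket (ν + 1) H 0 (vec _ Y)).2.1 (belowIncl (ν + 1) β) = 0 := by
        rw [iteratedBracket_zero, snd_fst_connecting, iOp_zero_apply]
      rw [w, w', z, add_zero, LinearMap.sub_apply, Module.End.mul_apply, sub_eq_add_neg,
        iteratedBracket_zero, fst_connecting, contrLie_eq, LinearMap.neg_apply, neg_neg,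
        Module.End.mul_apply]
      congr 1
      refine Eq.trans ?_ ((congrArg (lOp (Y 0)) hpar).trans
        (map_zsmul (lOp (Y 0)) (i.negOnePow : ℤ) (belowIncl (ν + 1) β))).symm
      rw [show i.negOnePow ^ (0 + 1) = i.negOnePow from pow_one _]
      rfl
    -- Here `β` can enter after `[D Y_0, Y_1]`, whose operator part is the contraction with the
    -- bracket; the sign at position two is trivial.
    | 1, Y =>
      have w : courantWord dOp (contrHom (ν + 1)) (signOp (ν + 1)) degProj ν Y =
          contr (ν + 1) (Y 1) * courantWord dOp (contrHom (ν + 1)) (signOp (ν + 1)) degProj ν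
          (fun i : Fin 1 => Y i.castSucc) - contrBracket (ν + 1) (Y 0) (Y 1) := by
        rw [courantWord, revProd_castSucc, lieWord_castSucc, courantWord]
        simp [bracketWord, revProd, mul_sub, mul_assoc]
        rfl
      have s2 : i.negOnePow ^ (1 + 1) = 1 := by rw [pow_two]; simp
      rw [w, fst_iteratedBracket_succ, snd_fst_iteratedBracket_one, lOp_zero_apply, zero_add, s2,
        one_smul, LinearMap.sub_apply, contrBracket_eq, LinearMap.neg_apply, sub_neg_eq_add]
      rfl
    -- After three or more vector fields the iterated bracket is a form, so `β` in last position
    -- contributes nothing and only a contraction is added.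
    | q + 2, Y =>
      rw [fst_iteratedBracket_succ, snd_fst_iteratedBracket_add_two, lOp_zero_apply,
        iOp_zero_apply, add_zero, smul_zero, add_zero]
      have w : courantWord dOp (contrHom (ν + 1)) (signOp (ν + 1)) degProj ν Y =
          contr (ν + 1) (Y (Fin.last _)) * courantWord dOp (contrHom (ν + 1)) (signOp (ν + 1))
          degProj ν (fun i : Fin (q + 2) => Y i.castSucc) := by
        rw [courantWord, revProd_castSucc, lieWord_castSucc, bracketWord_castSucc, courantWord,
          mul_sub, mul_sub, mul_assoc]
        rfl
      rw [w]
      rfl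

lemma courantForm_bracket_form {ν : ℕ} (H : Form A (ν + 1 + 1)) {i : ℤ}
    {β : (r : Fin (ν + 1)) → Form A r} (hβ : (0, β) ∈ (courant (ν + 1) H).gr i) {q : ℕ}
    (X : Fin q → VField A) :
    courantForm (ν + 1) ((courant (ν + 1) H).bracket (q + 1) (Fin.cons (0, β) (vec _ X))) =
      courantOp dOp (contrHom (ν + 1)) (signOp (ν + 1)) degProj ν q X
        (belowIncl (ν + 1) β) := by
  match q, X with
  | 0, X =>
    have e : courantOp dOp (contrHom (ν + 1)) (signOp (ν + 1)) degProj ν 0 X =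
        (dOp - dOp * degProj ν : FormOp A) := by
      simp [courantOp, courantWord, revProd, lieWord, bracketWord, altSum]
    rw [e]
    exact courantForm_bracket_one H _
  | q + 1, X =>
    have hx : ∀ l, (Fin.cons (0, β) (vec _ X) : Fin (q + 2) → CourantSpace A (ν + 1)) l ∈
        (courant (ν + 1) H).gr ((Fin.cons i fun _ => -1 : Fin (q + 2) → ℤ) l) := by
      intro l
      induction l using Fin.cases with
      | zero => exact hβ
      | succ l => exact (isExtensionGrading_courant H).vec_mem _
    rw [courantForm_bracket_add_two (by omega) H hx, koszulSum_cons (fun _ => rfl)]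
    simp only [Fin.cons_zero, Fin.tail_cons]
    rw [courantOp, if_neg (by omega), zero_sub, LinearMap.neg_apply, LinearMap.smul_apply, neg_smul]
    congr 2
    have e : ∀ j : Fin (q + 2), i.negOnePow ^ (j : ℕ) • altSum (fun y =>
        formPart (iteratedBracket (ν + 1) H (q + 1) (j.insertNth
          (α := fun _ => CourantSpace A (ν + 1)) (0, β) y))) (vec _ X) =
        altSum (fun Y : Fin (q + 1) → VField A => i.negOnePow ^ (j : ℕ) •
        formPart (iteratedBracket (ν + 1) H (q + 1) (j.insertNth
          (α := fun _ => CourantSpace A (ν + 1)) (0, β) (vec _ Y)))) X := by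
      intro j
      rw [altSum, altSum, Finset.smul_sum]
      refine Finset.sum_congr rfl fun σ _ => ?_
      rw [smul_comm]
      rfl
    rw [Finset.sum_congr rfl fun j _ => e j, altSum_apply]
    simp only [altSum]
    rw [Finset.sum_comm]
    refine Finset.sum_congr rfl fun σ _ => ?_
    rw [← Finset.smul_sum, sum_formPart_iteratedBracket H hβ (X ∘ σ)]

lemma signOp_single (n r : ℕ) (H : Form A r) :
    signOp n (TotalForm.single r H) = (-1 : ℝ) ^ (r + n) • TotalForm.single r H := by
  refine TotalForm.ext fun t => ?_
  rw [comp_signOp, map_smul]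
  by_cases h : t = r
  · rw [h]
  · rw [TotalForm.comp_single_of_ne h, smul_zero, smul_zero]

lemma signOp_single_succ (n : ℕ) (H : Form A (n + 1)) :
    signOp n (TotalForm.single (n + 1) H) = -TotalForm.single (n + 1) H := by
  rw [signOp_single, Odd.neg_one_pow ⟨n, by ring⟩, neg_one_smul]

theorem isExtension_courant {ν : ℕ} (H : Form A (ν + 1 + 1)) :
    IsExtension (courant (ν + 1) H) (belowIncl (ν + 1)) (signOp (ν + 1))
      (courantVec (contrHom (ν + 1)))
      (courantOp dOp (contrHom (ν + 1)) (signOp (ν + 1)) degProj ν)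
      (TotalForm.single (ν + 1 + 1) H) where
  grading := isExtensionGrading_courant H
  graded := isGradedSymmetric_courant H (by omega)
  fst_bracket := fst_courant_bracket H (by omega)
  givenBy :=
    { symm := by
        intro k hk d x hx σ
        have := (isGradedSymmetric_courant H (by omega)).symm k hk d x hx σ
        refine (congrArg (courantForm (ν + 1)) this).trans ?_
        rw [Units.smul_def, Units.smul_def, map_zsmul]
        rfl
      map_vec := fun k hk X => courantForm_bracket_vec (by omega) H hk X
      map_form := fun q i β X hβ => courantForm_bracket_form H hβ X
      eq_zero := by
        intro k x i j hij hi hj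
        refine (congrArg (courantForm (ν + 1)) (courant_bracket_eq_zero H k x i j hij hi hj)).trans ?_
        exact map_zero _ }

lemma courant_isInternal {n : ℕ} (hn : 1 ≤ n) (H : Form A (n + 1)) :
    DirectSum.IsInternal (courant n H).gr := by
  classical
  refine isInternal_of_projections _ (fun i => ∑ r : Fin n,
    if i = (r : ℤ) - n then (courantComponent n r).toAddMonoidHom else 0) ?_ ?_ ?_
    (Finset.univ.image fun r : Fin n => (r : ℤ) - n) ?_
  · intro i x
    rw [AddMonoidHom.finsetSum_apply]
    refine Submodule.sum_mem _ fun r _ => ?_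
    split_ifs with h
    · rw [h]
      exact courantComponent_mem H r x
    · exact Submodule.zero_mem _
  · intro i x hx
    conv_rhs => rw [← sum_courantComponent hn x]
    rw [AddMonoidHom.finsetSum_apply]
    refine Finset.sum_congr rfl fun r _ => ?_
    split_ifs with h
    · rfl
    · exact ((courantComponent_of_mem H hx r).trans (if_neg h)).symm
  · intro i j hij x hx
    rw [AddMonoidHom.finsetSum_apply]
    refine Finset.sum_eq_zero fun r _ => ?_
    split_ifs with h
    · exact (courantComponent_of_mem H hx r).trans (if_neg (by omega))
    · rfl
  · intro x
    have hinj : Function.Injective fun r : Fin n => (r : ℤ) - n := fun r r' h =>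
      Fin.ext (by simpa using h)
    rw [Finset.sum_image fun r _ r' _ h => hinj h]
    conv_rhs => rw [← sum_courantComponent hn x]
    refine Finset.sum_congr rfl fun r _ => ?_
    rw [AddMonoidHom.finsetSum_apply, Finset.sum_eq_single r]
    · rw [if_pos rfl]
      rfl
    · intro r' _ hr'
      rw [if_neg fun h => hr' (hinj h).symm]
      rfl
    · simp

lemma degProj_single (r : ℕ) (H : Form A r) :
    degProj r (TotalForm.single r H) = TotalForm.single r H := by
  rw [degProj_apply, TotalForm.comp_single_same]

lemma dOp_single_of_closed {r : ℕ} {H : Form A r} (hH : extd H = 0) :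
    dOp (TotalForm.single r H) = 0 := by
  refine TotalForm.ext fun t => ?_
  match t with
  | 0 => rfl
  | t + 1 =>
    rw [comp_dOp_succ]
    by_cases h : t = r
    · subst h
      rw [TotalForm.comp_single_same, hH, map_zero]
    · rw [TotalForm.comp_single_of_ne h, map_zero, map_zero]

/-- Homogeneous forms of degree `< n` are concentrated in one degree. -/
lemma exists_degProj_eq {ν : ℕ} (H : Form A (ν + 1 + 1)) {i : ℤ}
    {β : (r : Fin (ν + 1)) → Form A r} (hβ : (0, β) ∈ (courant (ν + 1) H).gr i) :
    ∃ r ≤ ν, degProj r (belowIncl (ν + 1) β) = belowIncl (ν + 1) β := by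
  by_cases h : ∃ r : Fin (ν + 1), i = (r : ℤ) - (ν + 1 : ℕ)
  · obtain ⟨r, hr⟩ := h
    refine ⟨r, Nat.lt_succ_iff.mp r.isLt, TotalForm.ext fun t => ?_⟩
    rw [comp_degProj]
    split_ifs with ht
    · rfl
    · exact (comp_belowIncl_of_mem H hβ (by omega)).symm
  · push Not at h
    have h0 := eq_zero_of_mem_courant_gr H (by omega) hβ h
    have hβ0 : β = 0 := congrArg Prod.snd h0
    exact ⟨0, Nat.zero_le _, by rw [hβ0, map_zero, map_zero]⟩

theorem isLInftyAlgebra_courant {n : ℕ} (hn : 1 ≤ n) (H : Form A (n + 1)) (hH : extd H = 0) :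
    IsLInftyAlgebra (courant n H) where
  isInternal := courant_isInternal hn H
  isGradedSymmetric := isGradedSymmetric_courant H hn
  jacobi := by
    intro k hk d x hx
    obtain ⟨ν, rfl⟩ : ∃ ν, n = ν + 1 := ⟨n - 1, by omega⟩
    have hc := isCartanSystem_contr (A := A) (ν + 1)
    refine (isExtension_courant H).jacobi ?_ (signOp_single_succ _ H) ?_ ?_ hk d x hx
    · intro y
      rw [courantVec, coeff_bernPsi_of_lt (by omega), mul_zero, zero_smul]
    · intro m X
      obtain ⟨a, ha⟩ := hc.courantVec_jacobi X (ν := ν)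
      have := congrArg (fun u : FormOp A => u (TotalForm.single (ν + 1 + 1) H)) ha
      simp only [Module.End.mul_apply] at this
      have hs : degProj (ν + 2) (TotalForm.single (ν + 1 + 1) H) =
        TotalForm.single (ν + 1 + 1) H := degProj_single (ν + 1 + 1) H
      -- The remaining term applies `d` to the closed form `H`.
      rw [hs, dOp_single_of_closed hH, map_zero] at this
      exact this
    · intro m X i β hβ
      obtain ⟨r, hr, hb⟩ := exists_degProj_eq H hβ
      have := congrArg (fun u : FormOp A => u (belowIncl (ν + 1) β)) (hc.courantOp_jacobi X hr)
      simp only [Module.End.mul_apply] at this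
      rw [hb] at this
      exact this

end CourantEvaluation

/-! ### Functions as forms of degree zero -/

section Functions

variable {A : Type*} [CommRing A] [Algebra ℝ A]

/-- Functions as forms of degree `0`. -/
def zeroForm : A →ₗ[ℝ] Form A 0 where
  toFun f := AlternatingMap.constOfIsEmpty A (VField A) (Fin 0) f
  map_add' _ _ := rfl
  map_smul' _ _ := rfl

lemma zeroForm_apply (f : A) (v : Fin 0 → VField A) : zeroForm f v = f := rfl

lemma zeroForm_eq (ω : Form A 0) (v : Fin 0 → VField A) : zeroForm (ω v) = ω := by
  ext w
  rw [zeroForm_apply, Subsingleton.elim v w]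

/-- Functions as inhomogeneous forms. -/
def funIncl : A →ₗ[ℝ] TotalForm A := TotalForm.single 0 ∘ₗ zeroForm

lemma comp_funIncl_zero (f : A) : (funIncl f).comp 0 = zeroForm f :=
  TotalForm.comp_single_same 0 _

lemma funIncl_injective : Function.Injective (funIncl (A := A)) := by
  intro f g h
  have := congrArg (fun β : TotalForm A => β.comp 0 ![]) h
  simp only [comp_funIncl_zero] at this
  exact this

lemma contr_single (n r : ℕ) (X : VField A) (ω : Form A (r + 1)) :
    contr n X (TotalForm.single (r + 1) ω) =
      TotalForm.single r ((-1 : ℝ) ^ (r + n) • interior X ω) := by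
  refine TotalForm.ext fun t => ?_
  rw [comp_contr]
  by_cases h : t = r
  · subst h
    rw [TotalForm.comp_single_same, TotalForm.comp_single_same]
  · rw [TotalForm.comp_single_of_ne h, TotalForm.comp_single_of_ne (by omega), map_zero, smul_zero]

lemma revProd_contr_single (n : ℕ) {q : ℕ} (X : Fin q → VField A) (ω : Form A q) :
    revProd (contr n) X (TotalForm.single q ω) =
      funIncl ((-1 : ℝ) ^ (∑ i ∈ Finset.range q, (i + n)) • ω X) := by
  induction q with
  | zero =>
    simp only [revProd, Finset.sum_range_zero, pow_zero, one_smul]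
    change TotalForm.single 0 ω = TotalForm.single 0 (zeroForm (ω X))
    rw [zeroForm_eq]
  | succ q ih =>
    rw [revProd_succ, Module.End.mul_apply, contr_single, ih, Finset.sum_range_succ,
      AlternatingMap.smul_apply, smul_smul, ← pow_add, interior_apply]
    congr 3
    exact Matrix.cons_head_tail X

/-- The twists add up to the exponent `∑ (i + n)` over `i ≤ n`, in which the part `n (n + 1)` is
even; what remains is the sign in the top bracket of the Atiyah algebra. -/
lemma revProd_contr_single_top {n : ℕ} (X : Fin (n + 1) → VField A) (H : Form A (n + 1)) :
    revProd (contr n) X (TotalForm.single (n + 1) H) =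
      funIncl ((-1 : ℝ) ^ ((n + 1) * n / 2) • H X) := by
  rw [revProd_contr_single, Finset.sum_add_distrib, Finset.sum_range_id, Finset.sum_const,
    Finset.card_range, smul_eq_mul, pow_add, Even.neg_one_pow (n := (n + 1) * n), mul_one]
  · rfl
  · rw [mul_comm]; exact Nat.even_mul_succ_self n

lemma lOp_funIncl (X : VField A) (f : A) : lOp X (funIncl f) = funIncl (X f) := by
  refine TotalForm.ext fun r => ?_
  rw [comp_lOp]
  by_cases h : r = 0
  · subst h
    rw [comp_funIncl_zero, comp_funIncl_zero]
    ext v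
    rw [lieDeriv_apply, Finset.univ_eq_empty, Finset.sum_empty, sub_zero]
    rfl
  · rw [show (funIncl f).comp r = 0 from TotalForm.comp_single_of_ne h _,
      show (funIncl (X f)).comp r = 0 from TotalForm.comp_single_of_ne h _, map_zero]

lemma contrLie_funIncl (n : ℕ) (X : VField A) (f : A) :
    contrLie n X (funIncl f) = -funIncl ((-1 : ℝ) ^ n • X f) := by
  rw [contrLie_eq, LinearMap.neg_apply, Module.End.mul_apply, show signOp n (funIncl f) =
    (-1 : ℝ) ^ (0 + n) • funIncl f from signOp_single n 0 _, map_smul, lOp_funIncl, map_smul,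
    zero_add]

end Functions

/-! ### The Atiyah algebra and its Jacobi identities -/

section AtiyahAlgebra

variable {A : Type*} [CommRing A] [Algebra ℝ A] {n : ℕ} (H : Form A (n + 1))

lemma atiyah_bracket (k : ℕ) : (atiyah n H).bracket k =
    (if h : k = 2 then (atiyahBinary n).domDomCongr (finCongr h.symm) else 0 :
      MultilinearMap ℝ (fun _ : Fin k => AtiyahSpace A) (AtiyahSpace A)) +
    (if h : k = n + 1 then (formBracket H).domDomCongr (finCongr h.symm) else 0) := rfl

lemma atiyah_bracket_two (hn : 2 ≤ n) (x : Fin 2 → AtiyahSpace A) : (atiyah n H).bracket 2 x =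
    (⁅(x 0).1, (x 1).1⁆, (x 0).1 (x 1).2 + (-1 : ℝ) ^ n • (x 1).1 (x 0).2) := by
  rw [atiyah_bracket, add_apply, dif_pos rfl, dif_neg (by omega), zero_apply, add_zero]
  rfl

lemma atiyah_bracket_top (hn : 2 ≤ n) (x : Fin (n + 1) → AtiyahSpace A) :
    (atiyah n H).bracket (n + 1) x = (0, (-1 : ℝ) ^ ((n + 1) * n / 2) • H fun i => (x i).1) := by
  rw [atiyah_bracket, add_apply, dif_pos rfl, dif_neg (by omega), zero_apply, zero_add]
  refine Prod.ext ?_ rfl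
  exact smul_zero _

lemma atiyah_bracket_of_ne {k : ℕ} (h2 : k ≠ 2) (hk : k ≠ n + 1) (x : Fin k → AtiyahSpace A) :
    (atiyah n H).bracket k x = 0 := by
  rw [atiyah_bracket, add_apply, dif_neg h2, dif_neg hk, zero_apply, add_zero]

lemma isExtensionGrading_atiyah :
    IsExtensionGrading (atiyah n H).gr funIncl (signOp n) where
  injective := funIncl_injective
  vec_mem X := ⟨fun h => absurd rfl h, fun _ => rfl⟩
  fst_mem i x hx := ⟨hx.1, fun _ => rfl⟩
  snd_mem i x hx := ⟨fun _ => rfl, hx.2⟩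
  fst_eq_zero i hi x hx := hx.1 hi
  parity i x hx := by
    refine (signOp_single n 0 _).trans ?_
    by_cases h : i = -n
    · rw [h, Int.negOnePow_neg, Int.negOnePow_def, zpow_natCast, Units.smul_def,
        ← Int.cast_smul_eq_zsmul ℝ, zero_add]
      simp
      rfl
    · rw [hx.2 h, map_zero, map_zero, map_zero, smul_zero, smul_zero]

lemma koszulSign_swap (d : Fin 2 → ℤ) :
    koszulSign d (Equiv.swap 0 1) = (d 0 * d 1).negOnePow := by
  simp [koszulSign, Fin.prod_univ_two, mul_comm]

lemma atiyah_gr_cases {i : ℤ} {v : AtiyahSpace A} (hn : 2 ≤ n) (hv : v ∈ (atiyah n H).gr i) :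
    (i = -1 ∧ v.2 = 0) ∨ (i = -n ∧ v.1 = 0) ∨ (v.1 = 0 ∧ v.2 = 0) := by
  by_cases h1 : i = -1
  · exact Or.inl ⟨h1, hv.2 (by omega)⟩
  · by_cases h2 : i = -n
    · exact Or.inr (Or.inl ⟨h2, hv.1 h1⟩)
    · exact Or.inr (Or.inr ⟨hv.1 h1, hv.2 h2⟩)

lemma isGradedSymmetric_atiyah (hn : 2 ≤ n) :
    IsGradedSymmetric (atiyah n H).gr (atiyah n H).gr 1 (atiyah n H).bracket where
  degree k hk d x hx := by
    by_cases h2 : k = 2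
    · subst h2
      rw [atiyah_bracket_two H hn, Fin.sum_univ_two]
      have z : ∀ a b : Fin 2, d a + d b + 1 ≠ -n → (x a).1 (x b).2 = 0 := by
        intro a b h
        by_cases ha : d a = -1
        · rw [(hx b).2 (by omega), map_zero]
        · rw [(hx a).1 ha, Derivation.zero_apply]
      refine ⟨fun h => ?_, fun h => ?_⟩
      · by_cases h0 : d 0 = -1
        · exact (congrArg _ ((hx 1).1 (by omega))).trans (lie_zero _)
        · exact (congrArg (fun Y => ⁅Y, (x 1).1⁆) ((hx 0).1 h0)).trans (zero_lie _)
      · change (x 0).1 (x 1).2 + (-1 : ℝ) ^ n • (x 1).1 (x 0).2 = 0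
        rw [z 0 1 h, z 1 0 (by omega), smul_zero, add_zero]
    by_cases hk' : k = n + 1
    · subst hk'
      rw [atiyah_bracket_top H hn]
      refine ⟨fun _ => rfl, fun h => ?_⟩
      have : ∃ i, d i ≠ -1 := by
        by_contra hc
        push Not at hc
        refine h ?_
        simp [hc]
      obtain ⟨i, hi⟩ := this
      change (-1 : ℝ) ^ ((n + 1) * n / 2) • H (fun i => (x i).1) = 0
      rw [H.map_coord_zero i ((hx i).1 hi), smul_zero]
    · rw [atiyah_bracket_of_ne H h2 hk']
      exact Submodule.zero_mem _
  symm k hk d x hx σ := by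
    by_cases h2 : k = 2
    · subst h2
      have : ∀ σ : Equiv.Perm (Fin 2), σ = 1 ∨ σ = Equiv.swap 0 1 := by decide
      rcases this σ with rfl | rfl
      · rw [koszulSign_one, one_smul]
        rfl
      · rw [koszulSign_swap, atiyah_bracket_two H hn, atiyah_bracket_two H hn, Function.comp_apply,
          Function.comp_apply, Equiv.swap_apply_left, Equiv.swap_apply_right]
        have hnn : ((n : ℤ)).negOnePow = (-1 : ℤˣ) ^ n := by
          rw [Int.negOnePow_def, zpow_natCast]
        have hsq : (-1 : ℝ) ^ n * (-1 : ℝ) ^ n = 1 := by rw [← mul_pow]; simp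
        have hs : ∀ a : A, ((-1 : ℤˣ) ^ n) • a = (-1 : ℝ) ^ n • a := by
          intro a
          rw [Units.smul_def, ← Int.cast_smul_eq_zsmul ℝ]
          simp
        -- Each argument is a vector field, a function, or zero; the degrees then determine the
        -- Koszul sign.
        rcases atiyah_gr_cases H hn (hx 0) with ⟨d0, e0⟩ | ⟨d0, e0⟩ | ⟨e0, e0'⟩ <;>
          rcases atiyah_gr_cases H hn (hx 1) with ⟨d1, e1⟩ | ⟨d1, e1⟩ | ⟨e1, e1'⟩ <;>
          refine Prod.ext ?_ ?_ <;> simp [*]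
        · rw [smul_smul, hsq, one_smul]
    by_cases hk' : k = n + 1
    · subst hk'
      rw [atiyah_bracket_top H hn, atiyah_bracket_top H hn]
      by_cases hd : ∀ i, d i = -1
      · rw [koszulSign_odd hd]
        have e : H (fun i => ((x ∘ σ) i).1) = Equiv.Perm.sign σ • H fun i => (x i).1 :=
          H.map_perm (fun i => (x i).1) σ
        refine Prod.ext (smul_zero _).symm ?_
        change _ = Equiv.Perm.sign σ • (-1 : ℝ) ^ ((n + 1) * n / 2) • H (fun i => ((x ∘ σ) i).1)
        rw [e, smul_comm _ (Equiv.Perm.sign σ), smul_smul]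
        simp
      · push Not at hd
        obtain ⟨i, hi⟩ := hd
        have h0 := (hx i).1 hi
        rw [H.map_coord_zero i h0, H.map_coord_zero (σ.symm i) (by simpa using h0), smul_zero]
        exact (smul_zero _).symm
    · rw [atiyah_bracket_of_ne H h2 hk', atiyah_bracket_of_ne H h2 hk', smul_zero]

lemma fst_atiyah_bracket (hn : 2 ≤ n) (k : ℕ) (x : Fin k → AtiyahSpace A) :
    ((atiyah n H).bracket k x).1 = (tangentLie A).bracket k fun i => (x i).1 := by
  by_cases h2 : k = 2
  · subst h2
    rw [atiyah_bracket_two H hn]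
    rfl
  rw [tangentLie_bracket_of_ne h2]
  by_cases hk' : k = n + 1
  · subst hk'
    rw [atiyah_bracket_top H hn]
  · rw [atiyah_bracket_of_ne H h2 hk']
    rfl

theorem isExtension_atiyah (hn : 2 ≤ n) :
    IsExtension (atiyah n H) funIncl (signOp n) (atiyahVec (contrHom n) n)
      (atiyahOp dOp (contrHom n) degProj) (TotalForm.single (n + 1) H) where
  grading := isExtensionGrading_atiyah H
  graded := isGradedSymmetric_atiyah H hn
  fst_bracket k _ := fst_atiyah_bracket H hn k
  givenBy :=
    { symm := by
        intro k hk d x hx σ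
        have := (isGradedSymmetric_atiyah H hn).symm k hk d x hx σ
        refine (congrArg (funIncl ∘ₗ LinearMap.snd ℝ (VField A) A) this).trans ?_
        rw [Units.smul_def, Units.smul_def, map_zsmul]
        rfl
      map_vec := by
        intro k hk X
        change funIncl ((atiyah n H).bracket k (vec A X)).2 = _
        by_cases h2 : k = 2
        · subst h2
          rw [atiyah_bracket_two H hn, atiyahVec, if_neg (by omega)]
          simp [vec]
        by_cases hk' : k = n + 1
        · subst hk'
          rw [atiyah_bracket_top H hn, atiyahVec, if_pos rfl]
          exact (revProd_contr_single_top X H).symm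
        · rw [atiyah_bracket_of_ne H h2 hk', atiyahVec, if_neg hk']
          exact map_zero _
      map_form := by
        intro q i β X _
        change funIncl ((atiyah n H).bracket (q + 1) (Fin.cons (0, β) (vec A X))).2 = _
        by_cases h2 : q = 1
        · subst h2
          have e : (Fin.cons (0, β) (vec A X) : Fin 2 → AtiyahSpace A) 1 = (X 0, 0) := rfl
          have e2 : atiyahOp dOp (contrHom n) degProj 1 X = -(contrLie n (X 0) * degProj 0) := rfl
          have e3 : degProj 0 (funIncl β) = funIncl β := degProj_single 0 _
          rw [atiyah_bracket_two H hn, Fin.cons_zero, e, e2, LinearMap.neg_apply,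
            Module.End.mul_apply, e3, contrLie_funIncl, neg_neg]
          simp
        · have z : atiyahOp dOp (contrHom n) degProj q X = 0 := by
            match q, X, h2 with
            | 0, _, _ => rfl
            | _ + 2, _, _ => rfl
          rw [z, LinearMap.zero_apply]
          by_cases hk' : q = n
          · subst hk'
            rw [atiyah_bracket_top H hn]
            change funIncl ((-1 : ℝ) ^ ((q + 1) * q / 2) • H _) = 0
            rw [H.map_coord_zero 0 rfl, smul_zero, map_zero]
          · rw [atiyah_bracket_of_ne H (by omega) (by omega)]
            exact map_zero _
      eq_zero := by
        intro k x i j hij hi hj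
        change funIncl ((atiyah n H).bracket k x).2 = 0
        by_cases h2 : k = 2
        · subst h2
          have h : ∀ l, (x l).1 = 0 := by
            have : ∀ i j : Fin 2, i ≠ j → ∀ l, l = i ∨ l = j := by decide
            intro l
            rcases this i j hij l with rfl | rfl
            · exact hi
            · exact hj
          rw [atiyah_bracket_two H hn, h, h]
          simp
        by_cases hk' : k = n + 1
        · subst hk'
          rw [atiyah_bracket_top H hn]
          change funIncl ((-1 : ℝ) ^ ((n + 1) * n / 2) • H _) = 0
          rw [H.map_coord_zero i hi, smul_zero, map_zero]
        · rw [atiyah_bracket_of_ne H h2 hk']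
          exact map_zero _ }

lemma atiyah_isInternal (hn : 2 ≤ n) : DirectSum.IsInternal (atiyah n H).gr := by
  refine isInternal_of_projections _ (fun i =>
    { toFun := fun x => (if i = -1 then x.1 else 0, if i = -n then x.2 else 0)
      map_zero' := by simp
      map_add' := fun x y => Prod.ext (by dsimp only; split_ifs <;> simp)
        (by dsimp only; split_ifs <;> simp) }) ?_ ?_ ?_ {-1, -(n : ℤ)} ?_
  · exact fun i x => ⟨fun h => if_neg h, fun h => if_neg h⟩
  · intro i x hx
    refine Prod.ext ?_ ?_
    · exact ite_eq_left_iff.mpr fun h => (hx.1 h).symm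
    · exact ite_eq_left_iff.mpr fun h => (hx.2 h).symm
  · intro i j hij x hx
    refine Prod.ext ?_ ?_
    · exact ite_eq_right_iff.mpr fun h => hx.1 (by omega)
    · exact ite_eq_right_iff.mpr fun h => hx.2 (by omega)
  · intro x
    rw [Finset.sum_pair (by omega)]
    have h1 : (-(n : ℤ)) ≠ -1 := by omega
    have h2 : (-1 : ℤ) ≠ -n := by omega
    simp [h2, h1]

theorem isLInftyAlgebra_atiyah (hn : 2 ≤ n) (hH : extd H = 0) : IsLInftyAlgebra (atiyah n H) where
  isInternal := atiyah_isInternal H hn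
  isGradedSymmetric := isGradedSymmetric_atiyah H hn
  jacobi := by
    intro k hk d x hx
    have hc := isCartanSystem_contr (A := A) n
    refine (isExtension_atiyah H hn).jacobi ?_ (signOp_single_succ _ H) ?_ ?_ hk d x hx
    · intro y
      rw [atiyahVec, if_neg (by omega)]
    · intro m X
      obtain ⟨a, ha⟩ := hc.atiyahVec_jacobi X n
      have := congrArg (fun u : FormOp A => u (TotalForm.single (n + 1) H)) ha
      simp only [Module.End.mul_apply] at this
      rw [degProj_single, dOp_single_of_closed hH, map_zero] at this
      exact this
    · intro m X i β _
      exact congrArg (fun u : FormOp A => u (funIncl β)) (hc.atiyahOp_jacobi X)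

end AtiyahAlgebra

/-! ### The components of the morphism -/

section Gauge

open PowerSeries (coeff)

variable {A : Type*} [CommRing A] [Algebra ℝ A] (n : ℕ)

/-- The evaluation of the component of degree `q` of the form part of the first argument on the
vector fields of the other `q` arguments. -/
def formEval (q : ℕ) : MultilinearMap ℝ (fun _ : Fin (q + 1) => CourantSpace A n) A :=
  LinearMap.uncurryLeft
    { toFun := fun v => ((((courantForm n v).comp q).toMultilinearMap.restrictScalars
        ℝ).compLinearMap fun _ => LinearMap.fst ℝ (VField A) ((r : Fin n) → Form A r))
      map_add' := fun v w => by ext; simp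
      map_smul' := fun c v => by ext; simp }

variable {n}

lemma formEval_apply {q : ℕ} (y : Fin (q + 1) → CourantSpace A n) :
    formEval n q y = (courantForm n (y 0)).comp q fun i => (y i.succ).1 := rfl

/-- The sign of the iterated contraction of a form of degree `q`. -/
def contrSign (n q : ℕ) : ℝ := (-1) ^ (∑ i ∈ Finset.range q, (i + n))

variable (A n) in
/-- The component on forms of the `∞`-morphism: it applies a form of degree `q` to `q` vector
fields, and vanishes on other homogeneous arguments. -/
def gaugeForm : (k : ℕ) → MultilinearMap ℝ (fun _ : Fin k => CourantSpace A n) A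
  | 0 => 0
  | q + 1 => (contrSign n q * ((q + 1)! : ℝ)⁻¹) • ∑ σ : Equiv.Perm (Fin (q + 1)),
      koszulSign (Function.update (fun _ => -1) (σ 0) ((q : ℤ) - n)) σ •
        (formEval n q).domDomCongr σ

variable (A n) in
/-- The `∞`-morphism from the Courant algebra to the Atiyah algebra. -/
def gaugeMap (k : ℕ) :
    MultilinearMap ℝ (fun _ : Fin k => CourantSpace A n) (AtiyahSpace A) :=
  (if h : 1 = k then (MultilinearMap.ofSubsingleton ℝ (CourantSpace A n) (AtiyahSpace A) (0 : Fin 1)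
    (LinearMap.inl ℝ (VField A) A ∘ₗ LinearMap.fst ℝ _ _)).domDomCongr (finCongr h) else 0 :
      MultilinearMap ℝ (fun _ : Fin k => CourantSpace A n) (AtiyahSpace A)) +
  (LinearMap.inr ℝ (VField A) A).compMultilinearMap (gaugeForm A n k)

lemma snd_gaugeMap (k : ℕ) (x : Fin k → CourantSpace A n) :
    (gaugeMap A n k x).2 = gaugeForm A n k x := by
  rw [gaugeMap, add_apply, Prod.snd_add]
  have : ∀ (a : VField A × A), a.2 = 0 → a.2 + gaugeForm A n k x = gaugeForm A n k x :=
    fun a ha => by rw [ha, zero_add]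
  refine this _ ?_
  split_ifs
  · rfl
  · rfl

lemma fst_gaugeMap_of_ne {k : ℕ} (hk : k ≠ 1) (x : Fin k → CourantSpace A n) :
    (gaugeMap A n k x).1 = 0 := by
  rw [gaugeMap, add_apply, dif_neg (Ne.symm hk), zero_apply, zero_add]
  rfl

lemma fst_gaugeMap_one (x : Fin 1 → CourantSpace A n) : (gaugeMap A n 1 x).1 = (x 0).1 := by
  rw [gaugeMap, add_apply, dif_pos rfl]
  exact add_zero _

variable (H : Form A (n + 1))

lemma formEval_eq_zero {q : ℕ} {d : Fin (q + 1) → ℤ} {x : Fin (q + 1) → CourantSpace A n}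
    (hx : ∀ i, x i ∈ (courant n H).gr (d i))
    (hd : d ≠ Function.update (fun _ => -1) 0 ((q : ℤ) - n)) : formEval n q x = 0 := by
  rw [formEval_apply]
  obtain ⟨i, hi⟩ := Function.ne_iff.mp hd
  induction i using Fin.cases with
  | zero =>
    rw [Function.update_self] at hi
    rw [show (courantForm n (x 0)).comp q = 0 from comp_belowIncl_of_mem H (hx 0) hi]
    rfl
  | succ i =>
    rw [Function.update_of_ne (Fin.succ_ne_zero i)] at hi
    exact AlternatingMap.map_coord_zero _ i ((hx i.succ).1 hi)

/-- A nonzero value of `formEval` forces degree `q - n` in the first slot and `-1` in the others.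
The Koszul signs of this pattern are built into `gaugeForm`, so that it is multilinear on all
arguments and still has the correct signs on homogeneous ones. -/
lemma gaugeForm_of_mem {q : ℕ} {d : Fin (q + 1) → ℤ} {x : Fin (q + 1) → CourantSpace A n}
    (hx : ∀ i, x i ∈ (courant n H).gr (d i)) : gaugeForm A n (q + 1) x =
      (contrSign n q * ((q + 1)! : ℝ)⁻¹) • koszulSum d (formEval n q) x := by
  rw [gaugeForm, smul_apply, sum_apply]
  congr 1
  refine Finset.sum_congr rfl fun σ _ => ?_
  change koszulSign (Function.update (fun _ => -1) (σ 0) ((q : ℤ) - n)) σ • formEval n q (x ∘ σ) = _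
  by_cases h : d ∘ σ = Function.update (fun _ => -1) 0 ((q : ℤ) - n)
  · have : Function.update (fun _ => -1) (σ 0) ((q : ℤ) - n) = d := by
      funext i
      obtain ⟨j, rfl⟩ := σ.surjective i
      have hj := congrFun h j
      rw [Function.comp_apply] at hj
      rw [hj, Function.update_apply, Function.update_apply]
      simp
    rw [this]
  · rw [formEval_eq_zero H (x := x ∘ σ) (fun i => hx (σ i)) h, smul_zero, smul_zero]

lemma gaugeForm_eq_zero_of_two {k : ℕ} (x : Fin k → CourantSpace A n) (i j : Fin k) (hij : i ≠ j)
    (hi : (x i).1 = 0) (hj : (x j).1 = 0) : gaugeForm A n k x = 0 := by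
  match k, i, j with
  | 0, i, _ => exact i.elim0
  | q + 1, i, j =>
    rw [gaugeForm, smul_apply, sum_apply, Finset.sum_eq_zero, smul_zero]
    intro σ _
    change koszulSign (Function.update (fun _ => -1) (σ 0) ((q : ℤ) - n)) σ •
      formEval n q (x ∘ σ) = 0
    have key : ∀ l : Fin (q + 1), (x (σ l)).1 = 0 → l ≠ 0 → formEval n q (x ∘ σ) = 0 := by
      intro l hl hl0
      obtain ⟨l, rfl⟩ := Fin.exists_succ_eq.mpr hl0
      exact AlternatingMap.map_coord_zero _ l hl
    by_cases h : σ.symm i = 0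
    · rw [key (σ.symm j) (by simpa using hj) fun h' => hij (σ.symm.injective (h.trans h'.symm)),
        smul_zero]
    · rw [key (σ.symm i) (by simpa using hi) h, smul_zero]

lemma formEval_of_snd_eq_zero {q : ℕ} {y : Fin (q + 1) → CourantSpace A n} (h : (y 0).2 = 0) :
    formEval n q y = 0 := by
  rw [formEval_apply, show courantForm n (y 0) = 0 from
    (congrArg (belowIncl n) h).trans (map_zero _), map_zero]
  rfl

lemma gaugeForm_vec (k : ℕ) (X : Fin k → VField A) : gaugeForm A n k (vec _ X) = 0 := by
  match k, X with
  | 0, _ => rfl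
  | q + 1, X =>
    rw [gaugeForm, smul_apply, sum_apply, Finset.sum_eq_zero, smul_zero]
    intro σ _
    have h0 : formEval n q (vec ((r : Fin n) → Form A r) X ∘ σ) = 0 := formEval_of_snd_eq_zero rfl
    change koszulSign (Function.update (fun _ => -1) (σ 0) ((q : ℤ) - n)) σ •
      formEval n q (vec _ X ∘ σ) = 0
    rw [h0, smul_zero]

lemma degProj_mul_revProd (q : ℕ) (X : Fin q → VField A) :
    degProj 0 * revProd (contrHom n) X = revProd (contrHom n) X * degProj q := by
  induction q with
  | zero => simp [revProd]
  | succ q ih =>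
    have h := degProj_mul_contr n (X 0) q
    rw [revProd_succ, ← mul_assoc, ih, mul_assoc, mul_assoc]
    congr 1

/-- The coefficient of `E` and the factor `q!` combine to `1 / (q + 1)`; the projection to degree
zero selects the component of degree `q`. -/
lemma gaugeOp_apply (q : ℕ) (X : Fin q → VField A) (β : TotalForm A) :
    gaugeOp (contrHom n) degProj q X β =
      funIncl (((q ! : ℝ) * ((q + 1)! : ℝ)⁻¹ * contrSign n q) • β.comp q X) := by
  rw [gaugeOp, degProj_mul_revProd, LinearMap.smul_apply, Module.End.mul_apply, degProj_apply,
    coeff_bernE]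
  have h := revProd_contr_single n X (β.comp q)
  rw [mul_smul, mul_smul, mul_smul, map_smul, map_smul]
  exact congrArg (fun a => (q ! : ℝ) • ((q + 1)! : ℝ)⁻¹ • a) h

lemma gaugeForm_form {i : ℤ} {β : (r : Fin n) → Form A r} (hβ : (0, β) ∈ (courant n H).gr i)
    {q : ℕ} (X : Fin q → VField A) :
    funIncl (gaugeForm A n (q + 1) (Fin.cons (0, β) (vec _ X))) =
      gaugeOp (contrHom n) degProj q X (belowIncl n β) := by
  have hx : ∀ l, (Fin.cons (0, β) (vec _ X) : Fin (q + 1) → CourantSpace A n) l ∈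
      (courant n H).gr ((Fin.cons i fun _ => -1 : Fin (q + 1) → ℤ) l) := by
    intro l
    induction l using Fin.cases with
    | zero => exact hβ
    | succ l => exact (isExtensionGrading_courant H).vec_mem _
  rw [gaugeForm_of_mem H hx, koszulSum_cons (fun _ => rfl), gaugeOp_apply, Finset.sum_eq_single 0]
  · simp only [Fin.cons_zero, Fin.tail_cons, Fin.val_zero, pow_zero, one_smul]
    have e : altSum (fun y => formEval n q ((0 : Fin (q + 1)).insertNth
        (α := fun _ => CourantSpace A n) (0, β) y)) (vec _ X) =
        altSum (fun Y : Fin q → VField A => (belowIncl n β).comp q Y) X := by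
      change altSum (fun Y : Fin q → VField A => formEval n q ((0 : Fin (q + 1)).insertNth
        (α := fun _ => CourantSpace A n) (0, β) (vec _ Y))) X = _
      refine altSum_congr (fun Y => ?_) X
      rw [Fin.insertNth_zero, formEval_apply]
      rfl
    rw [e, altSum_of_alternating (fun y σ => AlternatingMap.map_perm _ y σ), smul_smul]
    congr 2
    ring
  -- In any other position of `β` the first argument is a vector field, on which `formEval`
  -- vanishes.
  · intro j _ hj
    obtain ⟨j, rfl⟩ := Fin.exists_succ_eq.mpr hj
    simp only [Fin.cons_zero, Fin.tail_cons]
    have e : ∀ Y : Fin q → VField A, formEval n q (j.succ.insertNth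
        (α := fun _ => CourantSpace A n) (0, β) (vec _ Y)) = 0 := by
      intro Y
      refine formEval_of_snd_eq_zero ?_
      rw [insertNth_of_lt _ _ _ (by simp)]
      rfl
    have := (altSum_congr e X).trans (altSum_zero X)
    refine (congrArg _ this).trans (smul_zero _)
  · simp

lemma gaugeForm_symm {k : ℕ} (d : Fin k → ℤ) (x : Fin k → CourantSpace A n)
    (hx : ∀ i, x i ∈ (courant n H).gr (d i)) (σ : Equiv.Perm (Fin k)) :
    gaugeForm A n k x = koszulSign d σ • gaugeForm A n k (x ∘ σ) := by
  match k with
  | 0 => exact (smul_zero _).symm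
  | q + 1 =>
    rw [gaugeForm_of_mem H hx, gaugeForm_of_mem H (x := x ∘ σ) (d := d ∘ σ) fun i => hx (σ i),
      koszulSum_comp d _ x σ, smul_comm]

lemma isGivenBy_gaugeForm : IsGivenBy (courant n H).gr (belowIncl n)
    (fun k => funIncl.compMultilinearMap (gaugeForm A n k)) (fun _ _ => 0)
    (gaugeOp (contrHom n) degProj) (TotalForm.single (n + 1) H) where
  symm k _ d x hx σ := by
    refine (congrArg funIncl (gaugeForm_symm H d x hx σ)).trans ?_
    rw [Units.smul_def, Units.smul_def, map_zsmul]
    rfl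
  map_vec k _ X := (congrArg funIncl (gaugeForm_vec k X)).trans (map_zero _)
  map_form _ _ _ X hβ := gaugeForm_form H hβ X
  eq_zero k x i j hij hi hj :=
    (congrArg funIncl (gaugeForm_eq_zero_of_two x i j hij hi hj)).trans (map_zero _)

lemma gaugeForm_eq_zero_of_degree {k : ℕ} {d : Fin k → ℤ} {x : Fin k → CourantSpace A n}
    (hx : ∀ i, x i ∈ (courant n H).gr (d i)) (hd : ∑ i, d i ≠ -n) : gaugeForm A n k x = 0 := by
  match k with
  | 0 => rfl
  | q + 1 =>
    rw [gaugeForm_of_mem H hx, koszulSum, Finset.sum_eq_zero, smul_zero]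
    intro σ _
    rw [formEval_eq_zero H (d := d ∘ σ) (x := x ∘ σ) (fun i => hx (σ i)), smul_zero]
    intro h
    refine hd ?_
    rw [← Equiv.sum_comp σ d]
    refine (Finset.sum_congr rfl fun i _ => congrFun h i).trans ?_
    rw [Fin.sum_univ_succ]
    simp
    ring

theorem isGradedSymmetric_gaugeMap :
    IsGradedSymmetric (courant n H).gr (atiyah n H).gr 0 (gaugeMap A n) where
  degree k hk d x hx := by
    refine ⟨fun h => ?_, fun h => ?_⟩
    · by_cases hk' : k = 1
      · subst hk'
        rw [fst_gaugeMap_one]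
        refine (hx 0).1 fun h0 => h ?_
        rw [Fin.sum_univ_one, h0, add_zero]
      · exact fst_gaugeMap_of_ne hk' x
    · rw [snd_gaugeMap]
      exact gaugeForm_eq_zero_of_degree H hx (by rwa [add_zero] at h)
  symm k hk d x hx σ := by
    refine Prod.ext ?_ ?_
    · change _ = koszulSign d σ • (gaugeMap A n k (x ∘ σ)).1
      by_cases hk' : k = 1
      · subst hk'
        rw [Subsingleton.elim σ 1, koszulSign_one, one_smul]
        rfl
      · rw [fst_gaugeMap_of_ne hk', fst_gaugeMap_of_ne hk', smul_zero]
    · change _ = koszulSign d σ • (gaugeMap A n k (x ∘ σ)).2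
      rw [snd_gaugeMap, snd_gaugeMap, gaugeForm_symm H d x hx σ]

theorem linearPart_gaugeMap (v : CourantSpace A n) :
    linearPart (gaugeMap A n) v = courantToAtiyah n v := by
  refine Prod.ext (fst_gaugeMap_one _) ?_
  rw [linearPart, snd_gaugeMap, gaugeForm, smul_apply, sum_apply,
    Finset.sum_eq_single (1 : Equiv.Perm (Fin (0 + 1)))
      (fun σ _ h => absurd (Subsingleton.elim (α := Equiv.Perm (Fin 1)) σ 1) h) (by simp),
    koszulSign_one, one_smul]
  change (contrSign n 0 * ((0 + 1)! : ℝ)⁻¹) • formEval n 0 (fun _ => v) = _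
  simp only [contrSign, Finset.sum_range_zero, pow_zero, zero_add, Nat.factorial_one, Nat.cast_one,
    inv_one, mul_one, one_smul]
  rw [formEval_apply]
  change extendForms n v.2 0 _ = extendForms n v.2 0 _
  congr 1
  exact Subsingleton.elim _ _

theorem isOver_gaugeMap : IsOver (LinearMap.fst ℝ _ _) (LinearMap.fst ℝ _ _) (gaugeMap A n) :=
  ⟨fun _ => fst_gaugeMap_one _, fun _ hk x => fst_gaugeMap_of_ne (by omega) x⟩

theorem isFibration_gaugeMap (hn : 2 ≤ n) :
    IsFibration (courant n H) (atiyah n H) (gaugeMap A n) := by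
  intro i w hw
  refine ⟨(w.1, Pi.single ⟨0, by omega⟩ (zeroForm w.2)), ⟨hw.1, fun r hr => ?_⟩, ?_⟩
  · by_cases h : r = ⟨0, by omega⟩
    · subst h
      refine (Pi.single_eq_same (M := fun r : Fin n => Form A r) ⟨0, by omega⟩
        (zeroForm w.2)).trans ?_
      rw [hw.2 (by simpa using hr), map_zero]
    · exact Pi.single_eq_of_ne (M := fun r : Fin n => Form A r) h _
  · rw [linearPart_gaugeMap]
    refine Prod.ext rfl ?_
    have e : extendForms n (Pi.single (M := fun r : Fin n => Form A r) ⟨0, by omega⟩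
        (zeroForm w.2)) 0 = zeroForm w.2 := by
      refine (dif_pos (show 0 < n by omega)).trans ?_
      exact Pi.single_eq_same (M := fun r : Fin n => Form A r) _ _
    exact congrArg (fun ω : Form A 0 => ω ![]) e

variable {B : Type*} [CommRing B] [Algebra ℝ B] (u : A →ₐ[ℝ] B)

lemma formEval_related {q : ℕ} {v : Fin (q + 1) → CourantSpace A n}
    {w : Fin (q + 1) → CourantSpace B n} (h : ∀ i, CourantRelated u (v i) (w i)) :
    formEval n q w = u (formEval n q v) := by
  rw [formEval_apply, formEval_apply]
  rcases lt_or_ge q n with hq | hq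
  · rw [show (courantForm n (w 0)).comp q = (w 0).2 ⟨q, hq⟩ from comp_belowIncl_of_lt hq _,
      show (courantForm n (v 0)).comp q = (v 0).2 ⟨q, hq⟩ from comp_belowIncl_of_lt hq _]
    exact (h 0).2 ⟨q, hq⟩ _ _ fun i => (h i.succ).1
  · rw [show (courantForm n (w 0)).comp q = 0 from comp_belowIncl_of_le hq _,
      show (courantForm n (v 0)).comp q = 0 from comp_belowIncl_of_le hq _]
    exact (map_zero u).symm

/-- The components evaluate forms on vector fields and multiply by constants, both compatible with
relatedness by its definition. -/
theorem gaugeMap_related (k : ℕ) {v : Fin k → CourantSpace A n} {w : Fin k → CourantSpace B n}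
    (h : ∀ i, CourantRelated u (v i) (w i)) :
    AtiyahRelated u (gaugeMap A n k v) (gaugeMap B n k w) := by
  refine ⟨?_, ?_⟩
  · by_cases hk : k = 1
    · subst hk
      rw [fst_gaugeMap_one, fst_gaugeMap_one]
      exact (h 0).1
    · rw [fst_gaugeMap_of_ne hk, fst_gaugeMap_of_ne hk]
      intro a
      simp
  · rw [snd_gaugeMap, snd_gaugeMap]
    match k, v, w, h with
    | 0, _, _, _ => exact (map_zero u).symm
    | q + 1, v, w, h =>
      rw [gaugeForm, gaugeForm, smul_apply, smul_apply, sum_apply, sum_apply, map_smul, map_sum]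
      congr 1
      refine Finset.sum_congr rfl fun σ _ => ?_
      change koszulSign (Function.update (fun _ => -1) (σ 0) ((q : ℤ) - n)) σ •
        formEval n q (w ∘ σ) = u (koszulSign (Function.update (fun _ => -1) (σ 0)
          ((q : ℤ) - n)) σ • formEval n q (v ∘ σ))
      rw [formEval_related u (v := v ∘ σ) (w := w ∘ σ) fun i => h (σ i), Units.smul_def,
        Units.smul_def, map_zsmul]

end Gauge

/-! ### The right-hand side of the morphism equation -/

section CompositionSums

variable {A : Type*} [CommRing A] [Algebra ℝ A] {n : ℕ} (H : Form A (n + 1))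
variable {V : Type*} [AddCommGroup V] [Module ℝ V]
variable (Φ : (k : ℕ) → MultilinearMap ℝ (fun _ : Fin k => V) (AtiyahSpace A))
  (π : V →ₗ[ℝ] VField A)

/-- The derivative of `g` along the vector field of the first argument. -/
def firstAction {q : ℕ} (g : MultilinearMap ℝ (fun _ : Fin q => V) A) :
    MultilinearMap ℝ (fun _ : Fin (q + 1) => V) A :=
  LinearMap.uncurryLeft
    { toFun := fun v => (π v : A →ₗ[ℝ] A).compMultilinearMap g
      map_add' := fun v w => by ext; simp
      map_smul' := fun c v => by ext; simp }

/-- The derivative of `g` along the vector field of the last argument. -/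
def lastAction {q : ℕ} (g : MultilinearMap ℝ (fun _ : Fin q => V) A) :
    MultilinearMap ℝ (fun _ : Fin (q + 1) => V) A :=
  MultilinearMap.uncurryRight
    ((LinearMap.mk₂ ℝ (fun (a : A) (v : V) => π v a) (fun a b v => map_add _ a b)
      (fun c a v => (π v).map_smul c a) (fun a v w => by simp)
      (fun c a v => by simp)).compMultilinearMap g)

lemma firstAction_apply {q : ℕ} (g : MultilinearMap ℝ (fun _ : Fin q => V) A)
    (y : Fin (q + 1) → V) : firstAction π g y = π (y 0) (g (Fin.tail y)) := rfl

lemma lastAction_apply {q : ℕ} (g : MultilinearMap ℝ (fun _ : Fin q => V) A)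
    (y : Fin (q + 1) → V) :
    lastAction π g y = π (y (Fin.last q)) (g fun i => y i.castSucc) := rfl

variable (n) in
/-- The sum of the binary brackets of the values of `Φ`, on functions. -/
def pairMap : (k : ℕ) → MultilinearMap ℝ (fun _ : Fin k => V) A
  | 0 => 0
  | 1 => 0
  | m + 2 => (2 * ((m + 1)! : ℝ))⁻¹ •
      (firstAction π ((LinearMap.snd ℝ (VField A) A).compMultilinearMap (Φ (m + 1))) +
      (-1 : ℝ) ^ n • lastAction π ((LinearMap.snd ℝ (VField A) A).compMultilinearMap (Φ (m + 1))))

/-- The brackets of vector fields in the Atiyah algebra, on functions. -/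
def topMap (k : ℕ) : MultilinearMap ℝ (fun _ : Fin k => V) A :=
  (k ! : ℝ)⁻¹ • ((LinearMap.snd ℝ (VField A) A).compMultilinearMap
    ((atiyah n H).bracket k)).compLinearMap fun _ => LinearMap.inl ℝ (VField A) A ∘ₗ π

/-- The values of `Φ` on the blocks of a composition. -/
def blockValues {k : ℕ} (c : Composition k) (y : Fin k → V) (i : Fin c.length) : AtiyahSpace A :=
  Φ (c.blocksFun i) fun j => y (c.embedding i j)

lemma bracketOfMaps_eq_sum (T : LInftyData (AtiyahSpace A)) (k : ℕ) (d : Fin k → ℤ)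
    (x : Fin k → V) : bracketOfMaps T Φ k d x =
      ∑ c : Composition k, ((c.length ! : ℝ) * ∏ i, ((c.blocksFun i)! : ℝ))⁻¹ •
        koszulSum d (fun y => T.bracket c.length (blockValues Φ c y)) x := rfl

variable {Φ π} (hone : ∀ u : Fin 1 → V, (Φ 1 u).1 = π (u 0))
  (hne : ∀ k, k ≠ 1 → ∀ u : Fin k → V, (Φ k u).1 = 0)

include hone in
lemma fst_map_of_eq_one {b : ℕ} (hb : b = 1) (u : Fin b → V) :
    (Φ b u).1 = π (u ⟨0, by omega⟩) := by
  subst hb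
  exact hone u

include hne in
lemma fst_blockValues_of_ne_ones {k : ℕ} {c : Composition k} (hc : c ≠ Composition.ones k) :
    ∃ i, ∀ y, (blockValues Φ c y i).1 = 0 := by
  obtain ⟨b, hb, hb1⟩ := Composition.ne_ones_iff.mp hc
  rw [← Composition.ofFn_blocksFun, List.mem_ofFn', Set.mem_range] at hb
  obtain ⟨i, rfl⟩ := hb
  exact ⟨i, fun y => hne _ (by omega) _⟩

lemma multilinear_congr_length {W Z : Type*} [AddCommGroup W] [Module ℝ W] [AddCommGroup Z]
    [Module ℝ Z] (B : (l : ℕ) → MultilinearMap ℝ (fun _ : Fin l => W) Z) {l k : ℕ} (h : l = k)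
    (z : Fin l → W) (w : Fin k → W) (hz : ∀ i, z i = w (Fin.cast h i)) : B l z = B k w := by
  subst h
  congr 1
  exact funext hz

include hone in
lemma fst_blockValues_ones {k : ℕ} (y : Fin k → V) (i : Fin (Composition.ones k).length) :
    (blockValues Φ (Composition.ones k) y i).1 =
      π (y (Fin.cast (Composition.ones_length k) i)) := by
  rw [blockValues, fst_map_of_eq_one hone (Composition.ones_blocksFun k i)]
  congr 2
  rw [Composition.ones_embedding]
  rfl

include hone hne in
-- Only `Φ_1` has a vector component, so an operation that depends on vector components alone sees
-- only the composition into blocks of size one.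
lemma sum_composition_fst {Z : Type*} [AddCommGroup Z] [Module ℝ Z]
    (B : (l : ℕ) → MultilinearMap ℝ (fun _ : Fin l => VField A) Z) (k : ℕ) (d : Fin k → ℤ)
    (x : Fin k → V) :
    ∑ c : Composition k, ((c.length ! : ℝ) * ∏ i, ((c.blocksFun i)! : ℝ))⁻¹ •
      koszulSum d (fun y => B c.length fun i => (blockValues Φ c y i).1) x =
      (k ! : ℝ)⁻¹ • koszulSum d (fun y => B k fun i => π (y i)) x := by
  rw [Finset.sum_eq_single (Composition.ones k)]
  · congr 1
    · congr 1
      have hp : ∏ i, (((Composition.ones k).blocksFun i)! : ℝ) = 1 := Finset.prod_eq_one fun i _ => by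
        rw [Composition.ones_blocksFun, Nat.factorial_one, Nat.cast_one]
      rw [hp, mul_one, Composition.ones_length]
    · refine Finset.sum_congr rfl fun σ _ => congrArg _ ?_
      exact multilinear_congr_length B (Composition.ones_length k) _ _
        fun i => fst_blockValues_ones hone (x ∘ σ) i
  · intro c _ hc
    obtain ⟨i, hi⟩ := fst_blockValues_of_ne_ones hne hc
    rw [koszulSum, Finset.sum_eq_zero, smul_zero]
    intro σ _
    rw [(B c.length).map_coord_zero i (hi _), smul_zero]
  · simp

/-- The value of the binary bracket of the Atiyah algebra on functions. -/
def pairValue (n : ℕ) {l : ℕ} (z : Fin l → AtiyahSpace A) : A :=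
  if h : l = 2 then (z ⟨0, by omega⟩).1 (z ⟨1, by omega⟩).2 +
    (-1 : ℝ) ^ n • (z ⟨1, by omega⟩).1 (z ⟨0, by omega⟩).2 else 0

lemma snd_atiyah_bracket (hn : 2 ≤ n) {l : ℕ} (z : Fin l → AtiyahSpace A) :
    ((atiyah n H).bracket l z).2 =
      pairValue n z + ((atiyah n H).bracket l fun i => ((z i).1, 0)).2 := by
  by_cases h2 : l = 2
  · subst h2
    rw [atiyah_bracket_two H hn, atiyah_bracket_two H hn, pairValue, dif_pos rfl]
    simp
  rw [pairValue, dif_neg h2, zero_add]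
  by_cases hk : l = n + 1
  · subst hk
    rw [atiyah_bracket_top H hn, atiyah_bracket_top H hn]
  · rw [atiyah_bracket_of_ne H h2 hk, atiyah_bracket_of_ne H h2 hk]

omit [AddCommGroup V] [Module ℝ V] in
lemma koszulSum_add {k : ℕ} {Z : Type*} [AddCommGroup Z] (d : Fin k → ℤ) (F G : (Fin k → V) → Z)
    (x : Fin k → V) : koszulSum d (fun y => F y + G y) x = koszulSum d F x + koszulSum d G x := by
  simp only [koszulSum, smul_add, Finset.sum_add_distrib]

omit [AddCommGroup V] [Module ℝ V] in
lemma koszulSum_smul {k : ℕ} {Z : Type*} [AddCommGroup Z] [Module ℝ Z] (d : Fin k → ℤ) (a : ℝ)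
    (F : (Fin k → V) → Z) (x : Fin k → V) :
    koszulSum d (fun y => a • F y) x = a • koszulSum d F x := by
  simp only [koszulSum, Finset.smul_sum]
  exact Finset.sum_congr rfl fun σ _ => smul_comm _ _ _

/-- A composition with two blocks. -/
def twoBlocks {k : ℕ} (a b : ℕ) (ha : 0 < a) (hb : 0 < b) (h : a + b = k) : Composition k where
  blocks := [a, b]
  blocks_pos := by
    intro i hi
    rcases List.mem_pair.mp hi with rfl | rfl
    · exact ha
    · exact hb
  blocks_sum := by simpa using h

lemma pairValue_twoBlocks {k : ℕ} (n a b : ℕ) (ha : 0 < a) (hb : 0 < b) (h : a + b = k)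
    (y : Fin k → V) : pairValue n (blockValues Φ (twoBlocks a b ha hb h) y) =
      (Φ a fun j => y ⟨j, by omega⟩).1 (Φ b fun j => y ⟨a + j, by omega⟩).2 +
      (-1 : ℝ) ^ n • (Φ b fun j => y ⟨a + j, by omega⟩).1 (Φ a fun j => y ⟨j, by omega⟩).2 := by
  have e0 : blockValues Φ (twoBlocks a b ha hb h) y ⟨0, Nat.zero_lt_two⟩ =
      Φ a fun j => y ⟨j, by omega⟩ := by
    change Φ a _ = Φ a _
    congr 1
    funext j
    congr 1
    ext
    simp [Composition.coe_embedding, Composition.sizeUpTo]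
  have e1 : blockValues Φ (twoBlocks a b ha hb h) y ⟨1, Nat.one_lt_two⟩ =
      Φ b fun j => y ⟨a + j, by omega⟩ := by
    change Φ b _ = Φ b _
    congr 1
  rw [pairValue, dif_pos (show (twoBlocks a b ha hb h).length = 2 from rfl), e0, e1]

lemma exists_eq_twoBlocks {k : ℕ} (c : Composition k) (hc : c.length = 2) :
    ∃ (a b : ℕ) (ha : 0 < a) (hb : 0 < b) (h : a + b = k), c = twoBlocks a b ha hb h := by
  obtain ⟨a, b, hab⟩ := List.length_eq_two.mp hc
  have hs := c.blocks_sum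
  rw [hab] at hs
  refine ⟨a, b, c.blocks_pos (by simp [hab]), c.blocks_pos (by simp [hab]), by simpa using hs, ?_⟩
  exact Composition.ext hab

lemma weight_twoBlocks {k : ℕ} (a b : ℕ) (ha : 0 < a) (hb : 0 < b) (h : a + b = k) :
    ((((twoBlocks a b ha hb h).length)! : ℝ) *
      ∏ i, (((twoBlocks a b ha hb h).blocksFun i)! : ℝ)) = 2 * ((a ! : ℝ) * (b ! : ℝ)) := by
  have e : ∏ i, (((twoBlocks a b ha hb h).blocksFun i)! : ℝ) = (a ! : ℝ) * (b ! : ℝ) :=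
    Fin.prod_univ_two (fun i : Fin 2 => (((twoBlocks a b ha hb h).blocksFun i)! : ℝ))
  rw [e, show (twoBlocks a b ha hb h).length = 2 from rfl]
  norm_num

include hone hne in
-- The binary bracket on functions needs a vector component in one block, which must then have size
-- one. So only the compositions `1 + (m + 1)` and `(m + 1) + 1` contribute.
lemma sum_composition_pair (n k : ℕ) (d : Fin k → ℤ) (x : Fin k → V) :
    ∑ c : Composition k, ((c.length ! : ℝ) * ∏ i, ((c.blocksFun i)! : ℝ))⁻¹ •
      koszulSum d (fun y => pairValue n (blockValues Φ c y)) x =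
      koszulSum d (pairMap n Φ π k) x := by
  have hz : ∀ c : Composition k, (∀ y, pairValue n (blockValues Φ c y) = 0) →
      ((c.length ! : ℝ) * ∏ i, ((c.blocksFun i)! : ℝ))⁻¹ •
        koszulSum d (fun y => pairValue n (blockValues Φ c y)) x = 0 := by
    intro c hc
    rw [koszulSum, Finset.sum_eq_zero, smul_zero]
    exact fun σ _ => by rw [hc, smul_zero]
  have hz2 : ∀ c : Composition k, c.length ≠ 2 → ((c.length ! : ℝ) *
      ∏ i, ((c.blocksFun i)! : ℝ))⁻¹ •
        koszulSum d (fun y => pairValue n (blockValues Φ c y)) x = 0 :=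
    fun c hc => hz c fun y => dif_neg hc
  match k with
  | 0 =>
    rw [Finset.sum_eq_zero fun c _ => hz2 c (by have := c.length_le; omega)]
    exact (Finset.sum_eq_zero fun σ _ => smul_zero _).symm
  | 1 =>
    rw [Finset.sum_eq_zero fun c _ => hz2 c (by have := c.length_le; omega)]
    exact (Finset.sum_eq_zero fun σ _ => smul_zero _).symm
  | m + 2 =>
    have h1 : ∀ y : Fin (m + 2) → V, pairValue n (blockValues Φ (twoBlocks 1 (m + 1) (by omega)
        (by omega) (by omega)) y) = firstAction π ((LinearMap.snd ℝ (VField A) A).compMultilinearMap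
          (Φ (m + 1))) y + (-1 : ℝ) ^ n • (Φ (m + 1) fun j => y ⟨1 + j, by omega⟩).1
            (Φ 1 fun j => y ⟨j, by omega⟩).2 := by
      intro y
      rw [pairValue_twoBlocks, hone, firstAction_apply]
      congr 4
      funext j
      exact congrArg y (Fin.ext (add_comm _ _))
    have h2 : ∀ y : Fin (m + 2) → V, pairValue n (blockValues Φ (twoBlocks (m + 1) 1 (by omega)
        (by omega) (by omega)) y) = (Φ (m + 1) fun j => y ⟨j, by omega⟩).1
          (Φ 1 fun j => y ⟨m + 1 + j, by omega⟩).2 + (-1 : ℝ) ^ n • lastAction π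
            ((LinearMap.snd ℝ (VField A) A).compMultilinearMap (Φ (m + 1))) y := by
      intro y
      rw [pairValue_twoBlocks, hone, lastAction_apply]
      rfl
    rw [pairMap]
    have hR : koszulSum d ((2 * ((m + 1)! : ℝ))⁻¹ •
        (firstAction π ((LinearMap.snd ℝ (VField A) A).compMultilinearMap (Φ (m + 1))) +
        (-1 : ℝ) ^ n • lastAction π ((LinearMap.snd ℝ (VField A) A).compMultilinearMap
          (Φ (m + 1)))) : MultilinearMap ℝ (fun _ : Fin (m + 2) => V) A) x =
        (2 * ((m + 1)! : ℝ))⁻¹ • koszulSum d (fun y =>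
        firstAction π ((LinearMap.snd ℝ (VField A) A).compMultilinearMap (Φ (m + 1))) y +
        (-1 : ℝ) ^ n • lastAction π ((LinearMap.snd ℝ (VField A) A).compMultilinearMap
          (Φ (m + 1))) y) x := by
      rw [← koszulSum_smul]
      rfl
    rw [hR]
    -- For `m = 0` the two compositions coincide, and the single one contributes both summands.
    rcases Nat.eq_zero_or_pos m with rfl | hm
    · rw [Finset.sum_eq_single (twoBlocks 1 1 (by omega) (by omega) (by omega))]
      · rw [weight_twoBlocks]
        congr 1
        · simp
        · refine Finset.sum_congr rfl fun σ _ => congrArg _ ?_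
          refine (h1 (x ∘ σ)).trans ?_
          have h3 : (Φ (0 + 1) fun j => (x ∘ σ) ⟨1 + j, by omega⟩).1 = π ((x ∘ σ) (Fin.last 1)) :=
            hone _
          rw [h3]
          rfl
      · intro c _ hc
        refine hz2 c fun h => ?_
        obtain ⟨a, b, ha, hb, hab, rfl⟩ := exists_eq_twoBlocks c h
        obtain rfl : a = 1 := by omega
        obtain rfl : b = 1 := by omega
        exact hc rfl
      · simp
    · rw [Fintype.sum_eq_add (twoBlocks 1 (m + 1) (by omega) (by omega) (by omega))
        (twoBlocks (m + 1) 1 (by omega) (by omega) (by omega))]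
      · rw [weight_twoBlocks, weight_twoBlocks, koszulSum_add, smul_add]
        congr 1
        · congr 1
          · simp
          · refine Finset.sum_congr rfl fun σ _ => congrArg _ ?_
            refine (h1 (x ∘ σ)).trans ?_
            rw [hne (m + 1) (by omega), Derivation.zero_apply, smul_zero, add_zero]
        · congr 1
          · simp
          · refine Finset.sum_congr rfl fun σ _ => congrArg _ ?_
            refine (h2 (x ∘ σ)).trans ?_
            rw [hne (m + 1) (by omega), Derivation.zero_apply, zero_add]
      · intro h
        have := congrArg Composition.blocks h
        simp [twoBlocks] at this
        omega
      · rintro c ⟨hc1, hc2⟩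
        by_cases h : c.length = 2
        · obtain ⟨a, b, ha, hb, hab, rfl⟩ := exists_eq_twoBlocks c h
          refine hz _ fun y => ?_
          have ha1 : a ≠ 1 := by
            rintro rfl
            obtain rfl : b = m + 1 := by omega
            exact hc1 rfl
          have hb1 : b ≠ 1 := by
            rintro rfl
            obtain rfl : a = m + 1 := by omega
            exact hc2 rfl
          rw [pairValue_twoBlocks, hne a ha1, hne b hb1]
          simp
        · exact hz2 c h

include hone hne

theorem fst_bracketOfMaps (hn : 2 ≤ n) (k : ℕ) (d : Fin k → ℤ) (x : Fin k → V) :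
    (bracketOfMaps (atiyah n H) Φ k d x).1 =
      (k ! : ℝ)⁻¹ • koszulSum d (fun y => (tangentLie A).bracket k fun i => π (y i)) x := by
  rw [bracketOfMaps_eq_sum, ← sum_composition_fst hone hne (tangentLie A).bracket k d x,
    Prod.fst_sum]
  refine Finset.sum_congr rfl fun c _ => ?_
  rw [Prod.smul_fst]
  congr 1
  refine map_koszulSum_units (LinearMap.fst ℝ (VField A) A) d _ _ (fun y => ?_) x
  exact fst_atiyah_bracket H hn _ _

theorem snd_bracketOfMaps (hn : 2 ≤ n) (k : ℕ) (d : Fin k → ℤ) (x : Fin k → V) :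
    (bracketOfMaps (atiyah n H) Φ k d x).2 =
      koszulMap d (pairMap n Φ π k + topMap H π k) x := by
  have htop := sum_composition_fst hone hne (fun l => ((LinearMap.snd ℝ (VField A)
    A).compMultilinearMap ((atiyah n H).bracket l)).compLinearMap fun _ =>
      LinearMap.inl ℝ (VField A) A) k d x
  have e : koszulMap d (pairMap n Φ π k + topMap H π k) x =
      koszulSum d (pairMap n Φ π k) x + (k ! : ℝ)⁻¹ • koszulSum d (fun y =>
        ((LinearMap.snd ℝ (VField A) A).compMultilinearMap
          ((atiyah n H).bracket k)).compLinearMap (fun _ => LinearMap.inl ℝ (VField A) A)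
            fun i => π (y i)) x := by
    rw [koszulMap_apply, ← koszulSum_smul, ← koszulSum_add]
    rfl
  rw [e, ← sum_composition_pair hone hne, ← htop, bracketOfMaps_eq_sum, Prod.snd_sum,
    ← Finset.sum_add_distrib]
  refine Finset.sum_congr rfl fun c _ => ?_
  rw [← smul_add, ← koszulSum_add, Prod.smul_snd]
  congr 1
  refine map_koszulSum_units (LinearMap.snd ℝ (VField A) A) d _ _ (fun y => ?_) x
  exact snd_atiyah_bracket H hn _

end CompositionSums

/-! ### Both sides of the morphism equation on pure arguments -/

section Morphism

variable {A : Type*} [CommRing A] [Algebra ℝ A] {n : ℕ}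

/-- The operator with `q` vector fields sees only the `q`-form component of `β`, so the parity of
the degree may be replaced by that of `q + n`. -/
lemma gaugeOp_mul_signOp {i : ℤ} (H : Form A (n + 1)) {β : (r : Fin n) → Form A r}
    (hβ : (0, β) ∈ (courant n H).gr i) {q : ℕ} (X : Fin q → VField A) :
    i.negOnePow • gaugeOp (contrHom n) degProj q X (belowIncl n β) =
      (-1 : ℝ) ^ (q + n) • gaugeOp (contrHom n) degProj q X (belowIncl n β) := by
  have h := congrArg (fun ω : TotalForm A => gaugeOp (contrHom n) degProj q X ω) ((isExtensionGrading_courant H).parity i _ hβ)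
  simp only [Units.smul_def, map_zsmul] at h
  rw [Units.smul_def, ← h, gaugeOp_apply, gaugeOp_apply, comp_signOp, ← map_smul funIncl]
  congr 1
  exact smul_comm _ _ _

lemma init_insertNth_castSucc {V : Type*} {q : ℕ} (j : Fin (q + 1)) (b : V)
    (Y : Fin (q + 1) → V) :
    (fun i : Fin (q + 1) => j.castSucc.insertNth (α := fun _ => V) b Y i.castSucc) =
      j.insertNth (α := fun _ => V) b fun i => Y i.castSucc := by
  funext l
  have := insertNth_restrict (a := 0) j.castSucc b Y j (by simp) (by omega) l
  refine Eq.trans ?_ (this.trans ?_)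
  · exact congrArg _ (Fin.ext (zero_add _).symm)
  · congr 1
    funext t
    exact congrArg Y (Fin.ext (zero_add _))

variable (n) in
/-- The Lie derivative along the last vector field, after the gauge transformation by the other
ones. -/
def lieGauge (β : TotalForm A) {q : ℕ} (Y : Fin (q + 1) → VField A) : TotalForm A :=
  lOp (Y (Fin.last q)) (gaugeOp (contrHom n) degProj q (fun i => Y i.castSucc) β)

lemma lieSum_gaugeOp (β : TotalForm A) {q : ℕ} (X : Fin (q + 1) → VField A) :
    lieSum dOp (contrHom n) (gaugeOp (contrHom n) degProj) X β =
      -((q ! : ℝ)⁻¹ • (-1 : ℝ) ^ n • altSum (lieGauge n β) X) := by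
  rw [← smul_neg, ← smul_neg, lieSum, LinearMap.smul_apply]
  congr 1
  have e : ∀ Y : Fin (q + 1) → VField A, (lieTerm dOp (contrHom n) (Y (Fin.last q)) *
      gaugeOp (contrHom n) degProj q (fun i => Y i.castSucc)) β =
        (-1 : ℝ) ^ n • (-1 : ℝ) • lieGauge n β Y := by
    intro Y
    rw [Module.End.mul_apply, lieGauge, gaugeOp_apply, lOp_funIncl]
    refine (contrLie_funIncl n _ _).trans ?_
    rw [map_smul, neg_one_smul, smul_neg]
  have h := map_altSum (LinearMap.applyₗ (R := ℝ) (M := TotalForm A) (M₂ := TotalForm A) β)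
    (fun Y : Fin (q + 1) → VField A => lieTerm dOp (contrHom n) (Y (Fin.last q)) *
      gaugeOp (contrHom n) degProj q (fun i => Y i.castSucc)) X
  refine h.trans ((altSum_congr e X).trans ?_)
  rw [altSum_smul, altSum_smul, neg_one_smul]

variable (H : Form A (n + 1))

/-- Moving the first vector field past the other `q` gives `(-1)^q`, and together with the parity
`(-1)^(q + n)` this is `(-1)^n`, the sign in the binary bracket. Hence differentiation along the
first and along the last argument contribute the same. -/
lemma altSum_lieGauge_rotate {i : ℤ} {β : (r : Fin n) → Form A r}
    (hβ : (0, β) ∈ (courant n H).gr i) {q : ℕ} (X : Fin (q + 1) → VField A) :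
    i.negOnePow • altSum (fun Y => lieGauge n (belowIncl n β) (Y ∘ finRotate (q + 1))) X =
      (-1 : ℝ) ^ n • altSum (lieGauge n (belowIncl n β)) X := by
  have e : ∀ Y : Fin (q + 1) → VField A, i.negOnePow • lieGauge n (belowIncl n β) Y =
      (-1 : ℝ) ^ (q + n) • lieGauge n (belowIncl n β) Y := by
    intro Y
    rw [lieGauge, Units.smul_def, ← map_zsmul, ← Units.smul_def, gaugeOp_mul_signOp H hβ, map_smul]
  have e2 : i.negOnePow • altSum (lieGauge n (belowIncl n β)) X =
      (-1 : ℝ) ^ (q + n) • altSum (lieGauge n (belowIncl n β)) X := by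
    rw [← altSum_smul, ← altSum_congr e, altSum, altSum, Finset.smul_sum]
    exact Finset.sum_congr rfl fun σ _ => smul_comm _ _ _
  rw [altSum_comp_right, smul_comm, e2, sign_finRotate, Units.smul_def]
  push_cast
  rw [← Int.cast_smul_eq_zsmul ℝ, smul_smul]
  congr 1
  push_cast
  rw [pow_add, ← mul_assoc, ← mul_pow]
  norm_num

lemma firstAction_insertNth_succ {i : ℤ} {β : (r : Fin n) → Form A r}
    (hβ : (0, β) ∈ (courant n H).gr i) {q : ℕ} (j : Fin (q + 1)) (Y : Fin (q + 1) → VField A) :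
    funIncl (firstAction (LinearMap.fst ℝ _ _) (gaugeForm A n (q + 1))
      (j.succ.insertNth (α := fun _ => CourantSpace A n) (0, β) (vec _ Y))) =
      i.negOnePow ^ (j : ℕ) • lieGauge n (belowIncl n β) (Y ∘ finRotate (q + 1)) := by
  have h := (isGivenBy_gaugeForm H).map_insertNth (isExtensionGrading_courant H) j hβ (Fin.tail Y)
  rw [firstAction_apply, tail_insertNth_succ, insertNth_of_lt _ _ _ (by simp), ← lOp_funIncl]
  refine (congrArg (lOp (Y 0)) h).trans ?_
  rw [Units.smul_def, map_zsmul, ← Units.smul_def]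
  congr 1
  rw [lieGauge]
  congr 1
  · simp
  · congr 2
    funext t
    simp [Fin.tail]

lemma lastAction_insertNth_castSucc {i : ℤ} {β : (r : Fin n) → Form A r}
    (hβ : (0, β) ∈ (courant n H).gr i) {q : ℕ} (j : Fin (q + 1)) (Y : Fin (q + 1) → VField A) :
    funIncl (lastAction (LinearMap.fst ℝ _ _) (gaugeForm A n (q + 1))
      (j.castSucc.insertNth (α := fun _ => CourantSpace A n) (0, β) (vec _ Y))) =
      i.negOnePow ^ (j : ℕ) • lieGauge n (belowIncl n β) Y := by
  have h := (isGivenBy_gaugeForm H).map_insertNth (isExtensionGrading_courant H) j hβ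
    fun t => Y t.castSucc
  rw [lastAction_apply, init_insertNth_castSucc, insertNth_of_gt _ _ _ (by simp; omega),
    ← lOp_funIncl]
  refine (congrArg (lOp _) h).trans ?_
  rw [Units.smul_def, map_zsmul, ← Units.smul_def]
  rfl

lemma koszulSum_firstAction {i : ℤ} {β : (r : Fin n) → Form A r}
    (hβ : (0, β) ∈ (courant n H).gr i) {q : ℕ} (X : Fin (q + 1) → VField A) :
    funIncl (koszulSum (Fin.cons i fun _ => -1) (firstAction (LinearMap.fst ℝ _ _)
      (gaugeForm A n (q + 1))) (Fin.cons (0, β) (vec _ X))) =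
      ((q : ℝ) + 1) • (-1 : ℝ) ^ n • altSum (lieGauge n (belowIncl n β)) X := by
  rw [map_koszulSum, koszulSum_cons (fun _ => rfl), Fin.sum_univ_succ]
  simp only [Fin.cons_zero, Fin.tail_cons]
  have h0 : altSum (fun y => funIncl (firstAction (LinearMap.fst ℝ _ _) (gaugeForm A n (q + 1))
      ((0 : Fin (q + 2)).insertNth (α := fun _ => CourantSpace A n) (0, β) y))) (vec _ X) = 0 := by
    refine (altSum_congr (fun y => ?_) _).trans (altSum_zero _)
    rw [firstAction_apply, Fin.insertNth_apply_same, LinearMap.fst_apply, Derivation.zero_apply,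
      map_zero]
  have h1 : ∀ j : Fin (q + 1), altSum (fun y => funIncl (firstAction (LinearMap.fst ℝ _ _)
      (gaugeForm A n (q + 1)) (j.succ.insertNth (α := fun _ => CourantSpace A n) (0, β) y)))
        (vec _ X) = i.negOnePow ^ (j : ℕ) •
          altSum (fun Y => lieGauge n (belowIncl n β) (Y ∘ finRotate (q + 1))) X := by
    intro j
    refine (altSum_congr (fun Y => firstAction_insertNth_succ H hβ j Y) X).trans ?_
    rw [altSum, altSum, Finset.smul_sum]
    exact Finset.sum_congr rfl fun σ _ => smul_comm _ _ _
  rw [h0, smul_zero, zero_add, Finset.sum_congr rfl fun j _ => by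
    rw [h1, smul_smul, Fin.val_succ, pow_succ', mul_assoc, ← mul_pow, Int.units_mul_self, one_pow,
      mul_one, altSum_lieGauge_rotate H hβ]]
  rw [Finset.sum_const, Finset.card_univ, Fintype.card_fin, ← Nat.cast_smul_eq_nsmul ℝ]
  push_cast
  rfl

lemma koszulSum_lastAction {i : ℤ} {β : (r : Fin n) → Form A r}
    (hβ : (0, β) ∈ (courant n H).gr i) {q : ℕ} (X : Fin (q + 1) → VField A) :
    funIncl (koszulSum (Fin.cons i fun _ => -1) (lastAction (LinearMap.fst ℝ _ _)
      (gaugeForm A n (q + 1))) (Fin.cons (0, β) (vec _ X))) =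
      ((q : ℝ) + 1) • altSum (lieGauge n (belowIncl n β)) X := by
  rw [map_koszulSum, koszulSum_cons (fun _ => rfl), Fin.sum_univ_castSucc]
  simp only [Fin.cons_zero, Fin.tail_cons]
  have h0 : altSum (fun y => funIncl (lastAction (LinearMap.fst ℝ _ _) (gaugeForm A n (q + 1))
      ((Fin.last (q + 1)).insertNth (α := fun _ => CourantSpace A n) (0, β) y))) (vec _ X) = 0 := by
    refine (altSum_congr (fun y => ?_) _).trans (altSum_zero _)
    rw [lastAction_apply, Fin.insertNth_apply_same, LinearMap.fst_apply, Derivation.zero_apply,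
      map_zero]
  have h1 : ∀ j : Fin (q + 1), altSum (fun y => funIncl (lastAction (LinearMap.fst ℝ _ _)
      (gaugeForm A n (q + 1)) (j.castSucc.insertNth (α := fun _ => CourantSpace A n) (0, β) y)))
        (vec _ X) = i.negOnePow ^ (j : ℕ) • altSum (lieGauge n (belowIncl n β)) X := by
    intro j
    refine (altSum_congr (fun Y => lastAction_insertNth_castSucc H hβ j Y) X).trans ?_
    rw [altSum, altSum, Finset.smul_sum]
    exact Finset.sum_congr rfl fun σ _ => smul_comm _ _ _
  rw [h0, smul_zero, add_zero, Finset.sum_congr rfl fun j _ => by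
    rw [h1, smul_smul, Fin.val_castSucc, ← mul_pow, Int.units_mul_self, one_pow, one_smul]]
  rw [Finset.sum_const, Finset.card_univ, Fintype.card_fin, ← Nat.cast_smul_eq_nsmul ℝ]
  push_cast
  rfl

lemma snd_comp_gaugeMap (k : ℕ) :
    (LinearMap.snd ℝ (VField A) A).compMultilinearMap (gaugeMap A n k) = gaugeForm A n k :=
  MultilinearMap.ext fun x => snd_gaugeMap k x

lemma koszulSum_pairMap_form {i : ℤ} {β : (r : Fin n) → Form A r}
    (hβ : (0, β) ∈ (courant n H).gr i) {m : ℕ} (X : Fin m → VField A) :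
    funIncl (koszulSum (Fin.cons i fun _ => -1) (pairMap n (gaugeMap A n) (LinearMap.fst ℝ _ _)
      (m + 1)) (Fin.cons (0, β) (vec _ X))) =
      -lieSum dOp (contrHom n) (gaugeOp (contrHom n) degProj) X (belowIncl n β) := by
  match m, X with
  | 0, X =>
    refine (congrArg funIncl (Finset.sum_eq_zero fun σ _ => smul_zero _)).trans ?_
    rw [map_zero, lieSum, LinearMap.zero_apply, neg_zero]
  | q + 1, X =>
    rw [lieSum_gaugeOp, neg_neg]
    have e : koszulSum (Fin.cons i fun _ => -1) (pairMap n (gaugeMap A n) (LinearMap.fst ℝ _ _)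
        (q + 1 + 1)) (Fin.cons (0, β) (vec _ X)) = (2 * ((q + 1)! : ℝ))⁻¹ •
        (koszulSum (Fin.cons i fun _ => -1) (firstAction (LinearMap.fst ℝ _ _)
          (gaugeForm A n (q + 1))) (Fin.cons (0, β) (vec _ X)) + (-1 : ℝ) ^ n •
        koszulSum (Fin.cons i fun _ => -1) (lastAction (LinearMap.fst ℝ _ _)
          (gaugeForm A n (q + 1))) (Fin.cons (0, β) (vec _ X))) := by
      rw [← koszulSum_smul, ← koszulSum_add, ← koszulSum_smul, pairMap, snd_comp_gaugeMap]
      rfl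
    rw [e, map_smul, map_add, map_smul, koszulSum_firstAction H hβ, koszulSum_lastAction H hβ]
    have h1 : (q ! : ℝ) ≠ 0 := by positivity
    have h2 : (q : ℝ) + 1 ≠ 0 := by positivity
    -- Two equal contributions with `q + 1` positions each give `2 (q + 1) / (2 (q + 1)!) = 1 / q!`.
    rw [smul_comm ((-1 : ℝ) ^ n) ((q : ℝ) + 1), ← two_smul ℝ, smul_smul, smul_smul]
    congr 1
    rw [Nat.factorial_succ]
    push_cast
    field_simp

lemma topMap_eq_zero {k : ℕ} (x : Fin k → CourantSpace A n) {i : Fin k}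
    (hi : (x i).1 = 0) : topMap H (LinearMap.fst ℝ (VField A) ((r : Fin n) → Form A r)) k x =
        0 := by
  have : (topMap H (LinearMap.fst ℝ (VField A) ((r : Fin n) → Form A r)) k x) =
      (k ! : ℝ)⁻¹ • ((atiyah n H).bracket k fun i => ((x i).1, 0)).2 := rfl
  rw [this, ((atiyah n H).bracket k).map_coord_zero i (by rw [hi]; rfl), Prod.snd_zero, smul_zero]

lemma koszulSum_topMap_vec (hn : 2 ≤ n) {k : ℕ} (hk : 1 ≤ k) {d : Fin k → ℤ} (hd : ∀ i, d i = -1)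
    (X : Fin k → VField A) :
    funIncl (koszulSum d (topMap H (LinearMap.fst ℝ (VField A) ((r : Fin n) → Form A r)) k)
      (vec _ X)) = atiyahVec (contrHom n) n k X (TotalForm.single (n + 1) H) := by
  rw [koszulSum_odd hd, map_altSum]
  have e : ∀ Y : Fin k → VField A, funIncl (topMap H (LinearMap.fst ℝ (VField A)
      ((r : Fin n) → Form A r)) k (vec _ Y)) =
      (k ! : ℝ)⁻¹ • atiyahVec (contrHom n) n k Y (TotalForm.single (n + 1) H) := by
    intro Y
    rw [← (isExtension_atiyah H hn).givenBy.map_vec k hk Y]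
    exact map_smul _ _ _
  refine (altSum_congr e X).trans ?_
  rw [altSum_smul, altSum_of_alternating, smul_smul, inv_mul_cancel₀ (by positivity), one_smul]
  intro Y σ
  rw [atiyahVec, atiyahVec]
  split_ifs
  · rw [(isCartanSystem_contr (A := A) n).revProd_comp_perm, Units.smul_def, Units.smul_def,
      LinearMap.smul_apply]
  · rw [LinearMap.zero_apply, smul_zero]

lemma pairMap_vec (k : ℕ) (X : Fin k → VField A) :
    pairMap n (gaugeMap A n) (LinearMap.fst ℝ _ _) k (vec _ X) = 0 := by
  match k, X with
  | 0, _ => rfl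
  | 1, _ => rfl
  | m + 2, X =>
    have h1 := gaugeForm_vec (n := n) (m + 1) (Fin.tail X)
    have h2 := gaugeForm_vec (n := n) (m + 1) fun i => X i.castSucc
    rw [pairMap, snd_comp_gaugeMap, smul_apply, add_apply, smul_apply, firstAction_apply,
      lastAction_apply]
    have h1' : gaugeForm A n (m + 1) (Fin.tail (vec _ X)) = 0 := h1
    have h2' : (gaugeForm A n (m + 1) fun i => vec _ X i.castSucc) = 0 := h2
    rw [h1', h2', map_zero, map_zero, smul_zero, add_zero, smul_zero]

lemma pairMap_eq_zero {k : ℕ} (x : Fin k → CourantSpace A n) {i j : Fin k} (hij : i ≠ j)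
    (hi : (x i).1 = 0) (hj : (x j).1 = 0) :
    pairMap n (gaugeMap A n) (LinearMap.fst ℝ _ _) k x = 0 := by
  match k, x, i, j with
  | 0, _, _, _ => rfl
  | 1, _, _, _ => rfl
  | m + 2, x, i, j =>
    rw [pairMap, snd_comp_gaugeMap, smul_apply, add_apply, smul_apply, firstAction_apply,
      lastAction_apply]
    have h1 : (LinearMap.fst ℝ (VField A) ((r : Fin n) → Form A r)) (x 0)
        (gaugeForm A n (m + 1) (Fin.tail x)) = 0 := by
      by_cases h : (x 0).1 = 0
      · rw [LinearMap.fst_apply, h, Derivation.zero_apply]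
      · obtain ⟨a, rfl⟩ := Fin.exists_succ_eq.mpr fun h' : i = 0 => h (h' ▸ hi)
        obtain ⟨b, rfl⟩ := Fin.exists_succ_eq.mpr fun h' : j = 0 => h (h' ▸ hj)
        rw [gaugeForm_eq_zero_of_two (Fin.tail x) a b (fun h' => hij (by rw [h'])) hi hj, map_zero]
    have h2 : (LinearMap.fst ℝ (VField A) ((r : Fin n) → Form A r)) (x (Fin.last _))
        (gaugeForm A n (m + 1) fun i => x i.castSucc) = 0 := by
      by_cases h : (x (Fin.last _)).1 = 0
      · rw [LinearMap.fst_apply, h, Derivation.zero_apply]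
      · obtain ⟨a, rfl⟩ := Fin.exists_castSucc_eq.mpr fun h' : i = Fin.last _ => h (h' ▸ hi)
        obtain ⟨b, rfl⟩ := Fin.exists_castSucc_eq.mpr fun h' : j = Fin.last _ => h (h' ▸ hj)
        rw [gaugeForm_eq_zero_of_two (fun i => x i.castSucc) a b (fun h' => hij (by rw [h'])) hi hj,
          map_zero]
    rw [h1, h2, smul_zero, add_zero, smul_zero]

/-- An `(n + 1)`-form becomes a function after exactly `n + 1` contractions. -/
lemma degProj_mul_revProd_single (hn : 2 ≤ n) {k : ℕ} (hk : 1 ≤ k) (X : Fin k → VField A) :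
    (if 2 ≤ k then degProj 0 * revProd (contrHom n) X else 0 : FormOp A)
      (TotalForm.single (n + 1) H) = atiyahVec (contrHom n) n k X (TotalForm.single (n + 1) H) := by
  rw [degProj_mul_revProd, atiyahVec]
  by_cases hk' : k = n + 1
  · subst hk'
    rw [if_pos (by omega), if_pos rfl, Module.End.mul_apply, degProj_single]
  · have : degProj k (TotalForm.single (n + 1) H) = 0 := by
      rw [degProj_apply, TotalForm.comp_single_of_ne hk', map_zero]
    rw [if_neg hk']
    split_ifs
    · rw [Module.End.mul_apply, this, map_zero]
      rfl
    · rfl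

end Morphism

/-! ### The morphism equation -/

section Main

variable {A : Type*} [CommRing A] [Algebra ℝ A] {n : ℕ} (H : Form A (n + 1))

/-- The right-hand side of the equation for morphisms, on functions. -/
def atiyahSide (k : ℕ) : MultilinearMap ℝ (fun _ : Fin k => CourantSpace A n) A :=
  pairMap n (gaugeMap A n) (LinearMap.fst ℝ _ _) k + topMap H (LinearMap.fst ℝ _ _) k

lemma koszulSum_atiyahSide {k : ℕ} (d : Fin k → ℤ) (x : Fin k → CourantSpace A n) :
    koszulSum d (atiyahSide H k) x =
      koszulSum d (pairMap n (gaugeMap A n) (LinearMap.fst ℝ _ _) k) x +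
        koszulSum d (topMap H (LinearMap.fst ℝ _ _) k) x := by
  rw [← koszulSum_add]
  rfl

lemma koszulSum_eq_zero {V W : Type*} [AddCommGroup W] {k : ℕ} (d : Fin k → ℤ)
    {F : (Fin k → V) → W} {x : Fin k → V} (h : ∀ σ : Equiv.Perm (Fin k), F (x ∘ σ) = 0) :
    koszulSum d F x = 0 :=
  Finset.sum_eq_zero fun σ _ => by rw [h, smul_zero]

lemma koszulSum_atiyahSide_form {m k : ℕ} (h : m + 1 = k) {i : ℤ} {β : (r : Fin n) → Form A r}
    (hβ : (0, β) ∈ (courant n H).gr i) (X : Fin m → VField A) :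
    funIncl (koszulSum (Fin.cons i (fun _ => -1) ∘ Fin.cast h.symm) (atiyahSide H k)
      ((Fin.cons (0, β) (vec _ X) : Fin (m + 1) → CourantSpace A n) ∘ Fin.cast h.symm)) =
      -lieSum dOp (contrHom n) (gaugeOp (contrHom n) degProj) X (belowIncl n β) := by
  subst h
  have hp := koszulSum_pairMap_form H hβ X
  set x : Fin (m + 1) → CourantSpace A n := Fin.cons (0, β) (vec _ X) with hx
  set d : Fin (m + 1) → ℤ := Fin.cons i fun _ => -1
  have ht : koszulSum d (topMap H (LinearMap.fst ℝ _ _) (m + 1)) x = 0 :=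
    koszulSum_eq_zero d fun σ => topMap_eq_zero H (x ∘ σ) (i := σ.symm 0) (by simp [hx])
  change funIncl (koszulSum d (atiyahSide H (m + 1)) x) = _
  rw [koszulSum_atiyahSide, ht, add_zero, hp]

/-- Both sides vanish on two arguments without vector component. On vector fields the equation is `E
Ψ = e^t - 1 - t`, and on one form it is the intertwining relation for the connection. -/
theorem gaugeMap_equation_snd (hn : 2 ≤ n) {k : ℕ} (hk : 1 ≤ k) (d : Fin k → ℤ)
    (x : Fin k → CourantSpace A n) (hx : ∀ i, x i ∈ (courant n H).gr (d i)) :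
    funIncl (insertBracket (courant n H) (gaugeMap A n) k d x).2 =
      funIncl (koszulMap d (atiyahSide H k) x) := by
  have h1 := map_insertBracket (courant n H) (gaugeMap A n)
    (funIncl ∘ₗ LinearMap.snd ℝ (VField A) A) k d x
  refine h1.trans ?_
  have e : (fun k => (funIncl ∘ₗ LinearMap.snd ℝ (VField A) A).compMultilinearMap
      (gaugeMap A n k)) = fun k => funIncl.compMultilinearMap (gaugeForm A n k) :=
    funext fun k => MultilinearMap.ext fun y => congrArg funIncl (snd_gaugeMap k y)
  rw [e, ← insertBracketMap_apply, ← sub_eq_zero]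
  obtain ⟨ν, rfl⟩ : ∃ ν, n = ν + 1 := ⟨n - 1, by omega⟩
  have hc := isCartanSystem_contr (A := A) (ν + 1)
  refine eq_zero_of_pure (isExtensionGrading_courant H) (fun d => insertBracketMap
    (courant (ν + 1) H) (fun k => funIncl.compMultilinearMap (gaugeForm A (ν + 1) k)) k d -
      funIncl.compMultilinearMap (koszulMap d (atiyahSide H k))) ?_ ?_ ?_ ?_ d x hx
  · intro d x ρ
    rw [sub_apply, sub_apply, smul_sub, insertBracketMap_comp_perm _ _ _ _ _ ρ]
    congr 1
    change funIncl (koszulMap d _ x) = koszulSign d ρ • funIncl (koszulMap (d ∘ ρ) _ (x ∘ ρ))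
    rw [koszulMap_apply, koszulMap_apply, koszulSum_comp d _ x ρ, Units.smul_def, Units.smul_def,
      map_zsmul]
  · intro d x _ i j hij hi hj
    rw [sub_apply, insertBracketMap_apply,
      (isExtension_courant H).insertBracket_eq_zero (isGivenBy_gaugeForm H) d x hij hi hj]
    change 0 - funIncl (koszulMap d (atiyahSide H k) x) = 0
    rw [koszulMap_apply, koszulSum_atiyahSide, koszulSum_eq_zero, koszulSum_eq_zero, add_zero,
      map_zero, sub_zero]
    · exact fun σ => topMap_eq_zero H (x ∘ σ) (i := σ.symm i) (by simpa using hi)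
    · exact fun σ => pairMap_eq_zero (x ∘ σ) (i := σ.symm i) (j := σ.symm j)
        (fun h => hij (σ.symm.injective h)) (by simpa using hi) (by simpa using hj)
  · intro d hd X
    rw [sub_apply, insertBracketMap_apply,
      (isExtension_courant H).insertBracket_vec (isGivenBy_gaugeForm H) ?_
        (signOp_single_succ _ H) hk d hd]
    · change _ - funIncl (koszulMap d (atiyahSide H k) (vec _ X)) = 0
      -- The function component of the morphism is zero on vector fields alone, so terms with an
      -- inserted bracket of vector fields do not occur.
      have hz : insertedSum (fun q y => (0 : FormOp A) * signOp (ν + 1)) X = 0 := by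
        match k, X with
        | 0, _ => rfl
        | 1, _ => rfl
        | m + 2, X =>
          rw [insertedSum, altSum_congr (fun _ => zero_mul (signOp (ν + 1) : FormOp A)),
            altSum_zero, smul_zero]
      rw [koszulMap_apply, koszulSum_atiyahSide,
        koszulSum_eq_zero d fun σ => pairMap_vec k (X ∘ σ), zero_add,
        koszulSum_topMap_vec H hn hk hd, hz, sub_zero, hc.gaugeOp_courantVec,
        degProj_mul_revProd_single H hn hk, sub_self]
    · intro y
      rw [courantVec, coeff_bernPsi_of_lt (by omega), mul_zero, zero_smul]
  · intro m h i β X hβ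
    rw [sub_apply, insertBracketMap_apply,
      (isExtension_courant H).insertBracket_form_cast (isGivenBy_gaugeForm H) h X hβ,
      hc.gaugeOp_courantOp]
    change _ - funIncl (koszulMap _ (atiyahSide H k) _) = 0
    rw [koszulMap_apply, koszulSum_atiyahSide_form H h hβ]
    exact sub_self _

theorem gaugeMap_equation_fst (hn : 2 ≤ n) {k : ℕ} (hk : 1 ≤ k) (d : Fin k → ℤ)
    (x : Fin k → CourantSpace A n) :
    (insertBracket (courant n H) (gaugeMap A n) k d x).1 =
      (k ! : ℝ)⁻¹ • koszulSum d (fun y => (tangentLie A).bracket k fun i => (y i).1) x := by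
  obtain ⟨m, rfl⟩ : ∃ m, k = m + 1 := ⟨k - 1, by omega⟩
  have h1 := map_insertBracket (courant n H) (gaugeMap A n) (LinearMap.fst ℝ (VField A) A)
    (m + 1) d x
  refine h1.trans ?_
  -- Only `Φ_1` has a vector component, so all arguments must enter the inner bracket.
  rw [insertBracket_eq_sum, Finset.sum_eq_single (Fin.last m)]
  · congr 1
    · simp
    · have key : ∀ q (h : m + 1 + q = m + 1) y, insertTerm (courant n H)
          (fun k => (LinearMap.fst ℝ (VField A) A).compMultilinearMap (gaugeMap A n k)) h y =
            (tangentLie A).bracket (m + 1) fun i => (y i).1 := by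
        intro q h y
        obtain rfl : q = 0 := by omega
        refine (fst_gaugeMap_one _).trans ?_
        exact fst_courant_bracket H (by omega) (m + 1) (by omega) y
      exact Finset.sum_congr rfl fun σ _ => congrArg _ (key _ _ (x ∘ σ))
  · intro p _ hp
    rw [koszulSum_eq_zero, smul_zero]
    intro σ
    refine fst_gaugeMap_of_ne ?_ _
    have := Fin.val_lt_last hp
    omega
  · simp

theorem isInftyMorphism_gaugeMap (hn : 2 ≤ n) :
    IsInftyMorphism (courant n H) (atiyah n H) (gaugeMap A n) where
  isGradedSymmetric := isGradedSymmetric_gaugeMap H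
  map_bracket k hk d x hx := by
    have hone : ∀ u : Fin 1 → CourantSpace A n, (gaugeMap A n 1 u).1 =
      LinearMap.fst ℝ (VField A) ((r : Fin n) → Form A r) (u 0) := fst_gaugeMap_one
    have hne : ∀ k, k ≠ 1 → ∀ u : Fin k → CourantSpace A n, (gaugeMap A n k u).1 = 0 :=
      fun k hk u => fst_gaugeMap_of_ne hk u
    refine Prod.ext ?_ (funIncl_injective ?_)
    · rw [gaugeMap_equation_fst H hn hk, fst_bracketOfMaps H hone hne hn]
      rfl
    · rw [gaugeMap_equation_snd H hn hk d x hx, snd_bracketOfMaps H hone hne hn]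
      rfl

end Main

end HigherCourant

end

open HigherCourant

theorem theorem6p9 (n : ℕ) (hn : 2 ≤ n) :
    ∃ Φ : (M : SmoothMfd) → (H : M.ClosedForm (n + 1)) → (k : ℕ) →
        MultilinearMap ℝ (fun _ : Fin k => CourantSpace M.Fn n) (AtiyahSpace M.Fn),
      (∀ (M : SmoothMfd) (H : M.ClosedForm (n + 1)),
        IsLInftyAlgebra (courant n H.1) ∧
        IsLInftyAlgebra (atiyah n H.1) ∧
        IsLInftyAlgebra (tangentLie M.Fn) ∧
        IsStrictMorphism (courant n H.1) (tangentLie M.Fn) (LinearMap.fst ℝ _ _) ∧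
        IsStrictMorphism (atiyah n H.1) (tangentLie M.Fn) (LinearMap.fst ℝ _ _) ∧
        IsInftyMorphism (courant n H.1) (atiyah n H.1) (Φ M H) ∧
        IsOver (LinearMap.fst ℝ _ _) (LinearMap.fst ℝ _ _) (Φ M H) ∧
        IsFibration (courant n H.1) (atiyah n H.1) (Φ M H) ∧
        ∀ v, linearPart (Φ M H) v = courantToAtiyah n v) ∧
      ∀ (M N : SmoothMfd) (HM : M.ClosedForm (n + 1)) (HN : N.ClosedForm (n + 1)) (f : N.Map M),
        FormRelated (SmoothMfd.pullback f) HM.1 HN.1 →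
        ∀ k, 1 ≤ k → ∀ (v : Fin k → CourantSpace M.Fn n) (w : Fin k → CourantSpace N.Fn n),
          (∀ i, CourantRelated (SmoothMfd.pullback f) (v i) (w i)) →
          AtiyahRelated (SmoothMfd.pullback f) (Φ M HM k v) (Φ N HN k w) := by
  -- The same maps serve for every closed form on `M`: the twist enters only through the brackets.
  refine ⟨fun M _ => gaugeMap M.Fn n, fun M H => ⟨isLInftyAlgebra_courant (by omega) H.1 H.2,
    isLInftyAlgebra_atiyah H.1 hn H.2, isLInftyAlgebra_tangentLie, ?_,
    (isExtension_atiyah H.1 hn).isStrictMorphism_fst, isInftyMorphism_gaugeMap H.1 hn,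
    isOver_gaugeMap, isFibration_gaugeMap H.1 hn, linearPart_gaugeMap⟩,
    fun M N _ _ f _ k _ _ _ h => gaugeMap_related _ k h⟩
  obtain ⟨ν, rfl⟩ : ∃ ν, n = ν + 1 := ⟨n - 1, by omega⟩
  exact (isExtension_courant H.1).isStrictMorphism_fst
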